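/- Let $q\in\mathbb C$, $q\neq 0$, $q^2\neq 1$, fix a square root $q^{1/2}$, and write $z_\pm=zq^{\pm c/2}$, $[n]_q=\frac{q^n-q^{-n}}{q-q^{-1}}$, $\{a,b\}=ab+ba$, $\delta(z)=\sum_{l\in\mathbb Z}z^l$; $q^{c/2}$ is an invertible central element. **The super RS algebra.** Let $V$ have basis $v_1,v_2,v_3$ with parities $0,1,0$, and let $R(\frac zw)$ be the operator on $V\otimes V$ with matrix (basis $v_i\otimes v_k$ in lexicographic order) $$\begin{pmatrix}1&&&&&&&&\\&a&&b&&&&&\\&&d&&c'&&r&&\\&f&&a&&&&&\\&&g&&e&&c'&&\\&&&&&a&&b&\\&&s&&g&&d&&\\&&&&&f&&a&\\&&&&&&&&1\end{pmatrix},$$ where, with $D=(zq^2-w)(zq+w)$: $a=\frac{q(z-w)}{zq^2-w}$, $b=\frac{w(q^2-1)}{zq^2-w}$, $f=\frac{z(q^2-1)}{zq^2-w}$, $c'=-\frac{q^{1/2}w(q^2-1)(z-w)}{D}$, $g=-\frac{q^{1/2}z(q^2-1)(z-w)}{D}$, $d=\frac{q(z-w)(z+qw)}{D}$, $e=a-\frac{zw(q^2-1)(q+1)}{D}$,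 $r=\frac{w^2(q-1)(q+1)^2}{D}$, $s=\frac{z^2(q-1)(q+1)^2}{D}$, all expanded in powers of $z/w$. $U(\mathcal R)$ is the associative algebra generated by $q^{\pm c/2}$ and the coefficients of $3\times3$ matrices $L^+(z)=\sum_{n\ge0}L^+[n]z^n$, $L^-(z)=\sum_{n\ge0}L^-[n]z^{-n}$, with the leading principal quasi-minors of $L^\pm[0]$ made invertible (in particular $L^\pm(z)$ are invertible), subject to $$R(\tfrac zw)L_1^\pm(z)L_2^\pm(w)=L_2^\pm(w)L_1^\pm(z)R(\tfrac zw),\qquad R(\tfrac{z_+}{w_-})L_1^+(z)L_2^-(w)=L_2^-(w)L_1^+(z)R(\tfrac{z_-}{w_+}),$$ where $L_1=L\otimes1$ and $L_2=1\otimes L$ is the graded tensor product, $(L_2)^{ik}_{jl}=\delta_{ij}(-1)^{[i]([k]+[l])}L_{kl}$. **(1) Gauss decomposition and Drinfeld currents.** There are unique decompositions $$L^\pm=\begin{pmatrix}1&0&0\\e_1^\pm&1&0\\e_{3,1}^\pm&e_2^\pm&1\end{pmatrix}\begin{pmatrix}k_1^\pm&&\\&k_2^\pm&\\&&k_3^\pm\end{pmatrix}\begin{pmatrix}1&f_1^\pm&f_{1,3}^\pm\\0&1&f_2^\pm\\0&0&1\end{pmatrix}$$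 with $k_i^\pm(z)$ invertible. Put $X_i^+(z)=f_i^+(z_+)-f_i^-(z_-)$, $X_i^-(z)=e_i^-(z_+)-e_i^+(z_-)$, $\phi_i=k_{i+1}^+(k_i^+)^{-1}$, $\psi_i=k_{i+1}^-(k_i^-)^{-1}$ and define $X^\pm(z)=\sum_{n\in\mathbb Z}X^\pm_nz^{-n-1}$ and $\psi^\pm(z)$ by $$z(q-q^{-1})X^\pm(z)=X_1^\pm(z)+X_2^\pm(-zq^{-1}),$$ $$\psi^-(z)=(1+q^{-1/2}-q^{1/2})\phi_1(z)-\phi_2(-zq^{-1}),\quad \psi^+(z)=\psi_1(z)-(1+q^{1/2}-q^{-1/2})\psi_2(-zq^{-1}).$$ Under the automorphism $L^\pm_{ij}\mapsto(-1)^{[i]+[j]}L^\pm_{ij}$, $q^{c/2}\mapsto q^{c/2}$ of $U(\mathcal R)$, the $X^\pm_n$ are odd and the coefficients of $\psi^\pm(z)$ are even. If moreover $q$ is not a root of unity, the $\psi^\pm(z)$ are invertible and \begin{align*} &\psi^\pm(z)\psi^\pm(w)=\psi^\pm(w)\psi^\pm(z),\qquad \psi^+(z)\psi^-(w)=\frac{(z_+q+w_-)(z_-+w_+q)}{(z_++w_-q)(z_-q+w_+)}\psi^-(w)\psi^+(z),\\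 &\psi^\pm(z)^{-1}X^+(w)\psi^\pm(z)=\frac{z_\pm+wq}{z_\pm q+w}X^+(w),\qquad \psi^\pm(z)X^-(w)\psi^\pm(z)^{-1}=\frac{z_\mp+wq}{z_\mp q+w}X^-(w),\\ &(z+wq^{\pm1})X^\pm(z)X^\pm(w)+(zq^{\pm1}+w)X^\pm(w)X^\pm(z)=0,\\ &\{X^+(z),X^-(w)\}=\frac1{(q-q^{-1})zw}\Big[\delta(\tfrac wzq^c)\psi^+(w_+)-\delta(\tfrac wzq^{-c})\psi^-(z_+)\Big]. \end{align*} That is, there is a unique homomorphism to $U(\mathcal R)$ from the algebra with generators $q^{\pm c/2}$ (central), the coefficients of $X^\pm(z)$, $\psi^\pm(z)$, $\psi^\pm(z)^{-1}$ and these relations, which sends the generators to the elements just defined. **(2) Modes.** In any $\mathbb C$-algebra with elements $q^{\pm c/2},K^{\pm1},X^\pm_n\ (n\in\mathbb Z),H_n\ (n\ne0)$, set $\psi^\pm(z)=\sum_n\psi^\pm_nz^{-n}=K^{\pm1}\exp\big(\pm(q-q^{-1})\sum_{n>0}H_{\pm n}z^{\mp n}\big)$. Then the relations displayed in (1), with $q^{c/2}$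 central, hold if and only if $q^{c/2}$ is central and, for $n\neq0$ in $H_n$, \begin{align*} &[K,H_n]=0,\quad KX_n^\pm K^{-1}=q^{\pm1}X_n^\pm,\quad [H_n,H_m]=\delta_{n+m,0}(-1)^n\frac{[n]_q[nc]_q}{n},\\ &[H_n,X_m^\pm]=\pm\tfrac1n(-1)^n[n]_qq^{\mp\frac c2|n|}X^\pm_{n+m},\\ &X^\pm_{n+1}X^\pm_m+q^{\pm1}X^\pm_mX^\pm_{n+1}+q^{\pm1}X^\pm_nX^\pm_{m+1}+X^\pm_{m+1}X^\pm_n=0,\\ &\{X_n^+,X_m^-\}=\frac1{q-q^{-1}}\big(q^{\frac c2(n-m)}\psi^+_{n+m}-q^{\frac c2(m-n)}\psi^-_{n+m}\big). \end{align*} **(3) Chevalley generators.** Let $U_q$ be the algebra presented by the modes and the relations of (2). In $U_q$ the elements $K_1=K$, $E_1=X_0^+$, $F_1=X_0^-$, $K_0=q^cK^{-1}$, $E_0=X_1^-K^{-1}$, $F_0=-KX_{-1}^+$ satisfy the Chevalley relations of $U_q[osp(2|2)^{(2)}]$: with $a_{00}=a_{11}=1$, $a_{01}=a_{10}=-1$,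 $K_iK_j=K_jK_i$, $K_jE_iK_j^{-1}=q^{a_{ij}}E_i$, $K_jF_iK_j^{-1}=q^{-a_{ij}}F_i$, $\{E_i,F_j\}=\delta_{ij}\frac{K_i-K_i^{-1}}{q-q^{-1}}$, and the $q$-Serre relations $x^3y+(q+q^{-1}-1)(x^2yx-xyx^2)-yx^3=0$ for $(x,y)=(E_i,E_j),(F_i,F_j)$, $i\ne j$. Together with $q^{\pm c/2}$ they generate $U_q$, and \begin{align*} &H_1=q^{\frac c2}K^{-1}\{X_0^+,X_1^-\},\qquad H_{-1}=q^{-\frac c2}K\{X_{-1}^+,X_0^-\},\\ &X^\pm_{n+1}=\mp q^{\pm\frac c2}[H_1,X^\pm_n],\qquad X^\pm_{-n-1}=\mp q^{\pm\frac c2}[H_{-1},X^\pm_{-n}]\quad(n\ge0),\\ &\psi^\pm_{\pm n}=\pm(q-q^{-1})q^{\mp\frac c2(n-2)}\{X^\pm_{\pm n\mp1},X^\mp_{\pm1}\}\quad(n>0),\\ &H_{\pm n}=\pm\frac1{q-q^{-1}}\sum_{p_1+2p_2+\cdots+np_n=n}\frac{(-1)^{\sum p_i-1}(\sum p_i-1)!}{p_1!\cdots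 p_n!}(K^{\mp1}\psi^\pm_{\pm1})^{p_1}\cdots(K^{\mp1}\psi^\pm_{\pm n})^{p_n}\quad(n>0). \end{align*} -/

import Mathlib

namespace OspDrinfeld

noncomputable section

/-- The two signs occurring in `L^±`, `X^±`, `ψ^±`. -/
inductive Sgn : Type
  | pos : Sgn
  | neg : Sgn

/-- `+ ↦ 1`, `- ↦ -1`. -/
def Sgn.toInt : Sgn → ℤ
  | Sgn.pos => 1
  | Sgn.neg => -1

/-- The opposite sign. -/
def Sgn.opp : Sgn → Sgn
  | Sgn.pos => Sgn.neg
  | Sgn.neg => Sgn.pos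

/-- `ipow a b k` is `a ^ k` for `k ≥ 0` and `b ^ (-k)` for `k < 0`; it is used with `b` the
inverse of `a`. -/
def ipow {A : Type*} [Ring A] (a b : A) : ℤ → A
  | Int.ofNat n => a ^ n
  | Int.negSucc n => b ^ (n + 1)

/-- The `q`-integer `[n]_q = (q ^ n - q ^ (-n)) / (q - q⁻¹)`. -/
def qint (q : ℂ) (n : ℤ) : ℂ := (q ^ n - q ^ (-n)) / (q - q⁻¹)

/-- A one-sided series is stored as a power series `a` in the variable `z` (sign `+`) or `z⁻¹`
(sign `-`). `coefZ s a m` is its coefficient at `z ^ m`, for any integer `m`. -/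
def coefZ {A : Type*} [Ring A] : Sgn → PowerSeries A → ℤ → A
  | Sgn.pos, a, m => if 0 ≤ m then PowerSeries.coeff m.toNat a else 0
  | Sgn.neg, a, m => if m ≤ 0 then PowerSeries.coeff (-m).toNat a else 0

/-! ### The R-matrix -/

/-- The `ℤ/2`-degrees of the basis `v₁, v₂, v₃` of `V`: `[v₁] = [v₃] = 0`, `[v₂] = 1`. -/
def par : Fin 3 → ℕ := ![0, 1, 0]

/-- The R-matrix `R(z/w)` on `V ⊗ V`, in the basis `v_i ⊗ v_k` ordered lexicographically.
Its entries are homogeneous of degree `0` in `z, w`, that is, rational functions of `x = z/w`;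
they are expanded in nonnegative powers of `x`. Here `p` is `q^{1/2}`. -/
def Rmat (q p : ℂ) : Matrix (Fin 3 × Fin 3) (Fin 3 × Fin 3) (PowerSeries ℂ) :=
  let x : PowerSeries ℂ := PowerSeries.X
  let t : ℂ → PowerSeries ℂ := fun u => PowerSeries.C u
  let D₁ : PowerSeries ℂ := (t (q ^ 2) * x - 1)⁻¹
  let D₂ : PowerSeries ℂ := ((t (q ^ 2) * x - 1) * (t q * x + 1))⁻¹
  let a := t q * (x - 1) * D₁
  let b := t (q ^ 2 - 1) * D₁
  let c := - (t (p * (q ^ 2 - 1)) * (x - 1) * D₂)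
  let d := t q * (x - 1) * (x + t q) * D₂
  let e := a - t ((q ^ 2 - 1) * (q + 1)) * x * D₂
  let f := t (q ^ 2 - 1) * x * D₁
  let g := - (t (p * (q ^ 2 - 1)) * x * (x - 1) * D₂)
  let r := t ((q - 1) * (q + 1) ^ 2) * D₂
  let s := t ((q - 1) * (q + 1) ^ 2) * x ^ 2 * D₂
  (!![1, 0, 0, 0, 0, 0, 0, 0, 0;
      0, a, 0, b, 0, 0, 0, 0, 0;
      0, 0, d, 0, c, 0, r, 0, 0;
      0, f, 0, a, 0, 0, 0, 0, 0;
      0, 0, g, 0, e, 0, c, 0, 0;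
      0, 0, 0, 0, 0, a, 0, b, 0;
      0, 0, s, 0, g, 0, d, 0, 0;
      0, 0, 0, 0, 0, f, 0, a, 0;
      0, 0, 0, 0, 0, 0, 0, 0, 1] : Matrix (Fin (3 * 3)) (Fin (3 * 3)) (PowerSeries ℂ)).submatrix
    finProdFinEquiv finProdFinEquiv

/-- The coefficient of `x ^ k` in `R(x)`, as a matrix with entries in an algebra `A`. -/
def Rcoef (q p : ℂ) (A : Type*) [Ring A] [Algebra ℂ A] (k : ℕ) :
    Matrix (Fin 3 × Fin 3) (Fin 3 × Fin 3) A :=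
  (Rmat q p).map fun h => algebraMap ℂ A (PowerSeries.coeff k h)

/-! ### The super RS algebra -/

/-- `M ⊗ 1`, as a matrix of operators on `V ⊗ V`. -/
def tens₁ {A : Type*} [Ring A] (M : Matrix (Fin 3) (Fin 3) A) :
    Matrix (Fin 3 × Fin 3) (Fin 3 × Fin 3) A :=
  fun r s => if r.2 = s.2 then M r.1 s.1 else 0

/-- The graded `1 ⊗ M`: `1 ⊗ E_{kl}` maps `v_i ⊗ v_l` to
`(-1)^{[i]([k]+[l])} v_i ⊗ v_k`. -/
def tens₂ {A : Type*} [Ring A] (M : Matrix (Fin 3) (Fin 3) A) :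
    Matrix (Fin 3 × Fin 3) (Fin 3 × Fin 3) A :=
  fun r s => if r.1 = s.1 then (-1) ^ (par r.1 * (par r.2 + par s.2)) * M r.2 s.2 else 0

/-- The coefficient of `z ^ m` in the matrix of one-sided series `M(z)`. -/
def matCoefZ {A : Type*} [Ring A] (s : Sgn) (M : Matrix (Fin 3) (Fin 3) (PowerSeries A))
    (m : ℤ) : Matrix (Fin 3) (Fin 3) A :=
  M.map fun h => coefZ s h m

/-- The coefficient of `z ^ m w ^ n` in `R(θ z / w) M₁(z) N₂(w)`, where `R` is expanded in `z/w`,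
`θ` is central, and `M`, `N` are one-sided of signs `s`, `s'`, not `(s, s') = (-, +)`. All terms
with `k > |m| + |n|` vanish. -/
def RLLleft (q p : ℂ) {A : Type*} [Ring A] [Algebra ℂ A] (θ : A) (s s' : Sgn)
    (M N : Matrix (Fin 3) (Fin 3) (PowerSeries A)) (m n : ℤ) :
    Matrix (Fin 3 × Fin 3) (Fin 3 × Fin 3) A :=
  ∑ k ∈ Finset.range (m.natAbs + n.natAbs + 1),
    θ ^ k • (Rcoef q p A k * tens₁ (matCoefZ s M (m - k)) * tens₂ (matCoefZ s' N (n + k)))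

/-- The coefficient of `z ^ m w ^ n` in `N₂(w) M₁(z) R(θ z / w)`, as in `RLLleft`. -/
def RLLright (q p : ℂ) {A : Type*} [Ring A] [Algebra ℂ A] (θ : A) (s s' : Sgn)
    (M N : Matrix (Fin 3) (Fin 3) (PowerSeries A)) (m n : ℤ) :
    Matrix (Fin 3 × Fin 3) (Fin 3 × Fin 3) A :=
  ∑ k ∈ Finset.range (m.natAbs + n.natAbs + 1),
    θ ^ k • (tens₂ (matCoefZ s' N (n + k)) * tens₁ (matCoefZ s M (m - k)) * Rcoef q p A k)

/-- The data of L-operators in an algebra `A`: the series `L⁺(z) = ∑_{n ≥ 0} L⁺[n] z^n` and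
`L⁻(z) = ∑_{n ≥ 0} L⁻[n] z^{-n}`, the element `g = q^{c/2}` and its inverse `gi`, and inverses
`t` of the leading principal quasi-minors of `L^±[0]`. -/
structure RSData (A : Type*) [Ring A] where
  L : Sgn → Matrix (Fin 3) (Fin 3) (PowerSeries A)
  t : Sgn → Fin 3 → A
  g : A
  gi : A

/-- The zero mode of `L^±_{ij}`. -/
def RSData.L0 {A : Type*} [Ring A] (D : RSData A) (s : Sgn) (i j : Fin 3) : A :=
  PowerSeries.coeff 0 (D.L s i j)

/-- The leading principal quasi-minors of `L^±[0]`, i.e. the constant terms of the diagonal factors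
of a Gauss decomposition "lower unitriangular, diagonal, upper unitriangular" of `L^±`. -/
def RSData.minor {A : Type*} [Ring A] (D : RSData A) (s : Sgn) : Fin 3 → A :=
  ![D.L0 s 0 0,
    D.L0 s 1 1 - D.L0 s 1 0 * D.t s 0 * D.L0 s 0 1,
    D.L0 s 2 2 - D.L0 s 2 0 * D.t s 0 * D.L0 s 0 2
      - (D.L0 s 2 1 - D.L0 s 2 0 * D.t s 0 * D.L0 s 0 1) * D.t s 1
        * (D.L0 s 1 2 - D.L0 s 1 0 * D.t s 0 * D.L0 s 0 2)]

/-- The defining relations of the super RS algebra, for L-operators in any algebra `A`.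
With `z_± = z q^{±c/2}`, the ratio of `z_+` to `w_-` is `g² z/w`, and that of `z_-` to `w_+` is
`g⁻² z/w`. -/
inductive RSRel (q p : ℂ) {A : Type*} [Ring A] [Algebra ℂ A] (D : RSData A) : A → A → Prop
  | g_gi : RSRel q p D (D.g * D.gi) 1
  | gi_g : RSRel q p D (D.gi * D.g) 1
  | g_L (s : Sgn) (i j : Fin 3) (n : ℕ) :
      RSRel q p D (D.g * PowerSeries.coeff n (D.L s i j)) (PowerSeries.coeff n (D.L s i j) * D.g)
  | t_minor (s : Sgn) (i : Fin 3) : RSRel q p D (D.t s i * D.minor s i) 1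
  | minor_t (s : Sgn) (i : Fin 3) : RSRel q p D (D.minor s i * D.t s i) 1
  | same (s : Sgn) (m n : ℤ) (u v : Fin 3 × Fin 3) :
      RSRel q p D (RLLleft q p 1 s s (D.L s) (D.L s) m n u v)
        (RLLright q p 1 s s (D.L s) (D.L s) m n u v)
  | mixed (m n : ℤ) (u v : Fin 3 × Fin 3) :
      RSRel q p D
        (RLLleft q p (D.g ^ 2) Sgn.pos Sgn.neg (D.L Sgn.pos) (D.L Sgn.neg) m n u v)
        (RLLright q p (D.gi ^ 2) Sgn.pos Sgn.neg (D.L Sgn.pos) (D.L Sgn.neg) m n u v)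

/-- Generators of the super RS algebra. -/
inductive RSGen : Type
  | L (s : Sgn) (i j : Fin 3) (n : ℕ) : RSGen
  | t (s : Sgn) (i : Fin 3) : RSGen
  | g : RSGen
  | gi : RSGen

/-- The tautological L-operators over an algebra with chosen images of the generators. -/
def RSData.ofGen {A : Type*} [Ring A] (φ : RSGen → A) : RSData A where
  L s i j := PowerSeries.mk fun n => φ (RSGen.L s i j n)
  t s i := φ (RSGen.t s i)
  g := φ RSGen.g
  gi := φ RSGen.gi

/-- The super RS algebra `U(R)`. -/
abbrev RSAlgebra (q p : ℂ) : Type :=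
  RingQuot (RSRel q p (RSData.ofGen (FreeAlgebra.ι ℂ : RSGen → FreeAlgebra ℂ RSGen)))

/-- The generators of `U(R)`. -/
def rsGen (q p : ℂ) (x : RSGen) : RSAlgebra q p :=
  RingQuot.mkAlgHom ℂ (RSRel q p (RSData.ofGen (FreeAlgebra.ι ℂ))) (FreeAlgebra.ι ℂ x)

/-- The universal L-operators, with entries in `U(R)`. -/
def rsData (q p : ℂ) : RSData (RSAlgebra q p) := RSData.ofGen (rsGen q p)

/-! ### Gauss decomposition and currents -/

/-- Gauss coordinates of a `3 × 3` matrix of one-sided series; the indices `0, 1, 2` of `k` stand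
for `1, 2, 3`. -/
@[ext] structure GaussCoord (A : Type*) [Ring A] where
  e₁ : PowerSeries A
  e₂ : PowerSeries A
  e₃₁ : PowerSeries A
  f₁ : PowerSeries A
  f₂ : PowerSeries A
  f₁₃ : PowerSeries A
  k : Fin 3 → (PowerSeries A)ˣ

/-- `M` is the product lower unitriangular times diagonal times upper unitriangular. -/
def IsGauss {A : Type*} [Ring A] (M : Matrix (Fin 3) (Fin 3) (PowerSeries A))
    (G : GaussCoord A) : Prop :=
  M = !![1, 0, 0; G.e₁, 1, 0; G.e₃₁, G.e₂, 1]
      * Matrix.diagonal (fun i => (G.k i : PowerSeries A))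
      * !![1, G.f₁, G.f₁₃; 0, 1, G.f₂; 0, 0, 1]

/-- The coefficient of `z ^ m` in `X_i^+(z) = f_i^+(z q^{c/2}) - f_i^-(z q^{-c/2})` for `s = +`, and
in `X_i^-(z) = e_i^-(z q^{c/2}) - e_i^+(z q^{-c/2})` for `s = -`, where `h^±` is `f_i^±`,
respectively `e_i^±`. -/
def halfCurrent {A : Type*} [Ring A] (g gi : A) (h : Sgn → PowerSeries A) (s : Sgn) (m : ℤ) : A :=
  ipow g gi m * coefZ s (h s) m - ipow g gi (-m) * coefZ s.opp (h s.opp) m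

/-- The coefficient of `z ^ m` in `X_1^±(z)`. -/
def X₁ {A : Type*} [Ring A] (g gi : A) (G : Sgn → GaussCoord A) : Sgn → ℤ → A
  | Sgn.pos, m => halfCurrent g gi (fun s => (G s).f₁) Sgn.pos m
  | Sgn.neg, m => halfCurrent g gi (fun s => (G s).e₁) Sgn.neg m

/-- The coefficient of `z ^ m` in `X_2^±(z)`. -/
def X₂ {A : Type*} [Ring A] (g gi : A) (G : Sgn → GaussCoord A) : Sgn → ℤ → A
  | Sgn.pos, m => halfCurrent g gi (fun s => (G s).f₂) Sgn.pos m
  | Sgn.neg, m => halfCurrent g gi (fun s => (G s).e₂) Sgn.neg m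

/-- The mode `X^±_n` of `X^±(z) = ∑ X^±_n z^{-n-1}`, where
`z (q - q⁻¹) X^±(z) = X_1^±(z) + X_2^±(-z q⁻¹)`. -/
def gaussX (q : ℂ) {A : Type*} [Ring A] [Algebra ℂ A] (g gi : A) (G : Sgn → GaussCoord A)
    (s : Sgn) (n : ℤ) : A :=
  (q - q⁻¹)⁻¹ • (X₁ g gi G s (-n) + (-q⁻¹) ^ (-n) • X₂ g gi G s (-n))

/-- The ratios `k_2 k_1⁻¹` and `k_3 k_2⁻¹`. -/
def ratio {A : Type*} [Ring A] (G : GaussCoord A) : Fin 2 → PowerSeries A :=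
  ![(G.k 1 : PowerSeries A) * ((G.k 0)⁻¹ : (PowerSeries A)ˣ),
    (G.k 2 : PowerSeries A) * ((G.k 1)⁻¹ : (PowerSeries A)ˣ)]

/-- The coefficient of `z^{-n}` in
`ψ^+(z) = ψ_1(z) - (1 + q^{1/2} - q^{-1/2}) ψ_2(-z q⁻¹)`, with `ψ_i = k^-_{i+1} (k^-_i)⁻¹`, and the
coefficient of `z^n` in `ψ^-(z) = (1 + q^{-1/2} - q^{1/2}) φ_1(z) - φ_2(-z q⁻¹)`, with
`φ_i = k^+_{i+1} (k^+_i)⁻¹`. -/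
def gaussψ (q p : ℂ) {A : Type*} [Ring A] [Algebra ℂ A] (G : Sgn → GaussCoord A) :
    Sgn → ℕ → A
  | Sgn.pos, n => PowerSeries.coeff n (ratio (G Sgn.neg) 0)
      - ((1 + p - p⁻¹) * (-q⁻¹) ^ (-(n : ℤ))) • PowerSeries.coeff n (ratio (G Sgn.neg) 1)
  | Sgn.neg, n => (1 + p⁻¹ - p) • PowerSeries.coeff n (ratio (G Sgn.pos) 0)
      - (-q⁻¹) ^ n • PowerSeries.coeff n (ratio (G Sgn.pos) 1)

/-! ### The Drinfeld current relations -/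

/-- Drinfeld currents in an algebra `A`: `g = q^{c/2}`, its inverse `gi`, the modes of
`X^±(z) = ∑_{n ∈ ℤ} X^±_n z^{-n-1}`, the series `ψ^+(z)` in `z⁻¹` and `ψ^-(z)` in `z`, and the
inverse series `ψi`. -/
structure CurrentData (A : Type*) [Ring A] where
  g : A
  gi : A
  X : Sgn → ℤ → A
  ψ : Sgn → PowerSeries A
  ψi : Sgn → PowerSeries A

/-- The coefficient of `z^{-k}` in `ψ^±(z)`. -/
def CurrentData.ψZ {A : Type*} [Ring A] (D : CurrentData A) (s : Sgn) (k : ℤ) : A :=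
  coefZ s (D.ψ s) k

/-- `(1 + q y)/(q + y)`, so that `(z + w q)/(z q + w)` is this function of `y = w/z`. -/
def ratP (q : ℂ) : PowerSeries ℂ :=
  (1 + PowerSeries.C q * PowerSeries.X) * (PowerSeries.C q + PowerSeries.X)⁻¹

/-- `(q + x)/(1 + q x)`, so that `(z + w q)/(z q + w)` is this function of `x = z/w`. -/
def ratM (q : ℂ) : PowerSeries ℂ :=
  (PowerSeries.C q + PowerSeries.X) * (1 + PowerSeries.C q * PowerSeries.X)⁻¹

/-- The expansion of `(z + w q)/(z q + w)` that goes with `ψ^s(z)`: in `w/z` for `ψ^+(z)`, a series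
in `z⁻¹`, and in `z/w` for `ψ^-(z)`, a series in `z`. -/
def rat (q : ℂ) : Sgn → PowerSeries ℂ
  | Sgn.pos => ratP q
  | Sgn.neg => ratM q

/-- The coefficient of `(w/z)^k` in
`(z_+ q + w_-)(z_- + w_+ q) / ((z_+ + w_- q)(z_- q + w_+))`,
that is, in `ratM (g⁻² w/z) * ratP (g² w/z)`. -/
def ψcoef (q : ℂ) {A : Type*} [Ring A] [Algebra ℂ A] (g gi : A) (k : ℕ) : A :=
  ∑ u ∈ Finset.HasAntidiagonal.antidiagonal k,
    (PowerSeries.coeff u.1 (ratM q) * PowerSeries.coeff u.2 (ratP q)) •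
      (gi ^ (2 * u.1) * g ^ (2 * u.2))

/-- The defining relations of `U_q[osp(2|2)^{(2)}]` in terms of currents, coefficient by
coefficient. -/
inductive CurrentRel (q : ℂ) {A : Type*} [Ring A] [Algebra ℂ A] (D : CurrentData A) :
    A → A → Prop
  | g_gi : CurrentRel q D (D.g * D.gi) 1
  | gi_g : CurrentRel q D (D.gi * D.g) 1
  | g_X (s : Sgn) (n : ℤ) : CurrentRel q D (D.g * D.X s n) (D.X s n * D.g)
  | g_ψ (s : Sgn) (n : ℕ) : CurrentRel q D
      (D.g * PowerSeries.coeff n (D.ψ s)) (PowerSeries.coeff n (D.ψ s) * D.g)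
  | ψ_ψi (s : Sgn) (n : ℕ) : CurrentRel q D
      (PowerSeries.coeff n (D.ψ s * D.ψi s)) (PowerSeries.coeff n (1 : PowerSeries A))
  | ψi_ψ (s : Sgn) (n : ℕ) : CurrentRel q D
      (PowerSeries.coeff n (D.ψi s * D.ψ s)) (PowerSeries.coeff n (1 : PowerSeries A))
  -- `ψ^±(z) ψ^±(w) = ψ^±(w) ψ^±(z)`
  | ψ_same (s : Sgn) (m n : ℕ) : CurrentRel q D
      (PowerSeries.coeff m (D.ψ s) * PowerSeries.coeff n (D.ψ s))
      (PowerSeries.coeff n (D.ψ s) * PowerSeries.coeff m (D.ψ s))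
  -- `ψ^+(z) ψ^-(w)` at `z^{-m} w^n`
  | ψ_mixed (m n : ℕ) : CurrentRel q D
      (PowerSeries.coeff m (D.ψ Sgn.pos) * PowerSeries.coeff n (D.ψ Sgn.neg))
      (∑ k ∈ Finset.range (min m n + 1), ψcoef q D.g D.gi k *
        (PowerSeries.coeff (n - k) (D.ψ Sgn.neg) * PowerSeries.coeff (m - k) (D.ψ Sgn.pos)))
  -- `ψ^s(z)⁻¹ X^+(w) ψ^s(z) = (z_s + w q)/(z_s q + w) X^+(w)` at `z^{-sk} w^{-n-1}`
  | ψ_Xpos (s : Sgn) (k : ℕ) (n : ℤ) : CurrentRel q D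
      (PowerSeries.coeff k (D.ψi s * PowerSeries.C (D.X Sgn.pos n) * D.ψ s))
      (PowerSeries.coeff k (rat q s) • (D.gi ^ k * D.X Sgn.pos (n + s.toInt * k)))
  -- `ψ^s(z) X^-(w) ψ^s(z)⁻¹ = (z_{-s} + w q)/(z_{-s} q + w) X^-(w)` at `z^{-sk} w^{-n-1}`
  | ψ_Xneg (s : Sgn) (k : ℕ) (n : ℤ) : CurrentRel q D
      (PowerSeries.coeff k (D.ψ s * PowerSeries.C (D.X Sgn.neg n) * D.ψi s))
      (PowerSeries.coeff k (rat q s) • (D.g ^ k * D.X Sgn.neg (n + s.toInt * k)))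
  -- `(z + w q^s) X^s(z) X^s(w) + (z q^s + w) X^s(w) X^s(z) = 0` at `z^{-n-1} w^{-m-1}`
  | X_same (s : Sgn) (n m : ℤ) : CurrentRel q D
      (D.X s (n + 1) * D.X s m + q ^ s.toInt • (D.X s n * D.X s (m + 1))
        + (q ^ s.toInt • (D.X s m * D.X s (n + 1)) + D.X s (m + 1) * D.X s n)) 0
  -- `{X^+(z), X^-(w)} = ((q - q⁻¹) z w)⁻¹ (δ(w q^c / z) ψ^+(w_+) - δ(w q^{-c} / z) ψ^-(z_+))`
  -- at `z^{-n-1} w^{-m-1}`, with `δ(y) = ∑_{l ∈ ℤ} y^l`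
  | X_mixed (n m : ℤ) : CurrentRel q D
      (D.X Sgn.pos n * D.X Sgn.neg m + D.X Sgn.neg m * D.X Sgn.pos n)
      ((q - q⁻¹)⁻¹ • (ipow D.g D.gi (n - m) * D.ψZ Sgn.pos (n + m)
        - ipow D.g D.gi (m - n) * D.ψZ Sgn.neg (n + m)))

/-- Generators of `U_q[osp(2|2)^{(2)}]` in the current presentation. -/
inductive CurrentGen : Type
  | g : CurrentGen
  | gi : CurrentGen
  | X (s : Sgn) (n : ℤ) : CurrentGen
  | ψ (s : Sgn) (n : ℕ) : CurrentGen
  | ψi (s : Sgn) (n : ℕ) : CurrentGen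

/-- Currents assembled from chosen images of the generators. -/
def CurrentData.ofGen {A : Type*} [Ring A] (φ : CurrentGen → A) : CurrentData A where
  g := φ CurrentGen.g
  gi := φ CurrentGen.gi
  X s n := φ (CurrentGen.X s n)
  ψ s := PowerSeries.mk fun n => φ (CurrentGen.ψ s n)
  ψi s := PowerSeries.mk fun n => φ (CurrentGen.ψi s n)

/-- The algebra generated by the Drinfeld currents, with the current relations. -/
abbrev CurrentAlgebra (q : ℂ) : Type :=
  RingQuot (CurrentRel q
    (CurrentData.ofGen (FreeAlgebra.ι ℂ : CurrentGen → FreeAlgebra ℂ CurrentGen)))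

/-- The generators of the current algebra. -/
def curGen (q : ℂ) (x : CurrentGen) : CurrentAlgebra q :=
  RingQuot.mkAlgHom ℂ (CurrentRel q (CurrentData.ofGen (FreeAlgebra.ι ℂ))) (FreeAlgebra.ι ℂ x)

/-! ### Modes -/

/-- Drinfeld modes in an algebra: `g = q^{c/2}`, `K`, their inverses `gi`, `Ki`, and `X^±_n`
(`n ∈ ℤ`), `H_n` (`n ≠ 0`; the value at `0` is never used). -/
structure ModeData (A : Type*) [Ring A] where
  g : A
  gi : A
  K : A
  Ki : A
  X : Sgn → ℤ → A
  H : ℤ → A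

/-- The exponential of a power series with zero constant term. -/
def expSeries {A : Type*} [Ring A] [Algebra ℂ A] (h : PowerSeries A) : PowerSeries A :=
  PowerSeries.mk fun n =>
    ∑ j ∈ Finset.range (n + 1), ((Nat.factorial j : ℂ)⁻¹) • PowerSeries.coeff n (h ^ j)

/-- The series `(q - q⁻¹) ∑_{n > 0} H_{± n} z^{∓ n}`, in the variable `z^{∓1}`. -/
def ModeData.hSeries {A : Type*} [Ring A] [Algebra ℂ A] (q : ℂ) (D : ModeData A) (s : Sgn) :
    PowerSeries A :=
  PowerSeries.mk fun n => if n = 0 then 0 else (q - q⁻¹) • D.H (s.toInt * n)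

/-- The currents `X^±(z) = ∑ X^±_n z^{-n-1}` and
`ψ^±(z) = K^{±1} exp(± (q - q⁻¹) ∑_{n > 0} H_{± n} z^{∓ n})` with their inverses. -/
def ModeData.toCurrent {A : Type*} [Ring A] [Algebra ℂ A] (q : ℂ) (D : ModeData A) :
    CurrentData A where
  g := D.g
  gi := D.gi
  X := D.X
  ψ s := PowerSeries.C (ipow D.K D.Ki s.toInt) * expSeries (s.toInt • D.hSeries q s)
  ψi s := expSeries ((-s.toInt) • D.hSeries q s) * PowerSeries.C (ipow D.K D.Ki (-s.toInt))

/-- The defining relations of `U_q[osp(2|2)^{(2)}]` in terms of modes. -/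
inductive ModeRel (q : ℂ) {A : Type*} [Ring A] [Algebra ℂ A] (D : ModeData A) : A → A → Prop
  | g_gi : ModeRel q D (D.g * D.gi) 1
  | gi_g : ModeRel q D (D.gi * D.g) 1
  | K_Ki : ModeRel q D (D.K * D.Ki) 1
  | Ki_K : ModeRel q D (D.Ki * D.K) 1
  | g_K : ModeRel q D (D.g * D.K) (D.K * D.g)
  | g_H (n : ℤ) (hn : n ≠ 0) : ModeRel q D (D.g * D.H n) (D.H n * D.g)
  | g_X (s : Sgn) (n : ℤ) : ModeRel q D (D.g * D.X s n) (D.X s n * D.g)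
  | K_H (n : ℤ) (hn : n ≠ 0) : ModeRel q D (D.K * D.H n) (D.H n * D.K)
  | K_X (s : Sgn) (n : ℤ) : ModeRel q D (D.K * D.X s n * D.Ki) (q ^ s.toInt • D.X s n)
  | H_H (n m : ℤ) (hn : n ≠ 0) (hm : m ≠ 0) : ModeRel q D
      (D.H n * D.H m - D.H m * D.H n)
      (if n + m = 0 then ((-1) ^ n * (qint q n / n)) •
        ((q - q⁻¹)⁻¹ • (ipow D.g D.gi (2 * n) - ipow D.g D.gi (-(2 * n)))) else 0)
  | H_X (s : Sgn) (n m : ℤ) (hn : n ≠ 0) : ModeRel q D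
      (D.H n * D.X s m - D.X s m * D.H n)
      (((s.toInt : ℂ) * (1 / n) * (-1) ^ n * qint q n) •
        (ipow D.g D.gi (-(s.toInt * |n|)) * D.X s (n + m)))
  | X_same (s : Sgn) (n m : ℤ) : ModeRel q D
      (D.X s (n + 1) * D.X s m + q ^ s.toInt • (D.X s m * D.X s (n + 1))
        + q ^ s.toInt • (D.X s n * D.X s (m + 1)) + D.X s (m + 1) * D.X s n) 0
  | X_mixed (n m : ℤ) : ModeRel q D
      (D.X Sgn.pos n * D.X Sgn.neg m + D.X Sgn.neg m * D.X Sgn.pos n)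
      ((q - q⁻¹)⁻¹ • (ipow D.g D.gi (n - m) * (D.toCurrent q).ψZ Sgn.pos (n + m)
        - ipow D.g D.gi (m - n) * (D.toCurrent q).ψZ Sgn.neg (n + m)))

/-- Generators of `U_q[osp(2|2)^{(2)}]` in the mode presentation. -/
inductive ModeGen : Type
  | g : ModeGen
  | gi : ModeGen
  | K : ModeGen
  | Ki : ModeGen
  | X (s : Sgn) (n : ℤ) : ModeGen
  | H (n : ℤ) (hn : n ≠ 0) : ModeGen

/-- Modes assembled from chosen images of the generators. -/
def ModeData.ofGen {A : Type*} [Ring A] (φ : ModeGen → A) : ModeData A where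
  g := φ ModeGen.g
  gi := φ ModeGen.gi
  K := φ ModeGen.K
  Ki := φ ModeGen.Ki
  X s n := φ (ModeGen.X s n)
  H n := if hn : n ≠ 0 then φ (ModeGen.H n hn) else 0

/-- `U_q[osp(2|2)^{(2)}]` in the mode presentation. -/
abbrev Uq (q : ℂ) : Type :=
  RingQuot (ModeRel q (ModeData.ofGen (FreeAlgebra.ι ℂ : ModeGen → FreeAlgebra ℂ ModeGen)))

/-- The Drinfeld generators of `U_q[osp(2|2)^{(2)}]`. -/
def uqData (q : ℂ) : ModeData (Uq q) :=
  ModeData.ofGen fun x =>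
    RingQuot.mkAlgHom ℂ (ModeRel q (ModeData.ofGen (FreeAlgebra.ι ℂ))) (FreeAlgebra.ι ℂ x)

/-! ### Chevalley generators -/

/-- The symmetric Cartan matrix of `osp(2|2)^{(2)}`. -/
def cartan (i j : Fin 2) : ℤ := if i = j then 1 else -1

/-- Chevalley generators `E_i, F_i, K_i, K_i⁻¹`, `i = 0, 1`. -/
inductive ChevGen : Type
  | E (i : Fin 2) : ChevGen
  | F (i : Fin 2) : ChevGen
  | K (i : Fin 2) : ChevGen
  | Ki (i : Fin 2) : ChevGen

/-- The `q`-Serre element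
`[x, [x, [x, y]_q]_q]_q = x³y + (q + q⁻¹ - 1) x²yx - (q + q⁻¹ - 1) xyx² - yx³`
of two odd root vectors `x, y` of weights `α, β` with `(α, α) = 1`, `(α, β) = -1`, where
`[u, v]_q = u v - (-1)^{[u][v]} q^{-(wt u, wt v)} v u`. -/
def serre (q : ℂ) {A : Type*} [Ring A] [Algebra ℂ A] (x y : A) : A :=
  x ^ 3 * y + (q + q⁻¹ - 1) • (x ^ 2 * y * x) - (q + q⁻¹ - 1) • (x * y * x ^ 2) - y * x ^ 3

/-- The Chevalley relations of `U_q[osp(2|2)^{(2)}]`, including the `q`-Serre relations. -/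
inductive ChevRel (q : ℂ) {A : Type*} [Ring A] [Algebra ℂ A] (φ : ChevGen → A) : A → A → Prop
  | K_Ki (i : Fin 2) : ChevRel q φ (φ (ChevGen.K i) * φ (ChevGen.Ki i)) 1
  | Ki_K (i : Fin 2) : ChevRel q φ (φ (ChevGen.Ki i) * φ (ChevGen.K i)) 1
  | K_K (i j : Fin 2) :
      ChevRel q φ (φ (ChevGen.K i) * φ (ChevGen.K j)) (φ (ChevGen.K j) * φ (ChevGen.K i))
  | K_E (i j : Fin 2) : ChevRel q φ
      (φ (ChevGen.K j) * φ (ChevGen.E i) * φ (ChevGen.Ki j)) (q ^ cartan i j • φ (ChevGen.E i))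
  | K_F (i j : Fin 2) : ChevRel q φ
      (φ (ChevGen.K j) * φ (ChevGen.F i) * φ (ChevGen.Ki j)) (q ^ (-cartan i j) • φ (ChevGen.F i))
  | E_F (i j : Fin 2) : ChevRel q φ
      (φ (ChevGen.E i) * φ (ChevGen.F j) + φ (ChevGen.F j) * φ (ChevGen.E i))
      (if i = j then (q - q⁻¹)⁻¹ • (φ (ChevGen.K i) - φ (ChevGen.Ki i)) else 0)
  | serre_E (i j : Fin 2) (hij : i ≠ j) :
      ChevRel q φ (serre q (φ (ChevGen.E i)) (φ (ChevGen.E j))) 0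
  | serre_F (i j : Fin 2) (hij : i ≠ j) :
      ChevRel q φ (serre q (φ (ChevGen.F i)) (φ (ChevGen.F j))) 0

/-- The algebra with Chevalley generators and relations. -/
abbrev ChevAlgebra (q : ℂ) : Type :=
  RingQuot (ChevRel q (FreeAlgebra.ι ℂ : ChevGen → FreeAlgebra ℂ ChevGen))

/-- The Chevalley generators. -/
def chevGen (q : ℂ) (x : ChevGen) : ChevAlgebra q :=
  RingQuot.mkAlgHom ℂ (ChevRel q (FreeAlgebra.ι ℂ)) (FreeAlgebra.ι ℂ x)

/-- The images of the Chevalley generators: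
`K_1 = K`, `E_1 = X^+_0`, `F_1 = X^-_0`, `K_0 = q^c K⁻¹`, `E_0 = X^-_1 K⁻¹`, `F_0 = -K X^+_{-1}`. -/
def chevImage {A : Type*} [Ring A] (D : ModeData A) : ChevGen → A
  | ChevGen.E i => ![D.X Sgn.neg 1 * D.Ki, D.X Sgn.pos 0] i
  | ChevGen.F i => ![-(D.K * D.X Sgn.pos (-1)), D.X Sgn.neg 0] i
  | ChevGen.K i => ![D.g ^ 2 * D.Ki, D.K] i
  | ChevGen.Ki i => ![D.gi ^ 2 * D.K, D.Ki] i

/-- The right-hand side of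
`H_{±n} = ± (q - q⁻¹)⁻¹ ∑ (-1)^{∑ p_i - 1} (∑ p_i - 1)! / (p_1! ⋯ p_n!)
(K^{∓1} ψ^±_{±1})^{p_1} ⋯ (K^{∓1} ψ^±_{±n})^{p_n}`, the sum over all `p_1, …, p_n ≥ 0` with
`p_1 + 2 p_2 + ⋯ + n p_n = n`. -/
def hFormula (q : ℂ) {A : Type*} [Ring A] [Algebra ℂ A] (D : ModeData A) (s : Sgn) (n : ℕ) : A :=
  ((s.toInt : ℂ) / (q - q⁻¹)) •
    ∑ P ∈ (Fintype.piFinset fun _ : Fin n => Finset.range (n + 1)).filter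
        (fun P => ∑ i : Fin n, ((i : ℕ) + 1) * P i = n),
      ((-1) ^ ((∑ i, P i) - 1) * (Nat.factorial ((∑ i, P i) - 1) : ℂ)
          / ∏ i, (Nat.factorial (P i) : ℂ)) •
        (List.ofFn fun i : Fin n => (ipow D.K D.Ki (-s.toInt) *
          PowerSeries.coeff ((i : ℕ) + 1) ((D.toCurrent q).ψ s)) ^ P i).prod

/-- The formulae that build the Drinfeld generators up from the Chevalley generators. -/
structure DrinfeldRecursion (q : ℂ) {A : Type*} [Ring A] [Algebra ℂ A] (D : ModeData A) :
    Prop where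
  H_one : D.H 1 = D.g * D.Ki * (D.X Sgn.pos 0 * D.X Sgn.neg 1 + D.X Sgn.neg 1 * D.X Sgn.pos 0)
  H_neg_one : D.H (-1) =
    D.gi * D.K * (D.X Sgn.pos (-1) * D.X Sgn.neg 0 + D.X Sgn.neg 0 * D.X Sgn.pos (-1))
  X_up (s : Sgn) (n : ℕ) : D.X s (n + 1) =
    (-(s.toInt : ℂ)) • (ipow D.g D.gi s.toInt * (D.H 1 * D.X s n - D.X s n * D.H 1))
  X_down (s : Sgn) (n : ℕ) : D.X s (-n - 1) =
    (-(s.toInt : ℂ)) • (ipow D.g D.gi s.toInt * (D.H (-1) * D.X s (-n) - D.X s (-n) * D.H (-1)))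
  H_n (s : Sgn) (n : ℕ) (hn : 0 < n) : D.H (s.toInt * n) = hFormula q D s n
  ψ_n (s : Sgn) (n : ℕ) (hn : 0 < n) : PowerSeries.coeff n ((D.toCurrent q).ψ s) =
    ((s.toInt : ℂ) * (q - q⁻¹)) • (ipow D.g D.gi (-(s.toInt * (n - 2))) *
      (D.X s (s.toInt * n - s.toInt) * D.X s.opp s.toInt
        + D.X s.opp s.toInt * D.X s (s.toInt * n - s.toInt)))

end

end OspDrinfeld

open OspDrinfeld

/-!
# Drinfeld currents of `U_q[osp(2|2)^{(2)}]` from the super RS algebra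

*The currents.* Clearing denominators and substituting Gauss coordinates turns the exchange relation
of `L(z)` and `L(w)` into polynomial relations between these coordinates (`RLL`, `GaussData`). They
are identities in rings of two-variable series, one for each pair of signs (`Frame`,
`LModel.exists_frame`); an exchange relation of `L⁻` and `L⁺` follows from that of `L⁺` and `L⁻` by
unitarity of the R-matrix. Two L-operators of the same sign can moreover be compared at `z = l w`
for a constant `l`, as soon as denominators are cleared (`LModel.rll_specialized`). At the points
`l` where the R-matrix degenerates this gives linear relations: `h = f_{1,3}` is a multiple of
`f₁²` (`LModel.h_eq`, at `l = q²`), `k₁ f₁ k₁⁻¹` is a multiple of `f₁(q² z)` (`LModel.k_f_ki`, at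
`l = q⁻²`), and `f₂(z)` is a multiple of `f₁(-q z)` (`LModel.f₂_eq`, at `l = -q⁻¹`). On the last of
these points the R-matrix has rank one, which also yields `k₃ k₂⁻¹(z) = k₂ k₁⁻¹(-q z)`
(`LModel.K₃_Ki`). This is where `q` must not be a root of unity. Consequently `X^±` and `ψ^±` are
multiples of the currents of the first simple root alone.

In the exchange relations of `f₁` with itself and with `k₂ k₁⁻¹` the right-hand sides are sums of
terms that each depend on one of the two signs only, so they cancel in the difference
`f₁⁺(z_+) - f₁⁻(z_-)` (`LModel.cur_cur`, `LModel.cur_ψs`). In the anticommutator of `e₁` and `f₁`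
the expansions of a pole in opposite directions add up to delta functions (`LModel.cur_curE`). The
relations of `X⁻` are those of `X⁺` for the transposed L-operators over the opposite algebra
(`LModel.op`). The relations among the `ψ^±` need no further computation: conjugating
`{X⁺(z), X⁻(w)}` by `ψ⁺` multiplies it by rational functions, and comparison of coefficients gives
them (`ConjData.commute_coeff`, `ConjData.coeff_mul`, `Currents.rel`).

*The modes.* Write `ψ^s = K^s exp η_s`. For a series `h` with commuting coefficients and zero
constant term, the Euler derivation `z d/dz` turns `exp h · x = ρ(x) · exp h` into a differential
equation, which shows that conjugation by `exp h` multiplies a current by a rational function if and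
only if the coefficients of `h` have the commutators given by the logarithm of that function
(`expSeries_mul_C`, `commutator_of_expSeries_mul_C`, `ratLog`). This is the relation of `H_n` and
`X^±_m`. The commutator of `H_n` and `H_{-m}` is obtained as that of the `ψ^±`, by applying `ad H_n`
to the anticommutator of `X⁺` and `X⁻` (`ModeData.Cartan.H_H_opp`).

*The Chevalley generators.* `H_{±1}` are anticommutators of `X^±_n`, they shift the index of the
`X^±_n`, and the anticommutators of these are the coefficients of `ψ^±`, of which the `H_n` are
polynomials by the logarithm formula (`ModeData.drinfeldRecursion`, `coeff_eq_sum_multinomial`).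
With suitable `c ∈ {q, q⁻¹}` the Serre element is, up to a scalar, `[[[x, y]_c, x], x]_c`; the inner
bracket is a multiple of `H_{±1}`, the next one is a shifted current, and the last one vanishes by
the quadratic relation of two neighbouring modes (`serre_eq_zero`).
-/

open scoped Matrix

namespace OspDrinfeld

/-! ### Rings of two-variable series -/

noncomputable section

/-- The centre of a `ℂ`-algebra, as a commutative algebra. -/
def Zc (A : Type*) [Ring A] [Algebra ℂ A] : Type _ := Subalgebra.center ℂ A

section Centre

variable {A : Type*} [Ring A] [Algebra ℂ A]

instance : CommRing (Zc A) := inferInstanceAs (CommRing (Subalgebra.center ℂ A))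

instance : Algebra ℂ (Zc A) := inferInstanceAs (Algebra ℂ (Subalgebra.center ℂ A))

/-- The inclusion of the centre. -/
def Zc.val : Zc A →ₐ[ℂ] A := (Subalgebra.center ℂ A).val

instance : CoeOut (Zc A) A := ⟨Zc.val⟩

/-- A central element, as an element of the centre. -/
def Zc.mk (c : A) (hc : ∀ x, c * x = x * c) : Zc A :=
  ⟨c, Subalgebra.mem_center_iff.mpr fun x => (hc x).symm⟩

@[simp] lemma Zc.val_mk (c : A) (hc : ∀ x, c * x = x * c) : Zc.val (Zc.mk c hc) = c := rfl

lemma center_comm (c : Zc A) (x : A) : (c : A) * x = x * c :=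
  (Subalgebra.mem_center_iff.mp c.2 x).symm

lemma Zc.ext {c d : Zc A} (h : (c : A) = d) : c = d := Subtype.ext h

instance : Algebra (Zc A) A := RingHom.toAlgebra' (Zc.val : Zc A →ₐ[ℂ] A).toRingHom center_comm

lemma center_smul_def (c : Zc A) (x : A) : c • x = (c : A) * x := rfl

instance : IsScalarTower ℂ (Zc A) A :=
  IsScalarTower.of_algebraMap_eq fun c => ((Zc.val : Zc A →ₐ[ℂ] A).commutes c).symm

end Centre

section Series

variable {A : Type*} [Ring A]

/-- A sequence indexed by `ℕ`, extended by zero to `ℤ`. -/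
def extZ (a : ℕ → A) (m : ℤ) : A := if 0 ≤ m then a m.toNat else 0

lemma extZ_natCast (a : ℕ → A) (m : ℕ) : extZ a m = a m := by simp [extZ]

lemma extZ_of_neg (a : ℕ → A) {m : ℤ} (h : m < 0) : extZ a m = 0 := by
  simp [extZ, not_le.mpr h]

lemma coefZ_eq_extZ (s : Sgn) (a : PowerSeries A) (m : ℤ) :
    coefZ s a m = extZ (fun n => PowerSeries.coeff n a) (s.toInt * m) := by
  cases s <;> simp [coefZ, extZ, Sgn.toInt]

/-- The substitution `z ↦ t z` for a central element `t`. -/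
def scale [Algebra ℂ A] (t : Zc A) : PowerSeries A →+* PowerSeries A where
  toFun a := PowerSeries.mk fun n => (t : A) ^ n * PowerSeries.coeff n a
  map_zero' := by ext n; simp
  map_one' := by
    ext n
    rcases n with _ | n <;> simp [PowerSeries.coeff_one]
  map_add' a b := by ext n; simp [mul_add]
  map_mul' a b := by
    ext n
    simp only [PowerSeries.coeff_mk, PowerSeries.coeff_mul, Finset.mul_sum]
    refine Finset.sum_congr rfl fun x hx => ?_
    have hc : ∀ y : A, y * (t : A) ^ x.2 = (t : A) ^ x.2 * y := fun y => by
      rw [← map_pow, center_comm]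
    rw [← Finset.HasAntidiagonal.mem_antidiagonal.mp hx, pow_add]
    simp only [mul_assoc]
    rw [← mul_assoc (PowerSeries.coeff x.1 a) _ (PowerSeries.coeff x.2 b), hc, mul_assoc]

@[simp] lemma coeff_scale [Algebra ℂ A] (t : Zc A) (a : PowerSeries A) (n : ℕ) :
    PowerSeries.coeff n (scale t a) = (t : A) ^ n * PowerSeries.coeff n a := by
  simp [scale]

/-- The substitution of the product of the two variables, as a map from series in one variable
to series in two variables. -/
def diagHom : PowerSeries A →+* PowerSeries (PowerSeries A) where
  toFun a := PowerSeries.mk fun n => PowerSeries.monomial n (PowerSeries.coeff n a)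
  map_zero' := by ext n; simp
  map_one' := by
    ext n : 1
    rcases n with _ | n <;> simp [PowerSeries.coeff_one]
  map_add' a b := by ext n : 1; simp
  map_mul' a b := by
    ext n : 1
    simp only [PowerSeries.coeff_mk, PowerSeries.coeff_mul, map_sum,
      PowerSeries.monomial_mul_monomial]
    refine Finset.sum_congr rfl fun x hx => ?_
    rw [Finset.HasAntidiagonal.mem_antidiagonal.mp hx]

@[simp] lemma coeff_diagHom (a : PowerSeries A) (n : ℕ) :
    PowerSeries.coeff n (diagHom a) = PowerSeries.monomial n (PowerSeries.coeff n a) := by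
  simp [diagHom]

/-- The coefficient of a two-variable series at the outer exponent `i` and the inner exponent
`j`; it vanishes unless both are nonnegative. -/
def co₂ (i j : ℤ) : PowerSeries (PowerSeries A) →+ A where
  toFun F := if 0 ≤ i ∧ 0 ≤ j then PowerSeries.coeff j.toNat (PowerSeries.coeff i.toNat F) else 0
  map_zero' := by simp
  map_add' F G := by split_ifs <;> simp

lemma co₂_natCast (i j : ℕ) (F : PowerSeries (PowerSeries A)) :
    co₂ (i : ℤ) (j : ℤ) F = PowerSeries.coeff j (PowerSeries.coeff i F) := by
  simp [co₂]

lemma co₂_of_neg_left {i j : ℤ} (h : i < 0) (F : PowerSeries (PowerSeries A)) :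
    co₂ i j F = 0 := by
  simp [co₂, not_le.mpr h]

lemma co₂_of_neg_right {i j : ℤ} (h : j < 0) (F : PowerSeries (PowerSeries A)) :
    co₂ i j F = 0 := by
  simp [co₂, not_le.mpr h]

lemma eq_zero_of_co₂ {F : PowerSeries (PowerSeries A)} (h : ∀ i j, co₂ i j F = 0) : F = 0 := by
  ext i j
  simpa [co₂_natCast] using h i j

lemma co₂_diag_mul_C (u v : PowerSeries A) (i j : ℤ) :
    co₂ i j (diagHom u * PowerSeries.C v) =
      extZ (fun n => PowerSeries.coeff n u) i * extZ (fun n => PowerSeries.coeff n v) (j - i) := by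
  rcases lt_or_ge i 0 with hi | hi
  · rw [co₂_of_neg_left hi, extZ_of_neg _ hi, zero_mul]
  rcases lt_or_ge j 0 with hj | hj
  · rw [co₂_of_neg_right hj, extZ_of_neg _ (by omega : j - i < 0), mul_zero]
  lift i to ℕ using hi
  lift j to ℕ using hj
  rw [co₂_natCast, PowerSeries.coeff_mul_C, coeff_diagHom, extZ_natCast,
    ← mul_one (PowerSeries.coeff i u), ← PowerSeries.coeff_zero_one (R := A)]
  rw [PowerSeries.coeff_zero_one, mul_one, PowerSeries.monomial_eq_mk]
  rw [PowerSeries.coeff_mul]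
  rcases lt_or_ge j i with h | h
  · rw [extZ_of_neg _ (by omega), mul_zero]
    refine Finset.sum_eq_zero fun x hx => ?_
    have := Finset.HasAntidiagonal.mem_antidiagonal.mp hx
    rw [PowerSeries.coeff_mk, if_neg (by omega), zero_mul]
  · have : ((j : ℤ) - i) = ((j - i : ℕ) : ℤ) := by omega
    rw [this, extZ_natCast, Finset.sum_eq_single (i, j - i)]
    · simp
    · intro x hx hne
      have := Finset.HasAntidiagonal.mem_antidiagonal.mp hx
      have : x.1 ≠ i := fun h' => hne (by ext <;> simp <;> omega)
      rw [PowerSeries.coeff_mk, if_neg this, zero_mul]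
    · intro h'
      exact absurd (Finset.HasAntidiagonal.mem_antidiagonal.mpr (by simp; omega)) h'

lemma co₂_C_mul_diag (u v : PowerSeries A) (i j : ℤ) :
    co₂ i j (PowerSeries.C v * diagHom u) =
      extZ (fun n => PowerSeries.coeff n v) (j - i) * extZ (fun n => PowerSeries.coeff n u) i := by
  rcases lt_or_ge i 0 with hi | hi
  · rw [co₂_of_neg_left hi, extZ_of_neg _ hi, mul_zero]
  rcases lt_or_ge j 0 with hj | hj
  · rw [co₂_of_neg_right hj, extZ_of_neg _ (by omega : j - i < 0), zero_mul]
  lift i to ℕ using hi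
  lift j to ℕ using hj
  rw [co₂_natCast, PowerSeries.coeff_C_mul, coeff_diagHom, extZ_natCast,
    PowerSeries.monomial_eq_mk, PowerSeries.coeff_mul]
  rcases lt_or_ge j i with h | h
  · rw [extZ_of_neg _ (by omega), zero_mul]
    refine Finset.sum_eq_zero fun x hx => ?_
    have := Finset.HasAntidiagonal.mem_antidiagonal.mp hx
    rw [PowerSeries.coeff_mk, if_neg (by omega), mul_zero]
  · have : ((j : ℤ) - i) = ((j - i : ℕ) : ℤ) := by omega
    rw [this, extZ_natCast, Finset.sum_eq_single (j - i, i)]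
    · simp
    · intro x hx hne
      have := Finset.HasAntidiagonal.mem_antidiagonal.mp hx
      have : x.2 ≠ i := fun h' => hne (by ext <;> simp <;> omega)
      rw [PowerSeries.coeff_mk, if_neg this, mul_zero]
    · intro h'
      exact absurd (Finset.HasAntidiagonal.mem_antidiagonal.mpr (by simp; omega)) h'

lemma co₂_map_mul_C (u v : PowerSeries A) (i j : ℤ) :
    co₂ i j (PowerSeries.map PowerSeries.C u * PowerSeries.C v) =
      extZ (fun n => PowerSeries.coeff n u) i * extZ (fun n => PowerSeries.coeff n v) j := by
  rcases lt_or_ge i 0 with hi | hi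
  · rw [co₂_of_neg_left hi, extZ_of_neg _ hi, zero_mul]
  rcases lt_or_ge j 0 with hj | hj
  · rw [co₂_of_neg_right hj, extZ_of_neg _ hj, mul_zero]
  lift i to ℕ using hi
  lift j to ℕ using hj
  rw [co₂_natCast, PowerSeries.coeff_mul_C, PowerSeries.coeff_map, PowerSeries.coeff_C_mul,
    extZ_natCast, extZ_natCast]

lemma co₂_C_mul_map (u v : PowerSeries A) (i j : ℤ) :
    co₂ i j (PowerSeries.C v * PowerSeries.map PowerSeries.C u) =
      extZ (fun n => PowerSeries.coeff n v) j * extZ (fun n => PowerSeries.coeff n u) i := by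
  rcases lt_or_ge i 0 with hi | hi
  · rw [co₂_of_neg_left hi, extZ_of_neg _ hi, mul_zero]
  rcases lt_or_ge j 0 with hj | hj
  · rw [co₂_of_neg_right hj, extZ_of_neg _ hj, zero_mul]
  lift i to ℕ using hi
  lift j to ℕ using hj
  rw [co₂_natCast, PowerSeries.coeff_C_mul, PowerSeries.coeff_map, PowerSeries.coeff_mul_C,
    extZ_natCast, extZ_natCast]

lemma co₂_map_mul (r : PowerSeries A) (F : PowerSeries (PowerSeries A)) (i j : ℤ) (N : ℕ)
    (hN : i < N) :
    co₂ i j (PowerSeries.map PowerSeries.C r * F) =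
      ∑ k ∈ Finset.range N, PowerSeries.coeff k r * co₂ (i - k) j F := by
  rcases lt_or_ge i 0 with hi | hi
  · rw [co₂_of_neg_left hi, Finset.sum_eq_zero]
    intro k _
    rw [co₂_of_neg_left (by omega), mul_zero]
  rcases lt_or_ge j 0 with hj | hj
  · rw [co₂_of_neg_right hj, Finset.sum_eq_zero]
    intro k _
    rw [co₂_of_neg_right hj, mul_zero]
  lift i to ℕ using hi
  lift j to ℕ using hj
  rw [co₂_natCast, PowerSeries.coeff_mul, map_sum,
    Finset.Nat.sum_antidiagonal_eq_sum_range_succ_mk,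
    ← Finset.sum_subset (Finset.range_subset_range.mpr (by omega : i.succ ≤ N))]
  · refine Finset.sum_congr rfl fun k hk => ?_
    have : ((i : ℤ) - k) = ((i - k : ℕ) : ℤ) := by
      have := Finset.mem_range.mp hk
      omega
    rw [this, co₂_natCast, PowerSeries.coeff_map, PowerSeries.coeff_C_mul]
  · intro k _ hk
    rw [Finset.mem_range] at hk
    rw [co₂_of_neg_left (by omega), mul_zero]

lemma co₂_diag_mul (r : PowerSeries A) (F : PowerSeries (PowerSeries A)) (i j : ℤ) (N : ℕ)
    (hN : i < N) :
    co₂ i j (diagHom r * F) =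
      ∑ k ∈ Finset.range N, PowerSeries.coeff k r * co₂ (i - k) (j - k) F := by
  rcases lt_or_ge i 0 with hi | hi
  · rw [co₂_of_neg_left hi, Finset.sum_eq_zero]
    intro k _
    rw [co₂_of_neg_left (by omega), mul_zero]
  rcases lt_or_ge j 0 with hj | hj
  · rw [co₂_of_neg_right hj, Finset.sum_eq_zero]
    intro k _
    rw [co₂_of_neg_right (by omega), mul_zero]
  lift i to ℕ using hi
  lift j to ℕ using hj
  rw [co₂_natCast, PowerSeries.coeff_mul, map_sum,
    Finset.Nat.sum_antidiagonal_eq_sum_range_succ_mk,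
    ← Finset.sum_subset (Finset.range_subset_range.mpr (by omega : i.succ ≤ N))]
  · refine Finset.sum_congr rfl fun k hk => ?_
    have : ((i : ℤ) - k) = ((i - k : ℕ) : ℤ) := by
      have := Finset.mem_range.mp hk
      omega
    rw [this, coeff_diagHom]
    have hm : PowerSeries.monomial k (PowerSeries.coeff k r) =
        PowerSeries.C (PowerSeries.coeff k r) * PowerSeries.X ^ k := by
      ext n
      rw [PowerSeries.coeff_monomial, PowerSeries.coeff_C_mul_X_pow]
    rw [hm, mul_assoc, PowerSeries.coeff_C_mul, PowerSeries.coeff_X_pow_mul']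
    split_ifs with h
    · have : ((j : ℤ) - k) = ((j - k : ℕ) : ℤ) := by omega
      rw [this, co₂_natCast]
    · rw [co₂_of_neg_right (by omega)]
  · intro k _ hk
    rw [Finset.mem_range] at hk
    rw [co₂_of_neg_left (by omega), mul_zero]

end Series

end

/-! ### Exchange relations of `3 × 3` matrices -/

noncomputable section

/-- The ten scalars from which an R-matrix of the shape of `Rmat` is built; `o` is the entry at the
corners, so that multiples by a common denominator are covered as well. -/
structure RCoeffs (S : Type*) where
  o : S
  a : S
  b : S
  c : S
  d : S
  e : S
  f : S
  g : S
  r : S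
  s : S

/-- The `9 × 9` matrix with given entries, in the shape of `Rmat`. -/
def RCoeffs.mat₉ {S : Type*} [Zero S] (R : RCoeffs S) : Matrix (Fin (3 * 3)) (Fin (3 * 3)) S :=
  (!![R.o, 0, 0, 0, 0, 0, 0, 0, 0;
      0, R.a, 0, R.b, 0, 0, 0, 0, 0;
      0, 0, R.d, 0, R.c, 0, R.r, 0, 0;
      0, R.f, 0, R.a, 0, 0, 0, 0, 0;
      0, 0, R.g, 0, R.e, 0, R.c, 0, 0;
      0, 0, 0, 0, 0, R.a, 0, R.b, 0;
      0, 0, R.s, 0, R.g, 0, R.d, 0, 0;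
      0, 0, 0, 0, 0, R.f, 0, R.a, 0;
      0, 0, 0, 0, 0, 0, 0, 0, R.o] : Matrix (Fin 9) (Fin 9) S)

/-- The matrix with given entries as an operator on `V ⊗ V`. -/
def RCoeffs.mat {S : Type*} [Zero S] (R : RCoeffs S) : Matrix (Fin 3 × Fin 3) (Fin 3 × Fin 3) S :=
  R.mat₉.submatrix finProdFinEquiv finProdFinEquiv

/-- The R-matrix with the roles of its upper and lower triangles exchanged. -/
def RCoeffs.transpose {S : Type*} (R : RCoeffs S) : RCoeffs S where
  o := R.o
  a := R.a
  b := R.f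
  c := R.g
  d := R.d
  e := R.e
  f := R.b
  g := R.c
  r := R.s
  s := R.r

variable {S B : Type*} [CommRing S] [Ring B] [Algebra S B]

/-- The relation `R L₁ M₂ = M₂ L₁ R'`. -/
def RLL (R R' : RCoeffs S) (L M : Matrix (Fin 3) (Fin 3) B) : Prop :=
  R.mat.map (algebraMap S B) * (tens₁ L * tens₂ M) =
    tens₂ M * tens₁ L * R'.mat.map (algebraMap S B)

lemma RCoeffs.mat₉_transpose (R : RCoeffs S) : R.transpose.mat₉ = R.mat₉ᵀ := by
  refine Matrix.ext fun i j => ?_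
  change Fin 9 at i j
  unfold RCoeffs.mat₉ RCoeffs.transpose
  revert i j
  simp [Fin.forall_fin_succ]

lemma RCoeffs.mat_transpose (R : RCoeffs S) : R.transpose.mat = R.matᵀ := by
  rw [RCoeffs.mat, RCoeffs.mat₉_transpose, RCoeffs.mat, Matrix.transpose_submatrix]

variable {R R' : RCoeffs S} {L M : Matrix (Fin 3) (Fin 3) B}

lemma tens₁_mul_tens₂_apply (L M : Matrix (Fin 3) (Fin 3) B) (x y j l : Fin 3) :
    (tens₁ L * tens₂ M) (x, y) (j, l) =
      ((-1) ^ (par j * (par y + par l)) : ℤ) • (L x j * M y l) := by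
  rw [Matrix.mul_apply, Finset.sum_eq_single (j, y)]
  · simp only [tens₁, tens₂, if_true, zsmul_eq_mul, Int.cast_pow, Int.cast_neg, Int.cast_one]
    rw [← mul_assoc, ← mul_assoc, ((Commute.neg_one_left (L x j)).pow_left _).eq]
  · rintro ⟨x', y'⟩ - hne
    by_cases hy : y = y'
    · have : x' ≠ j := fun h' => hne (by rw [h', hy])
      simp [tens₂, this]
    · simp [tens₁, hy]
  · simp

lemma tens₂_mul_tens₁_apply (L M : Matrix (Fin 3) (Fin 3) B) (i k x y : Fin 3) :
    (tens₂ M * tens₁ L) (i, k) (x, y) =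
      ((-1) ^ (par i * (par k + par y)) : ℤ) • (M k y * L i x) := by
  rw [Matrix.mul_apply, Finset.sum_eq_single (i, y)]
  · simp [tens₁, tens₂, mul_assoc]
  · rintro ⟨x', y'⟩ - hne
    by_cases hy : i = x'
    · have : y' ≠ y := fun h' => hne (by rw [h', hy])
      simp [tens₁, this]
    · simp [tens₂, hy]
  · simp

lemma RLL.iff_apply : RLL R R' L M ↔ ∀ i k j l : Fin 3,
    (∑ x : Fin 3, ∑ y : Fin 3, R.mat (i, k) (x, y) •
        (((-1) ^ (par j * (par y + par l)) : ℤ) • (L x j * M y l)) : B) =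
      ∑ x : Fin 3, ∑ y : Fin 3, R'.mat (x, y) (j, l) •
        (((-1) ^ (par i * (par k + par y)) : ℤ) • (M k y * L i x)) := by
  have key : RLL R R' L M ↔ ∀ u v : Fin 3 × Fin 3,
      (R.mat.map (algebraMap S B) * (tens₁ L * tens₂ M)) u v =
        (tens₂ M * tens₁ L * R'.mat.map (algebraMap S B)) u v :=
    ⟨fun h u v => by rw [h], fun h => Matrix.ext h⟩
  rw [key, Prod.forall]
  simp only [Prod.forall, Matrix.mul_apply (M := R.mat.map _),
    Matrix.mul_apply (M := tens₂ M * tens₁ L), Fintype.sum_prod_type, Matrix.map_apply,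
    tens₁_mul_tens₂_apply, tens₂_mul_tens₁_apply, ← Algebra.commutes, ← Algebra.smul_def]

lemma RLL.apply (h : RLL R R' L M) (i k j l : Fin 3) :
    (∑ x : Fin 3, ∑ y : Fin 3, R.mat (i, k) (x, y) •
        (((-1) ^ (par j * (par y + par l)) : ℤ) • (L x j * M y l)) : B) =
      ∑ x : Fin 3, ∑ y : Fin 3, R'.mat (x, y) (j, l) •
        (((-1) ^ (par i * (par k + par y)) : ℤ) • (M k y * L i x)) :=
  RLL.iff_apply.mp h i k j l

/-- Gauss coordinates of a `3 × 3` matrix, together with inverses of the first two diagonal ones: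
`k`, `K`, `K₃` are the diagonal coordinates, `f`, `h`, `f₂` stand for `f₁`, `f_{1,3}`, `f₂`, and
`e`, `e₃₁`, `e₂` for `e₁`, `e_{3,1}`, `e₂`. -/
structure GaussData (B : Type*) where
  k : B
  ki : B
  K : B
  Ki : B
  K₃ : B
  f : B
  h : B
  f₂ : B
  e : B
  e₃₁ : B
  e₂ : B

/-- `L` has the Gauss decomposition with coordinates `G`. -/
structure GaussData.Rep (G : GaussData B) (L : Matrix (Fin 3) (Fin 3) B) : Prop where
  k_ki : G.k * G.ki = 1
  ki_k : G.ki * G.k = 1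
  K_Ki : G.K * G.Ki = 1
  Ki_K : G.Ki * G.K = 1
  L00 : L 0 0 = G.k
  L01 : L 0 1 = G.k * G.f
  L02 : L 0 2 = G.k * G.h
  L10 : L 1 0 = G.e * G.k
  L11 : L 1 1 = G.K + G.e * G.k * G.f
  L12 : L 1 2 = G.K * G.f₂ + G.e * G.k * G.h
  L20 : L 2 0 = G.e₃₁ * G.k
  L21 : L 2 1 = G.e₂ * G.K + G.e₃₁ * G.k * G.f
  L22 : L 2 2 = G.K₃ + G.e₂ * G.K * G.f₂ + G.e₃₁ * G.k * G.h

variable {G G' : GaussData B}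

lemma RLL.row00_col00 (h : RLL R R' L M) (hL : G.Rep L) (hM : G'.Rep M) (ho : R.o = R'.o)
    (hu : IsUnit R.o) : Commute G.k G'.k := by
  have := h.apply 0 0 0 0
  refine hu.smul_left_cancel.mp ?_
  simpa [Fin.sum_univ_three, par, RCoeffs.mat, RCoeffs.mat₉, finProdFinEquiv, hL.L00, hM.L00,
    ← ho] using this

lemma RLL.row00_col01 (h : RLL R R' L M) (hL : G.Rep L) (hM : G'.Rep M) :
    R.o • (G.k * (G'.k * G'.f)) =
      R'.a • (G'.k * (G'.f * G.k)) + R'.f • (G'.k * (G.k * G.f)) := by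
  have := h.apply 0 0 0 1
  simpa [Fin.sum_univ_three, par, RCoeffs.mat, RCoeffs.mat₉, finProdFinEquiv, hL.L00, hL.L01,
    hM.L00, hM.L01, mul_assoc] using this

lemma RLL.row00_col10 (h : RLL R R' L M) (hL : G.Rep L) (hM : G'.Rep M) :
    R.o • (G.k * (G.f * G'.k)) =
      R'.b • (G'.k * (G'.f * G.k)) + R'.a • (G'.k * (G.k * G.f)) := by
  have := h.apply 0 0 1 0
  simpa [Fin.sum_univ_three, par, RCoeffs.mat, RCoeffs.mat₉, finProdFinEquiv, hL.L00, hL.L01,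
    hM.L00, hM.L01, mul_assoc] using this

lemma RLL.row00_col11 (h : RLL R R' L M) (hL : G.Rep L) (hM : G'.Rep M) :
    -(R.o • (G.k * (G.f * (G'.k * G'.f)))) =
      R'.c • (G'.k * (G'.h * G.k)) + R'.e • (G'.k * (G'.f * (G.k * G.f))) +
        R'.g • (G'.k * (G.k * G.h)) := by
  have := h.apply 0 0 1 1
  simpa [Fin.sum_univ_three, par, RCoeffs.mat, RCoeffs.mat₉, finProdFinEquiv, hL.L00, hL.L01,
    hL.L02, hM.L00, hM.L01, hM.L02, mul_assoc] using this

lemma RLL.row00_col02 (h : RLL R R' L M) (hL : G.Rep L) (hM : G'.Rep M) :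
    R.o • (G.k * (G'.k * G'.h)) =
      R'.d • (G'.k * (G'.h * G.k)) + R'.g • (G'.k * (G'.f * (G.k * G.f))) +
        R'.s • (G'.k * (G.k * G.h)) := by
  have := h.apply 0 0 0 2
  simpa [Fin.sum_univ_three, par, RCoeffs.mat, RCoeffs.mat₉, finProdFinEquiv, hL.L00, hL.L01,
    hL.L02, hM.L00, hM.L01, hM.L02, mul_assoc] using this

lemma RLL.row01_col00 (h : RLL R R' L M) (hL : G.Rep L) (hM : G'.Rep M) :
    R.a • (G.k * (G'.e * G'.k)) + R.b • (G.e * (G.k * G'.k)) =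
      R'.o • (G'.e * (G'.k * G.k)) := by
  have := h.apply 0 1 0 0
  simpa [Fin.sum_univ_three, par, RCoeffs.mat, RCoeffs.mat₉, finProdFinEquiv, hL.L00, hL.L10,
    hM.L00, hM.L10, mul_assoc] using this

lemma RLL.row01_col01 (h : RLL R R' L M) (hL : G.Rep L) (hM : G'.Rep M) :
    R.a • (G.k * (G'.K + G'.e * (G'.k * G'.f))) + R.b • (G.e * (G.k * (G'.k * G'.f))) =
      R'.a • ((G'.K + G'.e * (G'.k * G'.f)) * G.k) + R'.f • (G'.e * (G'.k * (G.k * G.f))) := by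
  have := h.apply 0 1 0 1
  simpa [Fin.sum_univ_three, par, RCoeffs.mat, RCoeffs.mat₉, finProdFinEquiv, hL.L00, hL.L10,
    hL.L01, hM.L01, hM.L11, hM.L10, mul_assoc] using this

lemma RLL.row01_col10 (h : RLL R R' L M) (hL : G.Rep L) (hM : G'.Rep M) :
    -(R.a • (G.k * (G.f * (G'.e * G'.k)))) + R.b • ((G.K + G.e * (G.k * G.f)) * G'.k) =
      R'.b • ((G'.K + G'.e * (G'.k * G'.f)) * G.k) + R'.a • (G'.e * (G'.k * (G.k * G.f))) := by
  have := h.apply 0 1 1 0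
  simpa [Fin.sum_univ_three, par, RCoeffs.mat, RCoeffs.mat₉, finProdFinEquiv, hL.L00, hL.L11,
    hL.L01, hM.L00, hM.L11, hM.L10, mul_assoc] using this

lemma RLL.row01_col11 (h : RLL R R' L M) (hL : G.Rep L) (hM : G'.Rep M) :
    R.a • (G.k * (G.f * (G'.K + G'.e * (G'.k * G'.f)))) -
        R.b • ((G.K + G.e * (G.k * G.f)) * (G'.k * G'.f)) =
      R'.c • ((G'.K * G'.f₂ + G'.e * (G'.k * G'.h)) * G.k) +
        R'.e • ((G'.K + G'.e * (G'.k * G'.f)) * (G.k * G.f)) +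
        R'.g • (G'.e * (G'.k * (G.k * G.h))) := by
  have := h.apply 0 1 1 1
  simpa [Fin.sum_univ_three, par, RCoeffs.mat, RCoeffs.mat₉, finProdFinEquiv, hL.L00, hL.L01,
    hL.L02, hL.L11, hM.L10, hM.L01, hM.L11, hM.L12, sub_eq_add_neg, mul_assoc] using this

lemma RLL.row10_col00 (h : RLL R R' L M) (hL : G.Rep L) (hM : G'.Rep M) :
    R.f • (G.k * (G'.e * G'.k)) + R.a • (G.e * (G.k * G'.k)) =
      R'.o • (G'.k * (G.e * G.k)) := by
  have := h.apply 1 0 0 0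
  simpa [Fin.sum_univ_three, par, RCoeffs.mat, RCoeffs.mat₉, finProdFinEquiv, hL.L00, hL.L10,
    hM.L00, hM.L10, mul_assoc] using this

lemma RLL.row10_col01 (h : RLL R R' L M) (hL : G.Rep L) (hM : G'.Rep M) :
    R.f • (G.k * (G'.K + G'.e * (G'.k * G'.f))) + R.a • (G.e * (G.k * (G'.k * G'.f))) =
      -(R'.a • (G'.k * (G'.f * (G.e * G.k)))) + R'.f • (G'.k * (G.K + G.e * (G.k * G.f))) := by
  have := h.apply 1 0 0 1
  simpa [Fin.sum_univ_three, par, RCoeffs.mat, RCoeffs.mat₉, finProdFinEquiv, hL.L00, hL.L10,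
    hL.L01, hL.L11, hM.L00, hM.L01, hM.L11, hM.L10, mul_assoc] using this

lemma RLL.row10_col11 (h : RLL R R' L M) (hL : G.Rep L) (hM : G'.Rep M) :
    R.f • (G.k * (G.f * (G'.K + G'.e * (G'.k * G'.f)))) -
        R.a • ((G.K + G.e * (G.k * G.f)) * (G'.k * G'.f)) =
      R'.c • (G'.k * (G'.h * (G.e * G.k))) -
        R'.e • (G'.k * (G'.f * (G.K + G.e * (G.k * G.f)))) +
        R'.g • (G'.k * (G.K * G.f₂ + G.e * (G.k * G.h))) := by
  have := h.apply 1 0 1 1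
  simpa [Fin.sum_univ_three, par, RCoeffs.mat, RCoeffs.mat₉, finProdFinEquiv, hL.L10, hL.L01,
    hL.L12, hL.L11, hM.L00, hM.L01, hM.L11, hM.L02, sub_eq_add_neg, mul_assoc] using this

/-- Rows `v₁ ⊗ v₃` and `v₂ ⊗ v₂` of the exchange relation in the column `v₂ ⊗ v₂`. -/
lemma RLL.row02_row11_col11 (h : RLL R R' L M) (hL : G.Rep L) (hM : G'.Rep M) {κ : S}
    (h₁ : R.g = κ * R.d) (h₂ : R.e = κ * R.c) (h₃ : R.c = κ * R.r) :
    -(R'.c • ((G'.K * G'.f₂ + G'.e * (G'.k * G'.h)) * (G.e * G.k))) +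
        R'.e • ((G'.K + G'.e * (G'.k * G'.f)) * (G.K + G.e * (G.k * G.f))) -
        R'.g • (G'.e * (G'.k * (G.K * G.f₂ + G.e * (G.k * G.h)))) =
      κ • (R'.c • ((G'.K₃ + G'.e₂ * (G'.K * G'.f₂) + G'.e₃₁ * (G'.k * G'.h)) * G.k) +
        R'.e • ((G'.e₂ * G'.K + G'.e₃₁ * (G'.k * G'.f)) * (G.k * G.f)) +
        R'.g • (G'.e₃₁ * (G'.k * (G.k * G.h)))) := by
  have H₁ := h.apply 0 2 1 1
  have H₂ := h.apply 1 1 1 1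
  simp only [Fin.sum_univ_three, par, RCoeffs.mat, RCoeffs.mat₉, finProdFinEquiv, hL.L00, hL.L01,
    hL.L02, hL.L11, hM.L01, hM.L11, hM.L20, hM.L21, hM.L22, mul_assoc, Matrix.submatrix_apply,
    Equiv.coe_fn_mk, Matrix.of_apply] at H₁
  simp only [Fin.sum_univ_three, par, RCoeffs.mat, RCoeffs.mat₉, finProdFinEquiv, hL.L10, hL.L01,
    hL.L11, hL.L12, hM.L01, hM.L11, hM.L12, hM.L10, hM.L21, mul_assoc,
    Matrix.submatrix_apply, Equiv.coe_fn_mk, Matrix.of_apply] at H₂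
  simp at H₁ H₂
  rw [← H₁, sub_eq_add_neg, ← H₂]
  simp only [h₁, h₂]
  rw [h₃]
  module

end

noncomputable section

variable {S B : Type*} [CommRing S] [Ring B] [Algebra S B]
variable {R R' : RCoeffs S} {L M : Matrix (Fin 3) (Fin 3) B} {G G' : GaussData B}

/-! ### Exchange relations between Gauss coordinates -/

lemma GaussData.Rep.ki_k_assoc (hL : G.Rep L) (x : B) : G.ki * (G.k * x) = x := by
  rw [← mul_assoc, hL.ki_k, one_mul]

lemma GaussData.Rep.k_ki_assoc (hL : G.Rep L) (x : B) : G.k * (G.ki * x) = x := by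
  rw [← mul_assoc, hL.k_ki, one_mul]

lemma GaussData.Rep.Ki_K_assoc (hL : G.Rep L) (x : B) : G.Ki * (G.K * x) = x := by
  rw [← mul_assoc, hL.Ki_K, one_mul]

lemma GaussData.Rep.commute_ki (hL : G.Rep L) {x : B} (h : Commute G.k x) : Commute G.ki x := by
  rw [commute_iff_eq]
  calc G.ki * x = G.ki * (x * G.k) * G.ki := by rw [mul_assoc, mul_assoc, hL.k_ki, mul_one]
    _ = x * G.ki := by rw [← h.eq, ← mul_assoc, hL.ki_k, one_mul]

lemma RLL.conj_f' (h : RLL R R' L M) (hL : G.Rep L) (hM : G'.Rep M) (ho : R.o = R'.o)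
    (hk : Commute G.k G'.k) : R'.o • G'.f = R'.a • (G.ki * (G'.f * G.k)) + R'.f • G.f := by
  have c := (hM.commute_ki hk.symm).eq
  have := congrArg (fun x => G.ki * (G'.ki * x)) (h.row00_col01 hL hM)
  simp only [mul_add, mul_smul_comm, hM.ki_k_assoc] at this
  rw [← mul_assoc G'.ki G.k, c, mul_assoc, hM.ki_k_assoc, hL.ki_k_assoc, hL.ki_k_assoc] at this
  rw [← this, ho]

lemma RLL.conj_f (h : RLL R R' L M) (hL : G.Rep L) (hM : G'.Rep M) (ho : R.o = R'.o)
    (hk : Commute G.k G'.k) : R'.o • (G'.ki * (G.f * G'.k)) =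
    R'.b • (G.ki * (G'.f * G.k)) + R'.a • G.f := by
  have c := (hM.commute_ki hk.symm).eq
  have := congrArg (fun x => G.ki * (G'.ki * x)) (h.row00_col10 hL hM)
  simp only [mul_add, mul_smul_comm, hM.ki_k_assoc, hL.ki_k_assoc] at this
  rw [← mul_assoc G'.ki G.k, c, mul_assoc, hL.ki_k_assoc] at this
  rw [← this, ho]

lemma RLL.conj_ff (h : RLL R R' L M) (hL : G.Rep L) (hM : G'.Rep M) (ho : R.o = R'.o)
    (hk : Commute G.k G'.k) : -(R'.o • (G'.ki * (G.f * (G'.k * G'.f)))) =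
    R'.c • (G.ki * (G'.h * G.k)) + R'.e • (G.ki * (G'.f * (G.k * G.f))) + R'.g • G.h := by
  have c := (hM.commute_ki hk.symm).eq
  have := congrArg (fun x => G.ki * (G'.ki * x)) (h.row00_col11 hL hM)
  simp only [mul_add, mul_neg, mul_smul_comm, hM.ki_k_assoc, hL.ki_k_assoc] at this
  rw [← mul_assoc G'.ki G.k, c, mul_assoc, hL.ki_k_assoc] at this
  rw [← this, ho]

lemma RLL.conj_h (h : RLL R R' L M) (hL : G.Rep L) (hM : G'.Rep M) (ho : R.o = R'.o)
    (hk : Commute G.k G'.k) : R'.o • G'.h =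
    R'.d • (G.ki * (G'.h * G.k)) + R'.g • (G.ki * (G'.f * (G.k * G.f))) + R'.s • G.h := by
  have c := (hM.commute_ki hk.symm).eq
  have := congrArg (fun x => G.ki * (G'.ki * x)) (h.row00_col02 hL hM)
  simp only [mul_add, mul_smul_comm, hM.ki_k_assoc, hL.ki_k_assoc] at this
  rw [← mul_assoc G'.ki G.k, c, mul_assoc, hL.ki_k_assoc, hM.ki_k_assoc] at this
  rw [← this, ho]

/-- The relation between products of two `f`'s, before `h` is eliminated. -/
lemma RLL.ff_raw (h : RLL R R' L M) (hL : G.Rep L) (hM : G'.Rep M) (ho : R.o = R'.o)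
    (hk : Commute G.k G'.k) :
    (R'.d * (R'.a ^ 2 - R'.b * R'.f)) • (G.f * G'.f) +
        (R'.o * (R'.d * R'.e - R'.c * R'.g)) • (G'.f * G.f) +
        (R'.o * R'.d * R'.b) • (G'.f * G'.f) -
        (R'.f * (R'.d * R'.e - R'.c * R'.g)) • (G.f * G.f) +
        (R'.o * R'.c * R'.a) • G'.h + (R'.a * (R'.d * R'.g - R'.c * R'.s)) • G.h = 0 := by
  have h₁ := congrArg (· * G.f) (h.conj_f' hL hM ho hk)
  have h₁' := congrArg (· * G'.f) (h.conj_f' hL hM ho hk)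
  have h₂ := congrArg (· * G'.f) (h.conj_f hL hM ho hk)
  have h₃ := h.conj_ff hL hM ho hk
  have h₄ := h.conj_h hL hM ho hk
  simp only [add_mul, smul_mul_assoc, mul_assoc] at h₁ h₁' h₂
  linear_combination (norm := module) (-(R'.d * R'.a)) • h₂ + (R'.d * R'.b) • h₁' +
    (R'.d * R'.e - R'.c * R'.g) • h₁ + (R'.c * R'.a) • h₄ - (R'.d * R'.a) • h₃

/-- The exchange relation of `k₁` and `k₂`. -/
lemma RLL.k_K (h : RLL R R' L M) (hL : G.Rep L) (hM : G'.Rep M) (ho : R.o = R'.o)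
    (hk : Commute G.k G'.k) : R.a • (G.k * G'.K) = R'.a • (G'.K * G.k) := by
  have h₁ := h.row01_col01 hL hM
  have h₂ := congrArg (· * G'.f) (h.row01_col00 hL hM)
  have h₃ := congrArg (G'.e * ·) (h.row00_col01 hL hM)
  simp only [add_mul, mul_add, smul_mul_assoc, mul_smul_comm, mul_assoc, smul_add] at h₁ h₂ h₃
  have h₄ : G'.e * (G'.k * (G.k * G'.f)) = G'.e * (G.k * (G'.k * G'.f)) := by
    rw [← mul_assoc G'.k, ← hk.eq, mul_assoc]
  rw [h₄] at h₂
  rw [ho] at h₃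
  linear_combination (norm := module) h₁ - h₂ - h₃

/-- The exchange relation of `f₁` and `k₂`. -/
lemma RLL.f_K_raw (h : RLL R R' L M) (hL : G.Rep L) (hM : G'.Rep M) : R.a • (G.k * (G.f * G'.K)) =
    R'.b • (G'.K * (G.k * G'.f)) + R'.e • (G'.K * (G.k * G.f)) +
      R'.c • (G'.K * (G'.f₂ * G.k)) := by
  have h₁ := h.row01_col11 hL hM
  have h₂ := congrArg (· * G'.f) (h.row01_col10 hL hM)
  have h₃ := congrArg (G'.e * ·) (h.row00_col10 hL hM)
  have h₃ := congrArg (· * G'.f) h₃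
  have h₄ := congrArg (G'.e * ·) (h.row00_col11 hL hM)
  simp only [add_mul, mul_add, smul_mul_assoc, mul_smul_comm, mul_assoc, smul_add, mul_neg,
    neg_mul] at h₁ h₂ h₃ h₄
  linear_combination (norm := module) h₁ + h₂ - h₃ - h₄

/-- The anticommutator of `e₁` and `f₁`. -/
lemma RLL.e_f_raw (h : RLL R R' L M) (hL : G.Rep L) (hM : G'.Rep M) (ho : R.o = R'.o)
    (hk : Commute G.k G'.k) : (R.a * R'.a) • (G.e * G'.f + G'.f * G.e) =
    (R.a * R'.f) • (G.K * G.ki) - (R.f * R'.a) • (G'.ki * G'.K) := by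
  have h₁ := h.row10_col01 hL hM
  have h₂ := congrArg (· * G'.f) (h.row10_col00 hL hM)
  have h₃ := congrArg (fun x => G'.k * (G.e * (G'.ki * x))) (h.row00_col01 hL hM)
  simp only [add_mul, mul_add, smul_mul_assoc, mul_smul_comm, mul_assoc, smul_add] at h₁ h₂ h₃
  rw [← mul_assoc G'.ki G.k, (hM.commute_ki hk.symm).eq, mul_assoc] at h₃
  simp only [hM.ki_k_assoc] at h₃
  rw [ho] at h₃
  have h₄ : R'.a • (G'.k * (G.e * (G'.f * G.k))) + R'.a • (G'.k * (G'.f * (G.e * G.k))) =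
      R'.f • (G'.k * G.K) - R.f • (G.k * G'.K) := by
    linear_combination (norm := module) h₁ - h₂ - h₃
  have h₅ := congrArg (fun x => G'.ki * (x * G.ki)) h₄
  have h₆ := congrArg (fun x => G'.ki * (x * G.ki)) (h.k_K hL hM ho hk)
  simp only [add_mul, sub_mul, mul_add, mul_sub, smul_mul_assoc, mul_smul_comm, mul_assoc,
    hM.ki_k_assoc, hL.k_ki, mul_one] at h₅ h₆
  linear_combination (norm := module) R.a • h₅ - R.f • h₆

/-- The exchange relation of `f₁` and `k₂`, with `k₁` eliminated. -/
lemma RLL.f_K (h : RLL R R' L M) (hL : G.Rep L) (hM : G'.Rep M) (ho : R.o = R'.o)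
    (hk : Commute G.k G'.k) (ha : IsUnit R.a) : R'.a • (G.f * G'.K) =
      R'.b • (G'.K * G'.f) + R'.e • (G'.K * G.f) + R'.c • (G'.K * (G.ki * (G'.f₂ * G.k))) := by
  have h₁ := congrArg (G.ki * ·) (h.f_K_raw hL hM)
  have h₂ := congrArg (fun x => G.ki * (x * G.ki)) (h.k_K hL hM ho hk)
  simp only [mul_add, smul_mul_assoc, mul_smul_comm, mul_assoc, hL.ki_k_assoc, hL.k_ki,
    mul_one] at h₁ h₂
  have h₃ : ∀ x, R.a • (G'.K * (G.ki * x)) = R'.a • (G.ki * (G'.K * x)) := by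
    intro x
    have := congrArg (· * x) h₂
    simpa only [smul_mul_assoc, mul_assoc] using this
  have e₁ := h₃ (G.k * G'.f)
  have e₂ := h₃ (G.k * G.f)
  have e₃ := h₃ (G'.f₂ * G.k)
  rw [hL.ki_k_assoc] at e₁ e₂
  refine ha.smul_left_cancel.mp ?_
  linear_combination (norm := module) R'.a • h₁ - R'.b • e₁ - R'.e • e₂ - R'.c • e₃

/-! ### The R-matrix in parameters -/

/-- The entries of the R-matrix multiplied by its denominator `(z q² - w) (z q + w)`. The entries
below the diagonal carry powers of `u` and those above it powers of `v`; the R-matrix has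
`(u, v) = (z, w)` and its transpose `(u, v) = (w, z)`. -/
def RCoeffs.poly (q p z w u v : S) : RCoeffs S where
  o := (z * q ^ 2 - w) * (z * q + w)
  a := q * (z - w) * (z * q + w)
  b := v * (q ^ 2 - 1) * (z * q + w)
  c := -(p * v * (q ^ 2 - 1) * (z - w))
  d := q * (z - w) * (z + q * w)
  e := q * (z - w) * (z * q + w) - z * w * (q ^ 2 - 1) * (q + 1)
  f := u * (q ^ 2 - 1) * (z * q + w)
  g := -(p * u * (q ^ 2 - 1) * (z - w))
  r := v ^ 2 * (q - 1) * (q + 1) ^ 2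
  s := u ^ 2 * (q - 1) * (q + 1) ^ 2

section

variable {q p z w u v : S}

/-- The quadratic relation of `f`, before `h` is eliminated. -/
lemma RLL.ff_h (h : RLL R (.poly q p z w u v) L M) (hL : G.Rep L) (hM : G'.Rep M)
    (ho : R.o = (RCoeffs.poly q p z w u v).o) (hk : Commute G.k G'.k) (hp : p ^ 2 = q)
    (huv : u * v = z * w) (hq : IsUnit q) (h₁ : IsUnit (z - w)) (h₂ : IsUnit (z * q + w)) :
    ((z * q ^ 2 - w) * (z - q ^ 2 * w)) •
        ((z + q * w) • (G.f * G'.f) + (z * q + w) • (G'.f * G.f)) +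
      (v * (q ^ 2 - 1) * (z * q ^ 2 - w) * (z + q * w)) • (G'.f * G'.f) -
      (u * (q ^ 2 - 1) * (z - q ^ 2 * w) * (z * q + w)) • (G.f * G.f) -
      (p * v * (q ^ 2 - 1) * (z - w) * (z * q ^ 2 - w)) • G'.h -
      (p * u * (q ^ 2 - 1) * (z - w) * (z - q ^ 2 * w)) • G.h = 0 := by
  have := h.ff_raw hL hM ho hk
  refine ((hq.mul h₁).mul (h₂.pow 2)).smul_left_cancel.mp ?_
  rw [smul_zero, ← this]
  subst hp
  simp only [RCoeffs.poly]
  match_scalars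
  · linear_combination (p ^ 2 * (z - w) * (z + p ^ 2 * w) * (p ^ 4 - 1) ^ 2 *
      (z * p ^ 2 + w) ^ 2) * huv
  · linear_combination ((z * p ^ 4 - w) * (z * p ^ 2 + w) * p ^ 2 * (p ^ 4 - 1) ^ 2 *
      (z - w) ^ 2) * huv
  · ring
  · linear_combination (-(u * (p ^ 4 - 1) * (z * p ^ 2 + w) * p ^ 2 * (p ^ 4 - 1) ^ 2 *
      (z - w) ^ 2)) * huv
  · ring
  · linear_combination (-(p ^ 2 * (z - w) * (z * p ^ 2 + w) * p * u * (p ^ 4 - 1) * (z - w) *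
      (p ^ 2 - 1) * (p ^ 2 + 1) ^ 2)) * huv

/-- The quadratic relation of `f`. -/
lemma RLL.ff (h : RLL R (.poly q p z w u v) L M) (hL : G.Rep L) (hM : G'.Rep M)
    (ho : R.o = (RCoeffs.poly q p z w u v).o) (hk : Commute G.k G'.k) (hp : p ^ 2 = q)
    (huv : u * v = z * w) (hq : IsUnit q) (h₁ : IsUnit (z - w)) (h₂ : IsUnit (z * q + w))
    (h₃ : IsUnit (z * q ^ 2 - w)) (h₄ : IsUnit (z - q ^ 2 * w))
    (hh : (q - 1) • G.h = p • (G.f * G.f)) (hh' : (q - 1) • G'.h = p • (G'.f * G'.f)) :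
    (z + q * w) • (G.f * G'.f) + (z * q + w) • (G'.f * G.f) =
      ((q + 1) * v) • (G'.f * G'.f) + ((q + 1) * u) • (G.f * G.f) := by
  have := h.ff_h hL hM ho hk hp huv hq h₁ h₂
  refine (h₃.mul h₄).smul_left_cancel.mp ?_
  subst hp
  linear_combination (norm := skip) this +
    (p * v * (p ^ 2 + 1) * (z - w) * (z * p ^ 4 - w)) • hh' +
    (p * u * (p ^ 2 + 1) * (z - w) * (z - p ^ 4 * w)) • hh
  module

/-- At `z = q² w` the quadratic relation of `f` expresses `h` through `f`. -/
lemma RLL.h_eq (h : RLL R (.poly q p z w u v) L M) (hL : G.Rep L) (hM : G'.Rep M)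
    (ho : R.o = (RCoeffs.poly q p z w u v).o) (hk : Commute G.k G'.k) (hp : p ^ 2 = q)
    (huv : u * v = z * w) (hq : IsUnit q) (h₁ : IsUnit (z - w)) (h₂ : IsUnit (z * q + w))
    (h₃ : IsUnit (z * q ^ 2 - w)) (h₄ : z = q ^ 2 * w) (hv : IsUnit v) (h₅ : IsUnit (q ^ 2 - 1))
    (hw : IsUnit w) :
    (q - 1) • G'.h = p • (G'.f * G'.f) := by
  have := h.ff_h hL hM ho hk hp huv hq h₁ h₂
  have hpu : IsUnit p := by
    rw [← hp] at hq
    exact (isUnit_pow_iff two_ne_zero).mp hq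
  subst hp
  have h₆ : IsUnit (p ^ 2 + 1) := by
    rw [show (p ^ 2) ^ 2 - 1 = (p ^ 2 - 1) * (p ^ 2 + 1) by ring] at h₅
    exact isUnit_of_mul_isUnit_right h₅
  refine ((((hv.mul h₅).mul h₃).mul (hpu.mul h₆)).mul hw).smul_left_cancel.mp ?_
  subst h₄
  linear_combination (norm := skip) (-1 : S) • this
  module

/-- The exchange relation of `f₁` and `k₂ k₁⁻¹`. -/
lemma RLL.f_ψ (h : RLL R (.poly q p z w u v) L M) (hL : G.Rep L) (hM : G'.Rep M)
    (ho : R.o = (RCoeffs.poly q p z w u v).o) (hk : Commute G.k G'.k) (ha : IsUnit R.a)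
    (huv : u * v = z * w) (h₁ : IsUnit (z - w)) (h₂ : IsUnit (z * q + w))
    (h₃ : IsUnit (z * q ^ 2 - w))
    (hf : (p * (z + q * w)) • (G.ki * (G'.f₂ * G.k)) =
      (p * (z * q + w)) • G'.f₂ + ((q ^ 2 - 1) * u) • G.f) :
    (q * (z + q * w)) • (G.f * (G'.K * G'.ki)) =
      (q * (z * q + w)) • (G'.K * G'.ki * G.f) -
        v • (((q ^ 2 - 1) * (q - 1)) • (G'.K * G'.f * G'.ki) +
          (p * (q ^ 2 - 1)) • (G'.K * G'.f₂ * G'.ki)) := by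
  have e₁ := congrArg (· * G'.ki) (h.f_K hL hM ho hk ha)
  have e₂ := congrArg (fun x => G'.K * (x * G'.ki)) hf
  have e₃ := congrArg (fun x => G'.K * (x * G'.ki)) (h.conj_f hL hM ho hk)
  have e₄ := congrArg (fun x => G'.K * (x * G'.ki)) (h.conj_f' hL hM ho hk)
  simp only [add_mul, mul_add, smul_mul_assoc, mul_smul_comm, mul_assoc, hM.k_ki, mul_one]
    at e₁ e₂ e₃ e₄ ⊢
  simp only [RCoeffs.poly] at e₁ e₂ e₃ e₄
  refine ((h₁.mul h₂).mul h₃).smul_left_cancel.mp ?_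
  linear_combination (norm := skip) ((z + q * w) * (z * q ^ 2 - w)) • e₁ -
    (v * (q ^ 2 - 1) * (z - w) * (z * q ^ 2 - w)) • e₂ -
    (q * (z - w) * (z * q + w)) • e₃ + (v * (q ^ 2 - 1) * (z * q + w)) • e₄
  match_scalars <;> first
    | ring1
    | linear_combination ((q^2-1)^2*((z*q+w)^2-(z-w)*(z*q^2-w)))*huv

/-- On the pole `w = - q z` the R-matrix degenerates, and `f₂` is proportional to a conjugate
of `f₁`. -/
lemma RLL.f₂_eq (h : RLL R R' L M) (hL : G.Rep L) (hM : G'.Rep M) (ho : R.o = 0) (ha : R.a = 0)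
    (hb : R.b = 0) : R'.c • (G'.f₂ * G.k) + R'.e • (G.k * G.f) = 0 := by
  have h₁ := congrArg (G'.e * ·) (h.row00_col11 hL hM)
  have h₂ := h.row01_col11 hL hM
  simp only [ho, ha, hb, zero_smul, neg_zero, mul_zero, mul_add, add_mul,
    smul_add, mul_smul_comm, mul_assoc] at h₁ h₂
  have h₃ : G'.Ki * (R'.c • (G'.K * (G'.f₂ * G.k)) + R'.e • (G'.K * (G.k * G.f))) = G'.Ki * 0 := by
    congr 1
    linear_combination (norm := module) h₁ - h₂
  simpa only [mul_add, mul_smul_comm, hM.Ki_K_assoc, mul_zero] using h₃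

/-- On the pole `w = - q z` the R-matrix has rank one, and `k₃` is expressed through `k₂` and the
anticommutator of `e₁` and a conjugate of `f₁`. -/
lemma RLL.K₃_eq (h : RLL R R L M) (hL : G.Rep L) (hM : G'.Rep M) (ho : R.o = 0) (ha : R.a = 0)
    (hb : R.b = 0) (hf : R.f = 0) {κ : S}
    (h₁ : R.g = κ * R.d) (h₂ : R.e = κ * R.c) (h₃ : R.c = κ * R.r) (he : IsUnit R.e) :
    G'.K₃ * G.k =
      G'.K * (G.K + G.e * (G.k * G.f) + G.k * (G.f * (G.ki * (G.e * G.k)))) := by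
  have e₀ := h.f₂_eq hL hM ho ha hb
  have e₁ := congrArg (fun x => G'.K * (x * (G.ki * (G.e * G.k)))) e₀
  have e₂ := congrArg (fun x => G'.e₃₁ * x) (h.row00_col11 hL hM)
  have e₃ := congrArg (fun x => G'.e * x) (h.row10_col11 hL hM)
  have e₄ := h.row02_row11_col11 hL hM h₁ h₂ h₃
  have e₅ := congrArg (fun x => G'.e₂ * (G'.K * x)) e₀
  simp only [ho, ha, hf, zero_smul, neg_zero, mul_zero, zero_mul, mul_add, add_mul,
    mul_sub, smul_add, mul_smul_comm, smul_mul_assoc, mul_assoc, hL.k_ki_assoc]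
    at e₁ e₂ e₃ e₄ e₅ ⊢
  refine he.smul_left_cancel.mp ?_
  linear_combination (norm := skip) e₃ - e₁ - e₄ + κ • e₂ - κ • e₅
  rw [h₂]
  module

end

end

/-! ### Operations on exchange relations -/

noncomputable section

section

variable {S T B : Type*} [CommRing S] [CommRing T] [Ring B] [Algebra S B]
variable {R R' : RCoeffs S} {L M : Matrix (Fin 3) (Fin 3) B} {G G' : GaussData B}

/-- Entrywise image of a family of R-matrix entries. -/
def RCoeffs.map (φ : S → T) (R : RCoeffs S) : RCoeffs T :=
  ⟨φ R.o, φ R.a, φ R.b, φ R.c, φ R.d, φ R.e, φ R.f, φ R.g, φ R.r, φ R.s⟩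

instance : SMul S (RCoeffs S) := ⟨fun c R => R.map (c * ·)⟩

lemma RCoeffs.smul_def (c : S) (R : RCoeffs S) : c • R = R.map (c * ·) := rfl

lemma RCoeffs.mat_map (φ : S → T) (hφ : φ 0 = 0) (R : RCoeffs S) :
    (R.map φ).mat = R.mat.map φ := by
  have : (R.map φ).mat₉ = R.mat₉.map φ := by
    refine Matrix.ext fun i j => ?_
    change Fin 9 at i j
    unfold RCoeffs.mat₉ RCoeffs.map
    revert i j
    simp [Fin.forall_fin_succ, hφ]
  rw [RCoeffs.mat, this, RCoeffs.mat, Matrix.submatrix_map]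

lemma RCoeffs.mat_smul (c : S) (R : RCoeffs S) : (c • R).mat = c • R.mat := by
  rw [RCoeffs.smul_def, RCoeffs.mat_map _ (mul_zero c)]
  rfl

lemma RCoeffs.poly_map (φ : S →+* T) (q p z w u v : S) :
    (RCoeffs.poly q p z w u v).map φ =
      .poly (φ q) (φ p) (φ z) (φ w) (φ u) (φ v) := by
  simp [RCoeffs.map, RCoeffs.poly]

lemma map_algebraMap_smul (c : S) (X : Matrix (Fin 3 × Fin 3) (Fin 3 × Fin 3) S) :
    (c • X).map (algebraMap S B) = c • X.map (algebraMap S B) := by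
  ext i j
  rw [Matrix.map_apply, Matrix.smul_apply, Matrix.smul_apply, Matrix.map_apply, smul_eq_mul,
    map_mul, ← Algebra.smul_def]

lemma RLL.smul_iff {c : S} (hc : IsUnit c) : RLL (c • R) (c • R') L M ↔ RLL R R' L M := by
  unfold RLL
  rw [RCoeffs.mat_smul, RCoeffs.mat_smul, map_algebraMap_smul, map_algebraMap_smul,
    Matrix.smul_mul, Matrix.mul_smul, hc.smul_left_cancel]

end

/-! ### The graded flip -/

section

variable {B : Type*} [Ring B]

/-- Conjugation by the graded flip of `V ⊗ V`. -/
def flipConj (X : Matrix (Fin 3 × Fin 3) (Fin 3 × Fin 3) B) :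
    Matrix (Fin 3 × Fin 3) (Fin 3 × Fin 3) B :=
  fun u v => ((-1) ^ (par u.1 * par u.2 + par v.1 * par v.2) : ℤ) • X u.swap v.swap

lemma flipConj_mul (X Y : Matrix (Fin 3 × Fin 3) (Fin 3 × Fin 3) B) :
    flipConj (X * Y) = flipConj X * flipConj Y := by
  ext u v
  simp only [flipConj, Matrix.mul_apply]
  rw [Finset.smul_sum, ← Equiv.sum_comp (Equiv.prodComm (Fin 3) (Fin 3))]
  refine Finset.sum_congr rfl fun x _ => ?_
  rw [smul_mul_assoc, mul_smul_comm, smul_smul]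
  congr 1
  have : ((-1 : ℤ) ^ (par x.1 * par x.2)) * (-1) ^ (par x.1 * par x.2) = 1 := by
    rw [← pow_add, ← two_mul, pow_mul, neg_one_sq, one_pow]
  rw [pow_add, pow_add, pow_add]
  linear_combination (-(-1) ^ (par u.1 * par u.2) * (-1) ^ (par v.1 * par v.2)) * this

lemma flipConj_tens₁ (M : Matrix (Fin 3) (Fin 3) B) : flipConj (tens₁ M) = tens₂ M := by
  ext ⟨i, k⟩ ⟨j, l⟩
  by_cases h : i = j
  · subst h
    simp [flipConj, tens₁, tens₂, mul_add]
  · simp [flipConj, tens₁, tens₂, h]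

lemma flipConj_tens₂ (M : Matrix (Fin 3) (Fin 3) B) : flipConj (tens₂ M) = tens₁ M := by
  rw [← flipConj_tens₁]
  ext ⟨i, k⟩ ⟨j, l⟩
  simp only [flipConj, Prod.swap_prod_mk, smul_smul]
  rw [← pow_add, mul_comm (par k), mul_comm (par l), ← two_mul, pow_mul, neg_one_sq, one_pow,
    one_smul]

/-- The entries of the conjugate of an R-matrix by the graded flip. -/
def RCoeffs.flip {S : Type*} [CommRing S] (R : RCoeffs S) : RCoeffs S :=
  ⟨R.o, R.a, R.f, -R.g, R.d, R.e, R.b, -R.c, R.s, R.r⟩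

lemma RCoeffs.mat_flip {S : Type*} [CommRing S] (R : RCoeffs S) : R.flip.mat = flipConj R.mat := by
  ext ⟨i, k⟩ ⟨j, l⟩
  fin_cases i <;> fin_cases k <;> fin_cases j <;> fin_cases l <;>
    simp [flipConj, RCoeffs.flip, RCoeffs.mat, RCoeffs.mat₉, finProdFinEquiv, par]

/-- Unitarity of the R-matrix. -/
lemma RCoeffs.poly_unitarity {S : Type*} [CommRing S] {q p z w : S} (hp : p ^ 2 = q) :
    (RCoeffs.poly q p z w z w).mat * (RCoeffs.poly q p w z w z).flip.mat =
      ((RCoeffs.poly q p z w z w).o * (RCoeffs.poly q p w z w z).o) • 1 := by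
  subst hp
  ext ⟨i, k⟩ ⟨j, l⟩
  rw [Matrix.mul_apply, Fintype.sum_prod_type]
  fin_cases i <;> fin_cases k <;> fin_cases j <;> fin_cases l <;>
    simp [RCoeffs.flip, RCoeffs.mat, RCoeffs.mat₉, finProdFinEquiv, Fin.sum_univ_three,
      RCoeffs.poly] <;> ring

lemma RCoeffs.poly_unitarity' {S : Type*} [CommRing S] {q p z w : S} (hp : p ^ 2 = q) :
    (RCoeffs.poly q p z w z w).flip.mat * (RCoeffs.poly q p w z w z).mat =
      ((RCoeffs.poly q p z w z w).o * (RCoeffs.poly q p w z w z).o) • 1 := by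
  have h := congrArg flipConj (RCoeffs.poly_unitarity (z := z) (w := w) hp)
  rw [flipConj_mul, ← RCoeffs.mat_flip, ← RCoeffs.mat_flip] at h
  have h₁ : (RCoeffs.poly q p w z w z).flip.flip = RCoeffs.poly q p w z w z := by
    simp [RCoeffs.flip]
  rw [h₁] at h
  rw [h]
  ext ⟨i, k⟩ ⟨j, l⟩
  by_cases hij : i = j <;> by_cases hkl : k = l
  · subst hij hkl
    simp [flipConj, ← two_mul, pow_mul]
  all_goals simp [flipConj, hij, hkl]

/-- The entries of the R-matrix times its denominator, or of the transpose of this matrix. -/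
def RCoeffs.polyT {S : Type*} [CommRing S] (tr : Bool) (q p z w : S) : RCoeffs S :=
  if tr then .poly q p z w w z else .poly q p z w z w

@[simp] lemma RCoeffs.polyT_o {S : Type*} [CommRing S] (tr : Bool) (q p z w : S) :
    (RCoeffs.polyT tr q p z w).o = (z * q ^ 2 - w) * (z * q + w) := by
  cases tr <;> rfl

@[simp] lemma RCoeffs.polyT_a {S : Type*} [CommRing S] (tr : Bool) (q p z w : S) :
    (RCoeffs.polyT tr q p z w).a = q * (z - w) * (z * q + w) := by
  cases tr <;> rfl

lemma RCoeffs.transpose_flip {S : Type*} [CommRing S] (R : RCoeffs S) :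
    R.transpose.flip = R.flip.transpose := rfl

lemma RCoeffs.polyT_unitarity {S : Type*} [CommRing S] {tr : Bool} {q p z w : S}
    (hp : p ^ 2 = q) :
    (RCoeffs.polyT tr q p z w).mat * (RCoeffs.polyT tr q p w z).flip.mat =
      ((RCoeffs.polyT tr q p z w).o * (RCoeffs.polyT tr q p w z).o) • 1 := by
  cases tr
  · exact RCoeffs.poly_unitarity hp
  · have h := congrArg Matrix.transpose (RCoeffs.poly_unitarity' (z := w) (w := z) hp)
    rw [Matrix.transpose_mul, ← RCoeffs.mat_transpose, ← RCoeffs.mat_transpose,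
      ← RCoeffs.transpose_flip, Matrix.transpose_smul, Matrix.transpose_one, mul_comm] at h
    exact h

lemma RCoeffs.polyT_unitarity' {S : Type*} [CommRing S] {tr : Bool} {q p z w : S}
    (hp : p ^ 2 = q) :
    (RCoeffs.polyT tr q p z w).flip.mat * (RCoeffs.polyT tr q p w z).mat =
      ((RCoeffs.polyT tr q p z w).o * (RCoeffs.polyT tr q p w z).o) • 1 := by
  cases tr
  · exact RCoeffs.poly_unitarity' hp
  · have h := congrArg Matrix.transpose (RCoeffs.poly_unitarity (z := w) (w := z) hp)
    rw [Matrix.transpose_mul, ← RCoeffs.mat_transpose, ← RCoeffs.mat_transpose,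
      ← RCoeffs.transpose_flip, Matrix.transpose_smul, Matrix.transpose_one, mul_comm] at h
    exact h

/-- Unitarity turns an exchange relation of `L(z)` and `M(w)` into one of `M(w)` and `L(z)`. -/
lemma RLL.flip {S : Type*} [CommRing S] [Algebra S B] {tr : Bool} {q p z w z' : S} {cl cr : S}
    {L M : Matrix (Fin 3) (Fin 3) B} (hp : p ^ 2 = q)
    (h : RLL (cl • .polyT tr q p z w) (cr • .polyT tr q p z' w) L M) :
    RLL ((cr * (RCoeffs.polyT tr q p z' w).o * (RCoeffs.polyT tr q p w z').o) •
          .polyT tr q p w z)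
      ((cl * (RCoeffs.polyT tr q p z w).o * (RCoeffs.polyT tr q p w z).o) •
          .polyT tr q p w z') M L := by
  have hs : ∀ X : Matrix (Fin 3 × Fin 3) (Fin 3 × Fin 3) S,
      flipConj (X.map (algebraMap S B)) = (flipConj X).map (algebraMap S B) := by
    intro X
    ext u v
    simp [flipConj]
  have hsm : ∀ (c : S) (R : RCoeffs S), flipConj ((c • R).mat) = c • R.flip.mat := by
    intro c R
    ext u v
    rw [RCoeffs.mat_flip, RCoeffs.mat_smul]
    simp only [flipConj, Matrix.smul_apply]
    rw [smul_comm]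
  have h₁ := congrArg flipConj h
  simp only [flipConj_mul, flipConj_tens₁, flipConj_tens₂, hs, hsm] at h₁
  have h₂ := congrArg (fun X => (RCoeffs.polyT tr q p w z).mat.map (algebraMap S B) * X *
    (RCoeffs.polyT tr q p w z').mat.map (algebraMap S B)) h₁
  have hm : ∀ X Y : Matrix (Fin 3 × Fin 3) (Fin 3 × Fin 3) S,
      X.map (algebraMap S B) * Y.map (algebraMap S B) = (X * Y).map (algebraMap S B) :=
    fun X Y => by rw [Matrix.map_mul]
  have e₁ : ∀ X Y : Matrix (Fin 3 × Fin 3) (Fin 3 × Fin 3) B,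
      (RCoeffs.polyT tr q p w z).mat.map (algebraMap S B) *
        ((cl • (RCoeffs.polyT tr q p z w).flip.mat).map (algebraMap S B) * X) * Y =
      (cl * (RCoeffs.polyT tr q p z w).o * (RCoeffs.polyT tr q p w z).o) • (X * Y) := by
    intro X Y
    rw [← Matrix.mul_assoc, hm, Matrix.mul_smul, RCoeffs.polyT_unitarity hp, smul_smul,
      map_algebraMap_smul, Matrix.map_one _ (map_zero _) (map_one _), Matrix.smul_mul,
      Matrix.one_mul, Matrix.smul_mul]
    congr 1
    ring
  have e₂ : ∀ X Y : Matrix (Fin 3 × Fin 3) (Fin 3 × Fin 3) B,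
      Y * (X * (cr • (RCoeffs.polyT tr q p z' w).flip.mat).map (algebraMap S B)) *
        (RCoeffs.polyT tr q p w z').mat.map (algebraMap S B) =
      (cr * (RCoeffs.polyT tr q p z' w).o * (RCoeffs.polyT tr q p w z').o) • (Y * X) := by
    intro X Y
    rw [Matrix.mul_assoc, Matrix.mul_assoc, hm, Matrix.smul_mul, RCoeffs.polyT_unitarity' hp,
      smul_smul, map_algebraMap_smul, Matrix.map_one _ (map_zero _) (map_one _), Matrix.mul_smul,
      Matrix.mul_one, Matrix.mul_smul, mul_assoc]
  rw [e₁, e₂] at h₂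
  unfold RLL
  rw [RCoeffs.mat_smul, RCoeffs.mat_smul, map_algebraMap_smul, map_algebraMap_smul,
    Matrix.smul_mul, Matrix.mul_smul]
  exact h₂.symm

end

/-! ### The R-matrix as a series -/

/-- The denominator of `Rmat`. -/
def Rden (q : ℂ) : PowerSeries ℂ :=
  (PowerSeries.X * PowerSeries.C q ^ 2 - 1) * (PowerSeries.X * PowerSeries.C q + 1)

/-- The entries of `Rmat`, times the common denominator. -/
def Rnum (q p : ℂ) : RCoeffs (PowerSeries ℂ) :=
  .poly (PowerSeries.C q) (PowerSeries.C p) PowerSeries.X 1 PowerSeries.X 1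

/-- The entries of `RmatT`, times the common denominator. -/
def RnumT (tr : Bool) (q p : ℂ) : RCoeffs (PowerSeries ℂ) :=
  .polyT tr (PowerSeries.C q) (PowerSeries.C p) PowerSeries.X 1

/-- The R-matrix or its transpose. -/
def RmatT (tr : Bool) (q p : ℂ) : Matrix (Fin 3 × Fin 3) (Fin 3 × Fin 3) (PowerSeries ℂ) :=
  if tr then (Rmat q p)ᵀ else Rmat q p

lemma Rmat_eq (q p : ℂ) : Rden q • Rmat q p = (Rnum q p).mat := by
  have h₁ : (PowerSeries.C (q ^ 2) * PowerSeries.X - 1 : PowerSeries ℂ) *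
      (PowerSeries.C (q ^ 2) * PowerSeries.X - 1)⁻¹ = 1 :=
    PowerSeries.mul_inv_cancel _ (by simp)
  have h₂ : ((PowerSeries.C (q ^ 2) * PowerSeries.X - 1) *
      (PowerSeries.C q * PowerSeries.X + 1) : PowerSeries ℂ) *
      ((PowerSeries.C (q ^ 2) * PowerSeries.X - 1) * (PowerSeries.C q * PowerSeries.X + 1))⁻¹ = 1 :=
    PowerSeries.mul_inv_cancel _ (by simp)
  have hd : Rden q = (PowerSeries.C (q ^ 2) * PowerSeries.X - 1) *
      (PowerSeries.C q * PowerSeries.X + 1) := by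
    rw [Rden, map_pow]
    ring
  unfold Rmat
  simp only
  set D₁ := (PowerSeries.C (q ^ 2) * PowerSeries.X - 1 : PowerSeries ℂ)⁻¹
  set D₂ := ((PowerSeries.C (q ^ 2) * PowerSeries.X - 1) *
    (PowerSeries.C q * PowerSeries.X + 1) : PowerSeries ℂ)⁻¹
  have key : ∀ (R : RCoeffs (PowerSeries ℂ)), Rden q • R.mat = (Rden q • R).mat := fun R =>
    (RCoeffs.mat_smul _ R).symm
  refine (key ⟨1, PowerSeries.C q * (PowerSeries.X - 1) * D₁, PowerSeries.C (q ^ 2 - 1) * D₁,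
    -(PowerSeries.C (p * (q ^ 2 - 1)) * (PowerSeries.X - 1) * D₂),
    PowerSeries.C q * (PowerSeries.X - 1) * (PowerSeries.X + PowerSeries.C q) * D₂,
    PowerSeries.C q * (PowerSeries.X - 1) * D₁ -
      PowerSeries.C ((q ^ 2 - 1) * (q + 1)) * PowerSeries.X * D₂,
    PowerSeries.C (q ^ 2 - 1) * PowerSeries.X * D₁,
    -(PowerSeries.C (p * (q ^ 2 - 1)) * PowerSeries.X * (PowerSeries.X - 1) * D₂),
    PowerSeries.C ((q - 1) * (q + 1) ^ 2) * D₂,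
    PowerSeries.C ((q - 1) * (q + 1) ^ 2) * PowerSeries.X ^ 2 * D₂⟩).trans ?_
  congr 1
  rw [RCoeffs.smul_def, hd]
  simp only [RCoeffs.map, Rnum, RCoeffs.poly, RCoeffs.mk.injEq, map_mul, map_sub, map_pow, map_one,
    map_add] at h₁ h₂ ⊢
  set t : PowerSeries ℂ := PowerSeries.C q
  set x : PowerSeries ℂ := PowerSeries.X
  refine ⟨by ring, ?_, ?_, ?_, ?_, ?_, ?_, ?_, ?_, ?_⟩
  · linear_combination (t * x + 1) * t * (x - 1) * h₁
  · linear_combination (t * x + 1) * (t ^ 2 - 1) * h₁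
  · linear_combination (-(PowerSeries.C p * (t ^ 2 - 1) * (x - 1))) * h₂
  · linear_combination (t * (x - 1) * (x + t)) * h₂
  · linear_combination (t * x + 1) * t * (x - 1) * h₁ - ((t ^ 2 - 1) * (t + 1) * x) * h₂
  · linear_combination (t * x + 1) * (t ^ 2 - 1) * x * h₁
  · linear_combination (-(PowerSeries.C p * (t ^ 2 - 1) * x * (x - 1))) * h₂
  · linear_combination ((t - 1) * (t + 1) ^ 2) * h₂
  · linear_combination ((t - 1) * (t + 1) ^ 2 * x ^ 2) * h₂

lemma RmatT_eq (tr : Bool) (q p : ℂ) : Rden q • RmatT tr q p = (RnumT tr q p).mat := by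
  have h := Rmat_eq q p
  cases tr
  · exact h
  · have h' := congrArg Matrix.transpose h
    rw [Matrix.transpose_smul, ← RCoeffs.mat_transpose] at h'
    exact h'

end

/-! ### Frames -/

noncomputable section

section

variable {A : Type*} [Ring A] [Algebra ℂ A]

/-- Two-variable series over `A` in which a one-sided series in `z`, one in `w` and a power series
with central coefficients in `z / w` or in `w / z` can be multiplied. The coefficient of
`z ^ m w ^ n` is `co m n`; the central variable is `z / w` if `σ = +` and `w / z` if `σ = -`. -/
structure Frame (s s' : Sgn) (B : Type*) [Ring B] [Algebra (PowerSeries (Zc A)) B] where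
  ι₁ : PowerSeries A →+* B
  ι₂ : PowerSeries A →+* B
  σ : Sgn
  co : ℤ → ℤ → B →+ A
  co_inj : ∀ F, (∀ m n, co m n F = 0) → F = 0
  co_mul : ∀ u v m n, co m n (ι₁ u * ι₂ v) = coefZ s u m * coefZ s' v n
  co_mul' : ∀ u v m n, co m n (ι₂ v * ι₁ u) = coefZ s' v n * coefZ s u m
  co_series : ∀ (r : PowerSeries (Zc A)) (F : B) (m n : ℤ) (N : ℕ), m.natAbs + n.natAbs < N →
    co m n (r • F) = ∑ k ∈ Finset.range N,
      PowerSeries.coeff k r • co (m - σ.toInt * k) (n + σ.toInt * k) F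

/-- The coefficientwise inclusion of the centre. -/
def valS : PowerSeries (Zc A) →+* PowerSeries A := PowerSeries.map (Zc.val : Zc A →ₐ[ℂ] A).toRingHom

@[simp] lemma coeff_valS (r : PowerSeries (Zc A)) (k : ℕ) :
    PowerSeries.coeff k (valS r) = ((PowerSeries.coeff k r : Zc A) : A) := by
  simp [valS]

lemma valS_comm (r : PowerSeries (Zc A)) (F : PowerSeries A) : valS r * F = F * valS r := by
  ext n
  rw [PowerSeries.coeff_mul, PowerSeries.coeff_mul, ← Finset.Nat.sum_antidiagonal_swap]
  refine Finset.sum_congr rfl fun x _ => ?_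
  rw [coeff_valS, center_comm]
  simp

variable (A) in
/-- Series in `x` and `w` with `z = x w`, or in `x` and `z⁻¹` with `w⁻¹ = x z⁻¹`; the variable
`x = z / w` is the outer one. -/
def DiagRing : Type _ := PowerSeries (PowerSeries A)

instance : Ring (DiagRing A) := inferInstanceAs (Ring (PowerSeries (PowerSeries A)))

lemma map_valS_comm (r : PowerSeries (Zc A)) (F : PowerSeries (PowerSeries A)) :
    PowerSeries.map PowerSeries.C (valS r) * F = F * PowerSeries.map PowerSeries.C (valS r) := by
  ext n : 1
  rw [PowerSeries.coeff_mul, PowerSeries.coeff_mul, ← Finset.Nat.sum_antidiagonal_swap]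
  refine Finset.sum_congr rfl fun x _ => ?_
  ext j
  simp [center_comm]

instance : Algebra (PowerSeries (Zc A)) (DiagRing A) :=
  RingHom.toAlgebra' (((PowerSeries.map PowerSeries.C).comp valS :
      PowerSeries (Zc A) →+* PowerSeries (PowerSeries A))) map_valS_comm

variable (A) in
/-- Series in two variables, their product being the central variable. -/
def QuadRing : Type _ := PowerSeries (PowerSeries A)

instance : Ring (QuadRing A) := inferInstanceAs (Ring (PowerSeries (PowerSeries A)))

lemma monomial_center_comm (c : Zc A) (k : ℕ) (F : PowerSeries A) :
    (PowerSeries.monomial k (c : A) : PowerSeries A) * F = F * PowerSeries.monomial k (c : A) := by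
  have hm : PowerSeries.monomial k (c : A) =
      valS (PowerSeries.monomial k c : PowerSeries (Zc A)) := by
    ext n
    rw [coeff_valS, PowerSeries.coeff_monomial, PowerSeries.coeff_monomial]
    split_ifs <;> simp
  rw [hm, valS_comm]

lemma diagHom_valS_comm (r : PowerSeries (Zc A)) (F : PowerSeries (PowerSeries A)) :
    diagHom (valS r) * F = F * diagHom (valS r) := by
  ext n : 1
  rw [PowerSeries.coeff_mul, PowerSeries.coeff_mul, ← Finset.Nat.sum_antidiagonal_swap]
  refine Finset.sum_congr rfl fun x _ => ?_
  simp [monomial_center_comm]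

instance : Algebra (PowerSeries (Zc A)) (QuadRing A) :=
  RingHom.toAlgebra' ((diagHom.comp valS :
      PowerSeries (Zc A) →+* PowerSeries (PowerSeries A))) diagHom_valS_comm

variable (A)

/-- The frame for two series in `z` and `w`. -/
def framePP : Frame (A := A) .pos .pos (DiagRing A) where
  ι₁ := diagHom
  ι₂ := PowerSeries.C
  σ := .pos
  co m n := co₂ m (m + n)
  co_inj F h := eq_zero_of_co₂ fun i j =>
    (congrArg₂ (fun a b => co₂ a b F) rfl (by ring)).trans (h i (j - i))
  co_mul u v m n := by
    refine (co₂_diag_mul_C u v m (m + n)).trans ?_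
    simp [coefZ_eq_extZ, Sgn.toInt]
  co_mul' u v m n := by
    refine (co₂_C_mul_diag u v m (m + n)).trans ?_
    simp [coefZ_eq_extZ, Sgn.toInt]
  co_series r F m n N hN := by
    refine (co₂_map_mul (valS r) F _ _ N (by omega)).trans (Finset.sum_congr rfl fun k _ => ?_)
    rw [coeff_valS]
    simp only [Sgn.toInt, one_mul, sub_add_add_cancel]
    rfl

/-- The frame for two series in `z⁻¹` and `w⁻¹`. -/
def frameNN : Frame (A := A) .neg .neg (DiagRing A) where
  ι₁ := PowerSeries.C
  ι₂ := diagHom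
  σ := .pos
  co m n := co₂ (-n) (-n - m)
  co_inj F h := eq_zero_of_co₂ fun i j =>
    (congrArg₂ (fun a b => co₂ a b F) (by ring) (by ring)).trans (h (i - j) (-i))
  co_mul u v m n := by
    refine (co₂_C_mul_diag v u (-n) (-n - m)).trans ?_
    rw [show -n - m - -n = -m by ring]
    simp [coefZ_eq_extZ, Sgn.toInt]
  co_mul' u v m n := by
    refine (co₂_diag_mul_C v u (-n) (-n - m)).trans ?_
    rw [show -n - m - -n = -m by ring]
    simp [coefZ_eq_extZ, Sgn.toInt]
  co_series r F m n N hN := by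
    refine (co₂_map_mul (valS r) F _ _ N (by omega)).trans (Finset.sum_congr rfl fun k _ => ?_)
    rw [coeff_valS]
    simp only [Sgn.toInt, one_mul]
    rw [show -(n + (k : ℤ)) = -n - k by ring, show -n - (k : ℤ) - (m - k) = -n - m by ring]
    rfl

/-- The frame for series in `z` and `w⁻¹`. -/
def framePN : Frame (A := A) .pos .neg (QuadRing A) where
  ι₁ := PowerSeries.map PowerSeries.C
  ι₂ := PowerSeries.C
  σ := .pos
  co m n := co₂ m (-n)
  co_inj F h := eq_zero_of_co₂ fun i j =>
    (congrArg₂ (fun a b => co₂ a b F) rfl (by ring)).trans (h i (-j))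
  co_mul u v m n := by
    refine (co₂_map_mul_C u v m (-n)).trans ?_
    simp [coefZ_eq_extZ, Sgn.toInt]
  co_mul' u v m n := by
    refine (co₂_C_mul_map u v m (-n)).trans ?_
    simp [coefZ_eq_extZ, Sgn.toInt]
  co_series r F m n N hN := by
    refine (co₂_diag_mul (valS r) F _ _ N (by omega)).trans (Finset.sum_congr rfl fun k _ => ?_)
    rw [coeff_valS]
    simp only [Sgn.toInt, one_mul]
    rw [show -(n + (k : ℤ)) = -n - k by ring]
    rfl

/-- The frame for series in `z⁻¹` and `w`. -/
def frameNP : Frame (A := A) .neg .pos (QuadRing A) where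
  ι₁ := PowerSeries.C
  ι₂ := PowerSeries.map PowerSeries.C
  σ := .neg
  co m n := co₂ n (-m)
  co_inj F h := eq_zero_of_co₂ fun i j =>
    (congrArg₂ (fun a b => co₂ a b F) rfl (by ring)).trans (h (-j) i)
  co_mul u v m n := by
    refine (co₂_C_mul_map v u n (-m)).trans ?_
    simp [coefZ_eq_extZ, Sgn.toInt]
  co_mul' u v m n := by
    refine (co₂_map_mul_C v u n (-m)).trans ?_
    simp [coefZ_eq_extZ, Sgn.toInt]
  co_series r F m n N hN := by
    refine (co₂_diag_mul (valS r) F _ _ N (by omega)).trans (Finset.sum_congr rfl fun k _ => ?_)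
    rw [coeff_valS]
    simp only [Sgn.toInt, neg_mul, one_mul, sub_neg_eq_add, ← sub_eq_add_neg, neg_add]
    rfl

end

/-! ### Exchange relations of L-operators -/

section

variable {A : Type*} [Ring A] [Algebra ℂ A]

/-- The relation `R(θ z / w) M₁(z) N₂(w) = N₂(w) M₁(z) R(θ' z / w)`, coefficient by coefficient. -/
def Exch (R : Matrix (Fin 3 × Fin 3) (Fin 3 × Fin 3) (PowerSeries ℂ)) (θ θ' : Zc A) (s s' : Sgn)
    (M N : Matrix (Fin 3) (Fin 3) (PowerSeries A)) : Prop :=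
  ∀ m n : ℤ, ∑ k ∈ Finset.range (m.natAbs + n.natAbs + 1),
      θ ^ k • (R.map (fun h => algebraMap ℂ A (PowerSeries.coeff k h)) *
        (tens₁ (matCoefZ s M (m - k)) * tens₂ (matCoefZ s' N (n + k)))) =
    ∑ k ∈ Finset.range (m.natAbs + n.natAbs + 1),
      θ' ^ k • (tens₂ (matCoefZ s' N (n + k)) * tens₁ (matCoefZ s M (m - k)) *
        R.map (fun h => algebraMap ℂ A (PowerSeries.coeff k h)))

lemma coefZ_scale (τ : (Zc A)ˣ) (s : Sgn) (u : PowerSeries A) (m : ℤ) :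
    coefZ s (scale ((τ ^ s.toInt : (Zc A)ˣ) : Zc A) u) m =
      ((τ ^ m : (Zc A)ˣ) : Zc A) • coefZ s u m := by
  rw [center_smul_def]
  cases s
  · simp only [coefZ, Sgn.toInt, zpow_one]
    split_ifs with h
    · rw [coeff_scale]
      lift m to ℕ using h
      simp
    · simp
  · simp only [coefZ, Sgn.toInt]
    split_ifs with h
    · rw [coeff_scale]
      obtain ⟨k, rfl⟩ : ∃ k : ℕ, m = -k := ⟨(-m).toNat, by omega⟩
      simp only [neg_neg, Int.toNat_natCast, zpow_neg, zpow_natCast, zpow_one]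
      congr 1
    · simp

/-- The substitution `z ↦ τ z` in a matrix of one-sided series of sign `s`. -/
def matScale (s : Sgn) (τ : (Zc A)ˣ) (M : Matrix (Fin 3) (Fin 3) (PowerSeries A)) :
    Matrix (Fin 3) (Fin 3) (PowerSeries A) :=
  M.map (scale ((τ ^ s.toInt : (Zc A)ˣ) : Zc A))

lemma matCoefZ_matScale (s : Sgn) (τ : (Zc A)ˣ) (M : Matrix (Fin 3) (Fin 3) (PowerSeries A))
    (m : ℤ) : matCoefZ s (matScale s τ M) m = ((τ ^ m : (Zc A)ˣ) : Zc A) • matCoefZ s M m := by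
  ext i j
  exact coefZ_scale τ s (M i j) m

lemma tens₁_smul (c : Zc A) (M : Matrix (Fin 3) (Fin 3) A) : tens₁ (c • M) = c • tens₁ M := by
  ext i j
  simp [tens₁]

lemma tens₂_smul (c : Zc A) (M : Matrix (Fin 3) (Fin 3) A) : tens₂ (c • M) = c • tens₂ M := by
  ext i j
  simp only [tens₂, Matrix.smul_apply]
  split_ifs
  · rw [mul_smul_comm]
  · simp

lemma Exch.scale {R : Matrix (Fin 3 × Fin 3) (Fin 3 × Fin 3) (PowerSeries ℂ)} {θ θ' : Zc A}
    {s s' : Sgn} {M N : Matrix (Fin 3) (Fin 3) (PowerSeries A)} (h : Exch R θ θ' s s' M N)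
    (τ τ' : (Zc A)ˣ) :
    Exch R (θ * ((τ * τ'⁻¹ : (Zc A)ˣ) : Zc A)) (θ' * ((τ * τ'⁻¹ : (Zc A)ˣ) : Zc A)) s s'
      (matScale s τ M) (matScale s' τ' N) := by
  have key : ∀ (m n : ℤ) (k : ℕ), ((τ * τ'⁻¹ : (Zc A)ˣ) : Zc A) ^ k *
      (((τ ^ (m - k) : (Zc A)ˣ) : Zc A) * ((τ' ^ (n + k) : (Zc A)ˣ) : Zc A)) =
      ((τ ^ m * τ' ^ n : (Zc A)ˣ) : Zc A) := by
    intro m n k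
    rw [← Units.val_pow_eq_pow_val, ← Units.val_mul, ← Units.val_mul]
    congr 1
    rw [mul_pow, zpow_sub, zpow_add, zpow_natCast, zpow_natCast, inv_pow]
    have aux : ∀ a a' b b' c d : (Zc A)ˣ, a * b' * (c * a' * (d * b)) =
        a * a' * (b' * b) * (c * d) := by
      intros
      ac_rfl
    have e₁ := mul_inv_cancel (τ ^ k)
    have e₂ := inv_mul_cancel (τ' ^ k)
    calc _ = (τ ^ k * (τ ^ k)⁻¹) * ((τ' ^ k)⁻¹ * τ' ^ k) * (τ ^ m * τ' ^ n) := by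
          exact aux _ _ _ _ _ _
      _ = _ := by rw [e₁, e₂, one_mul, one_mul]
  intro m n
  have := congrArg (fun X => ((τ ^ m * τ' ^ n : (Zc A)ˣ) : Zc A) • X) (h m n)
  simp only [Finset.smul_sum] at this
  refine Eq.trans (Finset.sum_congr rfl fun k _ => ?_)
    (this.trans (Finset.sum_congr rfl fun k _ => ?_))
  · rw [matCoefZ_matScale, matCoefZ_matScale, tens₁_smul, tens₂_smul, Matrix.smul_mul,
      Matrix.mul_smul, Matrix.mul_smul, Matrix.mul_smul, smul_smul, smul_smul, smul_smul,
      ← key m n k]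
    congr 1
    ring
  · rw [matCoefZ_matScale, matCoefZ_matScale, tens₁_smul, tens₂_smul, Matrix.smul_mul,
      Matrix.mul_smul, Matrix.smul_mul, Matrix.smul_mul, smul_smul, smul_smul, smul_smul,
      ← key m n k]
    congr 1
    ring

/-- The substitution `x ↦ θ x` in a series of scalars. -/
def toS (θ : Zc A) : PowerSeries ℂ →+* PowerSeries (Zc A) :=
  (PowerSeries.rescale θ).comp (PowerSeries.map (algebraMap ℂ (Zc A)))

lemma coeff_toS (θ : Zc A) (r : PowerSeries ℂ) (k : ℕ) :
    PowerSeries.coeff k (toS θ r) = θ ^ k * algebraMap ℂ (Zc A) (PowerSeries.coeff k r) := by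
  simp [toS, PowerSeries.coeff_rescale]

/-- In a frame whose central variable is `z / w`, the exchange relation is an identity of
matrices. -/
lemma Exch.frame {B : Type*} [Ring B] [Algebra (PowerSeries (Zc A)) B] {s s' : Sgn}
    (F : Frame (A := A) s s' B) (hF : F.σ = .pos)
    {R : Matrix (Fin 3 × Fin 3) (Fin 3 × Fin 3) (PowerSeries ℂ)} {θ θ' : Zc A}
    {M N : Matrix (Fin 3) (Fin 3) (PowerSeries A)} (h : Exch R θ θ' s s' M N) :
    (R.map (toS θ)).map (algebraMap _ B) * (tens₁ (M.map F.ι₁) * tens₂ (N.map F.ι₂)) =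
      tens₂ (N.map F.ι₂) * tens₁ (M.map F.ι₁) * (R.map (toS θ')).map (algebraMap _ B) := by
  have h₁ : ∀ m n u v, F.co m n ((tens₁ (M.map F.ι₁) * tens₂ (N.map F.ι₂)) u v) =
      (tens₁ (matCoefZ s M m) * tens₂ (matCoefZ s' N n)) u v := by
    rintro m n ⟨x, y⟩ ⟨j, l⟩
    rw [tens₁_mul_tens₂_apply, tens₁_mul_tens₂_apply, map_zsmul]
    exact congrArg _ (F.co_mul _ _ m n)
  have h₂ : ∀ m n u v, F.co m n ((tens₂ (N.map F.ι₂) * tens₁ (M.map F.ι₁)) u v) =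
      (tens₂ (matCoefZ s' N n) * tens₁ (matCoefZ s M m)) u v := by
    rintro m n ⟨x, y⟩ ⟨j, l⟩
    rw [tens₂_mul_tens₁_apply, tens₂_mul_tens₁_apply, map_zsmul]
    exact congrArg _ (F.co_mul' _ _ m n)
  refine Matrix.ext fun u v => sub_eq_zero.mp (F.co_inj _ fun m n => ?_)
  rw [map_sub, sub_eq_zero, Matrix.mul_apply, Matrix.mul_apply, map_sum, map_sum]
  simp only [Matrix.map_apply, ← Algebra.commutes, ← Algebra.smul_def]
  have h₀ := congrFun (congrFun (h m n) u) v
  simp only [Matrix.sum_apply, Matrix.smul_apply] at h₀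
  refine Eq.trans ?_ (h₀.trans ?_)
  · simp only [F.co_series _ _ m n _ (Nat.lt_succ_self _), hF, h₁]
    rw [Finset.sum_comm]
    refine Finset.sum_congr rfl fun k _ => ?_
    rw [Matrix.mul_apply, Finset.smul_sum]
    refine Finset.sum_congr rfl fun x _ => ?_
    rw [coeff_toS, mul_smul, Matrix.map_apply, Sgn.toInt, one_mul, center_smul_def _ (_ : A),
      center_smul_def _ (_ : A), center_smul_def _ (_ : A)]
    rfl
  · simp only [F.co_series _ _ m n _ (Nat.lt_succ_self _), hF, h₂]
    rw [Finset.sum_comm]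
    refine Finset.sum_congr rfl fun k _ => ?_
    rw [Matrix.mul_apply, Finset.smul_sum]
    refine Finset.sum_congr rfl fun x _ => ?_
    rw [coeff_toS, mul_smul, Matrix.map_apply, Sgn.toInt, one_mul, ← Algebra.commutes]
    rfl

end

end

/-! ### Exchange relations in frames -/

noncomputable section

universe u

/-- L-operators with a Gauss decomposition, subject to the relations of the super RS algebra
(`tr = false`) or to the relations with the transposed R-matrix (`tr = true`) that hold for their
transposes in the opposite algebra. The unit `γ` is `q^{c/2}`, respectively its inverse. -/
structure LModel (tr : Bool) (q p : ℂ) (A : Type u) [Ring A] [Algebra ℂ A] where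
  γ : (Zc A)ˣ
  L : Sgn → Matrix (Fin 3) (Fin 3) (PowerSeries A)
  G : Sgn → GaussData (PowerSeries A)
  rep : ∀ s, (G s).Rep (L s)
  same : ∀ s, Exch (RmatT tr q p) 1 1 s s (L s) (L s)
  mixed : Exch (RmatT tr q p) ((γ ^ 2 : (Zc A)ˣ) : Zc A) ((γ⁻¹ ^ 2 : (Zc A)ˣ) : Zc A)
    .pos .neg (L .pos) (L .neg)

section

variable {A : Type u} [Ring A] [Algebra ℂ A]

/-- The parameter `z` of the R-matrix in a frame. -/
def Frame.z {s s' : Sgn} {B : Type*} [Ring B] [Algebra (PowerSeries (Zc A)) B]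
    (F : Frame (A := A) s s' B) : PowerSeries (Zc A) :=
  match F.σ with
  | .pos => PowerSeries.X
  | .neg => 1

/-- The parameter `w` of the R-matrix in a frame. -/
def Frame.w {s s' : Sgn} {B : Type*} [Ring B] [Algebra (PowerSeries (Zc A)) B]
    (F : Frame (A := A) s s' B) : PowerSeries (Zc A) :=
  match F.σ with
  | .pos => 1
  | .neg => PowerSeries.X

section

variable {s s' : Sgn} {B : Type*} [Ring B] [Algebra (PowerSeries (Zc A)) B]
    (F : Frame (A := A) s s' B)

lemma Frame.isUnit_add {a b : Zc A} (ha : IsUnit a) (hb : IsUnit b) :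
    IsUnit (PowerSeries.C a * F.z + PowerSeries.C b * F.w) := by
  rw [PowerSeries.isUnit_iff_constantCoeff]
  unfold Frame.z Frame.w
  cases F.σ <;> simpa

lemma Frame.isUnit_sub {a b : Zc A} (ha : IsUnit a) (hb : IsUnit b) :
    IsUnit (PowerSeries.C a * F.z - PowerSeries.C b * F.w) := by
  rw [PowerSeries.isUnit_iff_constantCoeff]
  unfold Frame.z Frame.w
  cases F.σ <;> simpa

lemma RCoeffs.smul_smul {S : Type*} [CommRing S] (a b : S) (R : RCoeffs S) :
    a • b • R = (a * b) • R := by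
  simp [RCoeffs.smul_def, RCoeffs.map, mul_assoc]

lemma RCoeffs.smul_o {S : Type*} [CommRing S] (a : S) (R : RCoeffs S) : (a • R).o = a * R.o := rfl

lemma RCoeffs.polyT_smul {S : Type*} [CommRing S] (tr : Bool) (q p z w a : S) :
    RCoeffs.polyT tr q p (a * z) (a * w) = (a ^ 2) • RCoeffs.polyT tr q p z w := by
  cases tr <;>
    simp only [RCoeffs.polyT, RCoeffs.poly, RCoeffs.smul_def, RCoeffs.map, RCoeffs.mk.injEq,
      Bool.false_eq_true, if_true, if_false] <;>
    refine ⟨?_, ?_, ?_, ?_, ?_, ?_, ?_, ?_, ?_, ?_⟩ <;> ring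

/-- The exchange relation of `M(w)` and `L(z)` that follows from that of `L(z)` and `M(w)` by
unitarity. -/
lemma RLL.flip_scaled {S B : Type*} [CommRing S] [Ring B] [Algebra S B] {tr : Bool}
    {q p x y a a' b b' : S} {L M : Matrix (Fin 3) (Fin 3) B} (hp : p ^ 2 = q) (ha : a * a' = 1)
    (hb : b * b' = 1) (hua : IsUnit (RCoeffs.polyT tr q p (a' * x) y).o)
    (hub : IsUnit (RCoeffs.polyT tr q p (b' * x) y).o)
    (h : RLL ((RCoeffs.polyT tr q p (b' * x) y).o • .polyT tr q p (a' * x) y)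
      ((RCoeffs.polyT tr q p (a' * x) y).o • .polyT tr q p (b' * x) y) L M) :
    RLL ((RCoeffs.polyT tr q p (b * y) x).o • .polyT tr q p (a * y) x)
      ((RCoeffs.polyT tr q p (a * y) x).o • .polyT tr q p (b * y) x) M L := by
  have h' := h.flip hp
  have key : ∀ c c' : S, c * c' = 1 → RCoeffs.polyT tr q p y (c' * x) =
      (c' ^ 2) • RCoeffs.polyT tr q p (c * y) x := by
    intro c c' hc
    rw [← RCoeffs.polyT_smul, ← mul_assoc, mul_comm c' c, hc, one_mul]
  rw [key a a' ha, key b b' hb] at h'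
  have hu : IsUnit ((RCoeffs.polyT tr q p (a' * x) y).o * (RCoeffs.polyT tr q p (b' * x) y).o *
      (a' ^ 2 * b' ^ 2)) :=
    (hua.mul hub).mul (((IsUnit.of_mul_eq_one_right _ ha).pow 2).mul
      ((IsUnit.of_mul_eq_one_right _ hb).pow 2))
  rw [← RLL.smul_iff hu]
  refine Eq.mp (congrArg₂ (fun X Y => RLL X Y _ _) ?_ ?_) h'
  · rw [RCoeffs.smul_smul, RCoeffs.smul_smul, RCoeffs.smul_o]
    congr 1
    ring
  · rw [RCoeffs.smul_smul, RCoeffs.smul_smul, RCoeffs.smul_o]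
    congr 1
    ring

/-- The R-matrix with central parameters, in a frame. -/
def Frame.R (F : Frame (A := A) s s' B) (tr : Bool) (q p : ℂ) (θ : Zc A) :
    RCoeffs (PowerSeries (Zc A)) :=
  .polyT tr (algebraMap ℂ _ q) (algebraMap ℂ _ p) (PowerSeries.C θ * F.z) F.w

lemma algebraMap_series (c : ℂ) :
    algebraMap ℂ (PowerSeries (Zc A)) c = PowerSeries.C (algebraMap ℂ (Zc A) c) :=
  PowerSeries.algebraMap_apply

lemma Frame.isUnit_R_o (tr : Bool) {q : ℂ} (p : ℂ) (hq : q ≠ 0) {θ : Zc A} (hθ : IsUnit θ) :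
    IsUnit (F.R tr q p θ).o := by
  have hq' : IsUnit (algebraMap ℂ (Zc A) q) := (IsUnit.mk0 q hq).map _
  rw [Frame.R, RCoeffs.polyT_o]
  refine IsUnit.mul ?_ ?_
  · convert F.isUnit_sub (hθ.mul (hq'.pow 2)) isUnit_one using 1
    rw [map_one]
    simp only [algebraMap_series, map_mul, map_pow]
    ring
  · convert F.isUnit_add (hθ.mul hq') isUnit_one using 1
    rw [map_one]
    simp only [algebraMap_series, map_mul]
    ring

lemma Frame.isUnit_z_sub_w {θ : Zc A} (hθ : IsUnit θ) :
    IsUnit (PowerSeries.C θ * F.z - F.w) := by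
  convert F.isUnit_sub hθ isUnit_one using 1
  rw [map_one, one_mul]

lemma Frame.isUnit_R_a (tr : Bool) {q : ℂ} (p : ℂ) (hq : q ≠ 0) {θ : Zc A} (hθ : IsUnit θ) :
    IsUnit (F.R tr q p θ).a := by
  have hq' : IsUnit (algebraMap ℂ (Zc A) q) := (IsUnit.mk0 q hq).map _
  rw [Frame.R, RCoeffs.polyT_a]
  refine IsUnit.mul (((IsUnit.mk0 q hq).map _).mul (F.isUnit_z_sub_w hθ)) ?_
  convert F.isUnit_add (hθ.mul hq') isUnit_one using 1
  rw [map_one]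
  simp only [algebraMap_series, map_mul]
  ring

lemma toS_C (θ : Zc A) (c : ℂ) : toS θ (PowerSeries.C c) = algebraMap ℂ _ c := by
  ext k
  rw [coeff_toS, algebraMap_series, PowerSeries.coeff_C, PowerSeries.coeff_C]
  split_ifs with h <;> simp [h]

lemma toS_X (θ : Zc A) : toS θ PowerSeries.X = PowerSeries.C θ * PowerSeries.X := by
  ext k
  rw [coeff_toS, PowerSeries.coeff_C_mul, PowerSeries.coeff_X, PowerSeries.coeff_X]
  split_ifs with h <;> simp [h]

lemma RnumT_map (tr : Bool) (q p : ℂ) (hF : F.σ = .pos) (θ : Zc A) :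
    (RnumT tr q p).map (toS θ) = F.R tr q p θ := by
  have hz : F.z = PowerSeries.X := by rw [Frame.z, hF]
  have hw : F.w = 1 := by rw [Frame.w, hF]
  rw [RnumT, Frame.R, hz, hw, RCoeffs.polyT, RCoeffs.polyT]
  split_ifs <;> rw [RCoeffs.poly_map, toS_C, toS_C, toS_X, map_one]

lemma toS_Rden (tr : Bool) (q p : ℂ) (hF : F.σ = .pos) (θ : Zc A) :
    toS θ (Rden q) = (F.R tr q p θ).o := by
  rw [← RnumT_map F tr q p hF, RnumT, RCoeffs.map, RCoeffs.polyT_o, Rden]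

/-- The exchange relation in a frame, with denominators cleared. -/
lemma Exch.rll (hF : F.σ = .pos) {tr : Bool} {q p : ℂ} {θ θ' : Zc A}
    {M N : Matrix (Fin 3) (Fin 3) (PowerSeries A)} (h : Exch (RmatT tr q p) θ θ' s s' M N) :
    RLL ((F.R tr q p θ').o • F.R tr q p θ) ((F.R tr q p θ).o • F.R tr q p θ')
      (M.map F.ι₁) (N.map F.ι₂) := by
  have key : ∀ θ : Zc A, (F.R tr q p θ).mat = (F.R tr q p θ).o • (RmatT tr q p).map (toS θ) := by
    intro θ
    rw [← toS_Rden F tr q p hF, ← RnumT_map F tr q p hF, RCoeffs.mat_map _ (map_zero _),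
      ← RmatT_eq]
    ext i j : 2
    simp
  have h' := h.frame F hF
  unfold RLL
  simp only [RCoeffs.mat_smul, key, smul_smul, map_algebraMap_smul, Matrix.smul_mul,
    Matrix.mul_smul, h']
  rw [mul_comm]

end

/-- The direction of expansion for L-operators of signs `s` and `s'`. -/
def frameσ : Sgn → Sgn → Sgn
  | .neg, .pos => .neg
  | _, _ => .pos

/-- The exchange relations between rescaled L-operators of any two signs. -/
theorem LModel.exists_frame {tr : Bool} {q p : ℂ} (𝓜 : LModel tr q p A) (hq : q ≠ 0)
    (hp : p ^ 2 = q) (s s' : Sgn) :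
    ∃ (B : Type u) (_ : Ring B) (_ : Algebra (PowerSeries (Zc A)) B)
      (F : Frame (A := A) s s' B), F.σ = frameσ s s' ∧
      ∀ τ τ' : (Zc A)ˣ,
      RLL ((F.R tr q p ((τ * τ'⁻¹ * 𝓜.γ ^ (s'.toInt - s.toInt) : (Zc A)ˣ) : Zc A)).o •
          F.R tr q p ((τ * τ'⁻¹ * 𝓜.γ ^ (s.toInt - s'.toInt) : (Zc A)ˣ) : Zc A))
        ((F.R tr q p ((τ * τ'⁻¹ * 𝓜.γ ^ (s.toInt - s'.toInt) : (Zc A)ˣ) : Zc A)).o •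
          F.R tr q p ((τ * τ'⁻¹ * 𝓜.γ ^ (s'.toInt - s.toInt) : (Zc A)ˣ) : Zc A))
        ((matScale s τ (𝓜.L s)).map F.ι₁) ((matScale s' τ' (𝓜.L s')).map F.ι₂) := by
  cases s <;> cases s'
  · refine ⟨_, _, _, framePP A, rfl, fun τ τ' => ?_⟩
    simpa using ((𝓜.same .pos).scale τ τ').rll (framePP A) rfl
  · refine ⟨_, _, _, framePN A, rfl, fun τ τ' => ?_⟩
    have h := (𝓜.mixed.scale τ τ').rll (framePN A) rfl
    simp only [← Units.val_mul] at h
    rw [mul_comm (𝓜.γ ^ 2), mul_comm (𝓜.γ⁻¹ ^ 2)] at h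
    have e : (𝓜.γ ^ (Sgn.neg.toInt - Sgn.pos.toInt) : (Zc A)ˣ) = 𝓜.γ⁻¹ ^ 2 := by
      rw [inv_pow, ← zpow_natCast, ← zpow_neg]
      rfl
    rw [e]
    exact h
  -- By unitarity of the R-matrix, the relation of `L⁺` and `L⁻` is also one of `L⁻` and `L⁺`.
  · refine ⟨_, _, _, frameNP A, rfl, fun τ τ' => ?_⟩
    have h := (𝓜.mixed.scale τ' τ).rll (framePN A) rfl
    simp only [← Units.val_mul] at h
    have e₁ : (𝓜.γ ^ 2 * (τ' * τ⁻¹) : (Zc A)ˣ) =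
        (τ * τ'⁻¹ * 𝓜.γ ^ (Sgn.neg.toInt - Sgn.pos.toInt))⁻¹ := by
      have : (𝓜.γ ^ (Sgn.neg.toInt - Sgn.pos.toInt) : (Zc A)ˣ) = 𝓜.γ⁻¹ ^ 2 := by
        rw [inv_pow, ← zpow_natCast, ← zpow_neg]
        rfl
      rw [this]
      simp
    have e₂ : (𝓜.γ⁻¹ ^ 2 * (τ' * τ⁻¹) : (Zc A)ˣ) =
        (τ * τ'⁻¹ * 𝓜.γ ^ (Sgn.pos.toInt - Sgn.neg.toInt))⁻¹ := by
      have : (𝓜.γ ^ (Sgn.pos.toInt - Sgn.neg.toInt) : (Zc A)ˣ) = 𝓜.γ ^ 2 := rfl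
      rw [this]
      simp
    rw [e₁, e₂] at h
    generalize τ * τ'⁻¹ * 𝓜.γ ^ (Sgn.neg.toInt - Sgn.pos.toInt) = ξ at h ⊢
    generalize τ * τ'⁻¹ * 𝓜.γ ^ (Sgn.pos.toInt - Sgn.neg.toInt) = ξ' at h ⊢
    exact RLL.flip_scaled (by rw [← map_pow, hp])
      (by rw [← map_mul, ξ.mul_inv, map_one]) (by rw [← map_mul, ξ'.mul_inv, map_one])
      ((framePN A).isUnit_R_o tr p hq ξ⁻¹.isUnit) ((framePN A).isUnit_R_o tr p hq ξ'⁻¹.isUnit) h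
  · refine ⟨_, _, _, frameNN A, rfl, fun τ τ' => ?_⟩
    simpa using ((𝓜.same .neg).scale τ τ').rll (frameNN A) rfl

end

end

noncomputable section

universe u

section

variable {A : Type u} [Ring A]

/-! ### Specialization of the exchange relations to proportional arguments -/

lemma extZ_conv (a b : ℕ → A) (N : ℤ) :
    ∑ᶠ m : ℤ, extZ a m * extZ b (N - m) =
      extZ (fun n => ∑ x ∈ Finset.HasAntidiagonal.antidiagonal n, a x.1 * b x.2) N := by
  rcases lt_or_ge N 0 with hN | hN
  · rw [extZ_of_neg _ hN]
    refine finsum_eq_zero_of_forall_eq_zero fun m => ?_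
    rcases lt_or_ge m 0 with hm | hm
    · rw [extZ_of_neg _ hm, zero_mul]
    · rw [extZ_of_neg b (by omega), mul_zero]
  · lift N to ℕ using hN
    rw [extZ_natCast, finsum_eq_sum_of_support_subset (s := (Finset.range (N + 1)).map
      Nat.castEmbedding)]
    · rw [Finset.sum_map, Finset.Nat.sum_antidiagonal_eq_sum_range_succ (fun i j => a i * b j)]
      refine Finset.sum_congr rfl fun k hk => ?_
      have : ((N : ℤ) - k) = ((N - k : ℕ) : ℤ) := by
        have := Finset.mem_range.mp hk
        omega
      simp only [Nat.castEmbedding_apply]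
      rw [this, extZ_natCast, extZ_natCast]
    · intro m hm
      rw [Function.mem_support] at hm
      rcases lt_or_ge m 0 with h | h
      · exact absurd (by rw [extZ_of_neg _ h, zero_mul]) hm
      rcases lt_or_ge (N : ℤ) m with h' | h'
      · exact absurd (by rw [extZ_of_neg b (by omega), mul_zero]) hm
      lift m to ℕ using h
      simp only [Finset.coe_map, Set.mem_image, Finset.mem_coe, Finset.mem_range]
      exact ⟨m, by omega, rfl⟩

/-- Multiplication by the sign, as a permutation of the integers. -/
def Sgn.equiv (s : Sgn) : ℤ ≃ ℤ where
  toFun m := s.toInt * m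
  invFun m := s.toInt * m
  left_inv m := by cases s <;> simp [Sgn.toInt]
  right_inv m := by cases s <;> simp [Sgn.toInt]

lemma coefZ_mul (s : Sgn) (a b : PowerSeries A) (N : ℤ) :
    ∑ᶠ m : ℤ, coefZ s a m * coefZ s b (N - m) = coefZ s (a * b) N := by
  rw [coefZ_eq_extZ]
  simp only [PowerSeries.coeff_mul]
  rw [← extZ_conv (fun n => PowerSeries.coeff n a) (fun n => PowerSeries.coeff n b)]
  refine Eq.trans (finsum_congr fun m => ?_) (finsum_comp_equiv s.equiv)
  rw [coefZ_eq_extZ, coefZ_eq_extZ, mul_sub]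
  rfl

lemma coefZ_mul' (s : Sgn) (a b : PowerSeries A) (N : ℤ) :
    ∑ᶠ m : ℤ, coefZ s a (N - m) * coefZ s b m = coefZ s (a * b) N := by
  rw [← coefZ_mul]
  refine Eq.trans (finsum_congr fun m => ?_) (finsum_comp_equiv (Equiv.subLeft N))
  simp

lemma ext_coefZ {s : Sgn} {a b : PowerSeries A} (h : ∀ m, coefZ s a m = coefZ s b m) : a = b := by
  ext n
  have := h (s.toInt * n)
  rw [coefZ_eq_extZ, coefZ_eq_extZ] at this
  have hs : s.toInt * (s.toInt * n) = n := by cases s <;> simp [Sgn.toInt]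
  rwa [hs, extZ_natCast, extZ_natCast] at this

lemma coefZ_zsmul (c : ℤ) (s : Sgn) (a : PowerSeries A) (m : ℤ) :
    coefZ s (c • a) m = c • coefZ s a m := by
  cases s <;> simp only [coefZ] <;> split_ifs <;> simp only [map_zsmul, smul_zero]

lemma coefZ_sum {ι : Type*} (t : Finset ι) (s : Sgn) (a : ι → PowerSeries A) (m : ℤ) :
    coefZ s (∑ i ∈ t, a i) m = ∑ i ∈ t, coefZ s (a i) m := by
  cases s <;> simp only [coefZ] <;> split_ifs <;> simp

lemma finite_support_coefZ_mul (s : Sgn) (a b : PowerSeries A) (N : ℤ) :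
    (Function.support fun m : ℤ => coefZ s a m * coefZ s b (N - m)).Finite := by
  refine (Set.finite_Icc (-|N|) |N|).subset fun m hm => ?_
  rw [Function.mem_support, coefZ_eq_extZ, coefZ_eq_extZ] at hm
  by_contra hc
  rw [Set.mem_Icc, not_and_or] at hc
  have hN := neg_abs_le N
  have hN' := le_abs_self N
  apply hm
  cases s <;> simp only [Sgn.toInt, one_mul, neg_mul] <;> rcases hc with hc | hc
  · rw [extZ_of_neg _ (by omega), zero_mul]
  · rw [extZ_of_neg (fun n => PowerSeries.coeff n b) (by omega), mul_zero]
  · rw [extZ_of_neg (fun n => PowerSeries.coeff n b) (by omega), mul_zero]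
  · rw [extZ_of_neg _ (by omega), zero_mul]

lemma finite_support_coefZ_mul' (s : Sgn) (a b : PowerSeries A) (N : ℤ) :
    (Function.support fun m : ℤ => coefZ s a (N - m) * coefZ s b m).Finite := by
  have h := (finite_support_coefZ_mul s a b N).preimage (f := fun m => N - m)
    ((Equiv.subLeft N).injective.injOn)
  refine h.subset fun m hm => ?_
  simpa using hm

end

section

variable {A : Type u} [Ring A] [Algebra ℂ A]

section

variable {s s' : Sgn} {B : Type*} [Ring B] [Algebra (PowerSeries (Zc A)) B]
    (F : Frame (A := A) s s' B)

lemma Frame.co_C (c : Zc A) (b : B) (m n : ℤ) :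
    F.co m n ((PowerSeries.C c : PowerSeries (Zc A)) • b) = c • F.co m n b := by
  rw [F.co_series _ _ m n (m.natAbs + n.natAbs + 1) (Nat.lt_succ_self _),
    Finset.sum_eq_single 0]
  · simp
  · intro k _ hk
    rw [PowerSeries.coeff_C, if_neg hk, zero_smul]
  · simp

lemma Frame.co_X (b : B) (m n : ℤ) :
    F.co m n ((PowerSeries.X : PowerSeries (Zc A)) • b) =
      F.co (m - F.σ.toInt) (n + F.σ.toInt) b := by
  rw [F.co_series _ _ m n (m.natAbs + n.natAbs + 2) (by omega), Finset.sum_eq_single 1]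
  · simp
  · intro k _ hk
    rw [PowerSeries.coeff_X, if_neg hk, zero_smul]
  · intro h
    exact absurd (Finset.mem_range.mpr (by omega)) h

lemma Frame.co_complex (c : ℂ) (b : B) (m n : ℤ) :
    F.co m n ((algebraMap ℂ (PowerSeries (Zc A)) c) • b) = c • F.co m n b := by
  rw [algebraMap_series, F.co_C, algebraMap_smul]

/-- The two-variable series `b` has a value at `z = l w`, with coefficient `v N` at `w ^ N`: for
each `N` only finitely many terms contribute. -/
def Frame.Val (l : ℂ) (b : B) (v : ℤ → A) : Prop :=
  ∀ N : ℤ, (Function.support fun m => F.co m (N - m) b).Finite ∧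
    ∑ᶠ m : ℤ, l ^ m • F.co m (N - m) b = v N

variable {F} {l : ℂ} {b b' : B} {v v' : ℤ → A}

lemma Frame.Val.unique (h : F.Val l b v) (h' : F.Val l b v') : v = v' :=
  funext fun N => (h N).2.symm.trans (h' N).2

lemma Frame.Val.finite_smul (h : F.Val l b v) (N : ℤ) :
    (Function.support fun m => l ^ m • F.co m (N - m) b).Finite :=
  (h N).1.subset fun m hm hm' => hm (by
    change l ^ m • F.co m (N - m) b = 0
    rw [show F.co m (N - m) b = 0 from hm', smul_zero])

lemma Frame.Val.zero : F.Val l 0 0 := fun N => by simp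

lemma Frame.Val.add (h : F.Val l b v) (h' : F.Val l b' v') : F.Val l (b + b') (v + v') := by
  refine fun N => ⟨((h N).1.union (h' N).1).subset ?_, ?_⟩
  · simp only [map_add]
    exact Function.support_add _ _
  · simp only [map_add, smul_add]
    rw [finsum_add_distrib (h.finite_smul N) (h'.finite_smul N), (h N).2, (h' N).2]
    rfl

lemma Frame.Val.zsmul (h : F.Val l b v) (k : ℤ) : F.Val l (k • b) (k • v) := by
  refine fun N => ⟨(h N).1.subset fun m hm hm' => hm ?_, ?_⟩
  · change F.co m (N - m) (k • b) = 0
    rw [map_zsmul, show F.co m (N - m) b = 0 from hm', smul_zero]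
  · simp only [map_zsmul, Pi.smul_apply]
    rw [← (h N).2, smul_finsum' _ (h.finite_smul N)]
    exact finsum_congr fun m => smul_comm _ _ _

lemma Frame.Val.sum {ι : Type*} (t : Finset ι) {b : ι → B} {v : ι → ℤ → A}
    (h : ∀ i ∈ t, F.Val l (b i) (v i)) : F.Val l (∑ i ∈ t, b i) (∑ i ∈ t, v i) := by
  classical
  induction t using Finset.induction_on with
  | empty => exact Frame.Val.zero
  | insert i t hi ih =>
    rw [Finset.sum_insert hi, Finset.sum_insert hi]
    exact (h i (Finset.mem_insert_self i t)).add
      (ih fun j hj => h j (Finset.mem_insert_of_mem hj))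

lemma Frame.Val.smul_complex (h : F.Val l b v) (c : ℂ) :
    F.Val l ((algebraMap ℂ (PowerSeries (Zc A)) c) • b) (c • v) := by
  refine fun N => ⟨(h N).1.subset fun m hm hm' => hm ?_, ?_⟩
  · change F.co m (N - m) _ = 0
    rw [F.co_complex, show F.co m (N - m) b = 0 from hm', smul_zero]
  · simp only [F.co_complex, Pi.smul_apply]
    rw [← (h N).2, smul_finsum' _ (h.finite_smul N)]
    exact finsum_congr fun m => smul_comm _ _ _

lemma Frame.Val.smul_X (h : F.Val l b v) (hl : l ≠ 0) (hF : F.σ = .pos) :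
    F.Val l ((PowerSeries.X : PowerSeries (Zc A)) • b) (l • v) := by
  have hc : ∀ N m, F.co m (N - m) ((PowerSeries.X : PowerSeries (Zc A)) • b) =
      F.co (m - 1) (N - (m - 1)) b := by
    intro N m
    rw [F.co_X, hF]
    simp only [Sgn.toInt]
    congr 2
    ring
  refine fun N => ⟨?_, ?_⟩
  · simp only [hc]
    exact ((h N).1.preimage ((Equiv.subRight (1 : ℤ)).injective.injOn)).subset fun m hm => hm
  · simp only [hc, Pi.smul_apply]
    rw [← (h N).2, smul_finsum' _ (h.finite_smul N)]
    refine Eq.trans (finsum_congr fun m => ?_) (finsum_comp_equiv (Equiv.subRight (1 : ℤ)))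
    rw [smul_smul, Equiv.subRight_apply, ← zpow_one_add₀ hl]
    congr 2
    ring

lemma Frame.Val.smul_poly (h : F.Val l b v) (hl : l ≠ 0) (hF : F.σ = .pos) (r : Polynomial ℂ) :
    F.Val l ((Polynomial.aeval (PowerSeries.X : PowerSeries (Zc A)) r) • b) (r.eval l • v) := by
  induction r using Polynomial.induction_on with
  | C a => simpa using h.smul_complex a
  | add r r' h₁ h₂ => simpa [add_smul] using h₁.add h₂
  | monomial n a ih =>
    have := ih.smul_X hl hF
    rw [smul_smul, smul_smul] at this
    convert this using 2
    · simp [pow_succ]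
      ring
    · simp [pow_succ]
      ring

variable (l) in
lemma Frame.val_mul (hs : s = s') (u u' : PowerSeries A) (τ : (Zc A)ˣ)
    (hτ : ∀ (m : ℤ) (x : A), ((τ ^ m : (Zc A)ˣ) : Zc A) • x = l ^ m • x) :
    F.Val l (F.ι₁ u * F.ι₂ u')
      (coefZ s (scale ((τ ^ s.toInt : (Zc A)ˣ) : Zc A) u * u')) := by
  subst hs
  refine fun N => ⟨?_, ?_⟩
  · simp only [F.co_mul]
    exact finite_support_coefZ_mul s u u' N
  · rw [← coefZ_mul]
    refine finsum_congr fun m => ?_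
    rw [F.co_mul, coefZ_scale, hτ, smul_mul_assoc]

variable (l) in
lemma Frame.val_mul' (hs : s = s') (u u' : PowerSeries A) (τ : (Zc A)ˣ)
    (hτ : ∀ (m : ℤ) (x : A), ((τ ^ m : (Zc A)ˣ) : Zc A) • x = l ^ m • x) :
    F.Val l (F.ι₂ u' * F.ι₁ u)
      (coefZ s (u' * scale ((τ ^ s.toInt : (Zc A)ˣ) : Zc A) u)) := by
  subst hs
  refine fun N => ⟨?_, ?_⟩
  · simp only [F.co_mul']
    exact finite_support_coefZ_mul' s u' u N
  · rw [← coefZ_mul']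
    refine finsum_congr fun m => ?_
    rw [F.co_mul', coefZ_scale, hτ, mul_smul_comm]

end

/-- A nonzero scalar, as a central unit. -/
def cu {l : ℂ} (hl : l ≠ 0) : (Zc A)ˣ :=
  Units.map (algebraMap ℂ (Zc A)).toMonoidHom (Units.mk0 l hl)

lemma cu_zpow_smul {l : ℂ} (hl : l ≠ 0) (m : ℤ) (x : A) :
    (((cu hl : (Zc A)ˣ) ^ m : (Zc A)ˣ) : Zc A) • x = l ^ m • x := by
  have : (((cu hl : (Zc A)ˣ) ^ m : (Zc A)ˣ) : Zc A) = algebraMap ℂ (Zc A) (l ^ m) := by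
    rw [cu, ← map_zpow, Units.coe_map]
    simp
  rw [this, algebraMap_smul]

lemma coefZ_smul (c : ℂ) (s : Sgn) (a : PowerSeries A) (m : ℤ) :
    coefZ s (c • a) m = c • coefZ s a m := by
  cases s <;> simp only [coefZ] <;> split_ifs <;> simp

/-- The exchange relation of `L(l w)` and `L(w)`. -/
theorem LModel.rll_specialized {tr : Bool} {q p : ℂ} (𝓜 : LModel tr q p A) (hq : q ≠ 0)
    (hp : p ^ 2 = q) (s : Sgn) {l : ℂ} (hl : l ≠ 0) :
    RLL (S := ℂ) (.polyT tr q p l 1) (.polyT tr q p l 1) (matScale s (cu hl) (𝓜.L s)) (𝓜.L s) := by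
  obtain ⟨B, _, _, F, hF, h⟩ := 𝓜.exists_frame hq hp s s
  have hF : F.σ = .pos := by rw [hF]; cases s <;> rfl
  have h := h 1 1
  have h1 : matScale s 1 (𝓜.L s) = 𝓜.L s := by
    ext i j n
    simp [matScale]
  simp only [inv_one, mul_one, sub_self, zpow_zero, h1] at h
  have h := (RLL.smul_iff (F.isUnit_R_o tr p hq (1 : (Zc A)ˣ).isUnit)).mp h
  -- With denominators cleared, the R-matrix is polynomial in `x = z/w`, so that both sides of
  -- the exchange relation can be evaluated at `x = l`.
  set φ : Polynomial ℂ →+* PowerSeries (Zc A) :=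
    (Polynomial.aeval (PowerSeries.X : PowerSeries (Zc A))).toRingHom
  have hR : F.R tr q p ((1 : (Zc A)ˣ) : Zc A) =
      (RCoeffs.polyT tr (Polynomial.C q) (Polynomial.C p) Polynomial.X 1).map φ := by
    have hz : F.z = PowerSeries.X := by rw [Frame.z, hF]
    have hw : F.w = 1 := by rw [Frame.w, hF]
    rw [Frame.R, hz, hw, RCoeffs.polyT, RCoeffs.polyT]
    split_ifs <;> rw [RCoeffs.poly_map] <;> simp [φ]
  have hR' : RCoeffs.polyT tr q p l 1 = (RCoeffs.polyT tr (Polynomial.C q) (Polynomial.C p)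
      Polynomial.X 1).map (Polynomial.evalRingHom l) := by
    rw [RCoeffs.polyT, RCoeffs.polyT]
    split_ifs <;> rw [RCoeffs.poly_map] <;> simp
  rw [hR] at h
  rw [hR', RLL.iff_apply]
  rw [RLL.iff_apply, RCoeffs.mat_map _ (map_zero _)] at h
  rw [RCoeffs.mat_map _ (map_zero _)]
  intro i k j l'
  have h' := h i k j l'
  refine ext_coefZ (s := s) fun N => ?_
  simp only [coefZ_sum, coefZ_smul, coefZ_zsmul]
  have e₁ := Frame.Val.sum (F := F) (l := l) (Finset.univ : Finset (Fin 3)) fun x _ =>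
    Frame.Val.sum (Finset.univ : Finset (Fin 3)) fun y _ =>
      (((F.val_mul l rfl (𝓜.L s x j) (𝓜.L s y l') (cu hl) (cu_zpow_smul hl)).zsmul
        ((-1) ^ (par j * (par y + par l')) : ℤ)).smul_poly hl hF
          ((RCoeffs.polyT tr (Polynomial.C q) (Polynomial.C p) Polynomial.X 1).mat (i, k) (x, y)))
  have e₂ := Frame.Val.sum (F := F) (l := l) (Finset.univ : Finset (Fin 3)) fun x _ =>
    Frame.Val.sum (Finset.univ : Finset (Fin 3)) fun y _ =>
      (((F.val_mul' l rfl (𝓜.L s i x) (𝓜.L s k y) (cu hl) (cu_zpow_smul hl)).zsmul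
        ((-1) ^ (par i * (par k + par y)) : ℤ)).smul_poly hl hF
          ((RCoeffs.polyT tr (Polynomial.C q) (Polynomial.C p) Polynomial.X 1).mat (x, y) (j, l')))
  have e₃ := congrFun (e₁.unique (h'.symm ▸ e₂)) N
  simp only [Finset.sum_apply, Pi.smul_apply] at e₃
  exact e₃

end

end

/-! ### Gauss coordinates at proportional arguments -/

noncomputable section

universe u

/-- The image of Gauss coordinates under a map. -/
def GaussData.map {B C : Type*} (φ : B → C) (G : GaussData B) : GaussData C :=
  ⟨φ G.k, φ G.ki, φ G.K, φ G.Ki, φ G.K₃, φ G.f, φ G.h, φ G.f₂, φ G.e, φ G.e₃₁, φ G.e₂⟩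

lemma GaussData.Rep.map {B C : Type*} [Ring B] [Ring C] (φ : B →+* C) {G : GaussData B}
    {L : Matrix (Fin 3) (Fin 3) B} (h : G.Rep L) : (G.map φ).Rep (L.map φ) := by
  constructor <;> simp only [GaussData.map, Matrix.map_apply, ← map_mul, ← map_add, ← map_one φ]
  · rw [h.k_ki]
  · rw [h.ki_k]
  · rw [h.K_Ki]
  · rw [h.Ki_K]
  · rw [h.L00]
  · rw [h.L01]
  · rw [h.L02]
  · rw [h.L10]
  · rw [h.L11]
  · rw [h.L12]
  · rw [h.L20]
  · rw [h.L21]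
  · rw [h.L22]

lemma RCoeffs.polyT_eq {S : Type*} [CommRing S] (tr : Bool) (q p z w : S) :
    RCoeffs.polyT tr q p z w = .poly q p z w (bif tr then w else z) (bif tr then z else w) := by
  cases tr <;> rfl

lemma RCoeffs.polyT_uv {S : Type*} [CommRing S] (tr : Bool) (z w : S) :
    (bif tr then w else z) * (bif tr then z else w) = z * w := by
  cases tr <;> simp [mul_comm]

section

variable {A : Type u} [Ring A] [Algebra ℂ A]

/-- The substitution `z ↦ τ z` in a one-sided series of sign `s`. -/
abbrev zScale (s : Sgn) (τ : (Zc A)ˣ) : PowerSeries A →+* PowerSeries A :=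
  scale ((τ ^ s.toInt : (Zc A)ˣ) : Zc A)

lemma zScale_zScale (s : Sgn) (τ τ' : (Zc A)ˣ) (a : PowerSeries A) :
    zScale s τ (zScale s τ' a) = zScale s (τ * τ') a := by
  refine ext_coefZ (s := s) fun m => ?_
  rw [coefZ_scale, coefZ_scale, coefZ_scale, smul_smul, mul_zpow, Units.val_mul]

lemma zScale_one (s : Sgn) (a : PowerSeries A) : zScale s 1 a = a := by
  refine ext_coefZ (s := s) fun m => ?_
  rw [coefZ_scale, one_zpow, Units.val_one, one_smul]

lemma zScale_smul (s : Sgn) (τ : (Zc A)ˣ) (c : ℂ) (a : PowerSeries A) :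
    zScale s τ (c • a) = c • zScale s τ a := by
  refine ext_coefZ (s := s) fun m => ?_
  rw [coefZ_scale, coefZ_smul, coefZ_smul, coefZ_scale, smul_comm]

lemma coefZ_zScale (s : Sgn) (τ : (Zc A)ˣ) (a : PowerSeries A) (m : ℤ) :
    coefZ s (zScale s τ a) m = ((τ ^ m : (Zc A)ˣ) : Zc A) • coefZ s a m :=
  coefZ_scale τ s a m

lemma coefZ_cu {l : ℂ} (hl : l ≠ 0) (s : Sgn) (a : PowerSeries A) (m : ℤ) :
    coefZ s (zScale s (cu hl) a) m = l ^ m • coefZ s a m := by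
  rw [coefZ_zScale, cu_zpow_smul]

lemma cu_mul {a b : ℂ} (ha : a ≠ 0) (hb : b ≠ 0) :
    (cu ha * cu hb : (Zc A)ˣ) = cu (mul_ne_zero ha hb) := by
  rw [cu, cu, ← map_mul]
  congr 1
  ext
  rfl

lemma commute_of_coefZ {A : Type*} [Ring A] {s : Sgn} {a b : PowerSeries A}
    (h : ∀ m n, Commute (coefZ s a m) (coefZ s b n)) : Commute a b := by
  refine ext_coefZ (s := s) fun N => ?_
  rw [← coefZ_mul, ← coefZ_mul']
  exact finsum_congr fun m => h m (N - m)

lemma Frame.isUnit_z_sub_one_w {s s' : Sgn} {B : Type*} [Ring B] [Algebra (PowerSeries (Zc A)) B]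
    (F : Frame (A := A) s s' B) : IsUnit (F.z - F.w) := by
  have := F.isUnit_sub (isUnit_one (M := Zc A)) isUnit_one
  rwa [map_one, one_mul, one_mul] at this

namespace LModel

variable {tr : Bool} {q p : ℂ} (𝓜 : LModel tr q p A)

/-- The coefficients of the series `k₁^±` commute with each other. -/
lemma commute_coefZ_k (hq : q ≠ 0) (hp : p ^ 2 = q) (s s' : Sgn) (m n : ℤ) :
    Commute (coefZ s (𝓜.G s).k m) (coefZ s' (𝓜.G s').k n) := by
  obtain ⟨B, _, _, F, -, h⟩ := 𝓜.exists_frame hq hp s s'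
  have h := h 1 1
  have h1 : ∀ s, matScale s 1 (𝓜.L s) = 𝓜.L s := fun s => by
    ext i j n
    simp [matScale]
  rw [h1, h1] at h
  have hc := h.row00_col00 (((𝓜.rep s).map F.ι₁)) ((𝓜.rep s').map F.ι₂)
    (by rw [RCoeffs.smul_o, RCoeffs.smul_o, mul_comm])
    (by
      rw [RCoeffs.smul_o]
      exact (F.isUnit_R_o tr p hq (Units.isUnit _)).mul (F.isUnit_R_o tr p hq (Units.isUnit _)))
  have := congrArg (F.co m n) hc.eq
  simp only [GaussData.map, F.co_mul, F.co_mul'] at this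
  exact this

lemma commute_k (hq : q ≠ 0) (hp : p ^ 2 = q) (s : Sgn) (τ τ' : (Zc A)ˣ) :
    Commute (zScale s τ (𝓜.G s).k) (zScale s τ' (𝓜.G s).k) := by
  refine commute_of_coefZ (s := s) fun m n => ?_
  rw [coefZ_zScale, coefZ_zScale, commute_iff_eq, smul_mul_smul_comm, smul_mul_smul_comm,
    (𝓜.commute_coefZ_k hq hp s s m n).eq, mul_comm ((τ ^ m : (Zc A)ˣ) : Zc A)]

/-- The coefficients of `k₁^±` and `k₂^±` of the same sign commute. -/
lemma commute_coefZ_k_K (hq : q ≠ 0) (hp : p ^ 2 = q) (s : Sgn) (m n : ℤ) :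
    Commute (coefZ s (𝓜.G s).k m) (coefZ s (𝓜.G s).K n) := by
  obtain ⟨B, _, _, F, -, h⟩ := 𝓜.exists_frame hq hp s s
  have h := h 1 1
  have h1 : ∀ s, matScale s 1 (𝓜.L s) = 𝓜.L s := fun s => by
    ext i j n
    simp [matScale]
  simp only [inv_one, mul_one, sub_self, zpow_zero, h1] at h
  have h := (RLL.smul_iff (F.isUnit_R_o tr p hq (1 : (Zc A)ˣ).isUnit)).mp h
  have hk := h.row00_col00 (((𝓜.rep s).map F.ι₁)) ((𝓜.rep s).map F.ι₂) rfl
    (F.isUnit_R_o tr p hq (1 : (Zc A)ˣ).isUnit)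
  have hc := (F.isUnit_R_a tr p hq (1 : (Zc A)ˣ).isUnit).smul_left_cancel.mp
    (h.k_K (((𝓜.rep s).map F.ι₁)) ((𝓜.rep s).map F.ι₂) rfl hk)
  have := congrArg (F.co m n) hc
  simp only [GaussData.map, F.co_mul, F.co_mul'] at this
  exact this

lemma commute_k_K (hq : q ≠ 0) (hp : p ^ 2 = q) (s : Sgn) (τ τ' : (Zc A)ˣ) :
    Commute (zScale s τ (𝓜.G s).k) (zScale s τ' (𝓜.G s).K) := by
  refine commute_of_coefZ (s := s) fun m n => ?_
  rw [coefZ_zScale, coefZ_zScale, commute_iff_eq, smul_mul_smul_comm, smul_mul_smul_comm,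
    (𝓜.commute_coefZ_k_K hq hp s m n).eq, mul_comm ((τ ^ m : (Zc A)ˣ) : Zc A)]

lemma rll_poly (hq : q ≠ 0) (hp : p ^ 2 = q) (s : Sgn) {l : ℂ} (hl : l ≠ 0) :
    RLL (S := ℂ) (.poly q p l 1 (bif tr then 1 else l) (bif tr then l else 1))
      (.poly q p l 1 (bif tr then 1 else l) (bif tr then l else 1))
      (matScale s (cu hl) (𝓜.L s)) (𝓜.L s) := by
  have := 𝓜.rll_specialized hq hp s hl
  rwa [RCoeffs.polyT_eq] at this

lemma rep_scale (s : Sgn) (τ : (Zc A)ˣ) :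
    ((𝓜.G s).map (zScale s τ)).Rep (matScale s τ (𝓜.L s)) :=
  (𝓜.rep s).map (zScale s τ)

/-- The coordinate `h = f_{1,3}` is a multiple of the square of `f = f₁`, by the relations of
`L(q² w)` and `L(w)`. -/
lemma h_eq (hp : p ^ 2 = q) (hq : q ≠ 0) (hr : ∀ n : ℕ, 0 < n → q ^ n ≠ 1) (s : Sgn) :
    (q - 1) • (𝓜.G s).h = p • ((𝓜.G s).f * (𝓜.G s).f) := by
  have h := 𝓜.rll_poly hq hp s (pow_ne_zero 2 hq)
  have hk := 𝓜.commute_k hq hp s (cu (pow_ne_zero 2 hq)) 1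
  rw [zScale_one] at hk
  refine h.h_eq (𝓜.rep_scale s _) (𝓜.rep s) rfl hk hp (RCoeffs.polyT_uv tr _ _) (.mk0 _ hq)
    (.mk0 _ ?_) (.mk0 _ ?_) (.mk0 _ ?_) (by ring) ?_ (.mk0 _ ?_) isUnit_one
  · exact sub_ne_zero.mpr (hr 2 two_pos)
  · intro h0
    -- The factor is `q³ + 1`, which divides `q⁶ - 1`.
    refine hr 6 (by norm_num) ?_
    linear_combination (q ^ 3 - 1) * h0
  · intro h0
    exact hr 4 (by norm_num) (by linear_combination h0)
  · cases tr
    · exact isUnit_one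
    · exact .mk0 _ (pow_ne_zero 2 hq)
  · exact sub_ne_zero.mpr (hr 2 two_pos)

/-- Conjugation of `f₁` by `k₁` at the same point, from the pole `z = q⁻² w` of the R-matrix. -/
lemma k_f_ki (hp : p ^ 2 = q) (hq : q ≠ 0) (hr : ∀ n : ℕ, 0 < n → q ^ n ≠ 1) (s : Sgn) :
    (𝓜.G s).k * (𝓜.G s).f * (𝓜.G s).ki =
      (bif tr then q⁻¹ else q) • zScale s (cu (pow_ne_zero 2 hq)) (𝓜.G s).f := by
  have hl : (q ^ 2)⁻¹ ≠ 0 := inv_ne_zero (pow_ne_zero 2 hq)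
  have h := 𝓜.rll_poly hq hp s hl
  have hk := 𝓜.commute_k hq hp s (cu hl) 1
  rw [zScale_one] at hk
  have hG := 𝓜.rep_scale s (cu hl)
  have h₁ := h.conj_f' hG (𝓜.rep s) rfl hk
  have hq1 : q + 1 ≠ 0 := fun h0 => hr 2 two_pos (by linear_combination (q - 1) * h0)
  have hq2 : q ^ 2 - 1 ≠ 0 := sub_ne_zero.mpr (hr 2 two_pos)
  have ho : (RCoeffs.poly q p (q ^ 2)⁻¹ 1 (bif tr then 1 else (q ^ 2)⁻¹)
      (bif tr then (q ^ 2)⁻¹ else 1)).o = 0 := by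
    simp [RCoeffs.poly, hq]
  rw [ho, zero_smul] at h₁
  have hcoef : (RCoeffs.poly q p (q ^ 2)⁻¹ 1 (bif tr then 1 else (q ^ 2)⁻¹)
      (bif tr then (q ^ 2)⁻¹ else 1)).a + (RCoeffs.poly q p (q ^ 2)⁻¹ 1
      (bif tr then 1 else (q ^ 2)⁻¹) (bif tr then (q ^ 2)⁻¹ else 1)).f *
        (bif tr then q⁻¹ else q) = 0 := by
    simp only [RCoeffs.poly]
    cases tr <;> simp only [cond_true, cond_false] <;> field_simp <;> ring
  have hc : (RCoeffs.poly q p (q ^ 2)⁻¹ 1 (bif tr then 1 else (q ^ 2)⁻¹)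
      (bif tr then (q ^ 2)⁻¹ else 1)).f ≠ 0 := by
    have : (q ^ 2)⁻¹ * q + 1 = (q + 1) / q := by
      field_simp
      ring
    simp only [RCoeffs.poly, this]
    refine mul_ne_zero (mul_ne_zero ?_ hq2) (div_ne_zero hq1 hq)
    cases tr
    · exact hl
    · exact one_ne_zero
  generalize (RCoeffs.poly q p (q ^ 2)⁻¹ 1 (bif tr then 1 else (q ^ 2)⁻¹)
      (bif tr then (q ^ 2)⁻¹ else 1)).a = ca at *
  generalize (RCoeffs.poly q p (q ^ 2)⁻¹ 1 (bif tr then 1 else (q ^ 2)⁻¹)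
      (bif tr then (q ^ 2)⁻¹ else 1)).f = cf at *
  have h₂ := congrArg (fun x => zScale s (cu hl) (𝓜.G s).k * (x * zScale s (cu hl) (𝓜.G s).ki)) h₁
  have k₁ := hG.k_ki
  have k₂ := hG.k_ki_assoc
  simp only [GaussData.map] at h₂ k₁ k₂
  simp only [zero_mul, mul_zero, add_mul, mul_add, smul_mul_assoc, mul_smul_comm, mul_assoc, k₁,
    k₂, mul_one] at h₂
  have h₃ := congrArg (zScale s (cu (pow_ne_zero 2 hq))) h₂
  rw [map_add, zScale_smul, zScale_smul, map_zero, map_mul, map_mul] at h₃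
  have hcu : (cu (pow_ne_zero 2 hq) * cu hl : (Zc A)ˣ) = 1 := by
    rw [cu_mul, Units.ext_iff]
    simp [cu, hq]
  rw [zScale_zScale, zScale_zScale, zScale_zScale, hcu, zScale_one, zScale_one, zScale_one,
    ← mul_assoc] at h₃
  refine (IsUnit.mk0 _ hc).smul_left_cancel.mp ?_
  rw [smul_smul, show cf * (bif tr then q⁻¹ else q) = -ca by linear_combination hcoef]
  linear_combination (norm := module) (-1 : ℂ) • h₃

/-- The proportionality factor in `f₂(- z q⁻¹) = κ f₁(z)`. -/
def κ (tr : Bool) (p : ℂ) : ℂ := bif tr then p⁻¹ else -p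

/-- The second simple root current is a rescaling of the first. -/
lemma f₂_eq (hp : p ^ 2 = q) (hq : q ≠ 0) (hr : ∀ n : ℕ, 0 < n → q ^ n ≠ 1) (s : Sgn) :
    (𝓜.G s).f₂ = κ tr p • zScale s (cu (neg_ne_zero.mpr hq)) (𝓜.G s).f := by
  have hl : -q⁻¹ ≠ 0 := neg_ne_zero.mpr (inv_ne_zero hq)
  have hp0 : p ≠ 0 := by
    rintro rfl
    exact hq (by rw [← hp]; ring)
  have h := 𝓜.rll_poly hq hp s hl
  have hG := 𝓜.rep_scale s (cu hl)
  have hq1 : q + 1 ≠ 0 := fun h0 => hr 2 two_pos (by linear_combination (q - 1) * h0)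
  have hq2 : q ^ 2 - 1 ≠ 0 := sub_ne_zero.mpr (hr 2 two_pos)
  -- The common denominator `o` of the R-matrix vanishes at `z = -q⁻¹ w`.
  have hz : -q⁻¹ * q + 1 = 0 := by
    rw [neg_mul, inv_mul_cancel₀ hq]
    ring
  have h₁ := h.f₂_eq hG (𝓜.rep s) (by simp only [RCoeffs.poly, hz, mul_zero])
    (by simp only [RCoeffs.poly, hz, mul_zero])
    (by simp only [RCoeffs.poly, hz, mul_zero])
  have hcoef : (RCoeffs.poly q p (-q⁻¹) 1 (bif tr then 1 else -q⁻¹)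
        (bif tr then -q⁻¹ else 1)).c * κ tr p +
      (RCoeffs.poly q p (-q⁻¹) 1 (bif tr then 1 else -q⁻¹)
        (bif tr then -q⁻¹ else 1)).e * (bif tr then q⁻¹ else q) = 0 := by
    simp only [RCoeffs.poly, κ, ← hp]
    cases tr <;> simp only [cond_true, cond_false] <;> field_simp <;> ring
  have hc : (RCoeffs.poly q p (-q⁻¹) 1 (bif tr then 1 else -q⁻¹)
        (bif tr then -q⁻¹ else 1)).c ≠ 0 := by
    have : -q⁻¹ - 1 = -(q + 1) / q := by
      field_simp
      ring
    simp only [RCoeffs.poly, this]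
    refine neg_ne_zero.mpr (mul_ne_zero (mul_ne_zero (mul_ne_zero hp0 ?_) hq2)
      (div_ne_zero (neg_ne_zero.mpr hq1) hq))
    cases tr
    · exact one_ne_zero
    · exact hl
  generalize (RCoeffs.poly q p (-q⁻¹) 1 (bif tr then 1 else -q⁻¹)
        (bif tr then -q⁻¹ else 1)).c = cc at *
  generalize (RCoeffs.poly q p (-q⁻¹) 1 (bif tr then 1 else -q⁻¹)
        (bif tr then -q⁻¹ else 1)).e = ce at *
  have h₂ := congrArg (fun x => x * zScale s (cu hl) (𝓜.G s).ki) h₁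
  have k₁ := hG.k_ki
  simp only [GaussData.map] at h₂ k₁
  simp only [zero_mul, add_mul, smul_mul_assoc, mul_assoc, k₁, mul_one] at h₂
  have h₃ := congrArg (zScale s (cu hl)) (𝓜.k_f_ki hp hq hr s)
  have hcu : (cu hl * cu (pow_ne_zero 2 hq) : (Zc A)ˣ) = cu (neg_ne_zero.mpr hq) := by
    rw [cu_mul, Units.ext_iff]
    simp only [cu, Units.coe_map, Units.val_mk0, MonoidHom.coe_coe, RingHom.toMonoidHom_eq_coe]
    congr 1
    field_simp
  rw [map_mul, map_mul, zScale_smul, zScale_zScale, hcu, mul_assoc] at h₃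
  rw [h₃] at h₂
  refine (IsUnit.mk0 _ hc).smul_left_cancel.mp ?_
  rw [smul_smul, show cc * κ tr p = -(ce * (bif tr then q⁻¹ else q)) by
    linear_combination hcoef]
  linear_combination (norm := module) h₂

end LModel

end

end

/-! ### Relations between currents -/

noncomputable section

universe u

section

variable {A : Type u} [Ring A] [Algebra ℂ A]

section

variable {s s' : Sgn} {B : Type*} [Ring B] [Algebra (PowerSeries (Zc A)) B]
    (F : Frame (A := A) s s' B)

lemma coefZ_one {A : Type*} [Ring A] (s : Sgn) (m : ℤ) :
    coefZ s (1 : PowerSeries A) m = if m = 0 then 1 else 0 := by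
  rw [coefZ_eq_extZ]
  rcases lt_trichotomy (s.toInt * m) 0 with h | h | h
  · rw [extZ_of_neg _ h, if_neg]
    rintro rfl
    simp at h
  · have : m = 0 := by cases s <;> simpa [Sgn.toInt] using h
    subst this
    simp [extZ]
  · have hm : m ≠ 0 := by
      rintro rfl
      simp at h
    obtain ⟨k, hk⟩ : ∃ k : ℕ, s.toInt * m = k := ⟨(s.toInt * m).toNat, by omega⟩
    rw [hk, extZ_natCast, PowerSeries.coeff_one, if_neg hm, if_neg (by omega)]

lemma Frame.co_ι₁ (u : PowerSeries A) (m n : ℤ) :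
    F.co m n (F.ι₁ u) = if n = 0 then coefZ s u m else 0 := by
  have := F.co_mul u 1 m n
  rw [map_one, mul_one] at this
  rw [this, coefZ_one]
  split_ifs <;> simp

lemma Frame.co_ι₂ (u : PowerSeries A) (m n : ℤ) :
    F.co m n (F.ι₂ u) = if m = 0 then coefZ s' u n else 0 := by
  have := F.co_mul 1 u m n
  rw [map_one, one_mul] at this
  rw [this, coefZ_one]
  split_ifs <;> simp

lemma Frame.ι₁_smul (c : ℂ) (u : PowerSeries A) :
    F.ι₁ (c • u) = (algebraMap ℂ (PowerSeries (Zc A)) c) • F.ι₁ u := by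
  refine sub_eq_zero.mp (F.co_inj _ fun m n => ?_)
  rw [map_sub, F.co_complex, F.co_ι₁, F.co_ι₁, coefZ_smul]
  split_ifs <;> simp

lemma Frame.ι₂_smul (c : ℂ) (u : PowerSeries A) :
    F.ι₂ (c • u) = (algebraMap ℂ (PowerSeries (Zc A)) c) • F.ι₂ u := by
  refine sub_eq_zero.mp (F.co_inj _ fun m n => ?_)
  rw [map_sub, F.co_complex, F.co_ι₂, F.co_ι₂, coefZ_smul]
  split_ifs <;> simp

/-- The coefficient of `z ^ m w ^ n` in a combination of two-variable series with coefficients `z`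
and `w`. -/
def Frame.co₁ (m n : ℤ) : B →+ A :=
  match F.σ with
  | .pos => F.co m (n - 1)
  | .neg => F.co (m - 1) n

lemma Frame.co₁_z (m n : ℤ) (b : B) : F.co₁ m n (F.z • b) = F.co (m - 1) n b := by
  rcases h : F.σ
  · simp only [Frame.co₁, Frame.z, h]
    rw [F.co_X, h]
    simp [Sgn.toInt]
  · simp only [Frame.co₁, Frame.z, h, one_smul]

lemma Frame.co₁_w (m n : ℤ) (b : B) : F.co₁ m n (F.w • b) = F.co m (n - 1) b := by
  rcases h : F.σ
  · simp only [Frame.co₁, Frame.w, h, one_smul]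
  · simp only [Frame.co₁, Frame.w, h]
    rw [F.co_X, h]
    simp [Sgn.toInt, sub_eq_add_neg]

lemma Frame.co₁_complex (m n : ℤ) (c : ℂ) (b : B) :
    F.co₁ m n ((algebraMap ℂ (PowerSeries (Zc A)) c) • b) = c • F.co₁ m n b := by
  rcases h : F.σ <;> simp only [Frame.co₁, h, F.co_complex]

end

namespace LModel

variable {tr : Bool} {q p : ℂ} (𝓜 : LModel tr q p A)

/-- The normalized exchange relation in which `f₁^±` is evaluated at `z q^{± c/2}`; the second
argument may be rescaled by a further constant `a`. -/
theorem exists_frame_f (hq : q ≠ 0) (hp : p ^ 2 = q) (s s' : Sgn) :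
    ∃ (B : Type u) (_ : Ring B) (_ : Algebra (PowerSeries (Zc A)) B)
      (F : Frame (A := A) s s' B), ∀ {a : ℂ} (ha : a ≠ 0), ∃ R : RCoeffs (PowerSeries (Zc A)),
      RLL R (.polyT tr (algebraMap ℂ _ q) (algebraMap ℂ _ p) F.z (algebraMap ℂ _ a * F.w))
        ((matScale s (𝓜.γ ^ s.toInt) (𝓜.L s)).map F.ι₁)
        ((matScale s' (𝓜.γ ^ s'.toInt * cu ha) (𝓜.L s')).map F.ι₂) ∧
      R.o = (RCoeffs.polyT tr (algebraMap ℂ _ q) (algebraMap ℂ _ p) F.z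
        (algebraMap ℂ (PowerSeries (Zc A)) a * F.w)).o ∧ IsUnit R.o ∧ IsUnit R.a := by
  obtain ⟨B, _, _, F, -, h⟩ := 𝓜.exists_frame hq hp s s'
  refine ⟨B, _, _, F, fun {a} ha => ?_⟩
  have h := h (𝓜.γ ^ s.toInt) (𝓜.γ ^ s'.toInt * cu ha)
  have hξ : 𝓜.γ ^ s.toInt * (𝓜.γ ^ s'.toInt * cu ha)⁻¹ * 𝓜.γ ^ (s'.toInt - s.toInt) =
      (cu ha)⁻¹ := by
    rw [mul_inv, zpow_sub]
    have : ∀ x y c : (Zc A)ˣ, x * (y⁻¹ * c⁻¹) * (y * x⁻¹) = c⁻¹ := by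
      intro x y c
      rw [mul_comm y⁻¹, mul_assoc, mul_assoc, inv_mul_cancel_left, mul_comm, inv_mul_cancel_right]
    exact this _ _ _
  rw [hξ] at h
  generalize 𝓜.γ ^ s.toInt * (𝓜.γ ^ s'.toInt * cu ha)⁻¹ * 𝓜.γ ^ (s.toInt - s'.toInt) = ξ at h
  have ho := F.isUnit_R_o tr p hq ξ.isUnit
  have ho' := F.isUnit_R_o tr p hq ((cu ha)⁻¹ : (Zc A)ˣ).isUnit
  have haU : IsUnit (algebraMap ℂ (PowerSeries (Zc A)) a) := (IsUnit.mk0 a ha).map _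
  have hR : ((algebraMap ℂ (PowerSeries (Zc A)) a) ^ 2) •
      F.R tr q p (((cu ha)⁻¹ : (Zc A)ˣ) : Zc A) =
      .polyT tr (algebraMap ℂ _ q) (algebraMap ℂ _ p) F.z (algebraMap ℂ _ a * F.w) := by
    rw [Frame.R, ← RCoeffs.polyT_smul, ← mul_assoc]
    congr 1
    have : (((cu ha)⁻¹ : (Zc A)ˣ) : Zc A) = algebraMap ℂ (Zc A) a⁻¹ := rfl
    rw [this, ← algebraMap_series, ← map_mul, mul_inv_cancel₀ ha, map_one, one_mul]
  have haR := F.isUnit_R_a tr p hq ξ.isUnit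
  obtain ⟨c, hc⟩ := ho
  generalize F.R tr q p (((cu ha)⁻¹ : (Zc A)ˣ) : Zc A) = Rr at h ho' hR
  generalize F.R tr q p (ξ : Zc A) = Rξ at h hc haR
  rw [← hc] at h
  generalize algebraMap ℂ (PowerSeries (Zc A)) a = aS at haU hR ⊢
  have hu : IsUnit (↑c⁻¹ * aS ^ 2) := c⁻¹.isUnit.mul (haU.pow 2)
  have e : (↑c⁻¹ * aS ^ 2) • ((c : PowerSeries (Zc A)) • Rr) = aS ^ 2 • Rr := by
    rw [RCoeffs.smul_smul]
    congr 1
    rw [mul_right_comm, Units.inv_mul, one_mul]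
  have ho'' : ((↑c⁻¹ * aS ^ 2) • (Rr.o • Rξ)).o = (aS ^ 2 • Rr).o := by
    rw [← e]
    simp only [RCoeffs.smul_def, RCoeffs.map, ← hc]
    ring
  refine ⟨(↑c⁻¹ * aS ^ 2) • (Rr.o • Rξ), ?_, ?_, ?_, ?_⟩
  · rw [← hR, ← e]
    exact (RLL.smul_iff hu).mpr h
  · rw [← hR, ho'']
  · rw [ho'']
    exact (haU.pow 2).mul ho'
  · exact hu.mul (ho'.mul haR)

end LModel

end

end

/-! ### Exchange relations of half currents -/

noncomputable section

universe u

section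

variable {A : Type u} [Ring A] [Algebra ℂ A]

lemma cu_one : (cu one_ne_zero : (Zc A)ˣ) = 1 := by
  rw [Units.ext_iff]
  simp [cu]

lemma Frame.isUnit_qz_sub_w {s s' : Sgn} {B : Type*} [Ring B] [Algebra (PowerSeries (Zc A)) B]
    (F : Frame (A := A) s s' B) {a b : ℂ} (ha : a ≠ 0) (hb : b ≠ 0) :
    IsUnit (F.z * algebraMap ℂ _ a - algebraMap ℂ _ b * F.w) := by
  have := F.isUnit_sub ((IsUnit.mk0 a ha).map (algebraMap ℂ (Zc A)))
    ((IsUnit.mk0 b hb).map (algebraMap ℂ (Zc A)))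
  rwa [← algebraMap_series, ← algebraMap_series, mul_comm _ F.z] at this

lemma Frame.isUnit_qz_add_w {s s' : Sgn} {B : Type*} [Ring B] [Algebra (PowerSeries (Zc A)) B]
    (F : Frame (A := A) s s' B) {a b : ℂ} (ha : a ≠ 0) (hb : b ≠ 0) :
    IsUnit (F.z * algebraMap ℂ _ a + algebraMap ℂ _ b * F.w) := by
  have := F.isUnit_add ((IsUnit.mk0 a ha).map (algebraMap ℂ (Zc A)))
    ((IsUnit.mk0 b hb).map (algebraMap ℂ (Zc A)))
  rwa [← algebraMap_series, ← algebraMap_series, mul_comm _ F.z] at this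

lemma RCoeffs.poly_conj {S B : Type*} [CommRing S] [AddCommGroup B] [Module S B] (tr : Bool)
    {P P' z w : S} {x y f : B} (hP : P * P' = 1) (hzw : IsUnit (P * P * (z - w)))
    (h : (RCoeffs.poly (P * P) P z (-(P * P) * w) (bif tr then -(P * P) * w else z)
        (bif tr then z else -(P * P) * w)).o • x =
      (RCoeffs.poly (P * P) P z (-(P * P) * w) (bif tr then -(P * P) * w else z)
        (bif tr then z else -(P * P) * w)).a • y +
      (RCoeffs.poly (P * P) P z (-(P * P) * w) (bif tr then -(P * P) * w else z)
        (bif tr then z else -(P * P) * w)).f • f) :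
    (P * (z + P * P * w)) • ((bif tr then P' else -P) • y) =
      (P * (z * (P * P) + w)) • ((bif tr then P' else -P) • x) +
        (((P * P) ^ 2 - 1) * (bif tr then w else z)) • f := by
  refine hzw.smul_left_cancel.mp ?_
  simp only [RCoeffs.poly] at h
  cases tr
  · simp only [cond_false] at h ⊢
    linear_combination (norm := module) h
  · simp only [cond_true] at h ⊢
    have e : ∀ c : S, P * c * P' = c := fun c => by linear_combination c * hP
    have hu : IsUnit (P * P) := IsUnit.of_mul_eq_one (P' * P') (by
      linear_combination (P * P' + 1) * hP)
    refine hu.smul_left_cancel.mp ?_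
    have e' : ∀ (c : S) (b : B), (P * c) • P' • b = c • b := fun c b => by rw [_root_.smul_smul, e]
    rw [e', e']
    linear_combination (norm := module) (-1 : S) • h

namespace LModel

variable {tr : Bool} {q p : ℂ} (𝓜 : LModel tr q p A)

/-- The series `f₁^±` at `z q^{± c/2}`. -/
def fs (s : Sgn) : PowerSeries A := zScale s (𝓜.γ ^ s.toInt) (𝓜.G s).f

/-- The series `k₂^± (k₁^±)⁻¹` at `z q^{± c/2}`. -/
def ψs (s : Sgn) : PowerSeries A := zScale s (𝓜.γ ^ s.toInt) ((𝓜.G s).K * (𝓜.G s).ki)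

lemma commute_of_rll {s s' : Sgn} {B : Type*} [Ring B] [Algebra (PowerSeries (Zc A)) B]
    {R R' : RCoeffs (PowerSeries (Zc A))} {F : Frame (A := A) s s' B} {τ τ' : (Zc A)ˣ}
    (h : RLL R R' ((matScale s τ (𝓜.L s)).map F.ι₁) ((matScale s' τ' (𝓜.L s')).map F.ι₂))
    (ho : R.o = R'.o) (hu : IsUnit R.o) :
    Commute (F.ι₁ (zScale s τ (𝓜.G s).k)) (F.ι₂ (zScale s' τ' (𝓜.G s').k)) :=
  h.row00_col00 ((𝓜.rep_scale s τ).map F.ι₁) ((𝓜.rep_scale s' τ').map F.ι₂) ho hu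

lemma zScale_f (s : Sgn) : zScale s (𝓜.γ ^ s.toInt) (𝓜.G s).f = 𝓜.fs s := rfl

/-- The exchange relation of `f₁^±` and `f₁^±`: the right-hand side is a sum of terms that depend on
one of the two signs only. -/
theorem f_f (hp : p ^ 2 = q) (hq : q ≠ 0) (hr : ∀ n : ℕ, 0 < n → q ^ n ≠ 1) :
    ∃ Φ₁ Φ₂ : Sgn → ℤ → ℤ → A, ∀ s s' m n,
      coefZ s (𝓜.fs s) (m - 1) * coefZ s' (𝓜.fs s') n +
        q • (coefZ s (𝓜.fs s) m * coefZ s' (𝓜.fs s') (n - 1)) +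
        (q • (coefZ s' (𝓜.fs s') n * coefZ s (𝓜.fs s) (m - 1)) +
          coefZ s' (𝓜.fs s') (n - 1) * coefZ s (𝓜.fs s) m) = Φ₁ s m n + Φ₂ s' m n := by
  -- `Φ₁` and `Φ₂` are the contributions of `f₁(z)²` and `f₁(w)²`, which arise from `f_{1,3}`.
  refine ⟨fun s m n => (q + 1) • (bif tr then
      (if n - 1 = 0 then coefZ s (𝓜.fs s * 𝓜.fs s) m else 0) else
      (if n = 0 then coefZ s (𝓜.fs s * 𝓜.fs s) (m - 1) else 0)),
    fun s m n => (q + 1) • (bif tr then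
      (if m - 1 = 0 then coefZ s (𝓜.fs s * 𝓜.fs s) n else 0) else
      (if m = 0 then coefZ s (𝓜.fs s * 𝓜.fs s) (n - 1) else 0)), fun s s' m n => ?_⟩
  obtain ⟨B, _, _, F, hF⟩ := 𝓜.exists_frame_f hq hp s s'
  obtain ⟨R, h, ho, hu, -⟩ := hF one_ne_zero
  rw [map_one, one_mul] at h ho
  rw [cu_one, mul_one] at h
  have hk := 𝓜.commute_of_rll h ho hu
  rw [RCoeffs.polyT_eq] at h ho
  have h₂ := F.isUnit_qz_add_w hq one_ne_zero
  have h₃ := F.isUnit_qz_sub_w (pow_ne_zero 2 hq) one_ne_zero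
  have h₄ := F.isUnit_qz_sub_w one_ne_zero (pow_ne_zero 2 hq)
  rw [map_one, one_mul] at h₂ h₃
  rw [map_one, mul_one] at h₄
  rw [map_pow] at h₃ h₄
  have hh : ∀ s, (q - 1) • zScale s (𝓜.γ ^ s.toInt) (𝓜.G s).h = p • (𝓜.fs s * 𝓜.fs s) := by
    intro s
    rw [← zScale_smul, 𝓜.h_eq hp hq hr, zScale_smul, map_mul]
    rfl
  have hqS : algebraMap ℂ (PowerSeries (Zc A)) q - 1 = algebraMap ℂ _ (q - 1) := by
    rw [map_sub, map_one]
  have key := h.ff ((𝓜.rep_scale s _).map F.ι₁) ((𝓜.rep_scale s' _).map F.ι₂) ho hk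
    (by rw [← map_pow, hp]) (RCoeffs.polyT_uv tr _ _) ((IsUnit.mk0 _ hq).map _)
    F.isUnit_z_sub_one_w h₂ h₃ h₄
    (by
      simp only [GaussData.map]
      rw [hqS, ← F.ι₁_smul, hh, F.ι₁_smul, map_mul]
      rfl)
    (by
      simp only [GaussData.map]
      rw [hqS, ← F.ι₂_smul, hh, F.ι₂_smul, map_mul]
      rfl)
  have := congrArg (F.co₁ m n) key
  simp only [GaussData.map, 𝓜.zScale_f] at this
  rw [show (algebraMap ℂ (PowerSeries (Zc A)) q + 1) = algebraMap ℂ _ (q + 1) by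
    rw [map_add, map_one], mul_comm F.z] at this
  simp only [add_smul, mul_smul, map_add, F.co₁_complex, F.co₁_z, F.co₁_w, F.co_mul,
    F.co_mul'] at this
  cases tr
  · simp only [cond_false, F.co₁_z, F.co₁_w, ← map_mul, F.co_ι₁, F.co_ι₂] at this ⊢
    rw [this, add_smul, add_smul, add_comm]
  · simp only [cond_true, F.co₁_z, F.co₁_w, ← map_mul, F.co_ι₁, F.co_ι₂] at this ⊢
    rw [this, add_smul, add_smul, add_comm]

/-- Conjugation of `f₂^±` by `k₁^±`, in a frame. -/
lemma conj_f₂ (hp : p ^ 2 = q) (hq : q ≠ 0) (hr : ∀ n : ℕ, 0 < n → q ^ n ≠ 1) {s s' : Sgn}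
    {B : Type*} [Ring B] [Algebra (PowerSeries (Zc A)) B] (F : Frame (A := A) s s' B)
    {R : RCoeffs (PowerSeries (Zc A))} {τ τ' : (Zc A)ˣ}
    (h : RLL R (.polyT tr (algebraMap ℂ _ q) (algebraMap ℂ _ p) F.z
        (algebraMap ℂ (PowerSeries (Zc A)) (-q) * F.w))
      ((matScale s τ (𝓜.L s)).map F.ι₁)
      ((matScale s' (τ' * cu (neg_ne_zero.mpr hq)) (𝓜.L s')).map F.ι₂))
    (ho : R.o = (RCoeffs.polyT tr (algebraMap ℂ _ q) (algebraMap ℂ _ p) F.z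
        (algebraMap ℂ (PowerSeries (Zc A)) (-q) * F.w)).o) (hu : IsUnit R.o)
    (hk : Commute (F.ι₁ (zScale s τ (𝓜.G s).k)) (F.ι₂ (zScale s' τ' (𝓜.G s').k))) :
    (algebraMap ℂ (PowerSeries (Zc A)) p * (F.z + algebraMap ℂ _ q * F.w)) •
      (F.ι₁ (zScale s τ (𝓜.G s).ki) * (F.ι₂ (zScale s' τ' (𝓜.G s').f₂) *
        F.ι₁ (zScale s τ (𝓜.G s).k))) =
    (algebraMap ℂ (PowerSeries (Zc A)) p * (F.z * algebraMap ℂ _ q + F.w)) •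
        F.ι₂ (zScale s' τ' (𝓜.G s').f₂) +
      ((algebraMap ℂ (PowerSeries (Zc A)) q ^ 2 - 1) * (bif tr then F.w else F.z)) •
        F.ι₁ (zScale s τ (𝓜.G s).f) := by
  have hk' := 𝓜.commute_of_rll h ho hu
  have key := h.conj_f' ((𝓜.rep_scale s _).map F.ι₁) ((𝓜.rep_scale s' _).map F.ι₂) ho hk'
  rw [𝓜.f₂_eq hp hq hr, zScale_smul, zScale_zScale, F.ι₂_smul]
  simp only [GaussData.map] at key
  generalize F.ι₂ (zScale s' (τ' * cu (neg_ne_zero.mpr hq)) (𝓜.G s').f) = x at key ⊢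
  rw [RCoeffs.polyT_eq] at key
  have hp0 : p ≠ 0 := by
    rintro rfl
    exact hq (by rw [← hp]; ring)
  have hPQ : algebraMap ℂ (PowerSeries (Zc A)) q =
      algebraMap ℂ _ p * algebraMap ℂ _ p := by
    rw [← map_mul, ← hp, sq]
  have hc := ((IsUnit.mk0 _ hq).map (algebraMap ℂ (PowerSeries (Zc A)))).mul F.isUnit_z_sub_one_w
  rw [map_neg] at key
  rw [hPQ] at key hc ⊢
  rw [κ, Bool.apply_cond (algebraMap ℂ (PowerSeries (Zc A))), map_neg, smul_mul_assoc,
    mul_smul_comm]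
  exact RCoeffs.poly_conj tr (by rw [← map_mul, mul_inv_cancel₀ hp0, map_one]) hc key

/-- The exchange relation of `f₁^±` and `k₂^± (k₁^±)⁻¹`, up to terms that depend on the second sign
only. -/
theorem f_ψ (hp : p ^ 2 = q) (hq : q ≠ 0) (hr : ∀ n : ℕ, 0 < n → q ^ n ≠ 1) :
    ∃ Φ : Sgn → ℤ → ℤ → A, ∀ s s' m n,
      coefZ s (𝓜.fs s) (m - 1) * coefZ s' (𝓜.ψs s') n +
        q • (coefZ s (𝓜.fs s) m * coefZ s' (𝓜.ψs s') (n - 1)) =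
      q • (coefZ s' (𝓜.ψs s') n * coefZ s (𝓜.fs s) (m - 1)) +
          coefZ s' (𝓜.ψs s') (n - 1) * coefZ s (𝓜.fs s) m + Φ s' m n := by
  have hS : ∀ s', ∃ Φ : ℤ → ℤ → A, ∀ s m n,
      coefZ s (𝓜.fs s) (m - 1) * coefZ s' (𝓜.ψs s') n +
        q • (coefZ s (𝓜.fs s) m * coefZ s' (𝓜.ψs s') (n - 1)) =
      q • (coefZ s' (𝓜.ψs s') n * coefZ s (𝓜.fs s) (m - 1)) +
          coefZ s' (𝓜.ψs s') (n - 1) * coefZ s (𝓜.fs s) m + Φ m n := by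
    intro s'
    -- `y` is made of the conjugates of `f₁` and `f₂` by `k₂ k₁⁻¹`, all at the point `w`.
    set y : PowerSeries A := -q⁻¹ • (((q ^ 2 - 1) * (q - 1)) •
        zScale s' (𝓜.γ ^ s'.toInt) ((𝓜.G s').K * (𝓜.G s').f * (𝓜.G s').ki) +
      (p * (q ^ 2 - 1)) •
        zScale s' (𝓜.γ ^ s'.toInt) ((𝓜.G s').K * (𝓜.G s').f₂ * (𝓜.G s').ki)) with hy
    refine ⟨fun m n => bif tr then (if m - 1 = 0 then coefZ s' y n else 0) else
      (if m = 0 then coefZ s' y (n - 1) else 0), fun s m n => ?_⟩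
    obtain ⟨B, _, _, F, hF⟩ := 𝓜.exists_frame_f hq hp s s'
    obtain ⟨R', h', ho', hu', -⟩ := hF (neg_ne_zero.mpr hq)
    obtain ⟨R, h, ho, hu, ha⟩ := hF one_ne_zero
    rw [map_one, one_mul] at h ho
    rw [cu_one, mul_one] at h
    have hk := 𝓜.commute_of_rll h ho hu
    have hf := 𝓜.conj_f₂ hp hq hr F h' ho' hu' hk
    rw [RCoeffs.polyT_eq] at h ho
    have h₂ := F.isUnit_qz_add_w hq one_ne_zero
    have h₃ := F.isUnit_qz_sub_w (pow_ne_zero 2 hq) one_ne_zero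
    rw [map_one, one_mul] at h₂ h₃
    rw [map_pow] at h₃
    have key := h.f_ψ ((𝓜.rep_scale s _).map F.ι₁) ((𝓜.rep_scale s' _).map F.ι₂) ho hk ha
      (RCoeffs.polyT_uv tr _ _) F.isUnit_z_sub_one_w h₂ h₃ hf
    have hyS : algebraMap ℂ (PowerSeries (Zc A)) q⁻¹ • (
        ((algebraMap ℂ (PowerSeries (Zc A)) q ^ 2 - 1) * (algebraMap ℂ _ q - 1)) •
          F.ι₂ (zScale s' (𝓜.γ ^ s'.toInt) ((𝓜.G s').K * (𝓜.G s').f * (𝓜.G s').ki)) +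
        (algebraMap ℂ (PowerSeries (Zc A)) p * (algebraMap ℂ _ q ^ 2 - 1)) •
          F.ι₂ (zScale s' (𝓜.γ ^ s'.toInt) ((𝓜.G s').K * (𝓜.G s').f₂ * (𝓜.G s').ki))) =
        -F.ι₂ y := by
      rw [hy, neg_smul, map_neg, neg_neg, F.ι₂_smul, map_add, F.ι₂_smul, F.ι₂_smul]
      simp only [map_mul (algebraMap ℂ (PowerSeries (Zc A))), map_sub (algebraMap ℂ _),
        map_pow (algebraMap ℂ _), map_one (algebraMap ℂ _)]
    simp only [GaussData.map] at key
    have key' := congrArg (fun b => algebraMap ℂ (PowerSeries (Zc A)) q⁻¹ • b) key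
    simp only [← map_mul F.ι₂, ← map_mul (zScale s' (𝓜.γ ^ s'.toInt))] at key'
    rw [𝓜.zScale_f] at key'
    have e : ∀ c : PowerSeries (Zc A), algebraMap ℂ (PowerSeries (Zc A)) q⁻¹ *
        (algebraMap ℂ _ q * c) = c := fun c => by
      rw [← mul_assoc, ← map_mul, inv_mul_cancel₀ hq, map_one, one_mul]
    rw [smul_sub, smul_comm _ (bif tr then F.z else F.w), hyS, smul_smul, smul_smul, e, e,
      smul_neg, sub_neg_eq_add] at key'
    have := congrArg (F.co₁ m n) key'
    rw [mul_comm F.z] at this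
    simp only [add_smul, mul_smul, map_add, F.co₁_complex, F.co₁_z, F.co₁_w, F.co_mul,
      F.co_mul'] at this
    cases tr
    · simp only [cond_false, F.co₁_w, F.co_ι₂] at this ⊢
      exact this
    · simp only [cond_true, F.co₁_z, F.co_ι₂] at this ⊢
      exact this
  choose Φ hΦ using hS
  exact ⟨Φ, fun s s' => hΦ s' s⟩

/-- The modes of `f₁^+(z_+) - f₁^-(z_-)`. -/
def cur (m : ℤ) : A := coefZ .pos (𝓜.fs .pos) m - coefZ .neg (𝓜.fs .neg) m

/-- The quadratic relation of `f₁^+(z_+) - f₁^-(z_-)`: the one-sign terms of `f_f` cancel. -/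
theorem cur_cur (hp : p ^ 2 = q) (hq : q ≠ 0) (hr : ∀ n : ℕ, 0 < n → q ^ n ≠ 1) (m n : ℤ) :
    𝓜.cur (m - 1) * 𝓜.cur n + q • (𝓜.cur m * 𝓜.cur (n - 1)) +
      (q • (𝓜.cur n * 𝓜.cur (m - 1)) + 𝓜.cur (n - 1) * 𝓜.cur m) = 0 := by
  obtain ⟨Φ₁, Φ₂, h⟩ := 𝓜.f_f hp hq hr
  simp only [cur, mul_sub, sub_mul, smul_sub]
  linear_combination (norm := module) h .pos .pos m n - h .pos .neg m n - h .neg .pos m n +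
    h .neg .neg m n

/-- The exchange relation of `f₁^+(z_+) - f₁^-(z_-)` and `k₂^± (k₁^±)⁻¹`. -/
theorem cur_ψs (hp : p ^ 2 = q) (hq : q ≠ 0) (hr : ∀ n : ℕ, 0 < n → q ^ n ≠ 1) (s : Sgn)
    (m n : ℤ) :
    𝓜.cur (m - 1) * coefZ s (𝓜.ψs s) n + q • (𝓜.cur m * coefZ s (𝓜.ψs s) (n - 1)) =
      q • (coefZ s (𝓜.ψs s) n * 𝓜.cur (m - 1)) + coefZ s (𝓜.ψs s) (n - 1) * 𝓜.cur m := by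
  obtain ⟨Φ, h⟩ := 𝓜.f_ψ hp hq hr
  simp only [cur, mul_sub, sub_mul, smul_sub]
  linear_combination (norm := module) h .pos s m n - h .neg s m n

end LModel

end

end

/-! ### The anticommutator of the currents -/

noncomputable section

universe u

section

variable {A : Type u} [Ring A] [Algebra ℂ A]

/-- The coefficient of `(w/z) ^ n` in `z / (z - w)`, expanded in powers of `z/w` or of `w/z`. -/
def poleSign : Sgn → ℤ → ℤ
  | .pos, n => if n < 0 then -1 else 0
  | .neg, n => if n < 0 then 0 else 1

lemma poleSign_eq_zero {σ : Sgn} {n : ℤ} (h : 0 < σ.toInt * n) : poleSign σ n = 0 := by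
  cases σ <;> simp only [poleSign, Sgn.toInt] at h ⊢
  · rw [if_neg (by omega)]
  · rw [if_pos (by omega)]

lemma poleSign_neg (n : ℤ) : poleSign .neg n = poleSign .pos n + 1 := by
  simp only [poleSign]
  split_ifs <;> rfl

variable {s s' : Sgn} {B : Type*} [Ring B] [Algebra (PowerSeries (Zc A)) B]
    (F : Frame (A := A) s s' B)

/-- The series `ξ z / (ξ z - w)`. -/
def Frame.pole (ξ : (Zc A)ˣ) : PowerSeries (Zc A) :=
  PowerSeries.mk fun k => poleSign F.σ (-(F.σ.toInt * k)) • ((ξ ^ (F.σ.toInt * k) : (Zc A)ˣ) : Zc A)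

lemma Frame.mul_pole (ξ : (Zc A)ˣ) :
    (PowerSeries.C (ξ : Zc A) * F.z - F.w) * F.pole ξ = PowerSeries.C (ξ : Zc A) * F.z := by
  rcases h : F.σ
  · simp only [Frame.pole, Frame.z, Frame.w, h]
    ext k
    rw [sub_mul, one_mul, map_sub, mul_assoc, PowerSeries.coeff_C_mul, PowerSeries.coeff_C_mul]
    rcases k with _ | _ | k
    · simp [poleSign, Sgn.toInt]
    · rw [PowerSeries.coeff_succ_X_mul]
      simp [poleSign, Sgn.toInt]
    · rw [PowerSeries.coeff_succ_X_mul, PowerSeries.coeff_mk, PowerSeries.coeff_mk,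
        PowerSeries.coeff_X, if_neg (by omega)]
      have hs : ∀ j : ℕ, poleSign .pos (-(Sgn.pos.toInt * (j + 1 : ℕ))) = -1 := fun j =>
        if_pos (by simp only [Sgn.toInt]; push_cast; omega)
      rw [hs, hs, show Sgn.pos.toInt = 1 from rfl, one_mul, one_mul, zpow_natCast, zpow_natCast,
        Units.val_pow_eq_pow_val,
        Units.val_pow_eq_pow_val]
      simp only [neg_smul, one_smul]
      ring
  · simp only [Frame.pole, Frame.z, Frame.w, h]
    ext k
    rw [sub_mul, map_sub, mul_one, PowerSeries.coeff_C_mul]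
    rcases k with _ | k
    · simp [poleSign, Sgn.toInt]
    · rw [PowerSeries.coeff_succ_X_mul, PowerSeries.coeff_mk, PowerSeries.coeff_mk,
        PowerSeries.coeff_C, if_neg (by omega)]
      have hs : ∀ j : ℕ, poleSign .neg (-(Sgn.neg.toInt * j)) = 1 := fun j =>
        if_neg (by simp only [Sgn.toInt]; omega)
      rw [hs, hs, show Sgn.neg.toInt = -1 from rfl, one_smul, one_smul,
        ← Units.val_mul, ← zpow_one_add, sub_eq_zero]
      congr 2
      push_cast
      ring

lemma Frame.co_pole₁ (ξ : (Zc A)ˣ) (u : PowerSeries A) (m n : ℤ) :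
    F.co m n (F.pole ξ • F.ι₁ u) =
      poleSign F.σ n • (((ξ ^ (-n) : (Zc A)ˣ) : Zc A) • coefZ s u (m + n)) := by
  rw [F.co_series _ _ m n (m.natAbs + n.natAbs + 1) (Nat.lt_succ_self _)]
  simp only [F.co_ι₁, Frame.pole, PowerSeries.coeff_mk]
  have hσ : F.σ.toInt * F.σ.toInt = 1 := by cases F.σ <;> rfl
  by_cases hn : 0 < F.σ.toInt * n
  · rw [poleSign_eq_zero hn, zero_smul]
    refine Finset.sum_eq_zero fun k _ => ?_
    rw [if_neg, smul_zero]
    intro h0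
    have : F.σ.toInt * n + k = 0 := by linear_combination F.σ.toInt * h0 - k * hσ
    omega
  · obtain ⟨k, hk⟩ : ∃ k : ℕ, F.σ.toInt * n = -k := ⟨(-(F.σ.toInt * n)).toNat, by omega⟩
    have hk' : n = -(F.σ.toInt * k) := by linear_combination F.σ.toInt * hk - n * hσ
    rw [Finset.sum_eq_single k]
    · rw [if_pos (by omega), ← hk', smul_assoc, show -n = F.σ.toInt * k by omega,
        show m - F.σ.toInt * k = m + n by omega]
    · intro b _ hb
      rw [if_neg, smul_zero]
      intro h0
      refine hb ?_
      have : F.σ.toInt * n + b = 0 := by linear_combination F.σ.toInt * h0 - b * hσ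
      omega
    · intro h0
      refine absurd (Finset.mem_range.mpr ?_) h0
      have : k = n.natAbs := by
        cases hs : F.σ <;> rw [hs] at hk <;> simp only [Sgn.toInt] at hk <;> omega
      omega

lemma Frame.co_pole₂ (ξ : (Zc A)ˣ) (u : PowerSeries A) (m n : ℤ) :
    F.co m n (F.pole ξ • F.ι₂ u) =
      poleSign F.σ (-m) • (((ξ ^ m : (Zc A)ˣ) : Zc A) • coefZ s' u (m + n)) := by
  rw [F.co_series _ _ m n (m.natAbs + n.natAbs + 1) (Nat.lt_succ_self _)]
  simp only [F.co_ι₂, Frame.pole, PowerSeries.coeff_mk]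
  have hσ : F.σ.toInt * F.σ.toInt = 1 := by cases F.σ <;> rfl
  by_cases hn : 0 < F.σ.toInt * -m
  · rw [poleSign_eq_zero hn, zero_smul]
    refine Finset.sum_eq_zero fun k _ => ?_
    rw [if_neg, smul_zero]
    intro h0
    have : F.σ.toInt * m - k = 0 := by linear_combination F.σ.toInt * h0 + k * hσ
    rw [mul_neg] at hn
    omega
  · rw [mul_neg] at hn
    obtain ⟨k, hk⟩ : ∃ k : ℕ, F.σ.toInt * m = k := ⟨(F.σ.toInt * m).toNat, by omega⟩
    have hk' : m = F.σ.toInt * k := by linear_combination F.σ.toInt * hk - m * hσ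
    rw [Finset.sum_eq_single k]
    · rw [if_pos (by omega), ← hk', smul_assoc, add_comm n]
    · intro b _ hb
      rw [if_neg, smul_zero]
      intro h0
      refine hb ?_
      have : F.σ.toInt * m - b = 0 := by linear_combination F.σ.toInt * h0 + b * hσ
      omega
    · intro h0
      refine absurd (Finset.mem_range.mpr ?_) h0
      have : k = m.natAbs := by
        cases hs : F.σ <;> rw [hs] at hk <;> simp only [Sgn.toInt] at hk <;> omega
      omega

/-- Cancellation of the common denominators in the exchange relation of `e₁` and `f₁`. -/
lemma RCoeffs.poly_e_f {S B : Type*} [CommRing S] [AddCommGroup B] [Module S B]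
    {q qi p z z' w P P' : S} {x y y' : B} (hqi : q * qi = 1)
    (hP : (z - w) * P = z) (hP' : (z' - w) * P' = z')
    (h₁ : IsUnit (z - w)) (h₂ : IsUnit (z * q + w)) (h₃ : IsUnit (z * q ^ 2 - w))
    (h₁' : IsUnit (z' - w)) (h₂' : IsUnit (z' * q + w)) (h₃' : IsUnit (z' * q ^ 2 - w))
    (h : (((RCoeffs.poly q p z' w z' w).o • RCoeffs.poly q p z w z w).a *
        ((RCoeffs.poly q p z w z w).o • RCoeffs.poly q p z' w z' w).a) • x =
      (((RCoeffs.poly q p z' w z' w).o • RCoeffs.poly q p z w z w).a *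
        ((RCoeffs.poly q p z w z w).o • RCoeffs.poly q p z' w z' w).f) • y -
      (((RCoeffs.poly q p z' w z' w).o • RCoeffs.poly q p z w z w).f *
        ((RCoeffs.poly q p z w z w).o • RCoeffs.poly q p z' w z' w).a) • y') :
    x = (q - qi) • (P' • y - P • y') := by
  have hq : IsUnit q := IsUnit.of_mul_eq_one qi hqi
  have hc := (((h₂.mul h₃).mul (h₂'.mul h₃')).mul (h₂.mul h₂')).mul (hq.pow 2)
  have hc' := hc.mul (h₁.mul h₁')
  refine hc'.smul_left_cancel.mp ?_
  simp only [RCoeffs.smul_def, RCoeffs.map, RCoeffs.poly] at h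
  have e₁ : (q ^ 2 * (z - w) * (z' - w)) * ((q - qi) * P') = q * (q ^ 2 - 1) * (z - w) * z' := by
    linear_combination q ^ 2 * (z - w) * (q - qi) * hP' - q * (z - w) * z' * hqi
  have e₂ : (q ^ 2 * (z - w) * (z' - w)) * ((q - qi) * P) = q * (q ^ 2 - 1) * (z' - w) * z := by
    linear_combination q ^ 2 * (z' - w) * (q - qi) * hP - q * (z' - w) * z * hqi
  set c := ((z * q + w) * (z * q ^ 2 - w)) * ((z' * q + w) * (z' * q ^ 2 - w)) *
    ((z * q + w) * (z' * q + w))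
  have f₁ : c * (q ^ 2 * (z - w) * (z' - w)) * ((q - qi) * P') =
      c * (q * (q ^ 2 - 1) * (z - w) * z') := by rw [mul_assoc c, e₁]
  have f₂ : c * (q ^ 2 * (z - w) * (z' - w)) * ((q - qi) * P) =
      c * (q * (q ^ 2 - 1) * (z' - w) * z) := by rw [mul_assoc c, e₂]
  have hce : c * q ^ 2 * ((z - w) * (z' - w)) = c * (q ^ 2 * (z - w) * (z' - w)) := by ring
  rw [hce, smul_sub, smul_sub, _root_.smul_smul (q - qi), _root_.smul_smul (q - qi),
    _root_.smul_smul _ ((q - qi) * P'), _root_.smul_smul _ ((q - qi) * P), f₁, f₂]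
  linear_combination (norm := module) h

namespace LModel

variable {q p : ℂ} (𝓜 : LModel false q p A)

/-- The series `e₁^±` at `z q^{∓ c/2}`. -/
def es (s : Sgn) : PowerSeries A := zScale s (𝓜.γ ^ (-s.toInt)) (𝓜.G s).e

/-- The modes of `k₂^± (k₁^±)⁻¹`. -/
def ratioZ (s : Sgn) (m : ℤ) : A := coefZ s ((𝓜.G s).K * (𝓜.G s).ki) m

lemma ki_K (hq : q ≠ 0) (hp : p ^ 2 = q) (s : Sgn) :
    (𝓜.G s).ki * (𝓜.G s).K = (𝓜.G s).K * (𝓜.G s).ki := by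
  have := 𝓜.commute_k_K hq hp s 1 1
  rw [zScale_one, zScale_one] at this
  exact ((𝓜.rep s).commute_ki this).eq

/-- The anticommutator of `e₁^±` and `f₁^±`; its pole at coinciding arguments is expanded in a
direction that depends on the two signs. -/
theorem e_f (hp : p ^ 2 = q) (hq : q ≠ 0) (s s' : Sgn) (m n : ℤ) :
    coefZ s (𝓜.es s) m * coefZ s' (𝓜.fs s') n + coefZ s' (𝓜.fs s') n * coefZ s (𝓜.es s) m =
      (q - q⁻¹) • (poleSign (frameσ s s') n •
          (((𝓜.γ ^ (s.toInt * (n - m)) : (Zc A)ˣ) : Zc A) • 𝓜.ratioZ s (m + n)) -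
        poleSign (frameσ s s') (-m) •
          (((𝓜.γ ^ (s'.toInt * (n - m)) : (Zc A)ˣ) : Zc A) • 𝓜.ratioZ s' (m + n))) := by
  obtain ⟨B, _, _, F, hσ, h⟩ := 𝓜.exists_frame hq hp s s'
  have h := h (𝓜.γ ^ (-s.toInt)) (𝓜.γ ^ s'.toInt)
  have hr : 𝓜.γ ^ (-s.toInt) * (𝓜.γ ^ s'.toInt)⁻¹ * 𝓜.γ ^ (s'.toInt - s.toInt) =
      𝓜.γ ^ (-(2 * s.toInt)) := by
    rw [← zpow_neg, ← zpow_add, ← zpow_add]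
    congr 1
    ring
  have hl : 𝓜.γ ^ (-s.toInt) * (𝓜.γ ^ s'.toInt)⁻¹ * 𝓜.γ ^ (s.toInt - s'.toInt) =
      𝓜.γ ^ (-(2 * s'.toInt)) := by
    rw [← zpow_neg, ← zpow_add, ← zpow_add]
    congr 1
    ring
  rw [hr, hl] at h
  have ho : ((F.R false q p ((𝓜.γ ^ (-(2 * s.toInt)) : (Zc A)ˣ) : Zc A)).o •
      F.R false q p ((𝓜.γ ^ (-(2 * s'.toInt)) : (Zc A)ˣ) : Zc A)).o =
      ((F.R false q p ((𝓜.γ ^ (-(2 * s'.toInt)) : (Zc A)ˣ) : Zc A)).o •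
      F.R false q p ((𝓜.γ ^ (-(2 * s.toInt)) : (Zc A)ˣ) : Zc A)).o := by
    rw [RCoeffs.smul_o, RCoeffs.smul_o, mul_comm]
  have hk := 𝓜.commute_of_rll h ho (by
    rw [RCoeffs.smul_o]
    exact (F.isUnit_R_o false p hq (Units.isUnit _)).mul (F.isUnit_R_o false p hq (Units.isUnit _)))
  have key := h.e_f_raw ((𝓜.rep_scale s _).map F.ι₁) ((𝓜.rep_scale s' _).map F.ι₂) ho hk
  have hqS : algebraMap ℂ (PowerSeries (Zc A)) q * algebraMap ℂ _ q⁻¹ = 1 := by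
    rw [← map_mul, mul_inv_cancel₀ hq, map_one]
  have hq' : ∀ θ : (Zc A)ˣ, IsUnit (PowerSeries.C (θ : Zc A) * F.z * algebraMap ℂ _ q + F.w) ∧
      IsUnit (PowerSeries.C (θ : Zc A) * F.z * algebraMap ℂ _ q ^ 2 - F.w) := by
    intro θ
    have := F.isUnit_R_o false p hq θ.isUnit
    rw [Frame.R, RCoeffs.polyT_o, IsUnit.mul_iff] at this
    exact ⟨this.2, this.1⟩
  have key' := RCoeffs.poly_e_f hqS (F.mul_pole (𝓜.γ ^ (-(2 * s'.toInt))))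
    (F.mul_pole (𝓜.γ ^ (-(2 * s.toInt)))) (F.isUnit_z_sub_w (Units.isUnit _)) (hq' _).1 (hq' _).2
    (F.isUnit_z_sub_w (Units.isUnit _)) (hq' _).1 (hq' _).2 key
  have := congrArg (F.co m n) key'
  simp only [GaussData.map, ← map_mul F.ι₁, ← map_mul F.ι₂, ← map_mul (zScale _ _)] at this
  rw [← map_sub (algebraMap ℂ (PowerSeries (Zc A))), F.co_complex, map_sub, map_add, F.co_pole₁,
    F.co_pole₂, F.co_mul, F.co_mul', 𝓜.ki_K hq hp, coefZ_zScale s _ (_ * _),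
    coefZ_zScale s' _ (_ * _), smul_smul, smul_smul, ← Units.val_mul, ← Units.val_mul,
    ← zpow_mul, ← zpow_mul, ← zpow_mul, ← zpow_mul,
    ← zpow_add, ← zpow_add, hσ] at this
  refine this.trans ?_
  rw [ratioZ, ratioZ, show -(2 * s.toInt) * -n + -s.toInt * (m + n) = s.toInt * (n - m) by ring,
    show -(2 * s'.toInt) * m + s'.toInt * (m + n) = s'.toInt * (n - m) by ring]

/-- The modes of `e₁^-(z_+) - e₁^+(z_-)`. -/
def curE (m : ℤ) : A := coefZ .neg (𝓜.es .neg) m - coefZ .pos (𝓜.es .pos) m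

/-- The anticommutator of the currents of `f₁` and `e₁`: the four expansions of the pole add up to
delta functions. -/
theorem cur_curE (hp : p ^ 2 = q) (hq : q ≠ 0) (m n : ℤ) :
    𝓜.cur n * 𝓜.curE m + 𝓜.curE m * 𝓜.cur n =
      (q - q⁻¹) • (((𝓜.γ ^ (m - n) : (Zc A)ˣ) : Zc A) • 𝓜.ratioZ .neg (m + n) -
        ((𝓜.γ ^ (n - m) : (Zc A)ˣ) : Zc A) • 𝓜.ratioZ .pos (m + n)) := by
  have h := 𝓜.e_f hp hq
  have h₁ := h .pos .pos m n
  have h₂ := h .pos .neg m n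
  have h₃ := h .neg .pos m n
  have h₄ := h .neg .neg m n
  simp only [frameσ, poleSign_neg, Sgn.toInt, one_mul, add_smul, one_smul] at h₁ h₂ h₃ h₄
  rw [show -1 * (n - m) = m - n by ring] at *
  simp only [cur, curE, mul_sub, sub_mul]
  linear_combination (norm := module) h₃ + h₂ - h₁ - h₄

end LModel

end

end

/-! ### The opposite algebra -/

noncomputable section

universe u

section

open MulOpposite

variable {A : Type u} [Ring A]

/-- A series, as a series over the opposite ring. -/
def opS (a : PowerSeries A) : PowerSeries Aᵐᵒᵖ := PowerSeries.mk fun n => op (PowerSeries.coeff n a)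

@[simp] lemma coeff_opS (a : PowerSeries A) (n : ℕ) :
    PowerSeries.coeff n (opS a) = op (PowerSeries.coeff n a) := by
  simp [opS]

lemma opS_mul (a b : PowerSeries A) : opS (a * b) = opS b * opS a := by
  ext n
  rw [coeff_opS, PowerSeries.coeff_mul, PowerSeries.coeff_mul, ← Finset.Nat.sum_antidiagonal_swap,
    Finset.op_sum]
  simp

lemma opS_add (a b : PowerSeries A) : opS (a + b) = opS a + opS b := by
  ext n
  simp

lemma opS_one : opS (1 : PowerSeries A) = 1 := by
  ext n
  rw [coeff_opS, PowerSeries.coeff_one, PowerSeries.coeff_one]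
  split_ifs <;> simp

lemma coefZ_opS (s : Sgn) (a : PowerSeries A) (m : ℤ) :
    coefZ s (opS a) m = op (coefZ s a m) := by
  cases s <;> simp only [coefZ] <;> split_ifs <;> simp

lemma opS_injective : Function.Injective (opS : PowerSeries A → PowerSeries Aᵐᵒᵖ) := by
  intro a b h
  ext n
  have := congrArg (PowerSeries.coeff n) h
  simpa using this

/-- The transpose of a matrix, over the opposite ring. -/
def opT {ι κ : Type*} (X : Matrix ι κ A) : Matrix κ ι Aᵐᵒᵖ := Xᵀ.map op

lemma opT_mul {ι κ μ : Type*} [Fintype κ] (X : Matrix ι κ A) (Y : Matrix κ μ A) :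
    opT (X * Y) = opT Y * opT X := by
  ext i j
  simp [opT, Matrix.mul_apply, Finset.op_sum]

lemma opT_sum {ι κ α : Type*} (t : Finset α) (X : α → Matrix ι κ A) :
    opT (∑ k ∈ t, X k) = ∑ k ∈ t, opT (X k) := by
  ext i j
  simp [opT, Matrix.sum_apply, Finset.op_sum]

lemma opT_tens₁ (M : Matrix (Fin 3) (Fin 3) A) : opT (tens₁ M) = tens₁ (opT M) := by
  ext i j
  simp only [opT, tens₁, Matrix.map_apply, Matrix.transpose_apply, eq_comm]
  split_ifs <;> rfl

lemma opT_tens₂ (M : Matrix (Fin 3) (Fin 3) A) : opT (tens₂ M) = tens₂ (opT M) := by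
  ext i j
  simp only [opT, tens₂, Matrix.map_apply, Matrix.transpose_apply]
  by_cases h : i.1 = j.1
  · rw [if_pos h, if_pos h.symm, h, add_comm (par j.2)]
    rcases Nat.even_or_odd (par j.1 * (par i.2 + par j.2)) with h | h
    · simp [h.neg_one_pow]
    · simp [h.neg_one_pow]
  · rw [if_neg h, if_neg (Ne.symm h), op_zero]

variable [Algebra ℂ A]

/-- A central element, as a central element of the opposite algebra. -/
def opZ : Zc A →+* Zc Aᵐᵒᵖ where
  toFun c := Zc.mk (op (c : A)) fun x => by
    rw [← op_unop x, ← op_mul, ← op_mul, center_comm]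
  map_zero' := Zc.ext (by simp)
  map_one' := Zc.ext (by simp)
  map_add' c d := Zc.ext (by simp)
  map_mul' c d := Zc.ext (by
    rw [Zc.val_mk, map_mul, map_mul, Zc.val_mk, Zc.val_mk, ← op_mul, center_comm])

lemma opZ_smul (c : Zc A) (x : A) : opZ c • op x = op (c • x) := by
  rw [center_smul_def, center_smul_def, center_comm]
  rfl

lemma opT_smul {ι κ : Type*} (c : Zc A) (X : Matrix ι κ A) : opT (c • X) = opZ c • opT X := by
  ext i j : 2
  exact (opZ_smul c (X j i)).symm

lemma Exch.op {R : Matrix (Fin 3 × Fin 3) (Fin 3 × Fin 3) (PowerSeries ℂ)} {θ θ' : Zc A}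
    {s s' : Sgn} {M N : Matrix (Fin 3) (Fin 3) (PowerSeries A)} (h : Exch R θ θ' s s' M N) :
    Exch Rᵀ (opZ θ') (opZ θ) s s' (Mᵀ.map opS) (Nᵀ.map opS) := by
  intro m n
  have := congrArg opT (h m n)
  have hM : ∀ (s : Sgn) (M : Matrix (Fin 3) (Fin 3) (PowerSeries A)) m,
      opT (matCoefZ s M m) = matCoefZ s (Mᵀ.map opS) m := by
    intro s M m
    ext i j : 2
    exact (coefZ_opS s (M j i) m).symm
  have hR : ∀ k, opT (R.map fun h => algebraMap ℂ A (PowerSeries.coeff k h)) =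
      Rᵀ.map fun h => algebraMap ℂ Aᵐᵒᵖ (PowerSeries.coeff k h) := fun k => rfl
  simp only [opT_sum, opT_smul, opT_mul, opT_tens₁, opT_tens₂, hM, hR, map_pow] at this
  exact this.symm

/-- The transposed L-operators over the opposite algebra. -/
def LModel.op {tr : Bool} {q p : ℂ} (𝓜 : LModel tr q p A) : LModel (!tr) q p Aᵐᵒᵖ where
  γ := Units.map opZ.toMonoidHom 𝓜.γ⁻¹
  L s := (𝓜.L s)ᵀ.map opS
  G s := ⟨opS (𝓜.G s).k, opS (𝓜.G s).ki, opS (𝓜.G s).K, opS (𝓜.G s).Ki, opS (𝓜.G s).K₃,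
    opS (𝓜.G s).e, opS (𝓜.G s).e₃₁, opS (𝓜.G s).e₂, opS (𝓜.G s).f, opS (𝓜.G s).h,
    opS (𝓜.G s).f₂⟩
  rep s := by
    have h := 𝓜.rep s
    constructor <;>
      simp only [Matrix.map_apply, Matrix.transpose_apply, ← opS_mul, ← opS_add, ← opS_one,
        h.k_ki, h.ki_k, h.K_Ki, h.Ki_K, h.L00, h.L01, h.L02, h.L10, h.L11, h.L12, h.L20, h.L21,
        h.L22, mul_assoc]
  same s := by
    have h := (𝓜.same s).op
    rw [map_one] at h
    cases tr
    · exact h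
    · exact h
  mixed := by
    have h := 𝓜.mixed.op
    have e₁ : ((Units.map opZ.toMonoidHom 𝓜.γ⁻¹ ^ 2 : (Zc Aᵐᵒᵖ)ˣ) : Zc Aᵐᵒᵖ) =
        opZ ((𝓜.γ⁻¹ ^ 2 : (Zc A)ˣ) : Zc A) := by
      simp
    have e₂ : (((Units.map opZ.toMonoidHom 𝓜.γ⁻¹)⁻¹ ^ 2 : (Zc Aᵐᵒᵖ)ˣ) : Zc Aᵐᵒᵖ) =
        opZ ((𝓜.γ ^ 2 : (Zc A)ˣ) : Zc A) := by
      rw [← map_inv, inv_inv]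
      simp
    rw [e₁, e₂]
    cases tr
    · exact h
    · exact h

lemma opS_zScale_cu (s : Sgn) {l : ℂ} (hl : l ≠ 0) (a : PowerSeries A) :
    opS (zScale s (cu hl) a) = zScale s (cu hl) (opS a) := by
  refine ext_coefZ (s := s) fun m => ?_
  rw [coefZ_opS, coefZ_cu, coefZ_cu, coefZ_opS, op_smul]

lemma opS_smul (c : ℂ) (a : PowerSeries A) : opS (c • a) = c • opS a := by
  ext n
  simp

namespace LModel

variable {q p : ℂ} (𝓜 : LModel false q p A)

lemma op_γ_zpow (k : ℤ) : ((𝓜.op.γ ^ k : (Zc Aᵐᵒᵖ)ˣ) : Zc Aᵐᵒᵖ) =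
    opZ ((𝓜.γ ^ (-k) : (Zc A)ˣ) : Zc A) := by
  have : 𝓜.op.γ ^ k = Units.map opZ.toMonoidHom (𝓜.γ ^ (-k)) := by
    rw [LModel.op, ← map_zpow, inv_zpow, zpow_neg]
  rw [this]
  rfl

lemma coefZ_op_fs (s : Sgn) (m : ℤ) :
    coefZ s (𝓜.op.fs s) m = MulOpposite.op (coefZ s (𝓜.es s) m) := by
  rw [fs, es, coefZ_zScale, coefZ_zScale, ← zpow_mul, op_γ_zpow, ← zpow_mul, neg_mul]
  exact (congrArg _ (coefZ_opS s _ m)).trans (opZ_smul _ _)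

lemma op_cur (m : ℤ) : 𝓜.op.cur m = -MulOpposite.op (𝓜.curE m) := by
  rw [cur, coefZ_op_fs, coefZ_op_fs, curE, op_sub, neg_sub]

lemma coefZ_op_ψs (hq : q ≠ 0) (hp : p ^ 2 = q) (s : Sgn) (m : ℤ) :
    coefZ s (𝓜.op.ψs s) m =
      MulOpposite.op (((𝓜.γ ^ (-(s.toInt * m)) : (Zc A)ˣ) : Zc A) • 𝓜.ratioZ s m) := by
  rw [ψs, ratioZ, ← 𝓜.ki_K hq hp, coefZ_zScale, ← zpow_mul, op_γ_zpow]
  refine Eq.trans (congrArg _ ?_) (opZ_smul _ _)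
  rw [← coefZ_opS, opS_mul]
  rfl

/-- The quadratic relation of the current of `e₁`, that of `f₁` in the opposite algebra. -/
theorem curE_curE (hp : p ^ 2 = q) (hq : q ≠ 0) (hr : ∀ n : ℕ, 0 < n → q ^ n ≠ 1) (m n : ℤ) :
    𝓜.curE n * 𝓜.curE (m - 1) + q • (𝓜.curE (n - 1) * 𝓜.curE m) +
      (q • (𝓜.curE (m - 1) * 𝓜.curE n) + 𝓜.curE m * 𝓜.curE (n - 1)) = 0 := by
  have h := 𝓜.op.cur_cur hp hq hr m n
  simp only [op_cur, neg_mul_neg] at h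
  exact op_injective h

/-- The exchange relation of the current of `e₁` and `k₂^± (k₁^±)⁻¹`. -/
theorem ratioZ_curE (hp : p ^ 2 = q) (hq : q ≠ 0) (hr : ∀ n : ℕ, 0 < n → q ^ n ≠ 1) (s : Sgn)
    (m n : ℤ) :
    (((𝓜.γ ^ (-(s.toInt * n)) : (Zc A)ˣ) : Zc A) • 𝓜.ratioZ s n) * 𝓜.curE (m - 1) +
      q • ((((𝓜.γ ^ (-(s.toInt * (n - 1))) : (Zc A)ˣ) : Zc A) • 𝓜.ratioZ s (n - 1)) * 𝓜.curE m) =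
    q • (𝓜.curE (m - 1) * (((𝓜.γ ^ (-(s.toInt * n)) : (Zc A)ˣ) : Zc A) • 𝓜.ratioZ s n)) +
      𝓜.curE m * (((𝓜.γ ^ (-(s.toInt * (n - 1))) : (Zc A)ˣ) : Zc A) • 𝓜.ratioZ s (n - 1)) := by
  have h := 𝓜.op.cur_ψs hp hq hr s m n
  simp only [op_cur, 𝓜.coefZ_op_ψs hq hp, neg_mul, mul_neg, smul_neg] at h
  have h' := congrArg (fun x => -unop x) h
  simpa only [unop_add, unop_neg, unop_mul, unop_smul, unop_op, neg_add_rev, neg_neg,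
    add_comm] using h'

lemma e₂_eq (hp : p ^ 2 = q) (hq : q ≠ 0) (hr : ∀ n : ℕ, 0 < n → q ^ n ≠ 1) (s : Sgn) :
    (𝓜.G s).e₂ = p⁻¹ • zScale s (cu (neg_ne_zero.mpr hq)) (𝓜.G s).e := by
  refine opS_injective ?_
  rw [opS_smul, opS_zScale_cu]
  exact 𝓜.op.f₂_eq hp hq hr s

end LModel

end

end

/-! ### Consequences of the anticommutator of `X⁺` and `X⁻` -/

noncomputable section

section

variable {A : Type*} [Ring A]

lemma ipow_eq (g : Aˣ) (k : ℤ) : ipow (g : A) (↑g⁻¹ : A) k = ↑(g ^ k) := by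
  rcases k with n | n
  · simp [ipow]
  · rw [ipow, zpow_negSucc, ← inv_pow, Units.val_pow_eq_pow_val]

variable [Algebra ℂ A]

/-- The series `∑ r_k t^k Z(n + k) x^k`, that is, the scalar series `r` in the operator of shift by
one and multiplication by `t x`, applied to `Z`. -/
def shiftS (r : PowerSeries ℂ) (t : A) (Z : ℤ → A) (n : ℤ) : PowerSeries A :=
  PowerSeries.mk fun k => PowerSeries.coeff k r • (t ^ k * Z (n + k))

lemma coeff_mul_C {A : Type*} [Ring A] (a : PowerSeries A) (x : A) (n : ℕ) :
    PowerSeries.coeff n (a * PowerSeries.C x) = PowerSeries.coeff n a * x :=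
  PowerSeries.coeff_mul_C n a x

/-- The coefficients of `r'(g⁻² y) r(g² y)`. -/
def thetaCoef (r' r : PowerSeries ℂ) (g : Aˣ) (N : ℕ) : A :=
  ∑ u ∈ Finset.HasAntidiagonal.antidiagonal N,
    (PowerSeries.coeff u.1 r' * PowerSeries.coeff u.2 r) • ((g ^ (2 * (u.2 - u.1 : ℤ)) : Aˣ) : A)

section

/-- Two families `X`, `Y` whose anticommutator is a combination of the coefficients of a series `E`
in `y` and of a series `Q` in `y⁻¹`, such that conjugation by `E` multiplies the generating series
of `X` by `r'(g⁻¹ y)` and that of `Y` by `r(g y)`, with `r' = r⁻¹`. -/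
structure ConjData (g : Aˣ) (X Y Q : ℤ → A) (E : PowerSeries A) (r r' : PowerSeries ℂ) (c : ℂ) :
    Prop where
  hc : c ≠ 0
  gX : ∀ n, Commute (g : A) (X n)
  gY : ∀ n, Commute (g : A) (Y n)
  gE : ∀ n, Commute (g : A) (PowerSeries.coeff n E)
  hr : r' * r = 1
  hX : ∀ n, E * PowerSeries.C (X n) = shiftS r' (↑g⁻¹ : A) X n * E
  hY : ∀ n, E * PowerSeries.C (Y n) = shiftS r (g : A) Y n * E
  hXY : ∀ n m, X n * Y m + Y m * X n = c • (((g ^ (n - m) : Aˣ) : A) * coefZ .pos E (n + m) -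
      ((g ^ (m - n) : Aˣ) : A) * Q (n + m))
  hQ : ∀ k, 0 < k → Q k = 0

variable {g : Aˣ} {X Y Q : ℤ → A} {E : PowerSeries A} {r r' : PowerSeries ℂ} {c : ℂ}

lemma shiftS_anticomm (gX : ∀ n, Commute (g : A) (X n)) (gY : ∀ n, Commute (g : A) (Y n))
    (n m : ℤ) :
    shiftS r' (↑g⁻¹ : A) X n * shiftS r (g : A) Y m +
        shiftS r (g : A) Y m * shiftS r' (↑g⁻¹ : A) X n =
      PowerSeries.mk fun N => ∑ u ∈ Finset.HasAntidiagonal.antidiagonal N,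
        (PowerSeries.coeff u.1 r' * PowerSeries.coeff u.2 r) •
          (((g ^ (u.2 - u.1 : ℤ) : Aˣ) : A) *
            (X (n + u.1) * Y (m + u.2) + Y (m + u.2) * X (n + u.1))) := by
  ext N
  rw [map_add, PowerSeries.coeff_mul, PowerSeries.coeff_mul,
    ← Finset.Nat.sum_antidiagonal_swap (n := N)
      (f := fun x => PowerSeries.coeff x.1 (shiftS r (g : A) Y m) *
        PowerSeries.coeff x.2 (shiftS r' (↑g⁻¹ : A) X n)),
    ← Finset.sum_add_distrib, PowerSeries.coeff_mk]
  refine Finset.sum_congr rfl fun u _ => ?_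
  simp only [shiftS, PowerSeries.coeff_mk, Prod.fst_swap, Prod.snd_swap]
  have e : ((g ^ (u.2 - u.1 : ℤ) : Aˣ) : A) = (↑g⁻¹ : A) ^ u.1 * (g : A) ^ u.2 := by
    rw [sub_eq_neg_add, zpow_add, zpow_neg, zpow_natCast, zpow_natCast, ← inv_pow]
    simp
  have e' : (↑g⁻¹ : A) ^ u.1 * (g : A) ^ u.2 = (g : A) ^ u.2 * (↑g⁻¹ : A) ^ u.1 :=
    ((Commute.refl g).inv_left.units_val.pow_pow u.1 u.2).eq
  have hx : X (n + u.1) * (g : A) ^ u.2 = (g : A) ^ u.2 * X (n + u.1) :=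
    ((gX _).pow_left _).eq.symm
  have hy : Y (m + u.2) * (↑g⁻¹ : A) ^ u.1 = (↑g⁻¹ : A) ^ u.1 * Y (m + u.2) :=
    ((gY _).units_inv_left.pow_left _).eq.symm
  rw [e, smul_mul_smul_comm, smul_mul_smul_comm, mul_comm (PowerSeries.coeff u.2 r), ← smul_add]
  congr 1
  rw [mul_add]
  congr 1
  · simp only [mul_assoc]
    rw [← mul_assoc (X (n + u.1)), hx, mul_assoc]
  · rw [e']
    simp only [mul_assoc]
    rw [← mul_assoc (Y (m + u.2)), hy, mul_assoc]

/-- Conjugation of the anticommutator of `X⁺` and `X⁻` by `ψ⁺`. -/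
lemma ConjData.mul_anticomm (D : ConjData g X Y Q E r r' c) (n m : ℤ) :
    E * PowerSeries.C (c • (((g ^ (n - m) : Aˣ) : A) * coefZ .pos E (n + m) -
      ((g ^ (m - n) : Aˣ) : A) * Q (n + m))) =
    (PowerSeries.mk fun N => c • ((if N = 0 then ((g ^ (n - m) : Aˣ) : A) * coefZ .pos E (n + m)
      else 0) - ((g ^ (m - n) : Aˣ) : A) * (thetaCoef r' r g N * Q (n + m + N)))) * E := by
  have h₁ : E * PowerSeries.C (X n * Y m + Y m * X n) =
      (shiftS r' (↑g⁻¹ : A) X n * shiftS r (g : A) Y m +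
        shiftS r (g : A) Y m * shiftS r' (↑g⁻¹ : A) X n) * E := by
    rw [map_add, map_mul, map_mul, mul_add, add_mul, ← mul_assoc, D.hX, mul_assoc, D.hY,
      ← mul_assoc, ← mul_assoc, D.hY, mul_assoc (shiftS r (g : A) Y m), D.hX, ← mul_assoc]
  rw [shiftS_anticomm D.gX D.gY] at h₁
  rw [← D.hXY, h₁]
  congr 1
  ext N
  rw [PowerSeries.coeff_mk, PowerSeries.coeff_mk]
  have e : ∀ u ∈ Finset.HasAntidiagonal.antidiagonal N,
      (PowerSeries.coeff u.1 r' * PowerSeries.coeff u.2 r) •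
          (((g ^ (u.2 - u.1 : ℤ) : Aˣ) : A) *
            (X (n + u.1) * Y (m + u.2) + Y (m + u.2) * X (n + u.1))) =
      (PowerSeries.coeff u.1 r' * PowerSeries.coeff u.2 r) • (c •
        (((g ^ (n - m) : Aˣ) : A) * coefZ .pos E (n + m + N))) -
      c • (((g ^ (m - n) : Aˣ) : A) * ((PowerSeries.coeff u.1 r' * PowerSeries.coeff u.2 r) •
        ((g ^ (2 * (u.2 - u.1 : ℤ)) : Aˣ) : A) * Q (n + m + N))) := by
    intro u hu
    have hu := Finset.HasAntidiagonal.mem_antidiagonal.mp hu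
    have hN : n + u.1 + (m + u.2) = n + m + N := by
      rw [← hu]
      push_cast
      ring
    rw [D.hXY, hN, mul_smul_comm, mul_sub, ← mul_assoc, ← mul_assoc, ← Units.val_mul,
      ← Units.val_mul, ← zpow_add, ← zpow_add,
      show (u.2 - u.1 : ℤ) + (n + u.1 - (m + u.2)) = n - m by ring,
      show (u.2 - u.1 : ℤ) + (m + u.2 - (n + u.1)) = (m - n) + 2 * (u.2 - u.1) by ring,
      zpow_add g (m - n), Units.val_mul, smul_sub, smul_sub, smul_mul_assoc, mul_smul_comm,
      smul_comm c (_ * _) (((g ^ (m - n) : Aˣ) : A) * _), mul_assoc]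
  -- On the `ψ⁺` term the powers of `g` do not depend on `u`, and the two rational factors cancel.
  have hδ : ∑ u ∈ Finset.HasAntidiagonal.antidiagonal N,
      PowerSeries.coeff u.1 r' * PowerSeries.coeff u.2 r = if N = 0 then 1 else 0 := by
    rw [← PowerSeries.coeff_mul, D.hr, PowerSeries.coeff_one]
  rw [Finset.sum_congr rfl e, Finset.sum_sub_distrib, ← Finset.sum_smul, hδ, ← Finset.smul_sum,
    ← Finset.mul_sum, ← Finset.sum_mul, smul_sub, thetaCoef]
  congr 1
  split_ifs with h
  · simp [h]
  · simp

/-- The coefficients of `ψ⁺` commute. -/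
theorem ConjData.commute_coeff (D : ConjData g X Y Q E r r' c) (i j : ℕ) :
    Commute (PowerSeries.coeff i E) (PowerSeries.coeff j E) := by
  have key : ∀ i j : ℕ, 0 < j → Commute (PowerSeries.coeff i E) (PowerSeries.coeff j E) := by
    intro i j hj
    -- Since `j > 0`, only `ψ⁺` contributes to the anticommutator of the modes `j` and `0`.
    have h := D.mul_anticomm j 0
    have hj' : coefZ .pos E (j + 0) = PowerSeries.coeff j E := by simp [coefZ]
    have e : (PowerSeries.mk fun N => c • ((if N = 0 then
        ((g ^ ((j : ℤ) - 0) : Aˣ) : A) * coefZ .pos E (j + 0)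
        else 0) - ((g ^ (0 - (j : ℤ)) : Aˣ) : A) * (thetaCoef r' r g N * Q (j + 0 + N)))) =
        PowerSeries.C (c • (((g ^ ((j : ℤ) - 0) : Aˣ) : A) * coefZ .pos E (j + 0))) := by
      ext N
      rw [PowerSeries.coeff_mk, D.hQ _ (by omega), mul_zero, mul_zero, sub_zero,
        PowerSeries.coeff_C]
      split_ifs <;> simp
    rw [e, D.hQ _ (by omega), mul_zero, sub_zero, hj'] at h
    have h := congrArg (PowerSeries.coeff i) h
    rw [coeff_mul_C, PowerSeries.coeff_C_mul, mul_smul_comm, smul_mul_assoc] at h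
    have h := smul_right_injective A D.hc h
    have hg := ((D.gE i).units_zpow_left ((j : ℤ) - 0)).eq
    rw [← mul_assoc, ← hg, mul_assoc, mul_assoc] at h
    exact (Units.mul_right_inj _).mp h
  rcases Nat.eq_zero_or_pos j with rfl | hj
  · rcases Nat.eq_zero_or_pos i with rfl | hi
    · exact Commute.refl _
    · exact (key 0 i hi).symm
  · exact key i j hj

/-- The exchange relation of `ψ⁺` and `ψ⁻`. -/
theorem ConjData.coeff_mul (D : ConjData g X Y Q E r r' c) (m n : ℕ) :
    PowerSeries.coeff m E * Q (-n) = ∑ k ∈ Finset.range (min m n + 1),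
      thetaCoef r' r g k * (Q (-(n - k : ℕ)) * PowerSeries.coeff (m - k) E) := by
  -- The anticommutator of the modes `-n` and `0` contains `Q (-n)`, and `ψ⁺` only for `n = 0`.
  have h := congrArg (PowerSeries.coeff m) (D.mul_anticomm (-n) 0)
  have hP : coefZ .pos E (-n + 0) = if n = 0 then PowerSeries.coeff 0 E else 0 := by
    rw [coefZ]
    rcases Nat.eq_zero_or_pos n with rfl | hn
    · simp
    · rw [if_neg (by omega), if_neg (by omega)]
  have hg : ∀ k : ℤ, PowerSeries.coeff m E * ((g ^ k : Aˣ) : A) =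
      ((g ^ k : Aˣ) : A) * PowerSeries.coeff m E := fun k => ((D.gE m).units_zpow_left k).eq.symm
  have hcomm : PowerSeries.coeff m E * (((g ^ (-(n : ℤ) - 0) : Aˣ) : A) * coefZ .pos E (-n + 0)) =
      ((g ^ (-(n : ℤ) - 0) : Aˣ) : A) * coefZ .pos E (-n + 0) * PowerSeries.coeff m E := by
    rw [hP]
    split_ifs
    · rw [← mul_assoc, hg, mul_assoc, (D.commute_coeff m 0).eq, mul_assoc]
    · simp
  rw [coeff_mul_C, mul_smul_comm, PowerSeries.coeff_mul] at h
  simp only [PowerSeries.coeff_mk, smul_mul_assoc, ← Finset.smul_sum, sub_mul,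
    Finset.sum_sub_distrib] at h
  have h := smul_right_injective A D.hc h
  have h0 : ∑ x ∈ Finset.HasAntidiagonal.antidiagonal m, (if x.1 = 0 then
      ((g ^ (-(n : ℤ) - 0) : Aˣ) : A) * coefZ .pos E (-n + 0) else 0) * PowerSeries.coeff x.2 E =
      ((g ^ (-(n : ℤ) - 0) : Aˣ) : A) * coefZ .pos E (-n + 0) * PowerSeries.coeff m E := by
    rw [Finset.sum_eq_single (0, m)]
    · simp
    · rintro ⟨a, b⟩ hx hne
      rw [if_neg, zero_mul]
      rintro rfl
      have := Finset.HasAntidiagonal.mem_antidiagonal.mp hx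
      simp at this
      exact hne (by rw [this])
    · intro hx
      exact absurd (Finset.HasAntidiagonal.mem_antidiagonal.mpr (zero_add m)) hx
  rw [h0, mul_sub, hcomm] at h
  have h := sub_right_injective h
  simp only [mul_assoc] at h
  rw [← mul_assoc, hg, mul_assoc, ← Finset.mul_sum] at h
  have h := (Units.mul_right_inj _).mp h
  rw [add_zero] at h
  rw [h, Finset.Nat.sum_antidiagonal_eq_sum_range_succ
    (fun a b => thetaCoef r' r g a * (Q (-n + a) * PowerSeries.coeff b E))]
  refine (Finset.sum_subset_zero_on_sdiff (fun x hx => ?_) (fun x hx => ?_) fun x hx => ?_).symm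
  · rw [Finset.mem_range] at hx ⊢
    omega
  · rw [Finset.mem_sdiff, Finset.mem_range, Finset.mem_range] at hx
    rw [D.hQ _ (by omega), zero_mul, mul_zero]
  · rw [Finset.mem_range] at hx
    rw [show (-(n : ℤ) + x) = -((n - x : ℕ) : ℤ) by omega]

end

end

end

/-! ### The current relations -/

noncomputable section

section

lemma ratP_mul {q : ℂ} (hq : q ≠ 0) :
    (PowerSeries.C q + PowerSeries.C 1 * PowerSeries.X) * ratP q =
      PowerSeries.C 1 + PowerSeries.C q * PowerSeries.X := by
  rw [ratP, map_one, one_mul, mul_left_comm, PowerSeries.mul_inv_cancel _ (by simpa), mul_one]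

lemma ratM_mul (q : ℂ) :
    (PowerSeries.C 1 + PowerSeries.C q * PowerSeries.X) * ratM q =
      PowerSeries.C q + PowerSeries.C 1 * PowerSeries.X := by
  rw [ratM, map_one, one_mul, mul_left_comm, PowerSeries.mul_inv_cancel _ (by simp), mul_one]

lemma ratM_mul_ratP {q : ℂ} (hq : q ≠ 0) : ratM q * ratP q = 1 := by
  have h : (PowerSeries.C q + PowerSeries.X : PowerSeries ℂ) *
      (PowerSeries.C q + PowerSeries.X)⁻¹ = 1 := PowerSeries.mul_inv_cancel _ (by simpa)
  have h' : (1 + PowerSeries.C q * PowerSeries.X : PowerSeries ℂ) *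
      (1 + PowerSeries.C q * PowerSeries.X)⁻¹ = 1 := PowerSeries.mul_inv_cancel _ (by simp)
  rw [ratM, ratP]
  linear_combination ((1 + PowerSeries.C q * PowerSeries.X : PowerSeries ℂ) *
      (1 + PowerSeries.C q * PowerSeries.X)⁻¹) * h + h'

lemma rat_opp_mul_rat {q : ℂ} (hq : q ≠ 0) (s : Sgn) : rat q s.opp * rat q s = 1 := by
  cases s
  · exact ratM_mul_ratP hq
  · exact (mul_comm _ _).trans (ratM_mul_ratP hq)

variable {A : Type*} [Ring A] [Algebra ℂ A]

/-- A first order recursion, solved by the expansion of a rational function. -/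
lemma eq_sum_of_recursion {L R : ℤ → ℕ → A} {a b c d : ℂ} {ρ : PowerSeries ℂ} (ha : a ≠ 0)
    (hρ : (PowerSeries.C a + PowerSeries.C b * PowerSeries.X) * ρ =
      PowerSeries.C c + PowerSeries.C d * PowerSeries.X)
    (h0 : ∀ m, a • L m 0 = c • R m 0)
    (hS : ∀ m j, a • L m (j + 1) + b • L (m + 1) j = c • R m (j + 1) + d • R (m + 1) j)
    (m : ℤ) (j : ℕ) : L m j = ∑ u ∈ Finset.HasAntidiagonal.antidiagonal j,
      PowerSeries.coeff u.1 ρ • R (m + u.1) u.2 := by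
  have hρ0 : a * PowerSeries.coeff 0 ρ = c := by
    have := congrArg (PowerSeries.coeff 0) hρ
    simpa [add_mul] using this
  have hρS : ∀ k, a * PowerSeries.coeff (k + 1) ρ + b * PowerSeries.coeff k ρ =
      if k = 0 then d else 0 := by
    intro k
    have := congrArg (PowerSeries.coeff (k + 1)) hρ
    rw [add_mul, map_add, PowerSeries.coeff_C_mul, mul_assoc, PowerSeries.coeff_C_mul,
      PowerSeries.coeff_succ_X_mul, map_add, PowerSeries.coeff_C, if_neg (by omega),
      PowerSeries.coeff_C_mul, PowerSeries.coeff_X, zero_add] at this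
    rw [this]
    split_ifs <;> simp_all
  induction j generalizing m with
  | zero =>
    refine smul_right_injective A ha ?_
    simp only [Finset.Nat.antidiagonal_zero, Finset.sum_singleton, h0, smul_smul, hρ0,
      Nat.cast_zero, add_zero]
  | succ j ih =>
    refine smul_right_injective A ha ?_
    simp only
    rw [Finset.Nat.sum_antidiagonal_succ, smul_add, smul_smul, hρ0, Nat.cast_zero, add_zero,
      Finset.smul_sum]
    have e : ∑ u ∈ Finset.HasAntidiagonal.antidiagonal j,
        a • PowerSeries.coeff (u.1 + 1) ρ • R (m + (u.1 + 1 : ℕ)) u.2 =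
        d • R (m + 1) j - b • L (m + 1) j := by
      have hd : d • R (m + 1) j = ∑ u ∈ Finset.HasAntidiagonal.antidiagonal j,
          (if u.1 = 0 then d else 0) • R (m + 1 + u.1) u.2 := by
        rw [Finset.sum_eq_single (0, j)]
        · simp
        · rintro ⟨x, y⟩ hx hne
          rw [if_neg, zero_smul]
          rintro rfl
          have := Finset.HasAntidiagonal.mem_antidiagonal.mp hx
          simp at this
          exact hne (by rw [this])
        · intro hx
          exact absurd (Finset.HasAntidiagonal.mem_antidiagonal.mpr (zero_add j)) hx
      rw [hd, ih, Finset.smul_sum, ← Finset.sum_sub_distrib]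
      refine Finset.sum_congr rfl fun u _ => ?_
      rw [← hρS, add_smul, smul_smul, smul_smul, add_sub_cancel_right]
      push_cast
      rw [add_assoc m, add_comm (1 : ℤ)]
    rw [e]
    linear_combination (norm := module) hS m j

/-- The series `∑ r_k t^k Z(n ± k) x^k`. -/
def dShift (r : PowerSeries ℂ) (t : A) (s : Sgn) (Z : ℤ → A) (n : ℤ) : PowerSeries A :=
  PowerSeries.mk fun k => PowerSeries.coeff k r • (t ^ k * Z (n + s.toInt * k))

lemma toInt_mul_self (s : Sgn) : s.toInt * s.toInt = 1 := by cases s <;> rfl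

lemma shiftS_eq_dShift (r : PowerSeries ℂ) (t : A) (s : Sgn) (Z : ℤ → A) (n : ℤ) :
    shiftS r t (fun k => Z (s.toInt * k)) n = dShift r t s Z (s.toInt * n) := by
  ext k
  rw [shiftS, dShift, PowerSeries.coeff_mk, PowerSeries.coeff_mk, mul_add]

/-- The current relations other than those between `ψ⁺` and `ψ⁻`, in a form without inverses. -/
structure Currents (q : ℂ) (g : Aˣ) (X : Sgn → ℤ → A) (ψ : Sgn → PowerSeries A) : Prop where
  g_X : ∀ s n, Commute (g : A) (X s n)
  g_ψ : ∀ s n, Commute (g : A) (PowerSeries.coeff n (ψ s))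
  X_ψ : ∀ s n, PowerSeries.C (X .pos n) * ψ s = ψ s * dShift (rat q s) (↑g⁻¹ : A) s (X .pos) n
  ψ_X : ∀ s n, ψ s * PowerSeries.C (X .pos n) =
    dShift (rat q s.opp) (↑g⁻¹ : A) s (X .pos) n * ψ s
  ψ_Y : ∀ s n, ψ s * PowerSeries.C (X .neg n) = dShift (rat q s) (g : A) s (X .neg) n * ψ s
  X_same : ∀ s n m, X s (n + 1) * X s m + q ^ s.toInt • (X s n * X s (m + 1))
        + (q ^ s.toInt • (X s m * X s (n + 1)) + X s (m + 1) * X s n) = 0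
  X_mixed : ∀ n m, X .pos n * X .neg m + X .neg m * X .pos n =
    (q - q⁻¹)⁻¹ • (((g ^ (n - m) : Aˣ) : A) * coefZ .pos (ψ .pos) (n + m) -
      ((g ^ (m - n) : Aˣ) : A) * coefZ .neg (ψ .neg) (n + m))

lemma Currents.conjData {q : ℂ} (hq : q ≠ 0) (hq1 : q ^ 2 ≠ 1) {g : Aˣ} {X : Sgn → ℤ → A}
    {ψ : Sgn → PowerSeries A} (D : Currents q g X ψ) (s : Sgn) :
    ConjData g (fun n => X .pos (s.toInt * n)) (fun n => X .neg (s.toInt * n))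
      (fun k => coefZ s.opp (ψ s.opp) (s.toInt * k)) (ψ s) (rat q s) (rat q s.opp)
      ((s.toInt : ℂ) * (q - q⁻¹)⁻¹) where
  hc := by
    refine mul_ne_zero (by cases s <;> simp [Sgn.toInt]) (inv_ne_zero fun h => hq1 ?_)
    field_simp at h
    linear_combination h
  gX n := D.g_X _ _
  gY n := D.g_X _ _
  gE n := D.g_ψ _ _
  hr := rat_opp_mul_rat hq s
  hX n := by rw [shiftS_eq_dShift, D.ψ_X]
  hY n := by rw [shiftS_eq_dShift, D.ψ_Y]
  hXY n m := by
    rw [D.X_mixed]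
    cases s
    · simp [Sgn.toInt, Sgn.opp]
    · have h₁ : ∀ k, coefZ .pos (ψ .pos) k = coefZ .neg (ψ .pos) (-k) := fun k => by
        rw [coefZ_eq_extZ, coefZ_eq_extZ]
        simp [Sgn.toInt]
      have h₂ : ∀ k, coefZ .pos (ψ .neg) k = coefZ .neg (ψ .neg) (-k) := fun k => by
        rw [coefZ_eq_extZ, coefZ_eq_extZ]
        simp [Sgn.toInt]
      simp only [Sgn.toInt, Sgn.opp, h₁, h₂, neg_mul, one_mul, Int.cast_neg, Int.cast_one, neg_smul,
        sub_neg_eq_add, neg_neg]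
      rw [← smul_neg, neg_sub, show -n + m = m - n by ring, show -m + n = n - m by ring,
        show n + m = - -(n + m) by ring, show -n + -m = -(n + m) by ring, neg_neg]
  hQ k hk := by
    rw [coefZ_eq_extZ, extZ_of_neg]
    cases s <;> simp [Sgn.toInt, Sgn.opp, hk]

lemma thetaCoef_eq_ψcoef (q : ℂ) (g : Aˣ) (k : ℕ) :
    thetaCoef (rat q .neg) (rat q .pos) g k = ψcoef q (g : A) (↑g⁻¹ : A) k := by
  refine Finset.sum_congr rfl fun u _ => ?_
  congr 1
  rw [show 2 * (u.2 - u.1 : ℤ) = -((2 * u.1 : ℕ) : ℤ) + ((2 * u.2 : ℕ) : ℤ) by push_cast; ring,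
    zpow_add, zpow_neg, zpow_natCast, zpow_natCast, ← inv_pow]
  simp

/-- All current relations follow from those of `Currents`. -/
theorem Currents.rel {q : ℂ} (hq : q ≠ 0) (hq1 : q ^ 2 ≠ 1) {D : CurrentData A} {g : Aˣ}
    (hg : D.g = g) (hgi : D.gi = (↑g⁻¹ : A)) (h : Currents q g D.X D.ψ)
    (h₁ : ∀ s, D.ψ s * D.ψi s = 1) (h₂ : ∀ s, D.ψi s * D.ψ s = 1) {x y : A}
    (hxy : CurrentRel q D x y) : x = y := by
  induction hxy with
  | g_gi => rw [hg, hgi, Units.mul_inv]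
  | gi_g => rw [hg, hgi, Units.inv_mul]
  | g_X s n => rw [hg]; exact h.g_X s n
  | g_ψ s n => rw [hg]; exact h.g_ψ s n
  | ψ_ψi s n => rw [h₁]
  | ψi_ψ s n => rw [h₂]
  | ψ_same s m n => exact (h.conjData hq hq1 s).commute_coeff m n
  | ψ_mixed m n =>
    have e : ∀ k : ℕ, coefZ .neg (D.ψ .neg) (Sgn.pos.toInt * -(k : ℤ)) =
        PowerSeries.coeff k (D.ψ .neg) := fun k => by simp [coefZ, Sgn.toInt]
    have := (h.conjData hq hq1 .pos).coeff_mul m n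
    simp only [Sgn.opp, e, thetaCoef_eq_ψcoef] at this
    rw [hg, hgi, this]
  | ψ_Xpos s k n =>
    rw [mul_assoc, h.X_ψ, ← mul_assoc, h₂, one_mul, dShift, PowerSeries.coeff_mk, hgi]
  | ψ_Xneg s k n =>
    rw [h.ψ_Y, mul_assoc, h₁, mul_one, dShift, PowerSeries.coeff_mk, hg]
  | X_same s n m => exact h.X_same s n m
  | X_mixed n m =>
    rw [h.X_mixed, hg, hgi, ipow_eq, ipow_eq]
    rfl

end

end

/-! ### Currents of the L-operators -/

noncomputable section

universe u

section

variable {A : Type u} [Ring A] [Algebra ℂ A]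

lemma shiftS_smul (α : ℂ) (r : PowerSeries ℂ) (t : A) (Z : ℤ → A) (n : ℤ) :
    shiftS r t (fun k => α • Z k) n = α • shiftS r t Z n := by
  ext k
  rw [PowerSeries.coeff_smul, shiftS, shiftS, PowerSeries.coeff_mk, PowerSeries.coeff_mk,
    mul_smul_comm, smul_comm]

lemma C_smul (α : ℂ) (x : A) : PowerSeries.C (α • x) = α • PowerSeries.C x := by
  ext k
  rw [PowerSeries.coeff_smul, PowerSeries.coeff_C, PowerSeries.coeff_C]
  split_ifs <;> simp

lemma units_cancel_sum {A : Type*} [Ring A] {h : Aˣ} {j : ℕ} {x : A} {f : ℕ × ℕ → A}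
    (hx : ((h ^ (j : ℤ) : Aˣ) : A) * x = ∑ u ∈ Finset.HasAntidiagonal.antidiagonal j,
      ((h ^ (u.2 : ℤ) : Aˣ) : A) * f u) :
    x = ∑ u ∈ Finset.HasAntidiagonal.antidiagonal j, (↑h⁻¹ : A) ^ u.1 * f u := by
  refine (Units.mul_right_inj (h ^ (j : ℤ))).mp ?_
  rw [hx, Finset.mul_sum]
  refine Finset.sum_congr rfl fun u hu => ?_
  rw [← Finset.HasAntidiagonal.mem_antidiagonal.mp hu, ← mul_assoc, Nat.cast_add, add_comm,
    zpow_add, ← Units.val_pow_eq_pow_val, ← Units.val_mul, inv_pow, zpow_natCast h u.1,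
    mul_inv_cancel_right]

section

variable {h : Aˣ} (hh : ∀ (k : ℤ) (x : A), Commute ((h ^ k : Aˣ) : A) x) {Z : ℤ → A}
  {E : PowerSeries A} {a b c d : ℂ} {ρ : PowerSeries ℂ} (ha : a ≠ 0)
  (hρ : (PowerSeries.C a + PowerSeries.C b * PowerSeries.X) * ρ =
    PowerSeries.C c + PowerSeries.C d * PowerSeries.X)

include hh ha hρ

lemma C_mul_of_recursion
    (h0 : ∀ m, a • (Z m * PowerSeries.coeff 0 E) = c • (PowerSeries.coeff 0 E * Z m))
    (hS : ∀ (m : ℤ) (j : ℕ),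
      a • (Z m * (((h ^ (j + 1 : ℤ) : Aˣ) : A) * PowerSeries.coeff (j + 1) E)) +
        b • (Z (m + 1) * (((h ^ (j : ℤ) : Aˣ) : A) * PowerSeries.coeff j E)) =
      c • (((h ^ (j + 1 : ℤ) : Aˣ) : A) * PowerSeries.coeff (j + 1) E * Z m) +
        d • (((h ^ (j : ℤ) : Aˣ) : A) * PowerSeries.coeff j E * Z (m + 1))) (n : ℤ) :
    PowerSeries.C (Z n) * E = E * shiftS ρ (↑h⁻¹ : A) Z n := by
  ext j
  have key := eq_sum_of_recursion
    (L := fun m j => Z m * (((h ^ (j : ℤ) : Aˣ) : A) * PowerSeries.coeff j E))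
    (R := fun m j => ((h ^ (j : ℤ) : Aˣ) : A) * PowerSeries.coeff j E * Z m) ha hρ
    (by simpa using h0) (by simpa using hS) n j
  rw [← mul_assoc, ← (hh _ (Z n)).eq, mul_assoc] at key
  rw [PowerSeries.coeff_C_mul, PowerSeries.coeff_mul, ← Finset.Nat.sum_antidiagonal_swap]
  refine (units_cancel_sum (f := fun u => PowerSeries.coeff u.1 ρ •
    (PowerSeries.coeff u.2 E * Z (n + u.1))) (key.trans (Finset.sum_congr rfl fun u _ => ?_))).trans
    (Finset.sum_congr rfl fun u _ => ?_)
  · rw [mul_smul_comm, mul_assoc]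
  · have := (hh (-(u.1 : ℤ)) (PowerSeries.coeff u.2 E)).eq
    rw [zpow_neg, zpow_natCast, ← inv_pow, Units.val_pow_eq_pow_val] at this
    simp only [Prod.fst_swap, Prod.snd_swap, shiftS, PowerSeries.coeff_mk]
    rw [mul_smul_comm, mul_smul_comm, ← mul_assoc, this, mul_assoc]

lemma mul_C_of_recursion
    (h0 : ∀ m, a • (PowerSeries.coeff 0 E * Z m) = c • (Z m * PowerSeries.coeff 0 E))
    (hS : ∀ (m : ℤ) (j : ℕ),
      a • (((h ^ (j + 1 : ℤ) : Aˣ) : A) * PowerSeries.coeff (j + 1) E * Z m) +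
        b • (((h ^ (j : ℤ) : Aˣ) : A) * PowerSeries.coeff j E * Z (m + 1)) =
      c • (Z m * (((h ^ (j + 1 : ℤ) : Aˣ) : A) * PowerSeries.coeff (j + 1) E)) +
        d • (Z (m + 1) * (((h ^ (j : ℤ) : Aˣ) : A) * PowerSeries.coeff j E))) (n : ℤ) :
    E * PowerSeries.C (Z n) = shiftS ρ (↑h⁻¹ : A) Z n * E := by
  ext j
  have key := eq_sum_of_recursion
    (L := fun m j => ((h ^ (j : ℤ) : Aˣ) : A) * PowerSeries.coeff j E * Z m)
    (R := fun m j => Z m * (((h ^ (j : ℤ) : Aˣ) : A) * PowerSeries.coeff j E)) ha hρ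
    (by simpa using h0) (by simpa using hS) n j
  rw [mul_assoc] at key
  rw [coeff_mul_C, PowerSeries.coeff_mul]
  refine (units_cancel_sum (f := fun u => PowerSeries.coeff u.1 ρ •
    (Z (n + u.1) * PowerSeries.coeff u.2 E)) (key.trans (Finset.sum_congr rfl fun u _ => ?_))).trans
    (Finset.sum_congr rfl fun u _ => ?_)
  · rw [mul_smul_comm, ← mul_assoc, ← (hh _ _).eq, mul_assoc]
  · simp only [shiftS, PowerSeries.coeff_mk]
    rw [mul_smul_comm, smul_mul_assoc, mul_assoc]

end

/-- The coefficients of `rat q s`: it is `(a₋ + a₊ x) / (a₊ + a₋ x)` for `s = +`, and the inverse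
for `s = -`. -/
def ratA (q : ℂ) : Sgn → ℂ
  | .pos => q
  | .neg => 1

lemma rat_mul {q : ℂ} (hq : q ≠ 0) (s : Sgn) :
    (PowerSeries.C (ratA q s) + PowerSeries.C (ratA q s.opp) * PowerSeries.X) * rat q s =
      PowerSeries.C (ratA q s.opp) + PowerSeries.C (ratA q s) * PowerSeries.X := by
  cases s
  · exact ratP_mul hq
  · exact ratM_mul q

lemma ratA_ne_zero {q : ℂ} (hq : q ≠ 0) (s : Sgn) : ratA q s ≠ 0 := by
  cases s
  · exact hq
  · exact one_ne_zero

lemma Sgn.opp_opp (s : Sgn) : s.opp.opp = s := by cases s <;> rfl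

namespace LModel

variable {q p : ℂ} (𝓜 : LModel false q p A)

/-- The element `q^{c/2}`. -/
def g : Aˣ := Units.map (Zc.val : Zc A →ₐ[ℂ] A).toMonoidHom 𝓜.γ

lemma val_g_zpow (k : ℤ) : ((𝓜.g ^ k : Aˣ) : A) = (((𝓜.γ ^ k : (Zc A)ˣ) : Zc A) : A) := by
  rw [g, ← map_zpow]
  rfl

lemma zpow_smul_eq (k : ℤ) (x : A) :
    ((𝓜.γ ^ k : (Zc A)ˣ) : Zc A) • x = ((𝓜.g ^ k : Aˣ) : A) * x := by
  rw [val_g_zpow, center_smul_def]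

lemma commute_g (k : ℤ) (x : A) : Commute ((𝓜.g ^ k : Aˣ) : A) x := by
  rw [val_g_zpow]
  exact center_comm _ x

/-- The modes of the currents `X^±`. As `f₂(-z q⁻¹)` and `e₂(-z q⁻¹)` are multiples of `f₁(z)` and
`e₁(z)`, the sums of the two simple root currents are `1 - p` and `1 + p⁻¹` times the first ones. -/
def X : Sgn → ℤ → A
  | .pos, n => ((1 - p) * (q - q⁻¹)⁻¹) • 𝓜.cur (-n)
  | .neg, n => ((1 + p⁻¹) * (q - q⁻¹)⁻¹) • 𝓜.curE (-n)

/-- The series `k₂ k₁⁻¹` in which `X^±` is conjugated. -/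
def ratioS (s : Sgn) : PowerSeries A := (𝓜.G s.opp).K * (𝓜.G s.opp).ki

lemma ratioZ_eq (s : Sgn) (n : ℤ) : 𝓜.ratioZ s.opp (-(s.toInt * n)) =
    extZ (fun k => PowerSeries.coeff k (𝓜.ratioS s)) n := by
  rw [ratioZ, coefZ_eq_extZ]
  congr 1
  cases s <;> simp [Sgn.toInt, Sgn.opp]

lemma coefZ_ψs (s : Sgn) (n : ℤ) :
    coefZ s.opp (𝓜.ψs s.opp) (-(s.toInt * n)) =
      ((𝓜.g ^ n : Aˣ) : A) * extZ (fun k => PowerSeries.coeff k (𝓜.ratioS s)) n := by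
  rw [ψs, coefZ_zScale, ← zpow_mul, zpow_smul_eq, ← ratioZ_eq, ratioZ]
  congr 3
  cases s <;> simp [Sgn.toInt, Sgn.opp]

/-- The series `ψ^±`. -/
def ψ (s : Sgn) : PowerSeries A := (p⁻¹ - p) • 𝓜.ratioS s

/-- The exchange relation of `X⁺` and `ψ^±` as a recursion. -/
lemma cur_recursion (hp : p ^ 2 = q) (hq : q ≠ 0) (hr : ∀ n : ℕ, 0 < n → q ^ n ≠ 1) (s : Sgn)
    (m j : ℤ) :
    ratA q s • (𝓜.cur (-(s.toInt * m)) * (((𝓜.g ^ (j + 1) : Aˣ) : A) *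
        extZ (fun k => PowerSeries.coeff k (𝓜.ratioS s)) (j + 1))) +
      ratA q s.opp • (𝓜.cur (-(s.toInt * (m + 1))) * (((𝓜.g ^ j : Aˣ) : A) *
        extZ (fun k => PowerSeries.coeff k (𝓜.ratioS s)) j)) =
    ratA q s.opp • (((𝓜.g ^ (j + 1) : Aˣ) : A) *
        extZ (fun k => PowerSeries.coeff k (𝓜.ratioS s)) (j + 1) * 𝓜.cur (-(s.toInt * m))) +
      ratA q s • (((𝓜.g ^ j : Aˣ) : A) *
        extZ (fun k => PowerSeries.coeff k (𝓜.ratioS s)) j * 𝓜.cur (-(s.toInt * (m + 1)))) := by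
  simp only [← coefZ_ψs]
  cases s
  · have h := 𝓜.cur_ψs hp hq hr .neg (-m) (-j)
    rw [show -m - 1 = -(Sgn.pos.toInt * (m + 1)) by simp [Sgn.toInt]; ring,
      show -j - 1 = -(Sgn.pos.toInt * (j + 1)) by simp [Sgn.toInt]; ring,
      show -m = -(Sgn.pos.toInt * m) by simp [Sgn.toInt],
      show -j = -(Sgn.pos.toInt * j) by simp [Sgn.toInt]] at h
    simp only [ratA, Sgn.opp]
    linear_combination (norm := module) h
  · have h := 𝓜.cur_ψs hp hq hr .pos (m + 1) (j + 1)
    rw [add_sub_cancel_right, add_sub_cancel_right,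
      show m + 1 = -(Sgn.neg.toInt * (m + 1)) by simp [Sgn.toInt],
      show j + 1 = -(Sgn.neg.toInt * (j + 1)) by simp [Sgn.toInt]] at h
    simp only [ratA, Sgn.opp, show -(Sgn.neg.toInt * m) = m by simp [Sgn.toInt],
      show -(Sgn.neg.toInt * j) = j by simp [Sgn.toInt]]
    linear_combination (norm := module) h

/-- The exchange relation of `X⁻` and `ψ^±` as a recursion. -/
lemma curE_recursion (hp : p ^ 2 = q) (hq : q ≠ 0) (hr : ∀ n : ℕ, 0 < n → q ^ n ≠ 1) (s : Sgn)
    (m j : ℤ) :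
    ratA q s • (((𝓜.g⁻¹ ^ (j + 1) : Aˣ) : A) *
        extZ (fun k => PowerSeries.coeff k (𝓜.ratioS s)) (j + 1) * 𝓜.curE (-(s.toInt * m))) +
      ratA q s.opp • (((𝓜.g⁻¹ ^ j : Aˣ) : A) *
        extZ (fun k => PowerSeries.coeff k (𝓜.ratioS s)) j * 𝓜.curE (-(s.toInt * (m + 1)))) =
    ratA q s.opp • (𝓜.curE (-(s.toInt * m)) * (((𝓜.g⁻¹ ^ (j + 1) : Aˣ) : A) *
        extZ (fun k => PowerSeries.coeff k (𝓜.ratioS s)) (j + 1))) +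
      ratA q s • (𝓜.curE (-(s.toInt * (m + 1))) * (((𝓜.g⁻¹ ^ j : Aˣ) : A) *
        extZ (fun k => PowerSeries.coeff k (𝓜.ratioS s)) j)) := by
  simp only [← ratioZ_eq, inv_zpow', ← zpow_smul_eq]
  cases s
  · have h := 𝓜.ratioZ_curE hp hq hr .neg (-m) (-j)
    rw [show -(Sgn.neg.toInt * -j) = -j by simp [Sgn.toInt],
      show -(Sgn.neg.toInt * (-j - 1)) = -(j + 1) by simp [Sgn.toInt]; ring,
      show -m - 1 = -(Sgn.pos.toInt * (m + 1)) by simp [Sgn.toInt]; ring,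
      show -j - 1 = -(Sgn.pos.toInt * (j + 1)) by simp [Sgn.toInt]; ring,
      show -m = -(Sgn.pos.toInt * m) by simp [Sgn.toInt]] at h
    simp only [ratA, Sgn.opp, show -(Sgn.pos.toInt * j) = -j by simp [Sgn.toInt]] at h ⊢
    linear_combination (norm := module) h
  · have h := 𝓜.ratioZ_curE hp hq hr .pos (m + 1) (j + 1)
    rw [add_sub_cancel_right, add_sub_cancel_right] at h
    simp only [ratA, Sgn.opp, show ∀ k, -(Sgn.neg.toInt * k) = k by simp [Sgn.toInt],
      show ∀ k, -(Sgn.pos.toInt * k) = -k by simp [Sgn.toInt]] at h ⊢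
    linear_combination (norm := module) h

lemma p_ne_zero (hp : p ^ 2 = q) (hq : q ≠ 0) : p ≠ 0 := by
  rintro rfl
  exact hq (by rw [← hp]; ring)

lemma p_sub_ne_zero (hp : p ^ 2 = q) (hq : q ≠ 0) (hq1 : q ^ 2 ≠ 1) : p⁻¹ - p ≠ 0 := by
  have hp0 := p_ne_zero hp hq
  intro h
  refine hq1 ?_
  have : q = 1 := by
    rw [← hp]
    field_simp at h
    linear_combination -h
  rw [this, one_pow]

/-- The currents of the L-operators satisfy the current relations. -/
theorem currents (hp : p ^ 2 = q) (hq : q ≠ 0) (hr : ∀ n : ℕ, 0 < n → q ^ n ≠ 1) :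
    Currents q 𝓜.g 𝓜.X 𝓜.ψ := by
  have hq1 : q ^ 2 ≠ 1 := hr 2 two_pos
  have hp0 := p_ne_zero hp hq
  have hcoef : ∀ s (j : ℕ), extZ (fun k => PowerSeries.coeff k (𝓜.ratioS s)) ((j : ℤ) + 1) =
      PowerSeries.coeff (j + 1) (𝓜.ratioS s) := fun s j => extZ_natCast _ (j + 1)
  have hneg : ∀ s, extZ (fun k => PowerSeries.coeff k (𝓜.ratioS s)) (-1) = 0 := fun s => rfl
  have hzero : ∀ s, extZ (fun k => PowerSeries.coeff k (𝓜.ratioS s)) (-1 + 1) =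
      PowerSeries.coeff 0 (𝓜.ratioS s) := fun s => rfl
  have hX : ∀ s r t n, dShift r t s (𝓜.X .pos) n = ((1 - p) * (q - q⁻¹)⁻¹) •
      shiftS r t (fun k => 𝓜.cur (-(s.toInt * k))) (s.toInt * n) := by
    intro s r t n
    rw [← shiftS_smul]
    refine Eq.trans ?_ (shiftS_eq_dShift r t s (𝓜.X .pos) (s.toInt * n)).symm
    rw [← mul_assoc, toInt_mul_self, one_mul]
  have hY : ∀ s r t n, dShift r t s (𝓜.X .neg) n = ((1 + p⁻¹) * (q - q⁻¹)⁻¹) •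
      shiftS r t (fun k => 𝓜.curE (-(s.toInt * k))) (s.toInt * n) := by
    intro s r t n
    rw [← shiftS_smul]
    refine Eq.trans ?_ (shiftS_eq_dShift r t s (𝓜.X .neg) (s.toInt * n)).symm
    rw [← mul_assoc, toInt_mul_self, one_mul]
  have hn : ∀ (s : Sgn) (n : ℤ), n = s.toInt * (s.toInt * n) := fun s n => by
    rw [← mul_assoc, toInt_mul_self, one_mul]
  constructor
  · intro s n
    have := 𝓜.commute_g 1 (𝓜.X s n)
    rwa [zpow_one] at this
  · intro s n
    have := 𝓜.commute_g 1 (PowerSeries.coeff n (𝓜.ψ s))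
    rwa [zpow_one] at this
  · intro s n
    have key := C_mul_of_recursion (𝓜.commute_g) (Z := fun k => 𝓜.cur (-(s.toInt * k)))
      (E := 𝓜.ratioS s) (ratA_ne_zero hq s) (rat_mul hq s)
      (fun m => by
        have := 𝓜.cur_recursion hp hq hr s m (-1)
        rw [hneg, hzero] at this
        simpa using this)
      (fun m j => by
        have := 𝓜.cur_recursion hp hq hr s m j
        rwa [hcoef, extZ_natCast] at this) (s.toInt * n)
    rw [← hn] at key
    rw [hX, X, ψ, C_smul, smul_mul_smul_comm, smul_mul_smul_comm, key, mul_comm (p⁻¹ - p)]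
  · intro s n
    have key := mul_C_of_recursion (𝓜.commute_g) (Z := fun k => 𝓜.cur (-(s.toInt * k)))
      (E := 𝓜.ratioS s) (ratA_ne_zero hq s.opp) (rat_mul hq s.opp)
      (fun m => by
        have := 𝓜.cur_recursion hp hq hr s m (-1)
        rw [hneg, hzero] at this
        rw [Sgn.opp_opp]
        simpa using this.symm)
      (fun m j => by
        have := 𝓜.cur_recursion hp hq hr s m j
        rw [hcoef, extZ_natCast] at this
        rw [Sgn.opp_opp]
        exact this.symm) (s.toInt * n)
    rw [← hn] at key
    rw [hX, X, ψ, C_smul, smul_mul_smul_comm, smul_mul_smul_comm, key, mul_comm (p⁻¹ - p)]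
  · intro s n
    have key := mul_C_of_recursion (h := 𝓜.g⁻¹)
      (fun k x => by rw [inv_zpow']; exact 𝓜.commute_g _ x)
      (Z := fun k => 𝓜.curE (-(s.toInt * k)))
      (E := 𝓜.ratioS s) (ratA_ne_zero hq s) (rat_mul hq s)
      (fun m => by
        have := 𝓜.curE_recursion hp hq hr s m (-1)
        rw [hneg, hzero] at this
        simpa using this)
      (fun m j => by
        have := 𝓜.curE_recursion hp hq hr s m j
        rwa [hcoef, extZ_natCast] at this) (s.toInt * n)
    rw [← hn, inv_inv] at key
    rw [hY, X, ψ, C_smul, smul_mul_smul_comm, smul_mul_smul_comm, key, mul_comm (p⁻¹ - p)]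
  · intro s n m
    cases s
    · have h := 𝓜.cur_cur hp hq hr (-n) (-m)
      simp only [X, Sgn.toInt, zpow_one, smul_mul_smul_comm, neg_add, ← sub_eq_add_neg]
      linear_combination (norm := module) (((1 - p) * (q - q⁻¹)⁻¹) ^ 2) • h
    · have h := 𝓜.curE_curE hp hq hr (-n) (-m)
      simp only [X, Sgn.toInt, zpow_neg, zpow_one, smul_mul_smul_comm, neg_add, ← sub_eq_add_neg]
      have h' := congrArg (fun x => q⁻¹ • x) h
      simp only [smul_add, smul_smul, inv_mul_cancel₀ hq, smul_zero, one_smul] at h'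
      linear_combination (norm := module) (((1 + p⁻¹) * (q - q⁻¹)⁻¹) ^ 2) • h'
  · intro n m
    have h := 𝓜.cur_curE hp hq (-m) (-n)
    have hc : q - q⁻¹ ≠ 0 := by
      intro h0
      refine hq1 ?_
      field_simp at h0
      linear_combination h0
    have e : ((1 - p) * (q - q⁻¹)⁻¹) * ((1 + p⁻¹) * (q - q⁻¹)⁻¹) * (q - q⁻¹) =
        (q - q⁻¹)⁻¹ * (p⁻¹ - p) := by
      have : (1 - p) * (1 + p⁻¹) = p⁻¹ - p := by
        field_simp
        ring
      rw [← this]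
      field_simp
    have e₁ : coefZ .pos (𝓜.ψ .pos) (n + m) = (p⁻¹ - p) • 𝓜.ratioZ .neg (-m + -n) := by
      rw [ψ, coefZ_smul, ratioZ, coefZ_eq_extZ, coefZ_eq_extZ, ratioS]
      congr 2
      simp [Sgn.toInt]
    have e₂ : coefZ .neg (𝓜.ψ .neg) (n + m) = (p⁻¹ - p) • 𝓜.ratioZ .pos (-m + -n) := by
      rw [ψ, coefZ_smul, ratioZ, coefZ_eq_extZ, coefZ_eq_extZ, ratioS]
      congr 2
      simp [Sgn.toInt]
    rw [e₁, e₂, mul_smul_comm, mul_smul_comm, ← smul_sub, smul_smul, ← e, X, X,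
      smul_mul_smul_comm, smul_mul_smul_comm, mul_comm ((1 + p⁻¹) * (q - q⁻¹)⁻¹), ← smul_add, h,
      smul_smul, zpow_smul_eq, zpow_smul_eq, show -m - -n = n - m by ring,
      show -n - -m = m - n by ring]

/-- The anticommutator of `e₁(z)` and `f₁(q² z)`. -/
lemma e_f_shift (hp : p ^ 2 = q) (hq : q ≠ 0) (hr : ∀ n : ℕ, 0 < n → q ^ n ≠ 1) (s : Sgn) :
    (𝓜.G s).e * zScale s (cu (pow_ne_zero 2 hq)) (𝓜.G s).f +
      zScale s (cu (pow_ne_zero 2 hq)) (𝓜.G s).f * (𝓜.G s).e =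
    -q⁻¹ • ((𝓜.G s).K * (𝓜.G s).ki -
      zScale s (cu (pow_ne_zero 2 hq)) ((𝓜.G s).K * (𝓜.G s).ki)) := by
  have hl : (q ^ 2)⁻¹ ≠ 0 := inv_ne_zero (pow_ne_zero 2 hq)
  have h := 𝓜.rll_poly hq hp s hl
  simp only [cond_false] at h
  have hk := 𝓜.commute_k hq hp s (cu hl) 1
  rw [zScale_one] at hk
  have h₁ := h.e_f_raw (𝓜.rep_scale s (cu hl)) (𝓜.rep s) rfl hk
  have hq1 : q + 1 ≠ 0 := fun h0 => hr 2 two_pos (by linear_combination (q - 1) * h0)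
  have hq2 : q ^ 2 - 1 ≠ 0 := sub_ne_zero.mpr (hr 2 two_pos)
  have ha : (RCoeffs.poly q p (q ^ 2)⁻¹ 1 (q ^ 2)⁻¹ 1).a = -(q ^ 2 - 1) * (q + 1) * (q ^ 2)⁻¹ := by
    simp only [RCoeffs.poly]
    field_simp
    ring
  have hf : (RCoeffs.poly q p (q ^ 2)⁻¹ 1 (q ^ 2)⁻¹ 1).f =
      -q⁻¹ * (RCoeffs.poly q p (q ^ 2)⁻¹ 1 (q ^ 2)⁻¹ 1).a := by
    rw [ha]
    simp only [RCoeffs.poly]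
    field_simp
    ring
  have ha0 : (RCoeffs.poly q p (q ^ 2)⁻¹ 1 (q ^ 2)⁻¹ 1).a ≠ 0 := by
    rw [ha]
    exact mul_ne_zero (mul_ne_zero (neg_ne_zero.mpr hq2) hq1) hl
  rw [hf] at h₁
  generalize (RCoeffs.poly q p (q ^ 2)⁻¹ 1 (q ^ 2)⁻¹ 1).a = α at ha0 h₁
  simp only [GaussData.map] at h₁
  have h₂ : zScale s (cu hl) (𝓜.G s).e * (𝓜.G s).f + (𝓜.G s).f * zScale s (cu hl) (𝓜.G s).e =
      -q⁻¹ • (zScale s (cu hl) ((𝓜.G s).K * (𝓜.G s).ki) - (𝓜.G s).K * (𝓜.G s).ki) := by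
    refine smul_right_injective _ (mul_ne_zero ha0 ha0) ?_
    simp only
    rw [h₁, 𝓜.ki_K hq hp, map_mul]
    module
  have hcu : (cu (pow_ne_zero 2 hq) * cu hl : (Zc A)ˣ) = 1 := by
    rw [cu_mul, Units.ext_iff]
    simp [cu, hq]
  have h₃ := congrArg (zScale s (cu (pow_ne_zero 2 hq))) h₂
  rw [map_add, map_mul, map_mul, zScale_smul, map_sub, zScale_zScale, zScale_zScale, hcu,
    zScale_one, zScale_one] at h₃
  exact h₃

/-- The third diagonal Gauss coordinate in terms of the first two. -/
lemma K₃_eq (hp : p ^ 2 = q) (hq : q ≠ 0) (hr : ∀ n : ℕ, 0 < n → q ^ n ≠ 1) (s : Sgn) :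
    (𝓜.G s).K₃ = (𝓜.G s).K *
      zScale s (cu (neg_ne_zero.mpr hq)) ((𝓜.G s).K * (𝓜.G s).ki) := by
  have hl : -q⁻¹ ≠ 0 := neg_ne_zero.mpr (inv_ne_zero hq)
  have h := 𝓜.rll_poly hq hp s hl
  simp only [cond_false] at h
  have hG := 𝓜.rep_scale s (cu hl)
  have hq1 : q + 1 ≠ 0 := fun h0 => hr 2 two_pos (by linear_combination (q - 1) * h0)
  have hq2 : q ^ 2 - 1 ≠ 0 := sub_ne_zero.mpr (hr 2 two_pos)
  have hz : -q⁻¹ * q + 1 = 0 := by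
    rw [neg_mul, inv_mul_cancel₀ hq]
    ring
  have h₁ := h.K₃_eq hG (𝓜.rep s) (by simp only [RCoeffs.poly, hz, mul_zero])
    (by simp only [RCoeffs.poly, hz, mul_zero]) (by simp only [RCoeffs.poly, hz, mul_zero])
    (by simp only [RCoeffs.poly, hz, mul_zero]) (κ := p * q⁻¹)
    (by
      simp only [RCoeffs.poly]
      field_simp
      ring)
    (by
      simp only [RCoeffs.poly, ← hp]
      have := p_ne_zero hp hq
      field_simp
      ring)
    (by
      simp only [RCoeffs.poly]
      field_simp
      ring)
    (by
      refine .mk0 _ ?_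
      have : (RCoeffs.poly q p (-q⁻¹) 1 (-q⁻¹) 1).e = (q ^ 2 - 1) * (q + 1) * q⁻¹ := by
        simp only [RCoeffs.poly, hz]
        ring
      rw [this]
      exact mul_ne_zero (mul_ne_zero hq2 hq1) (inv_ne_zero hq))
  have h₂ := congrArg (fun x => x * zScale s (cu hl) (𝓜.G s).ki) h₁
  simp only [GaussData.map, mul_assoc] at h₂
  rw [← map_mul _ (𝓜.G s).k (𝓜.G s).ki, (𝓜.rep s).k_ki, map_one, mul_one] at h₂
  simp only [← map_mul, ← map_add] at h₂
  rw [h₂]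
  congr 1
  have h₃ := 𝓜.k_f_ki hp hq hr s
  simp only [cond_false] at h₃
  have hcu : cu (neg_ne_zero.mpr hq) = (cu hl * cu (pow_ne_zero 2 hq) : (Zc A)ˣ) := by
    rw [cu_mul, Units.ext_iff]
    simp only [cu, Units.coe_map, Units.val_mk0, MonoidHom.coe_coe, RingHom.toMonoidHom_eq_coe]
    congr 1
    field_simp
  rw [hcu, ← zScale_zScale]
  congr 1
  have k₁ := (𝓜.rep s).k_ki_assoc
  have e₁ : (𝓜.G s).k * ((𝓜.G s).f * ((𝓜.G s).ki * ((𝓜.G s).e * (𝓜.G s).k))) * (𝓜.G s).ki =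
      (𝓜.G s).k * (𝓜.G s).f * (𝓜.G s).ki * (𝓜.G s).e := by
    simp only [mul_assoc, (𝓜.rep s).k_ki, mul_one]
  have e₂ : (𝓜.G s).e * ((𝓜.G s).k * (𝓜.G s).f) * (𝓜.G s).ki =
      (𝓜.G s).e * ((𝓜.G s).k * (𝓜.G s).f * (𝓜.G s).ki) := by
    simp only [mul_assoc]
  rw [add_mul, add_mul, e₁, e₂, h₃]
  have h₄ := congrArg (fun x => q • x) (𝓜.e_f_shift hp hq hr s)
  simp only [smul_add, smul_smul, mul_neg, mul_inv_cancel₀ hq] at h₄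
  rw [mul_smul_comm, smul_mul_assoc, add_assoc, h₄]
  module

/-- The ratio `k₃ k₂⁻¹` is a rescaling of the ratio `k₂ k₁⁻¹`. -/
theorem K₃_Ki (hp : p ^ 2 = q) (hq : q ≠ 0) (hr : ∀ n : ℕ, 0 < n → q ^ n ≠ 1) (s : Sgn) :
    (𝓜.G s).K₃ * (𝓜.G s).Ki =
      zScale s (cu (neg_ne_zero.mpr hq)) ((𝓜.G s).K * (𝓜.G s).ki) := by
  have hc := p_sub_ne_zero hp hq (hr 2 two_pos)
  -- `K ki` is a multiple of a current `ψ`, the coefficients of which commute with each other.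
  have h₁ : ∀ i j, Commute (PowerSeries.coeff i ((𝓜.G s).K * (𝓜.G s).ki))
      (PowerSeries.coeff j ((𝓜.G s).K * (𝓜.G s).ki)) := by
    intro i j
    have := ((𝓜.currents hp hq hr).conjData hq (hr 2 two_pos) s.opp).commute_coeff i j
    rw [ψ, ratioS, Sgn.opp_opp, PowerSeries.coeff_smul, PowerSeries.coeff_smul, commute_iff_eq,
      smul_mul_smul_comm, smul_mul_smul_comm] at this
    exact smul_right_injective A (mul_ne_zero hc hc) this
  have h₂ : ∀ τ τ', Commute (zScale s τ ((𝓜.G s).K * (𝓜.G s).ki))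
      (zScale s τ' ((𝓜.G s).K * (𝓜.G s).ki)) := fun τ τ' => by
    refine commute_of_coefZ (s := s) fun m n => ?_
    have : Commute (coefZ s ((𝓜.G s).K * (𝓜.G s).ki) m) (coefZ s ((𝓜.G s).K * (𝓜.G s).ki) n) := by
      rw [coefZ_eq_extZ, coefZ_eq_extZ]
      unfold extZ
      split_ifs
      · exact h₁ _ _
      all_goals simp
    rw [coefZ_zScale, coefZ_zScale, commute_iff_eq, smul_mul_smul_comm, smul_mul_smul_comm,
      this.eq, mul_comm ((τ ^ m : (Zc A)ˣ) : Zc A)]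
  have h₃ : Commute (𝓜.G s).k (zScale s (cu (neg_ne_zero.mpr hq)) ((𝓜.G s).K * (𝓜.G s).ki)) := by
    have e₁ := 𝓜.commute_k hq hp s 1 (cu (neg_ne_zero.mpr hq))
    have e₂ := 𝓜.commute_k_K hq hp s 1 (cu (neg_ne_zero.mpr hq))
    rw [zScale_one] at e₁ e₂
    rw [map_mul]
    exact e₂.mul_right (((𝓜.rep_scale s _).commute_ki e₁.symm).symm)
  have h₄ : Commute (𝓜.G s).K (zScale s (cu (neg_ne_zero.mpr hq)) ((𝓜.G s).K * (𝓜.G s).ki)) := by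
    have e := (h₂ 1 (cu (neg_ne_zero.mpr hq)))
    rw [zScale_one] at e
    have := e.mul_left h₃
    rwa [mul_assoc, (𝓜.rep s).ki_k, mul_one] at this
  rw [𝓜.K₃_eq hp hq hr, h₄.eq, mul_assoc, (𝓜.rep s).K_Ki, mul_one]

end LModel

end

end

/-! ### Existence and uniqueness of the Gauss decomposition -/

noncomputable section

section

variable {A : Type*} [Ring A]

lemma isGauss_iff (M : Matrix (Fin 3) (Fin 3) (PowerSeries A)) (G : GaussCoord A) :
    IsGauss M G ↔
      (M 0 0 = G.k 0 ∧ M 0 1 = G.k 0 * G.f₁ ∧ M 0 2 = G.k 0 * G.f₁₃) ∧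
      (M 1 0 = G.e₁ * G.k 0 ∧ M 1 1 = G.e₁ * G.k 0 * G.f₁ + G.k 1 ∧
        M 1 2 = G.e₁ * G.k 0 * G.f₁₃ + G.k 1 * G.f₂) ∧
      (M 2 0 = G.e₃₁ * G.k 0 ∧ M 2 1 = G.e₃₁ * G.k 0 * G.f₁ + G.e₂ * G.k 1 ∧
        M 2 2 = G.e₃₁ * G.k 0 * G.f₁₃ + G.e₂ * G.k 1 * G.f₂ + G.k 2) := by
  rw [IsGauss, ← Matrix.ext_iff]
  simp [Fin.forall_fin_succ, Matrix.mul_apply, Fin.sum_univ_three, Matrix.vecMul_diagonal]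

lemma IsGauss.unique {M : Matrix (Fin 3) (Fin 3) (PowerSeries A)} {G G' : GaussCoord A}
    (h : IsGauss M G) (h' : IsGauss M G') : G' = G := by
  rw [isGauss_iff] at h h'
  obtain ⟨⟨h00, h01, h02⟩, ⟨h10, h11, h12⟩, ⟨h20, h21, h22⟩⟩ := h
  obtain ⟨⟨g00, g01, g02⟩, ⟨g10, g11, g12⟩, ⟨g20, g21, g22⟩⟩ := h'
  have k0 : G'.k 0 = G.k 0 := Units.ext (g00.symm.trans h00)
  rw [k0] at g01 g02 g10 g11 g12 g20 g21 g22
  have f₁ : G'.f₁ = G.f₁ := (Units.mul_right_inj _).mp (g01.symm.trans h01)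
  have f₁₃ : G'.f₁₃ = G.f₁₃ := (Units.mul_right_inj _).mp (g02.symm.trans h02)
  have e₁ : G'.e₁ = G.e₁ := (Units.mul_left_inj _).mp (g10.symm.trans h10)
  have e₃₁ : G'.e₃₁ = G.e₃₁ := (Units.mul_left_inj _).mp (g20.symm.trans h20)
  rw [e₁, f₁] at g11
  rw [e₁, f₁₃] at g12
  rw [e₃₁, f₁] at g21
  rw [e₃₁, f₁₃] at g22
  have k1 : G'.k 1 = G.k 1 := Units.ext (add_left_cancel (g11.symm.trans h11))
  rw [k1] at g12 g21 g22
  have f₂ : G'.f₂ = G.f₂ := (Units.mul_right_inj _).mp (add_left_cancel (g12.symm.trans h12))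
  have e₂ : G'.e₂ = G.e₂ := (Units.mul_left_inj _).mp (add_left_cancel (g21.symm.trans h21))
  rw [f₂, e₂] at g22
  have k2 : G'.k 2 = G.k 2 := Units.ext (add_left_cancel (g22.symm.trans h22))
  ext1 <;> try assumption
  funext i
  fin_cases i <;> assumption

lemma exists_unit_of_constantCoeff (a : PowerSeries A) {u v : A} (huv : u * v = 1) (hvu : v * u = 1)
    (h : PowerSeries.constantCoeff a = u) : ∃ k : (PowerSeries A)ˣ, (k : PowerSeries A) = a ∧
      PowerSeries.constantCoeff ((k⁻¹ : (PowerSeries A)ˣ) : PowerSeries A) = v := by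
  let w : Aˣ := ⟨u, v, huv, hvu⟩
  let k : (PowerSeries A)ˣ := ⟨a, PowerSeries.invOfUnit a w, PowerSeries.mul_invOfUnit a w h,
    PowerSeries.invOfUnit_mul a w h⟩
  refine ⟨k, rfl, ?_⟩
  have h' : PowerSeries.constantCoeff ((k⁻¹ : (PowerSeries A)ˣ) : PowerSeries A) * u = 1 := by
    rw [← h, show a = (k : PowerSeries A) from rfl, ← map_mul, Units.inv_mul, map_one]
  exact left_inv_eq_right_inv h' huv

/-- The Gauss decomposition exists as soon as the leading principal quasi-minors of the zero mode
are invertible, because these are the zero modes of the diagonal factors. -/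
lemma RSData.exists_isGauss (D : RSData A) (s : Sgn) (h₁ : ∀ i, D.t s i * D.minor s i = 1)
    (h₂ : ∀ i, D.minor s i * D.t s i = 1) : ∃ G, IsGauss (D.L s) G := by
  set M := D.L s with hM
  have cM : ∀ i j, PowerSeries.constantCoeff (M i j) = D.L0 s i j := fun i j =>
    (PowerSeries.coeff_zero_eq_constantCoeff_apply _).symm
  obtain ⟨k₀, e₀, c₀⟩ := exists_unit_of_constantCoeff (M 0 0) (h₂ 0) (h₁ 0) (cM 0 0)
  generalize hi₀ : ((k₀⁻¹ : (PowerSeries A)ˣ) : PowerSeries A) = i₀ at c₀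
  obtain ⟨k₁, e₁, c₁⟩ := exists_unit_of_constantCoeff (M 1 1 - M 1 0 * i₀ * M 0 1)
    (h₂ 1) (h₁ 1) (by simp only [map_sub, map_mul, c₀, cM]; rfl)
  generalize hi₁ : ((k₁⁻¹ : (PowerSeries A)ˣ) : PowerSeries A) = i₁ at c₁
  obtain ⟨k₂, e₂, -⟩ := exists_unit_of_constantCoeff (M 2 2 - M 2 0 * i₀ * M 0 2 -
    (M 2 1 - M 2 0 * i₀ * M 0 1) * i₁ * (M 1 2 - M 1 0 * i₀ * M 0 2))
    (h₂ 2) (h₁ 2) (by simp only [map_sub, map_mul, c₀, c₁, cM]; rfl)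
  have a₀ : ∀ x, x * i₀ * k₀ = x := fun x => hi₀ ▸ Units.inv_mul_cancel_right x k₀
  have b₀ : ∀ x, k₀ * (i₀ * x) = x := fun x => hi₀ ▸ Units.mul_inv_cancel_left k₀ x
  have a₁ : ∀ x, x * i₁ * k₁ = x := fun x => hi₁ ▸ Units.inv_mul_cancel_right x k₁
  have b₁ : ∀ x, k₁ * (i₁ * x) = x := fun x => hi₁ ▸ Units.mul_inv_cancel_left k₁ x
  refine ⟨⟨M 1 0 * i₀, (M 2 1 - M 2 0 * i₀ * M 0 1) * i₁, M 2 0 * i₀, i₀ * M 0 1,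
    i₁ * (M 1 2 - M 1 0 * i₀ * M 0 2), i₀ * M 0 2, ![k₀, k₁, k₂]⟩, ?_⟩
  rw [isGauss_iff]
  simp only [Matrix.cons_val_zero, Matrix.cons_val_one, Matrix.cons_val, a₀, b₀, a₁, b₁, e₂]
  refine ⟨⟨e₀.symm, trivial, trivial⟩, ⟨trivial, ?_, ?_⟩, ⟨trivial, ?_, ?_⟩⟩
  · rw [e₁, mul_assoc, add_sub_cancel]
  · rw [mul_assoc, add_sub_cancel]
  · rw [mul_assoc, add_sub_cancel]
  · noncomm_ring

/-- Gauss coordinates as a representation of the matrix `M`. -/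
def GaussCoord.toData (G : GaussCoord A) : GaussData (PowerSeries A) where
  k := G.k 0
  ki := ((G.k 0)⁻¹ : (PowerSeries A)ˣ)
  K := G.k 1
  Ki := ((G.k 1)⁻¹ : (PowerSeries A)ˣ)
  K₃ := G.k 2
  f := G.f₁
  h := G.f₁₃
  f₂ := G.f₂
  e := G.e₁
  e₃₁ := G.e₃₁
  e₂ := G.e₂

lemma IsGauss.rep {M : Matrix (Fin 3) (Fin 3) (PowerSeries A)} {G : GaussCoord A}
    (h : IsGauss M G) : G.toData.Rep M := by
  rw [isGauss_iff] at h
  obtain ⟨⟨h00, h01, h02⟩, ⟨h10, h11, h12⟩, ⟨h20, h21, h22⟩⟩ := h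
  exact ⟨Units.mul_inv _, Units.inv_mul _, Units.mul_inv _, Units.inv_mul _, h00, h01, h02, h10,
    h11.trans (add_comm _ _), h12.trans (add_comm _ _), h20, h21.trans (add_comm _ _), by
      rw [h22]; simp only [GaussCoord.toData]; abel⟩

end

end

/-! ### The super RS algebra -/

noncomputable section

universe u

section Map

variable {A B : Type*} [Ring A] [Algebra ℂ A] [Ring B] [Algebra ℂ B] (φ : A →ₐ[ℂ] B)

lemma ipow_map (a b : A) (k : ℤ) : φ (ipow a b k) = ipow (φ a) (φ b) k := by
  cases k <;> simp [ipow]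

lemma coefZ_map (s : Sgn) (a : PowerSeries A) (m : ℤ) :
    φ (coefZ s a m) = coefZ s (PowerSeries.map (φ : A →+* B) a) m := by
  rw [coefZ_eq_extZ, coefZ_eq_extZ, extZ, extZ]
  split_ifs <;> simp

/-- The image of a system of L-operators. -/
def RSData.map (D : RSData A) : RSData B where
  L s := (D.L s).map (PowerSeries.map (φ : A →+* B))
  t s i := φ (D.t s i)
  g := φ D.g
  gi := φ D.gi

lemma RSData.map_ofGen (γ : RSGen → A) : (ofGen γ).map φ = ofGen (φ ∘ γ) := by
  have : ∀ s, ((ofGen γ).L s).map (PowerSeries.map (φ : A →+* B)) = (ofGen (φ ∘ γ)).L s := by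
    intro s
    ext i j n
    rw [Matrix.map_apply]
    simp [ofGen]
  simp only [map, this]
  rfl

lemma tens₁_map (M : Matrix (Fin 3) (Fin 3) A) : (tens₁ M).map φ = tens₁ (M.map φ) := by
  ext u v
  by_cases h : u.2 = v.2 <;> simp [tens₁, h]

lemma tens₂_map (M : Matrix (Fin 3) (Fin 3) A) : (tens₂ M).map φ = tens₂ (M.map φ) := by
  ext u v
  by_cases h : u.1 = v.1 <;> simp [tens₂, h]

lemma matCoefZ_map (s : Sgn) (M : Matrix (Fin 3) (Fin 3) (PowerSeries A)) (m : ℤ) :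
    (matCoefZ s M m).map φ = matCoefZ s (M.map (PowerSeries.map (φ : A →+* B))) m := by
  ext i j
  exact coefZ_map φ s _ m

lemma Rcoef_map (q p : ℂ) (k : ℕ) : (Rcoef q p A k).map φ = Rcoef q p B k := by
  ext i j
  simp [Rcoef]

lemma matrix_map_mul {ι : Type*} [Fintype ι] (M N : Matrix ι ι A) :
    (M * N).map φ = M.map φ * N.map φ := Matrix.map_mul (f := (φ : A →+* B))

lemma matrix_map_sum_smul {ι : Type*} (S : Finset ℕ) (θ : A) (M : ℕ → Matrix ι ι A) (u v : ι) :
    φ ((∑ k ∈ S, θ ^ k • M k) u v) = (∑ k ∈ S, φ θ ^ k • (M k).map φ) u v := by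
  simp [Matrix.sum_apply]

lemma RLLleft_map (q p : ℂ) (θ : A) (s s' : Sgn) (M N : Matrix (Fin 3) (Fin 3) (PowerSeries A))
    (m n : ℤ) (u v : Fin 3 × Fin 3) : φ (RLLleft q p θ s s' M N m n u v) =
      RLLleft q p (φ θ) s s' (M.map (PowerSeries.map (φ : A →+* B)))
        (N.map (PowerSeries.map (φ : A →+* B))) m n u v := by
  simp only [RLLleft, matrix_map_sum_smul, matrix_map_mul, tens₁_map, tens₂_map, matCoefZ_map,
    Rcoef_map]

lemma RLLright_map (q p : ℂ) (θ : A) (s s' : Sgn) (M N : Matrix (Fin 3) (Fin 3) (PowerSeries A))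
    (m n : ℤ) (u v : Fin 3 × Fin 3) : φ (RLLright q p θ s s' M N m n u v) =
      RLLright q p (φ θ) s s' (M.map (PowerSeries.map (φ : A →+* B)))
        (N.map (PowerSeries.map (φ : A →+* B))) m n u v := by
  simp only [RLLright, matrix_map_sum_smul, matrix_map_mul, tens₁_map, tens₂_map, matCoefZ_map,
    Rcoef_map]

lemma RSData.minor_map (D : RSData A) (s : Sgn) (i : Fin 3) :
    φ (D.minor s i) = (D.map φ).minor s i := by
  fin_cases i <;> simp [RSData.minor, RSData.L0, RSData.map]

lemma RSRel.map {q p : ℂ} {D : RSData A} {x y : A} (h : RSRel q p D x y) :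
    RSRel q p (D.map φ) (φ x) (φ y) := by
  cases h with
  | g_gi => rw [map_mul, map_one]; exact .g_gi
  | gi_g => rw [map_mul, map_one]; exact .gi_g
  | g_L s i j n =>
    have := RSRel.g_L (q := q) (p := p) (D := D.map φ) s i j n
    rw [map_mul, map_mul]
    simp only [RSData.map, Matrix.map_apply, PowerSeries.coeff_map] at this
    exact this
  | t_minor s i =>
    rw [map_mul, map_one, RSData.minor_map]
    exact .t_minor s i
  | minor_t s i =>
    rw [map_mul, map_one, RSData.minor_map]
    exact .minor_t s i
  | same s m n u v =>
    rw [RLLleft_map, RLLright_map, map_one]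
    exact .same s m n u v
  | mixed m n u v =>
    rw [RLLleft_map, RLLright_map, map_pow, map_pow]
    exact .mixed m n u v

lemma RSRel.exists_of_map {q p : ℂ} {D : RSData A} {x y : B} (h : RSRel q p (D.map φ) x y) :
    ∃ x' y', RSRel q p D x' y' ∧ φ x' = x ∧ φ y' = y := by
  cases h with
  | g_gi => exact ⟨_, _, .g_gi, map_mul _ _ _, map_one _⟩
  | gi_g => exact ⟨_, _, .gi_g, map_mul _ _ _, map_one _⟩
  | g_L s i j n =>
    refine ⟨_, _, .g_L s i j n, ?_, ?_⟩ <;>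
    · rw [map_mul]
      simp only [RSData.map, Matrix.map_apply, PowerSeries.coeff_map]
      rfl
  | t_minor s i =>
    exact ⟨_, _, .t_minor s i, by rw [map_mul, RSData.minor_map]; rfl, map_one _⟩
  | minor_t s i =>
    exact ⟨_, _, .minor_t s i, by rw [map_mul, RSData.minor_map]; rfl, map_one _⟩
  | same s m n u v =>
    exact ⟨_, _, .same s m n u v, by rw [RLLleft_map, map_one]; rfl,
      by rw [RLLright_map, map_one]; rfl⟩
  | mixed m n u v =>
    exact ⟨_, _, .mixed m n u v, by rw [RLLleft_map, map_pow]; rfl,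
      by rw [RLLright_map, map_pow]; rfl⟩

/-- The homomorphism from the super RS algebra given by a system of L-operators. -/
def rsLift {q p : ℂ} (γ : RSGen → A) (h : ∀ x y, RSRel q p (.ofGen γ) x y → x = y) :
    RSAlgebra q p →ₐ[ℂ] A :=
  RingQuot.liftAlgHom ℂ ⟨FreeAlgebra.lift ℂ γ, fun x y hxy => h _ _ (by
    have := hxy.map (FreeAlgebra.lift ℂ γ)
    rwa [RSData.map_ofGen, FreeAlgebra.ι_comp_lift] at this)⟩

lemma rsLift_gen {q p : ℂ} (γ : RSGen → A) (h : ∀ x y, RSRel q p (.ofGen γ) x y → x = y)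
    (x : RSGen) : rsLift γ h (rsGen q p x) = γ x := by
  rw [rsLift, rsGen, RingQuot.liftAlgHom_mkAlgHom_apply, FreeAlgebra.lift_ι_apply]

lemma rsAlgebra_hom_ext {q p : ℂ} {F F' : RSAlgebra q p →ₐ[ℂ] A}
    (h : ∀ x, F (rsGen q p x) = F' (rsGen q p x)) : F = F' := by
  refine RingQuot.ringQuot_ext' _ _ _ (FreeAlgebra.hom_ext ?_)
  funext x
  exact h x

end Map

lemma rsData_rel (q p : ℂ) (x y : RSAlgebra q p) (h : RSRel q p (rsData q p) x y) : x = y := by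
  have h₁ : rsData q p = (RSData.ofGen (FreeAlgebra.ι ℂ)).map
      (RingQuot.mkAlgHom ℂ (RSRel q p (RSData.ofGen (FreeAlgebra.ι ℂ)))) := by
    rw [RSData.map_ofGen]
    rfl
  rw [h₁] at h
  obtain ⟨x', y', h', rfl, rfl⟩ := h.exists_of_map
  exact RingQuot.mkAlgHom_rel ℂ h'

section Centre

variable {A : Type*} [Ring A] [Algebra ℂ A] {q p : ℂ}

lemma commute_of_mul_eq_one {A : Type*} [Ring A] {g m t : A} (hm : Commute g m)
    (h₁ : t * m = 1) (h₂ : m * t = 1) :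
    Commute g t := by
  let u : Aˣ := ⟨m, t, h₂, h₁⟩
  exact Commute.units_inv_right (u := u) hm

/-- `q^{c/2}` commutes with the inverses of the quasi-minors. -/
lemma RSData.commute_t {D : RSData A} (hD : ∀ x y, RSRel q p D x y → x = y) (s : Sgn) (i : Fin 3) :
    Commute D.g (D.t s i) := by
  have hL : ∀ i j, Commute D.g (D.L0 s i j) := fun i j => hD _ _ (.g_L s i j 0)
  have ht : ∀ i, Commute D.g (D.minor s i) → Commute D.g (D.t s i) := fun i hi =>
    commute_of_mul_eq_one hi (hD _ _ (.t_minor s i)) (hD _ _ (.minor_t s i))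
  have h0 : Commute D.g (D.t s 0) := ht 0 (hL 0 0)
  have hm : ∀ i j, Commute D.g (D.L0 s i j - D.L0 s i 0 * D.t s 0 * D.L0 s 0 j) := fun i j =>
    (hL i j).sub_right (((hL i 0).mul_right h0).mul_right (hL 0 j))
  have h1 : Commute D.g (D.t s 1) := ht 1 (hm 1 1)
  have h2 : Commute D.g (D.t s 2) :=
    ht 2 ((hm 2 2).sub_right (((hm 2 1).mul_right h1).mul_right (hm 1 2)))
  fin_cases i <;> assumption

lemma adjoin_range_rsGen (q p : ℂ) : Algebra.adjoin ℂ (Set.range (rsGen q p)) = ⊤ := by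
  have h := congrArg (Subalgebra.map (RingQuot.mkAlgHom ℂ (RSRel q p (.ofGen (FreeAlgebra.ι ℂ)))))
    (FreeAlgebra.adjoin_range_ι ℂ RSGen)
  rw [AlgHom.map_adjoin, ← Set.range_comp, Algebra.map_top,
    (AlgHom.range_eq_top _).mpr (RingQuot.mkAlgHom_surjective ℂ _)] at h
  exact h

lemma rs_g_commute (q p : ℂ) (x : RSAlgebra q p) : Commute (rsData q p).g x := by
  have hD := rsData_rel q p
  have : Algebra.adjoin ℂ (Set.range (rsGen q p)) ≤ Subalgebra.centralizer ℂ {(rsData q p).g} := by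
    rw [Algebra.adjoin_le_iff]
    rintro _ ⟨y, rfl⟩
    rw [SetLike.mem_coe, Subalgebra.mem_centralizer_iff]
    rintro _ rfl
    cases y with
    | L s i j n =>
      have := hD _ _ (.g_L s i j n)
      rwa [show PowerSeries.coeff n ((rsData q p).L s i j) = rsGen q p (.L s i j n) by
        simp [rsData, RSData.ofGen]] at this
    | t s i => exact RSData.commute_t hD s i
    | g => rfl
    | gi => exact (hD _ _ .g_gi).trans (hD _ _ .gi_g).symm
  rw [adjoin_range_rsGen] at this
  exact (Subalgebra.mem_centralizer_iff ℂ).mp (this Algebra.mem_top) _ rfl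

end Centre

section Model

variable {A : Type u} [Ring A] [Algebra ℂ A] {q p : ℂ}

lemma exch_of_RLL (θ θ' : Zc A) (s s' : Sgn) (M N : Matrix (Fin 3) (Fin 3) (PowerSeries A))
    (h : ∀ m n u v, RLLleft q p (θ : A) s s' M N m n u v = RLLright q p (θ' : A) s s' M N m n u v) :
    Exch (RmatT false q p) θ θ' s s' M N := by
  intro m n
  ext u v
  have := h m n u v
  simp only [RLLleft, RLLright, Matrix.sum_apply, Matrix.smul_apply, smul_eq_mul,
    Matrix.mul_assoc, Rcoef] at this
  simp only [RmatT, Bool.false_eq_true, if_false, Matrix.sum_apply, Matrix.smul_apply,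
    center_smul_def, map_pow, Matrix.mul_assoc]
  exact this

/-- L-operators with central `q^{c/2}` and a Gauss decomposition. -/
def RSData.model (D : RSData A) (hD : ∀ x y, RSRel q p D x y → x = y) (hg : ∀ x, Commute D.g x)
    (G : Sgn → GaussCoord A) (hG : ∀ s, IsGauss (D.L s) (G s)) : LModel false q p A where
  γ := ⟨Zc.mk D.g hg, Zc.mk D.gi fun x => (commute_of_mul_eq_one (hg x).symm
      (hD _ _ .gi_g) (hD _ _ .g_gi)).symm,
    Zc.ext (hD _ _ .g_gi), Zc.ext (hD _ _ .gi_g)⟩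
  L := D.L
  G s := (G s).toData
  rep s := (hG s).rep
  same s := exch_of_RLL _ _ _ _ _ _ fun m n u v => by
    simpa using hD _ _ (.same s m n u v)
  mixed := exch_of_RLL _ _ _ _ _ _ fun m n u v => by
    simp only [Units.val_pow_eq_pow_val, map_pow]
    exact hD _ _ (.mixed m n u v)

end Model

end

/-! ### The parity automorphism -/

noncomputable section

section Parity

/-- The sign `(-1)^{[i] + [j]}` of a matrix unit. -/
def parSign (i j : Fin 3) : ℤ := (-1) ^ (par i + par j)

lemma parSign_mul (i j k : Fin 3) : parSign i j * parSign j k = parSign i k := by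
  rw [parSign, parSign, parSign, pow_add, pow_add, pow_add]
  have : ((-1 : ℤ) ^ (par j)) * (-1) ^ (par j) = 1 := by
    rw [← pow_add, ← two_mul, pow_mul, neg_one_sq, one_pow]
  linear_combination (-1) ^ par i * (-1) ^ par k * this

lemma parSign_sq (i j : Fin 3) : parSign i j * parSign i j = 1 := by
  rw [parSign, ← pow_add, ← two_mul, pow_mul, neg_one_sq, one_pow]

lemma parSign_self (i : Fin 3) : parSign i i = 1 := by
  rw [parSign, ← two_mul, pow_mul, neg_one_sq, one_pow]

variable {A : Type*} [Ring A] [Algebra ℂ A]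

/-- Conjugation by the parity operator of `V ⊗ V`. -/
def parConj {A : Type*} [Ring A] (X : Matrix (Fin 3 × Fin 3) (Fin 3 × Fin 3) A) :
    Matrix (Fin 3 × Fin 3) (Fin 3 × Fin 3) A :=
  fun u v => (parSign u.1 v.1 * parSign u.2 v.2) • X u v

/-- Conjugation by the parity operator of `V`. -/
def parTwist {A : Type*} [Ring A] (M : Matrix (Fin 3) (Fin 3) A) : Matrix (Fin 3) (Fin 3) A :=
  fun i j => parSign i j • M i j

lemma parConj_mul {A : Type*} [Ring A] (X Y : Matrix (Fin 3 × Fin 3) (Fin 3 × Fin 3) A) :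
    parConj (X * Y) = parConj X * parConj Y := by
  ext u v
  simp only [parConj, Matrix.mul_apply]
  rw [Finset.smul_sum]
  refine Finset.sum_congr rfl fun x _ => ?_
  rw [smul_mul_assoc, mul_smul_comm, _root_.smul_smul]
  congr 1
  rw [← parSign_mul u.1 x.1 v.1, ← parSign_mul u.2 x.2 v.2]
  ring

lemma parConj_tens₁ {A : Type*} [Ring A] (M : Matrix (Fin 3) (Fin 3) A) :
    parConj (tens₁ M) = tens₁ (parTwist M) := by
  ext ⟨i, k⟩ ⟨j, l⟩
  by_cases h : k = l
  · subst h
    simp [parConj, tens₁, parTwist, parSign_self]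
  · simp [parConj, tens₁, h]

lemma parConj_tens₂ {A : Type*} [Ring A] (M : Matrix (Fin 3) (Fin 3) A) :
    parConj (tens₂ M) = tens₂ (parTwist M) := by
  ext ⟨i, k⟩ ⟨j, l⟩
  by_cases h : i = j
  · subst h
    simp [parConj, tens₂, parTwist, parSign_self, -zsmul_eq_mul]
  · simp [parConj, tens₂, h]

lemma RCoeffs.mat_even {S : Type*} [Ring S] (R : RCoeffs S) : parConj R.mat = R.mat := by
  ext ⟨i, k⟩ ⟨j, l⟩
  fin_cases i <;> fin_cases k <;> fin_cases j <;> fin_cases l <;>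
    simp [parConj, parSign, par, RCoeffs.mat, RCoeffs.mat₉, finProdFinEquiv]

lemma parConj_Rmat (q p : ℂ) : parConj (Rmat q p) = Rmat q p := by
  ext1 u v
  have h := congrFun₂ (RCoeffs.mat_even (Rnum q p)) u v
  rw [← Rmat_eq, parConj, Matrix.smul_apply, ← smul_comm (Rden q), smul_eq_mul, smul_eq_mul] at h
  refine mul_left_cancel₀ (fun h0 => ?_) h
  have := congrArg PowerSeries.constantCoeff h0
  simp [Rden] at this

lemma parConj_Rcoef (q p : ℂ) (k : ℕ) : parConj (Rcoef q p A k) = Rcoef q p A k := by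
  ext1 u v
  have h := congrArg (fun x => algebraMap ℂ A (PowerSeries.coeff k x))
    (congrFun₂ (parConj_Rmat q p) u v)
  simp only [parConj, Rcoef, Matrix.map_apply, map_zsmul] at h ⊢
  exact h

lemma matCoefZ_parTwist {A : Type*} [Ring A] (s : Sgn) (M : Matrix (Fin 3) (Fin 3) (PowerSeries A))
    (m : ℤ) :
    matCoefZ s (parTwist M) m = parTwist (matCoefZ s M m) := by
  ext i j
  simp only [matCoefZ, parTwist, Matrix.map_apply]
  rw [coefZ_eq_extZ, coefZ_eq_extZ, extZ, extZ]
  split_ifs <;> simp [-zsmul_eq_mul]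

lemma parConj_sum_smul {A : Type*} [Ring A] (S : Finset ℕ) (θ : A)
    (X : ℕ → Matrix (Fin 3 × Fin 3) (Fin 3 × Fin 3) A) :
    parConj (∑ k ∈ S, θ ^ k • X k) = ∑ k ∈ S, θ ^ k • parConj (X k) := by
  ext u v
  simp [parConj, Matrix.sum_apply, Finset.smul_sum, -zsmul_eq_mul]

lemma RLLleft_parTwist (q p : ℂ) (θ : A) (s s' : Sgn)
    (M N : Matrix (Fin 3) (Fin 3) (PowerSeries A)) (m n : ℤ) :
    RLLleft q p θ s s' (parTwist M) (parTwist N) m n = parConj (RLLleft q p θ s s' M N m n) := by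
  simp only [RLLleft, parConj_sum_smul, parConj_mul, parConj_tens₁, parConj_tens₂, parConj_Rcoef,
    matCoefZ_parTwist]

lemma RLLright_parTwist (q p : ℂ) (θ : A) (s s' : Sgn)
    (M N : Matrix (Fin 3) (Fin 3) (PowerSeries A)) (m n : ℤ) :
    RLLright q p θ s s' (parTwist M) (parTwist N) m n = parConj (RLLright q p θ s s' M N m n) := by
  simp only [RLLright, parConj_sum_smul, parConj_mul, parConj_tens₁, parConj_tens₂, parConj_Rcoef,
    matCoefZ_parTwist]

/-- The L-operators `(-1)^{[i]+[j]} L_{ij}`. -/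
def RSData.twist {A : Type*} [Ring A] (D : RSData A) : RSData A where
  L s := parTwist (D.L s)
  t := D.t
  g := D.g
  gi := D.gi

lemma RSData.twist_minor {A : Type*} [Ring A] (D : RSData A) (s : Sgn) (i : Fin 3) :
    D.twist.minor s i = D.minor s i := by
  fin_cases i <;> simp [minor, twist, L0, parTwist, parSign, par]
  noncomm_ring

lemma RSData.twist_rel {q p : ℂ} {D : RSData A} (hD : ∀ x y, RSRel q p D x y → x = y) (x y : A)
    (h : RSRel q p D.twist x y) : x = y := by
  cases h with
  | g_gi => exact hD _ _ .g_gi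
  | gi_g => exact hD _ _ .gi_g
  | g_L s i j n =>
    simp only [RSData.twist, parTwist, map_zsmul, mul_smul_comm, smul_mul_assoc]
    rw [hD _ _ (.g_L s i j n)]
  | t_minor s i => rw [twist_minor]; exact hD _ _ (.t_minor s i)
  | minor_t s i => rw [twist_minor]; exact hD _ _ (.minor_t s i)
  | same s m n u v =>
    simp only [twist, RLLleft_parTwist, RLLright_parTwist]
    rw [parConj, parConj, hD _ _ (.same s m n u v)]
  | mixed m n u v =>
    simp only [twist, RLLleft_parTwist, RLLright_parTwist]
    rw [parConj, parConj, hD _ _ (.mixed m n u v)]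

/-- The images of the generators of the super RS algebra under its parity automorphism. -/
def rsTwistGen (q p : ℂ) : RSGen → RSAlgebra q p
  | .L s i j n => parSign i j • rsGen q p (.L s i j n)
  | x => rsGen q p x

lemma ofGen_rsTwistGen (q p : ℂ) : RSData.ofGen (rsTwistGen q p) = (rsData q p).twist := by
  have : (RSData.ofGen (rsTwistGen q p)).L = (rsData q p).twist.L := by
    funext s
    ext i j n
    simp [RSData.ofGen, rsData, RSData.twist, parTwist, rsTwistGen, -zsmul_eq_mul]
  exact congrArg (fun l => (⟨l, fun s i => rsGen q p (.t s i), rsGen q p .g, rsGen q p .gi⟩ :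
    RSData (RSAlgebra q p))) this

/-- The parity automorphism as a homomorphism. -/
def rsTwistHom (q p : ℂ) : RSAlgebra q p →ₐ[ℂ] RSAlgebra q p :=
  rsLift (rsTwistGen q p) (by
    rw [ofGen_rsTwistGen]
    exact RSData.twist_rel (rsData_rel q p))

lemma rsTwistHom_comp (q p : ℂ) : (rsTwistHom q p).comp (rsTwistHom q p) = AlgHom.id ℂ _ := by
  refine rsAlgebra_hom_ext fun x => ?_
  rw [AlgHom.comp_apply, rsTwistHom, rsLift_gen, AlgHom.id_apply]
  cases x with
  | L s i j n =>
    rw [rsTwistGen, map_zsmul, rsLift_gen, rsTwistGen, _root_.smul_smul, parSign_sq, one_smul]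
  | t | g | gi => exact rsLift_gen _ _ _

/-- The parity automorphism of the super RS algebra. -/
def rsTwist (q p : ℂ) : RSAlgebra q p ≃ₐ[ℂ] RSAlgebra q p :=
  AlgEquiv.ofAlgHom (rsTwistHom q p) (rsTwistHom q p) (rsTwistHom_comp q p) (rsTwistHom_comp q p)

lemma rsTwist_gen (q p : ℂ) (x : RSGen) : rsTwist q p (rsGen q p x) = rsTwistGen q p x :=
  rsLift_gen _ _ _

end Parity

section GaussMap

variable {A B : Type*} [Ring A] [Algebra ℂ A] [Ring B] [Algebra ℂ B] (φ : A →ₐ[ℂ] B)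

/-- The image of Gauss coordinates. -/
def GaussCoord.map (G : GaussCoord A) : GaussCoord B where
  e₁ := PowerSeries.map (φ : A →+* B) G.e₁
  e₂ := PowerSeries.map (φ : A →+* B) G.e₂
  e₃₁ := PowerSeries.map (φ : A →+* B) G.e₃₁
  f₁ := PowerSeries.map (φ : A →+* B) G.f₁
  f₂ := PowerSeries.map (φ : A →+* B) G.f₂
  f₁₃ := PowerSeries.map (φ : A →+* B) G.f₁₃
  k i := Units.map (PowerSeries.map (φ : A →+* B)).toMonoidHom (G.k i)

/-- Gauss coordinates with the signs of the odd ones changed. -/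
def GaussCoord.twist {A : Type*} [Ring A] (G : GaussCoord A) : GaussCoord A where
  e₁ := -G.e₁
  e₂ := -G.e₂
  e₃₁ := G.e₃₁
  f₁ := -G.f₁
  f₂ := -G.f₂
  f₁₃ := G.f₁₃
  k := G.k

lemma IsGauss.map {M : Matrix (Fin 3) (Fin 3) (PowerSeries A)} {G : GaussCoord A}
    (h : IsGauss M G) : IsGauss (M.map (PowerSeries.map (φ : A →+* B))) (G.map φ) := by
  rw [isGauss_iff] at h ⊢
  simp only [Matrix.map_apply, h, map_mul, map_add, GaussCoord.map]
  simp

lemma IsGauss.twist {A : Type*} [Ring A] {M : Matrix (Fin 3) (Fin 3) (PowerSeries A)}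
    {G : GaussCoord A} (h : IsGauss M G) : IsGauss (parTwist M) G.twist := by
  rw [isGauss_iff] at h ⊢
  simp only [parTwist, h, GaussCoord.twist, parSign, par]
  simp

lemma gaussX_map (q : ℂ) (g gi : A) (G : Sgn → GaussCoord A) (s : Sgn) (n : ℤ) :
    φ (gaussX q g gi G s n) = gaussX q (φ g) (φ gi) (fun s => (G s).map φ) s n := by
  cases s <;>
    simp [gaussX, X₁, X₂, halfCurrent, ipow_map, coefZ_map, GaussCoord.map]

lemma gaussψ_map (q p : ℂ) (G : Sgn → GaussCoord A) (s : Sgn) (n : ℕ) :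
    φ (gaussψ q p G s n) = gaussψ q p (fun s => (G s).map φ) s n := by
  have h : ∀ s i, PowerSeries.map (φ : A →+* B) (ratio (G s) i) = ratio ((G s).map φ) i := by
    intro s i
    fin_cases i <;> simp [ratio, GaussCoord.map]
  cases s <;> simp [gaussψ, ← h]

lemma coefZ_neg {A : Type*} [Ring A] (s : Sgn) (a : PowerSeries A) (m : ℤ) :
    coefZ s (-a) m = -coefZ s a m := by
  rw [coefZ_eq_extZ, coefZ_eq_extZ, extZ, extZ]
  split_ifs <;> simp

lemma gaussX_twist (q : ℂ) (g gi : A) (G : Sgn → GaussCoord A) (s : Sgn) (n : ℤ) :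
    gaussX q g gi (fun s => (G s).twist) s n = -gaussX q g gi G s n := by
  cases s <;> simp only [gaussX, X₁, X₂, halfCurrent, GaussCoord.twist, coefZ_neg] <;>
    rw [← smul_neg] <;> congr 1 <;> simp only [mul_neg] <;> module

lemma gaussψ_twist (q p : ℂ) (G : Sgn → GaussCoord A) (s : Sgn) (n : ℕ) :
    gaussψ q p (fun s => (G s).twist) s n = gaussψ q p G s n := rfl

variable {q p : ℂ} {G : Sgn → GaussCoord (RSAlgebra q p)}

lemma map_rsTwist (hG : ∀ s, IsGauss ((rsData q p).L s) (G s)) (s : Sgn) :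
    (G s).map (rsTwist q p : RSAlgebra q p →ₐ[ℂ] RSAlgebra q p) = (G s).twist := by
  refine (hG s).twist.unique ?_
  have := (hG s).map (rsTwist q p : RSAlgebra q p →ₐ[ℂ] RSAlgebra q p)
  convert this using 1
  ext i j n
  rw [Matrix.map_apply]
  simp [rsData, RSData.ofGen, parTwist, rsTwist_gen, rsTwistGen, -zsmul_eq_mul]

lemma rsTwist_gaussX (hG : ∀ s, IsGauss ((rsData q p).L s) (G s)) (s : Sgn) (n : ℤ) :
    rsTwist q p (gaussX q (rsData q p).g (rsData q p).gi G s n) =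
      -gaussX q (rsData q p).g (rsData q p).gi G s n := by
  refine (gaussX_map (rsTwist q p : RSAlgebra q p →ₐ[ℂ] RSAlgebra q p) q _ _ G s n).trans ?_
  simp only [map_rsTwist hG, gaussX_twist]
  congr 2
  · exact rsTwist_gen q p .g
  · exact rsTwist_gen q p .gi

lemma rsTwist_gaussψ (hG : ∀ s, IsGauss ((rsData q p).L s) (G s)) (s : Sgn) (n : ℕ) :
    rsTwist q p (gaussψ q p G s n) = gaussψ q p G s n := by
  refine (gaussψ_map (rsTwist q p : RSAlgebra q p →ₐ[ℂ] RSAlgebra q p) q p G s n).trans ?_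
  simp only [map_rsTwist hG, gaussψ_twist]

end GaussMap

end

/-! ### The homomorphism from the current algebra -/

noncomputable section

universe u

section Map

variable {A B : Type*} [Ring A] [Algebra ℂ A] [Ring B] [Algebra ℂ B] (φ : A →ₐ[ℂ] B)

/-- The image of currents. -/
def CurrentData.map (D : CurrentData A) : CurrentData B where
  g := φ D.g
  gi := φ D.gi
  X s n := φ (D.X s n)
  ψ s := PowerSeries.map (φ : A →+* B) (D.ψ s)
  ψi s := PowerSeries.map (φ : A →+* B) (D.ψi s)

lemma CurrentData.map_ofGen (γ : CurrentGen → A) : (ofGen γ).map φ = ofGen (φ ∘ γ) := by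
  have h₁ : ∀ s, PowerSeries.map (φ : A →+* B) ((ofGen γ).ψ s) = (ofGen (φ ∘ γ)).ψ s := by
    intro s
    ext n
    simp [ofGen]
  have h₂ : ∀ s, PowerSeries.map (φ : A →+* B) ((ofGen γ).ψi s) = (ofGen (φ ∘ γ)).ψi s := by
    intro s
    ext n
    simp [ofGen]
  simp only [map, h₁, h₂]
  rfl

lemma map_coeff (a : PowerSeries A) (n : ℕ) :
    φ (PowerSeries.coeff n a) = PowerSeries.coeff n (PowerSeries.map (φ : A →+* B) a) := by
  simp

lemma map_C_of_algHom (a : A) :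
    PowerSeries.map (φ : A →+* B) (PowerSeries.C a) = PowerSeries.C (φ a) := by
  simp

lemma ψcoef_map (q : ℂ) (g gi : A) (k : ℕ) : φ (ψcoef q g gi k) = ψcoef q (φ g) (φ gi) k := by
  simp [ψcoef]

lemma CurrentRel.map_eq {q : ℂ} {D : CurrentData A}
    (hD : ∀ x y, CurrentRel q (D.map φ) x y → x = y) {x y : A} (h : CurrentRel q D x y) :
    φ x = φ y := by
  cases h with
  | g_gi => rw [map_mul, map_one]; exact hD _ _ .g_gi
  | gi_g => rw [map_mul, map_one]; exact hD _ _ .gi_g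
  | g_X s n => rw [map_mul, map_mul]; exact hD _ _ (.g_X s n)
  | g_ψ s n =>
    simp only [map_mul, map_coeff]
    exact hD _ _ (.g_ψ s n)
  | ψ_ψi s n =>
    rw [map_coeff, map_coeff, map_mul, map_one]
    exact hD _ _ (.ψ_ψi s n)
  | ψi_ψ s n =>
    rw [map_coeff, map_coeff, map_mul, map_one]
    exact hD _ _ (.ψi_ψ s n)
  | ψ_same s m n =>
    simp only [map_mul, map_coeff]
    exact hD _ _ (.ψ_same s m n)
  | ψ_mixed m n =>
    simp only [map_mul, map_sum, ψcoef_map, map_coeff]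
    exact hD _ _ (.ψ_mixed m n)
  | ψ_Xpos s k n =>
    simp only [map_mul, map_smul, map_pow, map_coeff, map_C_of_algHom]
    exact hD _ _ (.ψ_Xpos s k n)
  | ψ_Xneg s k n =>
    simp only [map_mul, map_smul, map_pow, map_coeff, map_C_of_algHom]
    exact hD _ _ (.ψ_Xneg s k n)
  | X_same s n m =>
    simp only [map_mul, map_smul, map_add, map_zero]
    exact hD _ _ (.X_same s n m)
  | X_mixed n m =>
    simp only [map_mul, map_smul, map_add, map_sub, ipow_map, CurrentData.ψZ, coefZ_map]
    exact hD _ _ (.X_mixed n m)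

/-- The homomorphism from the current algebra given by currents that satisfy its relations. -/
def curLift {q : ℂ} (γ : CurrentGen → A) (h : ∀ x y, CurrentRel q (.ofGen γ) x y → x = y) :
    CurrentAlgebra q →ₐ[ℂ] A :=
  RingQuot.liftAlgHom ℂ ⟨FreeAlgebra.lift ℂ γ, fun x y hxy =>
    CurrentRel.map_eq (FreeAlgebra.lift ℂ γ) (by
      rw [CurrentData.map_ofGen, FreeAlgebra.ι_comp_lift]
      exact h) hxy⟩

lemma curLift_gen {q : ℂ} (γ : CurrentGen → A) (h : ∀ x y, CurrentRel q (.ofGen γ) x y → x = y)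
    (x : CurrentGen) : curLift γ h (curGen q x) = γ x := by
  rw [curLift, curGen, RingQuot.liftAlgHom_mkAlgHom_apply, FreeAlgebra.lift_ι_apply]

/-- A homomorphism from the current algebra is determined by its values on `q^{c/2}`, the `X^±_n`
and the coefficients of `ψ^±`; its values on the other generators are forced, these being inverses
of the former. -/
lemma currentAlgebra_hom_ext {q : ℂ} {F F' : CurrentAlgebra q →ₐ[ℂ] A}
    (hg : F (curGen q .g) = F' (curGen q .g))
    (hX : ∀ s n, F (curGen q (.X s n)) = F' (curGen q (.X s n)))
    (hψ : ∀ s n, F (curGen q (.ψ s n)) = F' (curGen q (.ψ s n))) : F = F' := by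
  let D := CurrentData.ofGen (FreeAlgebra.ι ℂ : CurrentGen → FreeAlgebra ℂ CurrentGen)
  let μ := RingQuot.mkAlgHom ℂ (CurrentRel q D)
  have hμ : ∀ (F : CurrentAlgebra q →ₐ[ℂ] A) {x y}, CurrentRel q D x y →
      F.comp μ x = F.comp μ y := fun F x y h => congrArg F (RingQuot.mkAlgHom_rel ℂ h)
  have hgi : F (curGen q .gi) = F' (curGen q .gi) := by
    have h₁ : F (curGen q .gi) * F (curGen q .g) = 1 :=
      (map_mul (F.comp μ) _ _).symm.trans ((hμ F .gi_g).trans (map_one _))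
    have h₂ : F' (curGen q .g) * F' (curGen q .gi) = 1 :=
      (map_mul (F'.comp μ) _ _).symm.trans ((hμ F' .g_gi).trans (map_one _))
    rw [hg] at h₁
    exact left_inv_eq_right_inv h₁ h₂
  have hcoe : ∀ (F : CurrentAlgebra q →ₐ[ℂ] A) s, PowerSeries.map (F.comp μ : _ →+* A) (D.ψ s) =
      PowerSeries.mk fun n => F (curGen q (.ψ s n)) := by
    intro F s
    ext n
    rw [← map_coeff, PowerSeries.coeff_mk, show PowerSeries.coeff n (D.ψ s) = FreeAlgebra.ι ℂ
      (.ψ s n) by simp [D, CurrentData.ofGen]]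
    rfl
  have hcoei : ∀ (F : CurrentAlgebra q →ₐ[ℂ] A) s,
      PowerSeries.map (F.comp μ : _ →+* A) (D.ψi s) =
      PowerSeries.mk fun n => F (curGen q (.ψi s n)) := by
    intro F s
    ext n
    rw [← map_coeff, PowerSeries.coeff_mk, show PowerSeries.coeff n (D.ψi s) = FreeAlgebra.ι ℂ
      (.ψi s n) by simp [D, CurrentData.ofGen]]
    rfl
  have hψi : ∀ s n, F (curGen q (.ψi s n)) = F' (curGen q (.ψi s n)) := by
    intro s n
    have h₁ : PowerSeries.map (F.comp μ : _ →+* A) (D.ψi s) *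
        PowerSeries.map (F.comp μ : _ →+* A) (D.ψ s) = 1 := by
      ext k
      rw [← map_mul, ← map_coeff, hμ F (.ψi_ψ s k), map_coeff, map_one]
    have h₂ : PowerSeries.map (F'.comp μ : _ →+* A) (D.ψ s) *
        PowerSeries.map (F'.comp μ : _ →+* A) (D.ψi s) = 1 := by
      ext k
      rw [← map_mul, ← map_coeff, hμ F' (.ψ_ψi s k), map_coeff, map_one]
    rw [hcoe, hcoei] at h₁ h₂
    simp only [hψ] at h₁
    have := congrArg (PowerSeries.coeff n) (left_inv_eq_right_inv h₁ h₂)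
    simpa using this
  refine RingQuot.ringQuot_ext' _ _ _ (FreeAlgebra.hom_ext ?_)
  funext x
  cases x with
  | g => exact hg
  | gi => exact hgi
  | X s n => exact hX s n
  | ψ s n => exact hψ s n
  | ψi s n => exact hψi s n

end Map

section Currents

variable {A : Type u} [Ring A] [Algebra ℂ A] {q p : ℂ} {D : RSData A}
  (hD : ∀ x y, RSRel q p D x y → x = y) (hg : ∀ x, Commute D.g x)
  {G : Sgn → GaussCoord A} (hG : ∀ s, IsGauss (D.L s) (G s))

lemma RSData.model_g_zpow (k : ℤ) :
    (((D.model hD hg G hG).g ^ k : Aˣ) : A) = ipow D.g D.gi k :=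
  (ipow_eq (D.model hD hg G hG).g k).symm

lemma RSData.model_ratio (s : Sgn) :
    (D.model hD hg G hG).ratioS s = ratio (G s.opp) 0 := rfl

lemma RSData.model_cur (m : ℤ) : (D.model hD hg G hG).cur m = X₁ D.g D.gi G .pos m := by
  rw [LModel.cur, LModel.fs, LModel.fs, coefZ_zScale, coefZ_zScale, ← zpow_mul, ← zpow_mul,
    LModel.zpow_smul_eq, LModel.zpow_smul_eq, model_g_zpow, model_g_zpow]
  simp only [Sgn.toInt, one_mul, neg_mul]
  rfl

lemma RSData.model_curE (m : ℤ) : (D.model hD hg G hG).curE m = X₁ D.g D.gi G .neg m := by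
  rw [LModel.curE, LModel.es, LModel.es, coefZ_zScale, coefZ_zScale, ← zpow_mul, ← zpow_mul,
    LModel.zpow_smul_eq, LModel.zpow_smul_eq, model_g_zpow, model_g_zpow]
  simp only [Sgn.toInt, one_mul, neg_mul, neg_neg]
  rfl

lemma halfCurrent_scale (g gi : A) {f f' : Sgn → PowerSeries A} {α l : ℂ} (hl : l ≠ 0)
    (h : ∀ s, f' s = α • zScale s (cu hl) (f s)) (s : Sgn) (m : ℤ) :
    halfCurrent g gi f' s m = (α * l ^ m) • halfCurrent g gi f s m := by
  simp only [halfCurrent, h, coefZ_smul, coefZ_cu, mul_smul_comm]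
  module

variable (hp : p ^ 2 = q) (hq : q ≠ 0) (hr : ∀ n : ℕ, 0 < n → q ^ n ≠ 1)

include hD hg hG hp hq hr

lemma RSData.gaussX_eq (s : Sgn) (n : ℤ) :
    gaussX q D.g D.gi G s n = (D.model hD hg G hG).X s n := by
  have hs : (-q⁻¹) ^ (-n) * (-q) ^ (-n) = 1 := by
    rw [← mul_zpow, neg_mul_neg, inv_mul_cancel₀ hq, one_zpow]
  cases s
  · have h := halfCurrent_scale D.g D.gi (f := fun s => (G s).f₁) (f' := fun s => (G s).f₂)
      (neg_ne_zero.mpr hq) (fun s => (D.model hD hg G hG).f₂_eq hp hq hr s) .pos (-n)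
    rw [gaussX, LModel.X, model_cur, X₂, h, X₁, _root_.smul_smul, mul_left_comm, hs]
    simp only [LModel.κ, cond_false]
    module
  · have h := halfCurrent_scale D.g D.gi (f := fun s => (G s).e₁) (f' := fun s => (G s).e₂)
      (neg_ne_zero.mpr hq) (fun s => (D.model hD hg G hG).e₂_eq hp hq hr s) .neg (-n)
    rw [gaussX, LModel.X, model_curE, X₂, h, X₁, _root_.smul_smul, mul_left_comm, hs]
    module

lemma RSData.coeff_ratio_one (s : Sgn) (n : ℕ) : PowerSeries.coeff n (ratio (G s) 1) =
    (-q) ^ (s.toInt * n) • PowerSeries.coeff n (ratio (G s) 0) := by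
  have h := (D.model hD hg G hG).K₃_Ki hp hq hr s
  have h' := congrArg (fun a => coefZ s a (s.toInt * n)) h
  simp only [coefZ_cu] at h'
  simp only [coefZ_eq_extZ, ← mul_assoc, toInt_mul_self, one_mul, extZ_natCast] at h'
  exact h'

lemma RSData.gaussψ_eq (s : Sgn) (n : ℕ) :
    gaussψ q p G s n = PowerSeries.coeff n ((D.model hD hg G hG).ψ s) := by
  rw [LModel.ψ, PowerSeries.coeff_smul, model_ratio]
  cases s
  · have hs : (-q⁻¹) ^ (-(n : ℤ)) * (-q) ^ (-(n : ℤ)) = 1 := by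
      rw [← mul_zpow, neg_mul_neg, inv_mul_cancel₀ hq, one_zpow]
    rw [gaussψ, coeff_ratio_one hD hg hG hp hq hr, _root_.smul_smul]
    simp only [Sgn.toInt, Sgn.opp, neg_mul, one_mul]
    rw [mul_assoc, hs]
    module
  · have hs : (-q⁻¹) ^ n * (-q) ^ (n : ℤ) = 1 := by
      rw [zpow_natCast, ← mul_pow, neg_mul_neg, inv_mul_cancel₀ hq, one_pow]
    rw [gaussψ, coeff_ratio_one hD hg hG hp hq hr, _root_.smul_smul]
    simp only [Sgn.toInt, Sgn.opp, one_mul]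
    rw [hs]
    module

lemma RSData.ψ_isUnit (s : Sgn) : ∃ ψi : PowerSeries A,
    (D.model hD hg G hG).ψ s * ψi = 1 ∧ ψi * (D.model hD hg G hG).ψ s = 1 := by
  have hc := LModel.p_sub_ne_zero hp hq (hr 2 two_pos)
  set c := p⁻¹ - p with hcdef
  have h₁ : (D.model hD hg G hG).ψ s = c • ((((G s.opp).k 1) * ((G s.opp).k 0)⁻¹ :
    (PowerSeries A)ˣ) : PowerSeries A) := rfl
  refine ⟨c⁻¹ • ((((G s.opp).k 1) * ((G s.opp).k 0)⁻¹ : (PowerSeries A)ˣ)⁻¹ :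
    (PowerSeries A)ˣ), ?_, ?_⟩
  · rw [h₁, smul_mul_smul_comm, Units.mul_inv, mul_inv_cancel₀ hc, one_smul]
  · rw [h₁, smul_mul_smul_comm, Units.inv_mul, inv_mul_cancel₀ hc, one_smul]

/-- The homomorphism from the current algebra given by the Gauss decomposition of L-operators, for
`q` not a root of unity. -/
theorem RSData.exists_hom : ∃ Φ : CurrentAlgebra q →ₐ[ℂ] A, Φ (curGen q .g) = D.g ∧
    (∀ s n, Φ (curGen q (.X s n)) = gaussX q D.g D.gi G s n) ∧
    (∀ s n, Φ (curGen q (.ψ s n)) = gaussψ q p G s n) := by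
  choose ψi h₁ h₂ using ψ_isUnit hD hg hG hp hq hr
  let 𝓜 := D.model hD hg G hG
  let γ : CurrentGen → A
    | .g => D.g
    | .gi => D.gi
    | .X s n => 𝓜.X s n
    | .ψ s n => PowerSeries.coeff n (𝓜.ψ s)
    | .ψi s n => PowerSeries.coeff n (ψi s)
  have hψ : ∀ s, (CurrentData.ofGen γ).ψ s = 𝓜.ψ s := fun s => by
    ext n
    simp [γ, CurrentData.ofGen]
  have hψi : ∀ s, (CurrentData.ofGen γ).ψi s = ψi s := fun s => by
    ext n
    simp [γ, CurrentData.ofGen]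
  have hC : Currents q 𝓜.g (CurrentData.ofGen γ).X (CurrentData.ofGen γ).ψ := by
    rw [show (CurrentData.ofGen γ).ψ = 𝓜.ψ from funext hψ]
    exact 𝓜.currents hp hq hr
  have hrel : ∀ x y, CurrentRel q (.ofGen γ) x y → x = y := fun x y hxy =>
    Currents.rel hq (hr 2 two_pos) (g := 𝓜.g) rfl rfl hC
      (fun s => by rw [hψ, hψi]; exact h₁ s) (fun s => by rw [hψ, hψi]; exact h₂ s) hxy
  refine ⟨curLift γ hrel, curLift_gen _ _ _, fun s n => ?_, fun s n => ?_⟩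
  · rw [curLift_gen, gaussX_eq hD hg hG hp hq hr]
  · rw [curLift_gen, gaussψ_eq hD hg hG hp hq hr]

end Currents

end

/-! ### Exponentials of noncommutative power series -/

noncomputable section

section Exp

variable {A : Type*} [Ring A] [Algebra ℂ A]

/-- The Euler derivation `z d/dz`. -/
def eul : PowerSeries A →ₗ[ℂ] PowerSeries A where
  toFun a := PowerSeries.mk fun n => (n : ℂ) • PowerSeries.coeff n a
  map_add' a b := by ext n; simp
  map_smul' c a := by ext n; simp [_root_.smul_smul, mul_comm]

@[simp] lemma coeff_eul (a : PowerSeries A) (n : ℕ) :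
    PowerSeries.coeff n (eul a) = (n : ℂ) • PowerSeries.coeff n a := by
  simp [eul]

lemma eul_mul (a b : PowerSeries A) : eul (a * b) = eul a * b + a * eul b := by
  ext n
  rw [coeff_eul, map_add, PowerSeries.coeff_mul, PowerSeries.coeff_mul, PowerSeries.coeff_mul,
    Finset.smul_sum, ← Finset.sum_add_distrib]
  refine Finset.sum_congr rfl fun u hu => ?_
  rw [coeff_eul, coeff_eul, ← Finset.HasAntidiagonal.mem_antidiagonal.mp hu, smul_mul_assoc,
    mul_smul_comm, ← add_smul, Nat.cast_add]

lemma eul_C (x : A) : eul (PowerSeries.C x) = 0 := by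
  ext n
  rw [coeff_eul, PowerSeries.coeff_C]
  split_ifs with h <;> simp [h]

lemma eul_one : eul (1 : PowerSeries A) = 0 := by
  rw [← map_one (PowerSeries.C (R := A)), eul_C]

lemma eul_pow {h : PowerSeries A} (hc : Commute h (eul h)) (j : ℕ) :
    eul (h ^ (j + 1)) = (j + 1 : ℂ) • (h ^ j * eul h) := by
  induction j with
  | zero => simp
  | succ j ih =>
    rw [pow_succ h (j + 1), eul_mul, ih, smul_mul_assoc, mul_assoc, ← hc.eq, ← mul_assoc,
      ← pow_succ]
    push_cast
    module

/-- The solution of `z d/dz a = v a` with given constant coefficient is unique. -/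
lemma eq_zero_of_eul_eq_mul {a v : PowerSeries A} (hv : PowerSeries.coeff 0 v = 0)
    (h : eul a = v * a) (h0 : PowerSeries.coeff 0 a = 0) : a = 0 := by
  ext n
  induction n using Nat.strong_induction_on with
  | _ n ih =>
    rcases Nat.eq_zero_or_pos n with rfl | hn
    · simpa using h0
    · have hcoef := congrArg (PowerSeries.coeff n) h
      rw [coeff_eul, PowerSeries.coeff_mul, Finset.sum_eq_zero] at hcoef
      · rw [map_zero]
        refine smul_right_injective A (Nat.cast_ne_zero.mpr hn.ne' : (n : ℂ) ≠ 0) ?_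
        simpa using hcoef
      · rintro ⟨i, k⟩ hu
        have hu' := Finset.HasAntidiagonal.mem_antidiagonal.mp hu
        simp only at hu' ⊢
        rcases Nat.eq_zero_or_pos i with rfl | hi
        · rw [hv, zero_mul]
        · rw [ih k (by omega), map_zero, mul_zero]

lemma coeff_pow_of_lt {A : Type*} [Ring A] {h : PowerSeries A} (h0 : PowerSeries.coeff 0 h = 0)
    {n j : ℕ} (hn : n < j) :
    PowerSeries.coeff n (h ^ j) = 0 := by
  induction j generalizing n with
  | zero => omega
  | succ j ih =>
    rw [pow_succ', PowerSeries.coeff_mul]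
    refine Finset.sum_eq_zero ?_
    rintro ⟨i, k⟩ hu
    have hu' := Finset.HasAntidiagonal.mem_antidiagonal.mp hu
    simp only at hu' ⊢
    rcases Nat.eq_zero_or_pos i with rfl | hi
    · rw [h0, zero_mul]
    · rw [ih (by omega), mul_zero]

lemma coeff_expSeries {h : PowerSeries A} (h0 : PowerSeries.coeff 0 h = 0) {n N : ℕ} (hn : n ≤ N) :
    PowerSeries.coeff n (expSeries h) = PowerSeries.coeff n
      (∑ j ∈ Finset.range (N + 1), ((Nat.factorial j : ℂ)⁻¹) • h ^ j) := by
  rw [expSeries, PowerSeries.coeff_mk, map_sum]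
  simp only [PowerSeries.coeff_smul]
  refine Finset.sum_subset (Finset.range_subset_range.mpr (by omega)) fun j _ hj => ?_
  rw [coeff_pow_of_lt h0 (by simpa using hj), smul_zero]

@[simp] lemma coeff_zero_expSeries (h : PowerSeries A) : PowerSeries.coeff 0 (expSeries h) = 1 := by
  rw [expSeries, PowerSeries.coeff_mk]
  simp

/-- The exponential of `h` solves `z d/dz E = E (z d/dz h)` if `h` and its derivative commute. -/
lemma eul_expSeries {h : PowerSeries A} (h0 : PowerSeries.coeff 0 h = 0)
    (hc : Commute h (eul h)) : eul (expSeries h) = expSeries h * eul h := by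
  ext n
  rw [coeff_eul, coeff_expSeries h0 (Nat.le_succ n), ← coeff_eul, map_sum, Finset.sum_range_succ',
    map_smul, pow_zero, eul_one, smul_zero, add_zero]
  have h₁ : ∀ j : ℕ, eul (((Nat.factorial (j + 1) : ℂ)⁻¹) • h ^ (j + 1)) =
      (((Nat.factorial j : ℂ)⁻¹) • h ^ j) * eul h := by
    intro j
    have : (Nat.factorial j : ℂ) ≠ 0 := Nat.cast_ne_zero.mpr (Nat.factorial_ne_zero j)
    have h2 : (j + 1 : ℂ) ≠ 0 := Nat.cast_add_one_ne_zero j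
    rw [map_smul, eul_pow hc, _root_.smul_smul, smul_mul_assoc, Nat.factorial_succ]
    congr 1
    push_cast
    field_simp
  simp only [h₁]
  rw [← Finset.sum_mul, PowerSeries.coeff_mul, PowerSeries.coeff_mul]
  refine Finset.sum_congr rfl fun u hu => ?_
  rw [coeff_expSeries h0 (N := n) (by
    have := Finset.HasAntidiagonal.mem_antidiagonal.mp hu
    omega)]

lemma coeff_mul_mem {S : Subalgebra ℂ A} {a b : PowerSeries A} {n : ℕ}
    (h : ∀ i k, i + k = n → PowerSeries.coeff i a * PowerSeries.coeff k b ∈ S) :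
    PowerSeries.coeff n (a * b) ∈ S := by
  rw [PowerSeries.coeff_mul]
  exact S.sum_mem fun u hu => h _ _ (Finset.HasAntidiagonal.mem_antidiagonal.mp hu)

lemma coeff_pow_mem {S : Subalgebra ℂ A} {h : PowerSeries A} {n : ℕ}
    (hS : ∀ m < n, PowerSeries.coeff m h ∈ S) (j : ℕ) :
    ∀ m < n, PowerSeries.coeff m (h ^ j) ∈ S := by
  induction j with
  | zero =>
    intro m _
    rw [pow_zero, PowerSeries.coeff_one]
    split_ifs
    · exact S.one_mem
    · exact S.zero_mem
  | succ j ih =>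
    intro m hm
    rw [pow_succ]
    exact coeff_mul_mem fun i k hik => S.mul_mem (ih i (by omega)) (hS k (by omega))

lemma expSeries_mem {S : Subalgebra ℂ A} {h : PowerSeries A}
    (hS : ∀ n, PowerSeries.coeff n h ∈ S) (n : ℕ) : PowerSeries.coeff n (expSeries h) ∈ S := by
  rw [expSeries, PowerSeries.coeff_mk]
  exact S.sum_mem fun j _ =>
    S.smul_mem (coeff_pow_mem (n := n + 1) (fun m _ => hS m) j n (by omega)) _

/-- The coefficients of a logarithm are polynomials in those of the exponential. -/
lemma mem_of_expSeries_mem {S : Subalgebra ℂ A} {h : PowerSeries A}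
    (h0 : PowerSeries.coeff 0 h = 0) (hS : ∀ n, PowerSeries.coeff n (expSeries h) ∈ S) (n : ℕ) :
    PowerSeries.coeff n h ∈ S := by
  induction n using Nat.strong_induction_on with
  | _ n ih =>
    rcases Nat.eq_zero_or_pos n with rfl | hn
    · rw [h0]
      exact S.zero_mem
    · have key : ∀ j, PowerSeries.coeff n (h ^ (j + 1 + 1)) ∈ S := by
        intro j
        rw [pow_succ]
        refine coeff_mul_mem fun i k hik => ?_
        rcases Nat.eq_zero_or_pos i with rfl | hi
        · rw [coeff_pow_of_lt h0 (Nat.succ_pos j), zero_mul]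
          exact S.zero_mem
        · rcases Nat.eq_zero_or_pos k with rfl | hk
          · rw [h0, mul_zero]
            exact S.zero_mem
          · exact S.mul_mem (coeff_pow_mem ih _ _ (by omega)) (ih _ (by omega))
      have hE := hS n
      obtain ⟨m, rfl⟩ : ∃ m, n = m + 1 := ⟨n - 1, by omega⟩
      rw [expSeries, PowerSeries.coeff_mk, Finset.sum_range_succ', Finset.sum_range_succ'] at hE
      have h₁ := S.sub_mem (S.sub_mem hE (S.smul_mem (x := PowerSeries.coeff (m + 1) (h ^ 0)) (by
        rw [pow_zero, PowerSeries.coeff_one, if_neg (by omega)]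
        exact S.zero_mem) ((Nat.factorial 0 : ℂ)⁻¹)))
        (S.sum_mem (t := Finset.range m)
          (f := fun j => ((Nat.factorial (j + 1 + 1) : ℂ)⁻¹) •
            PowerSeries.coeff (m + 1) (h ^ (j + 1 + 1)))
          fun j _ => S.smul_mem (key j) _)
      rw [add_sub_cancel_right, add_sub_cancel_left] at h₁
      simpa using h₁

lemma commute_of_coeff {A : Type*} [Ring A] {a b : PowerSeries A}
    (h : ∀ i k, Commute (PowerSeries.coeff i a) (PowerSeries.coeff k b)) : Commute a b := by
  ext n
  rw [PowerSeries.coeff_mul, PowerSeries.coeff_mul, ← Finset.Nat.sum_antidiagonal_swap]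
  exact Finset.sum_congr rfl fun u _ => h _ _

lemma commute_expSeries {h : PowerSeries A} {x : A} (hx : ∀ n, Commute x (PowerSeries.coeff n h))
    (n : ℕ) : Commute x (PowerSeries.coeff n (expSeries h)) := by
  have := expSeries_mem (S := Subalgebra.centralizer ℂ {x}) (h := h)
    (fun n => (Subalgebra.mem_centralizer_iff ℂ).mpr fun y hy => by
      rw [Set.mem_singleton_iff.mp hy]; exact hx n) n
  exact (Subalgebra.mem_centralizer_iff ℂ).mp this x rfl

lemma commute_of_expSeries {h : PowerSeries A} (h0 : PowerSeries.coeff 0 h = 0) {x : A}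
    (hx : ∀ n, Commute x (PowerSeries.coeff n (expSeries h))) (n : ℕ) :
    Commute x (PowerSeries.coeff n h) := by
  have := mem_of_expSeries_mem (S := Subalgebra.centralizer ℂ {x}) (h := h) h0
    (fun n => (Subalgebra.mem_centralizer_iff ℂ).mpr fun y hy => by
      rw [Set.mem_singleton_iff.mp hy]; exact hx n) n
  exact (Subalgebra.mem_centralizer_iff ℂ).mp this x rfl

section

variable {h : PowerSeries A} (h0 : PowerSeries.coeff 0 h = 0)
  (hh : ∀ i k, Commute (PowerSeries.coeff i h) (PowerSeries.coeff k h))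

include h0 hh

lemma eul_expSeries' : eul (expSeries h) = eul h * expSeries h := by
  have h₁ : ∀ i k, Commute (PowerSeries.coeff i (eul h)) (PowerSeries.coeff k h) := fun i k => by
    rw [coeff_eul]
    exact (hh i k).smul_left _
  rw [eul_expSeries h0 (commute_of_coeff h₁).symm]
  exact ((commute_of_coeff fun i k => commute_expSeries (h₁ i) k).eq).symm

lemma expSeries_mul_neg : expSeries h * expSeries (-h) = 1 := by
  have hn0 : PowerSeries.coeff 0 (-h) = 0 := by rw [map_neg, h0, neg_zero]
  have hnn : ∀ i k, Commute (PowerSeries.coeff i (-h)) (PowerSeries.coeff k (-h)) := fun i k => by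
    rw [map_neg, map_neg]
    exact (hh i k).neg_left.neg_right
  have hc : Commute h (eul h) := commute_of_coeff fun i k => by
    rw [coeff_eul]
    exact (hh i k).smul_right _
  refine sub_eq_zero.mp (eq_zero_of_eul_eq_mul (v := 0) (map_zero _) ?_ ?_)
  · rw [map_sub, eul_one, eul_mul, eul_expSeries h0 hc, eul_expSeries' hn0 hnn, map_neg]
    noncomm_ring
  · rw [map_sub, PowerSeries.coeff_mul, Finset.Nat.antidiagonal_zero, Finset.sum_singleton,
      coeff_zero_expSeries, coeff_zero_expSeries]
    simp

lemma expSeries_neg_mul : expSeries (-h) * expSeries h = 1 := by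
  have := expSeries_mul_neg (h := -h) (by rw [map_neg, h0, neg_zero]) fun i k => by
    rw [map_neg, map_neg]
    exact (hh i k).neg_left.neg_right
  rwa [neg_neg] at this

end

end Exp

end

/-! ### Conjugation by an exponential -/

noncomputable section

section Conj

variable {A : Type*} [Ring A] [Algebra ℂ A]

lemma coeff_dShift (r : PowerSeries ℂ) (t : A) (s : Sgn) (Z : ℤ → A) (n : ℤ) (k : ℕ) :
    PowerSeries.coeff k (dShift r t s Z n) =
      PowerSeries.coeff k r • (t ^ k * Z (n + s.toInt * k)) := PowerSeries.coeff_mk _ _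

lemma eul_dShift (r : PowerSeries ℂ) (t : A) (s : Sgn) (Z : ℤ → A) (n : ℤ) :
    eul (dShift r t s Z n) = dShift (eul r) t s Z n := by
  ext k
  rw [coeff_eul, coeff_dShift, coeff_dShift, coeff_eul, smul_assoc]

variable {t : A} {a : PowerSeries A} (ht : ∀ i, Commute t (PowerSeries.coeff i a))

include ht in
lemma coeff_commutator_dShift (ρ v : PowerSeries ℂ) (s : Sgn) (Z : ℤ → A) (n : ℤ) (N : ℕ) :
    PowerSeries.coeff N
        (a * dShift ρ t s Z n - dShift ρ t s Z n * a - dShift (v * ρ) t s Z n) =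
      ∑ u ∈ Finset.HasAntidiagonal.antidiagonal N, PowerSeries.coeff u.2 ρ •
        (t ^ u.2 * (PowerSeries.coeff u.1 a * Z (n + s.toInt * u.2) -
          Z (n + s.toInt * u.2) * PowerSeries.coeff u.1 a -
          PowerSeries.coeff u.1 v • (t ^ u.1 * Z (n + s.toInt * u.2 + s.toInt * u.1)))) := by
  rw [map_sub, map_sub, PowerSeries.coeff_mul, coeff_dShift, PowerSeries.coeff_mul,
    PowerSeries.coeff_mul, Finset.sum_smul,
    ← Finset.Nat.sum_antidiagonal_swap (f := fun u => PowerSeries.coeff u.1 (dShift ρ t s Z n) * _),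
    ← Finset.sum_sub_distrib, ← Finset.sum_sub_distrib]
  refine Finset.sum_congr rfl fun u hu => ?_
  have h₁ : PowerSeries.coeff u.1 a * (t ^ u.2 * Z (n + s.toInt * u.2)) =
      t ^ u.2 * (PowerSeries.coeff u.1 a * Z (n + s.toInt * u.2)) := by
    rw [← mul_assoc, ((ht u.1).symm.pow_right u.2).eq, mul_assoc]
  have h₂ : (t ^ N * Z (n + s.toInt * N) : A) =
      t ^ u.2 * (t ^ u.1 * Z (n + s.toInt * u.2 + s.toInt * u.1)) := by
    rw [← Finset.HasAntidiagonal.mem_antidiagonal.mp hu, ← mul_assoc, ← pow_add, add_comm u.2 u.1]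
    push_cast
    ring_nf
  simp only [Prod.fst_swap, Prod.snd_swap]
  rw [coeff_dShift, h₂, mul_smul_comm, h₁, smul_mul_assoc, mul_assoc, mul_sub, mul_sub, smul_sub,
    smul_sub, mul_smul_comm, _root_.smul_smul, mul_comm (PowerSeries.coeff u.2 ρ)]

end Conj

section ExpConj

variable {A : Type*} [Ring A] [Algebra ℂ A] {t : A} {h : PowerSeries A}
  (h0 : PowerSeries.coeff 0 h = 0)
  (hh : ∀ i k, Commute (PowerSeries.coeff i h) (PowerSeries.coeff k h))
  (ht : ∀ i, Commute t (PowerSeries.coeff i h)) {ρ v : PowerSeries ℂ}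
  (hρ : eul ρ = v * ρ) (hρ0 : PowerSeries.coeff 0 ρ = 1) {s : Sgn} {Z : ℤ → A}

include h0 hh ht hρ hρ0

/-- Commutation relations with the coefficients of `h` integrate to conjugation by `exp h`. -/
lemma expSeries_mul_C (H : ∀ (k : ℕ) (n : ℤ),
      (k : ℂ) • (PowerSeries.coeff k h * Z n - Z n * PowerSeries.coeff k h) =
        PowerSeries.coeff k v • (t ^ k * Z (n + s.toInt * k))) (n : ℤ) :
    expSeries h * PowerSeries.C (Z n) = dShift ρ t s Z n * expSeries h := by
  have ht' : ∀ i, Commute t (PowerSeries.coeff i (eul h)) := fun i => by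
    rw [coeff_eul]
    exact (ht i).smul_right _
  have key : eul h * dShift ρ t s Z n - dShift ρ t s Z n * eul h = dShift (v * ρ) t s Z n := by
    refine sub_eq_zero.mp ?_
    ext N
    rw [coeff_commutator_dShift ht', map_zero]
    refine Finset.sum_eq_zero fun u _ => ?_
    rw [coeff_eul, smul_mul_assoc, mul_smul_comm, ← smul_sub, H, sub_self, mul_zero, smul_zero]
  refine sub_eq_zero.mp (eq_zero_of_eul_eq_mul (v := eul h) (by simp) ?_ ?_)
  · rw [map_sub, eul_mul, eul_mul, eul_C, eul_dShift, hρ, eul_expSeries' h0 hh, ← key]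
    noncomm_ring
  · rw [map_sub, PowerSeries.coeff_mul, PowerSeries.coeff_mul, Finset.Nat.antidiagonal_zero,
      Finset.sum_singleton, Finset.sum_singleton, coeff_zero_expSeries, coeff_dShift, hρ0]
    simp

/-- Conversely, the commutation relations are recovered from conjugation by `exp h`. -/
lemma commutator_of_expSeries_mul_C
    (H : ∀ n, expSeries h * PowerSeries.C (Z n) = dShift ρ t s Z n * expSeries h) (k : ℕ) (n : ℤ) :
    (k : ℂ) • (PowerSeries.coeff k h * Z n - Z n * PowerSeries.coeff k h) =
      PowerSeries.coeff k v • (t ^ k * Z (n + s.toInt * k)) := by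
  have ht' : ∀ i, Commute t (PowerSeries.coeff i (eul h)) := fun i => by
    rw [coeff_eul]
    exact (ht i).smul_right _
  have key : ∀ n, eul h * dShift ρ t s Z n - dShift ρ t s Z n * eul h - dShift (v * ρ) t s Z n =
      0 := by
    intro n
    have h₁ := congrArg eul (H n)
    rw [eul_mul, eul_mul, eul_C, eul_dShift, hρ, eul_expSeries' h0 hh, mul_zero, add_zero,
      mul_assoc, H] at h₁
    have h₂ : (eul h * dShift ρ t s Z n - dShift ρ t s Z n * eul h - dShift (v * ρ) t s Z n) *
        expSeries h = 0 := by
      rw [sub_mul, sub_mul, mul_assoc, h₁]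
      noncomm_ring
    rw [← mul_one (_ - _), ← expSeries_mul_neg h0 hh, ← mul_assoc, h₂, zero_mul]
  have main : ∀ n, PowerSeries.coeff k (eul h) * Z n - Z n * PowerSeries.coeff k (eul h) -
      PowerSeries.coeff k v • (t ^ k * Z (n + s.toInt * k)) = 0 := by
    induction k using Nat.strong_induction_on with
    | _ k ih =>
      intro n
      have hk := congrArg (PowerSeries.coeff k) (key n)
      rw [coeff_commutator_dShift ht', map_zero, Finset.sum_eq_single (k, 0)] at hk
      · simpa [hρ0] using hk
      · rintro ⟨i, j⟩ hu hne
        have hu' := Finset.HasAntidiagonal.mem_antidiagonal.mp hu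
        simp only at hu' ⊢
        rw [ih i, mul_zero, smul_zero]
        refine lt_of_le_of_ne (by omega) fun hik => hne ?_
        rw [Prod.mk.injEq]
        omega
      · intro hne
        exact absurd (Finset.HasAntidiagonal.mem_antidiagonal.mpr (add_zero k)) hne
  have := main n
  rw [coeff_eul, smul_mul_assoc, mul_smul_comm, ← smul_sub] at this
  exact sub_eq_zero.mp this

end ExpConj

/-! ### Logarithmic derivatives of the structure functions -/

/-- The coefficients of the logarithmic derivative of `rat q s`. -/
def ratLog (q : ℂ) (s : Sgn) : PowerSeries ℂ :=
  PowerSeries.mk fun k => -(s.toInt : ℂ) * (-1) ^ k * (q ^ k - q⁻¹ ^ k)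

/-- `rat q s`, normalized to have constant coefficient `1`. -/
def ratN (q : ℂ) (s : Sgn) : PowerSeries ℂ := q ^ s.toInt • rat q s

lemma coeff_zero_ratN {q : ℂ} (hq : q ≠ 0) (s : Sgn) : PowerSeries.coeff 0 (ratN q s) = 1 := by
  cases s <;> simp [ratN, rat, ratP, ratM, Sgn.toInt, hq]

lemma ratLog_mul {q : ℂ} (hq : q ≠ 0) (s : Sgn) :
    (PowerSeries.C (ratA q s) + PowerSeries.C (ratA q s.opp) * PowerSeries.X) *
      ((PowerSeries.C (ratA q s.opp) + PowerSeries.C (ratA q s) * PowerSeries.X) * ratLog q s) =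
      PowerSeries.C (ratA q s ^ 2 - ratA q s.opp ^ 2) * PowerSeries.X := by
  ext n
  rcases n with _ | _ | n
  · simp [ratLog, add_mul]
  · rw [PowerSeries.coeff_C_mul, PowerSeries.coeff_X, if_pos rfl]
    cases s <;>
    · simp [ratLog, ratA, add_mul, mul_add, mul_assoc, PowerSeries.coeff_succ_X_mul, Sgn.toInt,
        Sgn.opp]
      field_simp
  · rw [PowerSeries.coeff_C_mul, PowerSeries.coeff_X, if_neg (by omega), mul_zero]
    cases s <;>
    · simp [ratLog, ratA, add_mul, mul_add, mul_assoc, PowerSeries.coeff_succ_X_mul, Sgn.toInt,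
        Sgn.opp]
      field_simp
      ring

lemma eul_rat {q : ℂ} (hq : q ≠ 0) (s : Sgn) : eul (rat q s) = ratLog q s * rat q s := by
  have h := rat_mul hq s
  have hl := ratLog_mul hq s
  have hX : eul (PowerSeries.X : PowerSeries ℂ) = PowerSeries.X := by
    ext n
    rw [coeff_eul, PowerSeries.coeff_X]
    split_ifs with h <;> simp [h]
  have he := congrArg eul h
  simp only [eul_mul, map_add, eul_C, hX] at he
  set a := ratA q s with ha
  set b := ratA q s.opp with hb
  have ha0 : a ≠ 0 := ratA_ne_zero hq s
  have hb0 : b ≠ 0 := ratA_ne_zero hq s.opp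
  set P := PowerSeries.C a + PowerSeries.C b * PowerSeries.X with hP
  set Q := PowerSeries.C b + PowerSeries.C a * PowerSeries.X with hQ
  have hP0 : P ≠ 0 := fun h0 => ha0 (by
    simpa [hP] using congrArg PowerSeries.constantCoeff h0)
  have hQ0 : Q ≠ 0 := fun h0 => hb0 (by
    simpa [hQ] using congrArg PowerSeries.constantCoeff h0)
  refine mul_left_cancel₀ (mul_ne_zero hP0 (mul_ne_zero hP0 hQ0)) ?_
  have hPQ : PowerSeries.C a * P - PowerSeries.C b * Q = PowerSeries.C (a ^ 2 - b ^ 2) := by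
    rw [hP, hQ, map_sub, map_pow, map_pow]
    ring
  linear_combination (P * Q) * he - (P * Q * ratLog q s + PowerSeries.C b * PowerSeries.X * Q) * h -
    Q * hl + PowerSeries.X * Q * hPQ

lemma eul_ratN {q : ℂ} (hq : q ≠ 0) (s : Sgn) : eul (ratN q s) = ratLog q s * ratN q s := by
  rw [ratN, map_smul, eul_rat hq, mul_smul_comm]

end

/-! ### Currents and modes -/

noncomputable section

/-- The sign `τ` for which `ψ^s X^{s'} (ψ^s)⁻¹` is given by `rat q τ`. -/
def Sgn.conj (s : Sgn) : Sgn → Sgn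
  | .pos => s.opp
  | .neg => s

lemma Sgn.toInt_opp (s : Sgn) : s.opp.toInt = -s.toInt := by cases s <;> rfl

lemma Sgn.toInt_conj (s s' : Sgn) :
    (s.conj s').toInt = -(s.toInt * s'.toInt) := by
  cases s <;> cases s' <;> rfl

lemma sub_inv_ne_zero {q : ℂ} (hq : q ≠ 0) (hq1 : q ^ 2 ≠ 1) : q - q⁻¹ ≠ 0 := fun h => hq1 (by
  have := congrArg (q * ·) h
  simp only [mul_sub, mul_inv_cancel₀ hq, mul_zero] at this
  linear_combination this)

lemma toInt_ne_zero (s : Sgn) : (s.toInt : ℂ) ≠ 0 := by cases s <;> simp [Sgn.toInt]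

lemma toInt_mul_ne_zero (s : Sgn) {k : ℕ} (hk : k ≠ 0) : s.toInt * k ≠ 0 := by
  cases s <;> simp [Sgn.toInt, hk]

section

variable {A : Type*} [Ring A] [Algebra ℂ A] {q : ℂ}

/-- The series `± (q - q⁻¹) ∑ H_{±n} z^{∓n}` whose exponential is `K^{∓1} ψ^±`. -/
def ModeData.η (q : ℂ) (D : ModeData A) (s : Sgn) : PowerSeries A := s.toInt • D.hSeries q s

lemma ModeData.coeff_zero_η (D : ModeData A) (s : Sgn) : PowerSeries.coeff 0 (D.η q s) = 0 := by
  rw [η, map_zsmul, hSeries, PowerSeries.coeff_mk, if_pos rfl, smul_zero]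

lemma ModeData.coeff_η (D : ModeData A) (s : Sgn) {k : ℕ} (hk : k ≠ 0) :
    PowerSeries.coeff k (D.η q s) = ((s.toInt : ℂ) * (q - q⁻¹)) • D.H (s.toInt * k) := by
  rw [η, map_zsmul, hSeries, PowerSeries.coeff_mk, if_neg hk, mul_smul, Int.cast_smul_eq_zsmul]

lemma ModeData.toCurrent_ψ (D : ModeData A) (s : Sgn) : (D.toCurrent q).ψ s =
    PowerSeries.C (ipow D.K D.Ki s.toInt) * expSeries (D.η q s) := rfl

lemma ModeData.toCurrent_ψi (D : ModeData A) (s : Sgn) : (D.toCurrent q).ψi s =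
    expSeries (-D.η q s) * PowerSeries.C (ipow D.K D.Ki (-s.toInt)) := by
  rw [η, ← neg_smul]
  rfl

lemma dShift_ratN (t : A) (s' s : Sgn) (Z : ℤ → A) (n : ℤ) :
    dShift (ratN q s') t s Z n = q ^ s'.toInt • dShift (rat q s') t s Z n := by
  ext k
  rw [PowerSeries.coeff_smul, coeff_dShift, coeff_dShift, ratN, PowerSeries.coeff_smul, smul_assoc]

/-- The relations of Cartan type among the modes, apart from those between `H_n` and `H_{-m}`. -/
structure ModeData.Cartan (q : ℂ) (D : ModeData A) : Prop where
  g_gi : D.g * D.gi = 1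
  gi_g : D.gi * D.g = 1
  K_Ki : D.K * D.Ki = 1
  Ki_K : D.Ki * D.K = 1
  g_K : Commute D.g D.K
  g_H (n : ℤ) (hn : n ≠ 0) : Commute D.g (D.H n)
  g_X (s : Sgn) (n : ℤ) : Commute D.g (D.X s n)
  K_H (n : ℤ) (hn : n ≠ 0) : Commute D.K (D.H n)
  K_X (s : Sgn) (n : ℤ) : D.K * D.X s n = q ^ s.toInt • (D.X s n * D.K)
  H_H (s : Sgn) (i k : ℕ) (hi : i ≠ 0) (hk : k ≠ 0) :
    Commute (D.H (s.toInt * i)) (D.H (s.toInt * k))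

namespace ModeData.Cartan

variable {D : ModeData A} (h : D.Cartan q)

include h

/-- `q^{c/2}` as a unit. -/
def gU : Aˣ := ⟨D.g, D.gi, h.g_gi, h.gi_g⟩

/-- `K` as a unit. -/
def kU : Aˣ := ⟨D.K, D.Ki, h.K_Ki, h.Ki_K⟩

lemma ipow_g (n : ℤ) : ipow D.g D.gi n = ↑(h.gU ^ n) := ipow_eq h.gU n

lemma ipow_K (n : ℤ) : ipow D.K D.Ki n = ↑(h.kU ^ n) := ipow_eq h.kU n

lemma commute_g_zpow {x : A} (hx : Commute D.g x) (n : ℤ) : Commute (↑(h.gU ^ n) : A) x :=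
  Commute.units_zpow_left (u := h.gU) hx n

lemma commute_η (s : Sgn) (i k : ℕ) :
    Commute (PowerSeries.coeff i (D.η q s)) (PowerSeries.coeff k (D.η q s)) := by
  by_cases hi : i = 0
  · rw [hi, coeff_zero_η]
    exact Commute.zero_left _
  by_cases hk : k = 0
  · rw [hk, coeff_zero_η]
    exact Commute.zero_right _
  rw [coeff_η D s hi, coeff_η D s hk]
  exact ((h.H_H s i k hi hk).smul_left _).smul_right _

lemma g_η (s : Sgn) (i : ℕ) : Commute D.g (PowerSeries.coeff i (D.η q s)) := by
  by_cases hi : i = 0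
  · rw [hi, coeff_zero_η]
    exact Commute.zero_right _
  · rw [coeff_η D s hi]
    exact (h.g_H _ (toInt_mul_ne_zero s hi)).smul_right _

lemma K_η (s : Sgn) (i : ℕ) : Commute D.K (PowerSeries.coeff i (D.η q s)) := by
  by_cases hi : i = 0
  · rw [hi, coeff_zero_η]
    exact Commute.zero_right _
  · rw [coeff_η D s hi]
    exact (h.K_H _ (toInt_mul_ne_zero s hi)).smul_right _

lemma K_zpow_X (hq : q ≠ 0) (s' : Sgn) (n : ℤ) (s : Sgn) :
    (↑(h.kU ^ s.toInt) : A) * D.X s' n =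
      q ^ (s.toInt * s'.toInt) • (D.X s' n * ↑(h.kU ^ s.toInt)) := by
  cases s
  · simpa [Sgn.toInt, kU] using h.K_X s' n
  · have h₁ := h.K_X s' n
    have h₂ : D.X s' n * D.Ki = q ^ s'.toInt • (D.Ki * D.X s' n) := by
      have := congrArg (fun x => D.Ki * x * D.Ki) h₁
      simp only [← mul_assoc, h.Ki_K, one_mul, mul_smul_comm, smul_mul_assoc] at this
      rwa [mul_assoc _ D.K, h.K_Ki, mul_one] at this
    rw [show Sgn.neg.toInt = -1 from rfl, neg_mul, one_mul, zpow_neg, zpow_neg, zpow_one]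
    show D.Ki * D.X s' n = _ • (D.X s' n * D.Ki)
    rw [h₂, _root_.smul_smul, inv_mul_cancel₀ (zpow_ne_zero _ hq), one_smul]

lemma expSeries_η_mul (s : Sgn) : expSeries (D.η q s) * expSeries (-D.η q s) = 1 :=
  expSeries_mul_neg (coeff_zero_η D s) (h.commute_η s)

lemma expSeries_mul_η (s : Sgn) : expSeries (-D.η q s) * expSeries (D.η q s) = 1 :=
  expSeries_neg_mul (coeff_zero_η D s) (h.commute_η s)

lemma ψ_mul_ψi (s : Sgn) : (D.toCurrent q).ψ s * (D.toCurrent q).ψi s = 1 := by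
  rw [toCurrent_ψ, toCurrent_ψi, mul_assoc, ← mul_assoc (expSeries _), h.expSeries_η_mul, one_mul,
    ← map_mul, h.ipow_K, h.ipow_K, zpow_neg, Units.mul_inv, map_one]

lemma ψi_mul_ψ (s : Sgn) : (D.toCurrent q).ψi s * (D.toCurrent q).ψ s = 1 := by
  rw [toCurrent_ψ, toCurrent_ψi, mul_assoc, ← mul_assoc (PowerSeries.C _), ← map_mul, h.ipow_K,
    h.ipow_K, zpow_neg, Units.inv_mul, map_one, one_mul, h.expSeries_mul_η]

/-- The relation between `H_{±k}` and `X^±_n` in terms of the coefficients of `η`. -/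
lemma H_X_iff (hq : q ≠ 0) (hq1 : q ^ 2 ≠ 1) (s s' : Sgn) {k : ℕ} (hk : k ≠ 0) (n : ℤ) :
    D.H (s.toInt * k) * D.X s' n - D.X s' n * D.H (s.toInt * k) =
      ((s'.toInt : ℂ) * (1 / (s.toInt * k : ℤ)) * (-1) ^ (s.toInt * k : ℤ) *
        qint q (s.toInt * k)) •
        (ipow D.g D.gi (-(s'.toInt * |(s.toInt * k : ℤ)|)) * D.X s' (s.toInt * k + n)) ↔
    (k : ℂ) • (PowerSeries.coeff k (D.η q s) * D.X s' n -
        D.X s' n * PowerSeries.coeff k (D.η q s)) =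
      PowerSeries.coeff k (ratLog q (s.conj s')) •
        ((↑(h.gU ^ (-s'.toInt)) : A) ^ k * D.X s' (n + s.toInt * k)) := by
  have hc : (k : ℂ) * ((s.toInt : ℂ) * (q - q⁻¹)) ≠ 0 := mul_ne_zero (Nat.cast_ne_zero.mpr hk)
    (mul_ne_zero (toInt_ne_zero s) (sub_inv_ne_zero hq hq1))
  have hS : (k : ℂ) * ((s.toInt : ℂ) * (q - q⁻¹)) * ((s'.toInt : ℂ) * (1 / (s.toInt * k : ℤ)) *
      (-1) ^ (s.toInt * k : ℤ) * qint q (s.toInt * k)) =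
      PowerSeries.coeff k (ratLog q (s.conj s')) := by
    have hk' : (k : ℂ) ≠ 0 := Nat.cast_ne_zero.mpr hk
    have h1 : ((-1 : ℂ) ^ k)⁻¹ = (-1) ^ k := by rw [← inv_pow, inv_neg_one]
    have h2 := sub_inv_ne_zero hq hq1
    rw [ratLog, PowerSeries.coeff_mk, Sgn.toInt_conj, qint]
    cases s <;> simp only [Sgn.toInt, one_mul, neg_mul, zpow_natCast, zpow_neg, h1, inv_pow,
      Int.cast_neg, Int.cast_natCast, neg_neg, Int.cast_one] <;> (field_simp; try ring)
  have hab : |(s.toInt * k : ℤ)| = k := by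
    cases s <;> simp [Sgn.toInt]
  have hg : (↑(h.gU ^ (-(s'.toInt * (k : ℤ)))) : A) = (↑(h.gU ^ (-s'.toInt)) : A) ^ k := by
    rw [← Units.val_pow_eq_pow_val, ← zpow_natCast, ← zpow_mul, neg_mul]
  rw [coeff_η D s hk, smul_mul_assoc, mul_smul_comm, ← smul_sub, _root_.smul_smul, ← hS, hab,
    h.ipow_g, hg, add_comm n]
  exact ⟨fun e => by rw [e, _root_.smul_smul], fun e => smul_right_injective A hc (by
    simpa only [_root_.smul_smul] using e)⟩

lemma g_ipow_η (s s' : Sgn) (i : ℕ) :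
    Commute (↑(h.gU ^ (-s'.toInt)) : A) (PowerSeries.coeff i (D.η q s)) :=
  h.commute_g_zpow (h.g_η s i) _

/-- The commutators of the `H_{±k}`, `k > 0`, with the `X^±_n`, in terms of `η`. -/
def HX (D : ModeData A) (h : D.Cartan q) : Prop :=
  ∀ (s s' : Sgn) (k : ℕ) (n : ℤ),
    (k : ℂ) • (PowerSeries.coeff k (D.η q s) * D.X s' n -
        D.X s' n * PowerSeries.coeff k (D.η q s)) =
      PowerSeries.coeff k (ratLog q (s.conj s')) •
        ((↑(h.gU ^ (-s'.toInt)) : A) ^ k * D.X s' (n + s.toInt * k))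

lemma exp_X (hq : q ≠ 0) (hX : h.HX) (s s' : Sgn) (n : ℤ) :
    expSeries (D.η q s) * PowerSeries.C (D.X s' n) =
      dShift (ratN q (s.conj s')) (↑(h.gU ^ (-s'.toInt)) : A) s (D.X s') n *
        expSeries (D.η q s) :=
  expSeries_mul_C (coeff_zero_η D s) (h.commute_η s) (h.g_ipow_η s s') (eul_ratN hq _)
    (coeff_zero_ratN hq _) (hX s s') n

lemma exp_neg_X (hq : q ≠ 0) (hX : h.HX) (s s' : Sgn) (n : ℤ) :
    expSeries (-D.η q s) * PowerSeries.C (D.X s' n) =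
      dShift (ratN q (s.conj s'.opp)) (↑(h.gU ^ (-s'.toInt)) : A) s (D.X s') n *
        expSeries (-D.η q s) := by
  refine expSeries_mul_C (by rw [map_neg, coeff_zero_η, neg_zero]) (fun i k => by
    rw [map_neg, map_neg]
    exact (h.commute_η s i k).neg_left.neg_right) (fun i => by
    rw [map_neg]
    exact (h.g_ipow_η s s' i).neg_right) (eul_ratN hq _) (coeff_zero_ratN hq _) (fun k m => ?_) n
  have hl : PowerSeries.coeff k (ratLog q (s.conj s'.opp)) =
      -PowerSeries.coeff k (ratLog q (s.conj s')) := by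
    rw [ratLog, ratLog, PowerSeries.coeff_mk, PowerSeries.coeff_mk, Sgn.toInt_conj, Sgn.toInt_conj,
      Sgn.toInt_opp]
    push_cast
    ring
  rw [map_neg, hl, neg_smul, ← hX s s' k m, neg_mul, mul_neg]
  module

lemma C_K_mul_dShift (hq : q ≠ 0) (r : PowerSeries ℂ) (s s' : Sgn) (n : ℤ) :
    PowerSeries.C (↑(h.kU ^ s.toInt) : A) *
      dShift r (↑(h.gU ^ (-s'.toInt)) : A) s (D.X s') n =
    q ^ (s.toInt * s'.toInt) •
    (dShift r (↑(h.gU ^ (-s'.toInt)) : A) s (D.X s') n *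
      PowerSeries.C (↑(h.kU ^ s.toInt) : A)) := by
  ext k
  have hgk : Commute (↑(h.kU ^ s.toInt) : A) (↑(h.gU ^ (-s'.toInt)) ^ k : A) :=
    (h.commute_g_zpow (Commute.units_zpow_right (u := h.kU) h.g_K _) _).symm.pow_right k
  rw [PowerSeries.coeff_C_mul, PowerSeries.coeff_smul, PowerSeries.coeff_mul_C, coeff_dShift,
    mul_smul_comm, ← mul_assoc, hgk.eq, mul_assoc, h.K_zpow_X hq, smul_mul_assoc, mul_smul_comm,
    mul_assoc, smul_comm]

/-- The series `ψ^s` conjugates `X^{s'}` by a rational function. -/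
lemma ψ_mul_X (hq : q ≠ 0) (hX : h.HX) (s s' : Sgn) (n : ℤ) :
    (D.toCurrent q).ψ s * PowerSeries.C (D.X s' n) =
      dShift (rat q (s.conj s')) (↑(h.gU ^ (-s'.toInt)) : A) s (D.X s') n *
        (D.toCurrent q).ψ s := by
  rw [toCurrent_ψ, h.ipow_K, mul_assoc, h.exp_X hq hX, dShift_ratN, smul_mul_assoc, mul_smul_comm,
    ← mul_assoc, h.C_K_mul_dShift hq, smul_mul_assoc, _root_.smul_smul, Sgn.toInt_conj, zpow_neg,
    inv_mul_cancel₀ (zpow_ne_zero _ hq), one_smul, mul_assoc]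

lemma X_mul_ψ (hq : q ≠ 0) (hX : h.HX) (s s' : Sgn) (n : ℤ) :
    PowerSeries.C (D.X s' n) * (D.toCurrent q).ψ s = (D.toCurrent q).ψ s *
      dShift (rat q (s.conj s'.opp)) (↑(h.gU ^ (-s'.toInt)) : A) s (D.X s') n := by
  have h₁ := h.exp_neg_X hq hX s s' n
  have h₂ : PowerSeries.C (D.X s' n) * expSeries (D.η q s) = expSeries (D.η q s) *
      dShift (ratN q (s.conj s'.opp)) (↑(h.gU ^ (-s'.toInt)) : A) s (D.X s') n := by
    have := congrArg (fun x => expSeries (D.η q s) * x * expSeries (D.η q s)) h₁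
    simpa only [← mul_assoc, h.expSeries_η_mul, one_mul, mul_assoc _ (expSeries (-D.η q s)),
      h.expSeries_mul_η, mul_one] using this
  have hK : D.X s' n * ↑(h.kU ^ s.toInt) =
      q ^ (-(s.toInt * s'.toInt)) • (↑(h.kU ^ s.toInt) * D.X s' n) := by
    rw [h.K_zpow_X hq, _root_.smul_smul, zpow_neg, inv_mul_cancel₀ (zpow_ne_zero _ hq), one_smul]
  rw [toCurrent_ψ, h.ipow_K, ← mul_assoc, ← map_mul, hK, C_smul, map_mul, smul_mul_assoc, mul_assoc,
    h₂, dShift_ratN, mul_smul_comm, mul_smul_comm, _root_.smul_smul, ← zpow_add₀ hq, mul_assoc,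
    Sgn.toInt_conj, Sgn.toInt_opp, show -(s.toInt * s'.toInt) + -(s.toInt * -s'.toInt) = 0 by ring,
    zpow_zero, one_smul]

end ModeData.Cartan

end

end

/-! ### The Cartan part of the mode relations -/

noncomputable section

section

variable {A : Type*} [Ring A] [Algebra ℂ A] {q : ℂ} {D : ModeData A}

lemma Sgn.exists_eq_toInt_mul {n : ℤ} (hn : n ≠ 0) :
    ∃ (s : Sgn) (k : ℕ), k ≠ 0 ∧ n = s.toInt * k := by
  rcases lt_or_gt_of_ne hn with h | h
  · exact ⟨.neg, n.natAbs, by omega, by simp only [Sgn.toInt]; omega⟩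
  · exact ⟨.pos, n.natAbs, by omega, by simp only [Sgn.toInt]; omega⟩

lemma ipow_one {A : Type*} [Ring A] (a b : A) : ipow a b 1 = a := pow_one a

lemma ipow_neg_one {A : Type*} [Ring A] (a b : A) : ipow a b (-1) = b := pow_one b

lemma commute_of_commute_mul_unit {A : Type*} [Ring A] {x y : A} (k : Aˣ) (hk : Commute x (k : A))
    (h : Commute x (↑k * y)) : Commute x y := by
  have := (Commute.units_inv_right (u := k) hk).mul_right h
  rwa [Units.inv_mul_cancel_left] at this

lemma ModeData.cartan_of_modeRel (h : ∀ x y, ModeRel q D x y → x = y) : D.Cartan q where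
  g_gi := h _ _ .g_gi
  gi_g := h _ _ .gi_g
  K_Ki := h _ _ .K_Ki
  Ki_K := h _ _ .Ki_K
  g_K := h _ _ .g_K
  g_H n hn := h _ _ (.g_H n hn)
  g_X s n := h _ _ (.g_X s n)
  K_H n hn := h _ _ (.K_H n hn)
  K_X s n := by
    rw [← smul_mul_assoc, ← h _ _ (.K_X s n), mul_assoc _ D.Ki, h _ _ .Ki_K, mul_one]
  H_H s i k hi hk := by
    have := h _ _ (.H_H (s.toInt * i) (s.toInt * k) (toInt_mul_ne_zero s hi)
      (toInt_mul_ne_zero s hk))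
    rw [if_neg (by
      rw [← mul_add]
      exact_mod_cast toInt_mul_ne_zero s (k := i + k) (by omega))] at this
    exact sub_eq_zero.mp this

lemma coeff_zero_mul {A : Type*} [Ring A] (a b : PowerSeries A) : PowerSeries.coeff 0 (a * b) =
    PowerSeries.coeff 0 a * PowerSeries.coeff 0 b := by
  rw [PowerSeries.coeff_mul, Finset.Nat.antidiagonal_zero, Finset.sum_singleton]

lemma ModeData.coeff_zero_ψ (D : ModeData A) (s : Sgn) :
    PowerSeries.coeff 0 ((D.toCurrent q).ψ s) = ipow D.K D.Ki s.toInt := by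
  rw [toCurrent_ψ, PowerSeries.coeff_C_mul, coeff_zero_expSeries, mul_one]

lemma ModeData.coeff_zero_ψi (D : ModeData A) (s : Sgn) :
    PowerSeries.coeff 0 ((D.toCurrent q).ψi s) = ipow D.K D.Ki (-s.toInt) := by
  rw [toCurrent_ψi, PowerSeries.coeff_mul_C, coeff_zero_expSeries, one_mul]

lemma coeff_zero_rat_pos (q : ℂ) : PowerSeries.coeff 0 (rat q .pos) = q⁻¹ := by
  simp [rat, ratP]

/-- The relations of Cartan type follow from the current relations, because the coefficients of a
logarithm are polynomials in those of the exponential. -/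
lemma ModeData.cartan_of_currentRel (hq : q ≠ 0) (hq1 : q ^ 2 ≠ 1)
    (h : ∀ x y, CurrentRel q (D.toCurrent q) x y → x = y) : D.Cartan q := by
  have K_Ki : D.K * D.Ki = 1 := by
    have := h _ _ (.ψ_ψi .pos 0)
    rw [coeff_zero_mul, coeff_zero_ψ, coeff_zero_ψi, PowerSeries.coeff_one, if_pos rfl] at this
    rwa [show Sgn.pos.toInt = 1 from rfl, ipow_one, ipow_neg_one] at this
  have Ki_K : D.Ki * D.K = 1 := by
    have := h _ _ (.ψi_ψ .pos 0)
    rw [coeff_zero_mul, coeff_zero_ψ, coeff_zero_ψi, PowerSeries.coeff_one, if_pos rfl] at this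
    rwa [show Sgn.pos.toInt = 1 from rfl, ipow_one, ipow_neg_one] at this
  let k : Aˣ := ⟨D.K, D.Ki, K_Ki, Ki_K⟩
  have hk : ∀ n, ipow D.K D.Ki n = ↑(k ^ n) := ipow_eq k
  have hψ : ∀ s n, PowerSeries.coeff n ((D.toCurrent q).ψ s) =
      ↑(k ^ s.toInt) * PowerSeries.coeff n (expSeries (D.η q s)) := fun s n => by
    rw [toCurrent_ψ, PowerSeries.coeff_C_mul, hk]
  have hψ0 : ∀ s, PowerSeries.coeff 0 ((D.toCurrent q).ψ s) = (↑(k ^ s.toInt) : A) := fun s => by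
    rw [coeff_zero_ψ, hk]
  -- an element that commutes with `ψ^s` commutes with the coefficients of its logarithm
  have main : ∀ (s : Sgn) (x : A),
      (∀ n, Commute x (PowerSeries.coeff n ((D.toCurrent q).ψ s))) →
      Commute x (↑(k ^ s.toInt) : A) ∧ ∀ n, Commute x (PowerSeries.coeff n (D.η q s)) := by
    intro s x hx
    have h0 := hψ0 s ▸ hx 0
    exact ⟨h0, commute_of_expSeries (coeff_zero_η D s) fun n =>
      commute_of_commute_mul_unit _ h0 (hψ s n ▸ hx n)⟩
  have hH : ∀ (s : Sgn) (x : A), (∀ n, Commute x (PowerSeries.coeff n (D.η q s))) →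
      ∀ n : ℕ, n ≠ 0 → Commute x (D.H (s.toInt * n)) := by
    intro s x hx n hn
    have := hx n
    rw [coeff_η D s hn] at this
    have h2 := this.smul_right ((s.toInt : ℂ) * (q - q⁻¹))⁻¹
    rwa [_root_.smul_smul, inv_mul_cancel₀ (mul_ne_zero (toInt_ne_zero s) (sub_inv_ne_zero hq hq1)),
      one_smul] at h2
  have g_all : ∀ s, _ := fun s => main s D.g fun n => h _ _ (.g_ψ s n)
  have K_all : ∀ s, ∀ n, Commute (↑(k ^ s.toInt) : A) (PowerSeries.coeff n (D.η q s)) := fun s =>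
    (main s _ fun n => by rw [← hψ0]; exact h _ _ (.ψ_same s 0 n)).2
  have K_all' : ∀ s, ∀ n, Commute D.K (PowerSeries.coeff n (D.η q s)) := by
    intro s n
    cases s
    · simpa [Sgn.toInt] using K_all .pos n
    · have := Commute.units_inv_left (K_all .neg n)
      simpa [Sgn.toInt] using this
  refine
    { g_gi := h _ _ .g_gi
      gi_g := h _ _ .gi_g
      K_Ki := K_Ki
      Ki_K := Ki_K
      g_K := by simpa [Sgn.toInt] using (g_all .pos).1
      g_H := fun n hn => ?_
      g_X := fun s n => h _ _ (.g_X s n)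
      K_H := fun n hn => ?_
      K_X := fun s n => ?_
      H_H := fun s i j hi hj => ?_ }
  · obtain ⟨s, m, hm, rfl⟩ := Sgn.exists_eq_toInt_mul hn
    exact hH s _ (g_all s).2 m hm
  · obtain ⟨s, m, hm, rfl⟩ := Sgn.exists_eq_toInt_mul hn
    exact hH s _ (K_all' s) m hm
  · cases s
    · have := h _ _ (.ψ_Xpos .pos 0 n)
      rw [coeff_zero_mul, coeff_zero_mul, coeff_zero_ψ, coeff_zero_ψi, coeff_zero_rat_pos,
        PowerSeries.coeff_zero_C, hk, hk, pow_zero, one_mul, zpow_neg] at this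
      have h2 := congrArg (fun x => q • ((↑(k ^ Sgn.pos.toInt) : A) * x)) this
      simp only [← mul_assoc, Units.mul_inv, one_mul, mul_smul_comm] at h2
      rw [_root_.smul_smul, mul_inv_cancel₀ hq, one_smul] at h2
      simpa [Sgn.toInt, toCurrent, k] using h2.symm
    · have := h _ _ (.ψ_Xneg .pos 0 n)
      rw [coeff_zero_mul, coeff_zero_mul, coeff_zero_ψ, coeff_zero_ψi, coeff_zero_rat_pos,
        PowerSeries.coeff_zero_C, hk, hk, pow_zero, one_mul, zpow_neg] at this
      have h2 := congrArg (fun x => x * (↑(k ^ Sgn.pos.toInt) : A)) this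
      simp only [Units.inv_mul_cancel_right, smul_mul_assoc] at h2
      simpa [Sgn.toInt, toCurrent, k] using h2
  · have h1 : ∀ m n, Commute (PowerSeries.coeff m (D.η q s))
        (PowerSeries.coeff n ((D.toCurrent q).ψ s)) := fun m n =>
      ((main s _ fun n' => h _ _ (.ψ_same s n n')).2 m).symm
    exact (hH s _ (fun n => ((hH s _ (fun m => ((main s _ (h1 m)).2 n).symm) i hi).symm)) j hj)

namespace ModeData.Cartan

variable (C : D.Cartan q)

include C

lemma HX_of_modeRel (hq : q ≠ 0) (hq1 : q ^ 2 ≠ 1) (h : ∀ x y, ModeRel q D x y → x = y) :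
    C.HX := by
  intro s s' k n
  by_cases hk : k = 0
  · simp [hk, ratLog]
  · refine (C.H_X_iff hq hq1 s s' hk n).mp ?_
    have := h _ _ (.H_X s' (s.toInt * k) n (toInt_mul_ne_zero s hk))
    exact this

lemma HX_of_currentRel (hq : q ≠ 0) (h : ∀ x y, CurrentRel q (D.toCurrent q) x y → x = y) :
    C.HX := by
  have hs : ∀ s : Sgn, q ^ (s.toInt * s.toInt) = q := fun s => by rw [toInt_mul_self, zpow_one]
  intro s s' k n
  cases s'
  · have hd : ∀ n, (D.toCurrent q).ψi s * PowerSeries.C (D.X .pos n) * (D.toCurrent q).ψ s =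
        dShift (rat q s) (↑(C.gU ^ (-Sgn.pos.toInt)) : A) s (D.X .pos) n := fun n => by
      ext j
      rw [coeff_dShift, ← C.ipow_g, show -Sgn.pos.toInt = -1 from rfl, ipow_neg_one]
      exact h _ _ (.ψ_Xpos s j n)
    have key : ∀ n, expSeries (-D.η q s) * PowerSeries.C (D.X .pos n) =
        dShift (ratN q s) (↑(C.gU ^ (-Sgn.pos.toInt)) : A) s (D.X .pos) n *
          expSeries (-D.η q s) := fun n => by
      have h₁ := congrArg (· * (D.toCurrent q).ψi s) (hd n)
      simp only [mul_assoc, C.ψ_mul_ψi, mul_one] at h₁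
      rw [toCurrent_ψi, C.ipow_K, ← Sgn.toInt_opp, mul_assoc, ← map_mul, C.K_zpow_X hq, C_smul,
        map_mul, mul_smul_comm, ← mul_assoc, ← mul_assoc, ← smul_mul_assoc] at h₁
      have hu : ∀ x : PowerSeries A, x * PowerSeries.C (↑(C.kU ^ s.opp.toInt) : A) *
          PowerSeries.C (↑(C.kU ^ s.opp.toInt)⁻¹ : A) = x := fun x => by
        rw [mul_assoc, ← map_mul, Units.mul_inv, map_one, mul_one]
      have h₂ := congrArg (· * PowerSeries.C (↑(C.kU ^ s.opp.toInt)⁻¹ : A)) h₁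
      simp only [hu] at h₂
      rw [dShift_ratN, smul_mul_assoc, ← h₂, _root_.smul_smul, ← zpow_add₀ hq, Sgn.toInt_opp]
      simp [Sgn.toInt]
    have := commutator_of_expSeries_mul_C (by rw [map_neg, coeff_zero_η, neg_zero])
      (fun i k => by
        rw [map_neg, map_neg]
        exact (C.commute_η s i k).neg_left.neg_right) (fun i => by
        rw [map_neg]
        exact (C.g_ipow_η s .pos i).neg_right) (eul_ratN hq s) (coeff_zero_ratN hq s) key k n
    have hl : PowerSeries.coeff k (ratLog q (s.conj .pos)) = -PowerSeries.coeff k (ratLog q s) := by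
      rw [ratLog, ratLog, PowerSeries.coeff_mk, PowerSeries.coeff_mk, Sgn.conj, Sgn.toInt_opp]
      push_cast
      ring
    rw [hl, neg_smul, ← this, map_neg, neg_mul, mul_neg]
    module
  · have hd : ∀ n, (D.toCurrent q).ψ s * PowerSeries.C (D.X .neg n) * (D.toCurrent q).ψi s =
        dShift (rat q s) (↑(C.gU ^ (-Sgn.neg.toInt)) : A) s (D.X .neg) n := fun n => by
      ext j
      rw [coeff_dShift, ← C.ipow_g, show -Sgn.neg.toInt = 1 from rfl, ipow_one]
      exact h _ _ (.ψ_Xneg s j n)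
    have key : ∀ n, expSeries (D.η q s) * PowerSeries.C (D.X .neg n) =
        dShift (ratN q s) (↑(C.gU ^ (-Sgn.neg.toInt)) : A) s (D.X .neg) n *
          expSeries (D.η q s) := fun n => by
      have h₁ := congrArg (· * (D.toCurrent q).ψ s) (hd n)
      simp only [mul_assoc, C.ψi_mul_ψ, mul_one] at h₁
      have hu : ∀ x : PowerSeries A, PowerSeries.C (↑(C.kU ^ s.toInt)⁻¹ : A) *
          (PowerSeries.C (↑(C.kU ^ s.toInt) : A) * x) = x := fun x => by
        rw [← mul_assoc, ← map_mul, Units.inv_mul, map_one, one_mul]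
      have hdK : dShift (rat q s) (↑(C.gU ^ (-Sgn.neg.toInt)) : A) s (D.X .neg) n *
          PowerSeries.C (↑(C.kU ^ s.toInt) : A) =
            q ^ s.toInt • (PowerSeries.C (↑(C.kU ^ s.toInt) : A) * dShift (rat q s) (↑(C.gU ^ (-Sgn.neg.toInt)) : A) s (D.X .neg) n) := by
        rw [C.C_K_mul_dShift hq, _root_.smul_smul, ← zpow_add₀ hq]
        simp [Sgn.toInt]
      rw [toCurrent_ψ, C.ipow_K, mul_assoc, ← mul_assoc (dShift _ _ _ _ _), hdK, smul_mul_assoc,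
        mul_assoc] at h₁
      have h₂ := congrArg (PowerSeries.C (↑(C.kU ^ s.toInt)⁻¹ : A) * ·) h₁
      simp only [hu, mul_smul_comm] at h₂
      rw [h₂, dShift_ratN, smul_mul_assoc]
    exact commutator_of_expSeries_mul_C (coeff_zero_η D s) (C.commute_η s) (C.g_ipow_η s .neg)
      (eul_ratN hq s) (coeff_zero_ratN hq s) key k n

lemma currents (hq : q ≠ 0) (hX : C.HX)
    (h_same : ∀ s n m, D.X s (n + 1) * D.X s m + q ^ s.toInt • (D.X s n * D.X s (m + 1))
        + (q ^ s.toInt • (D.X s m * D.X s (n + 1)) + D.X s (m + 1) * D.X s n) = 0)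
    (h_mixed : ∀ n m, D.X .pos n * D.X .neg m + D.X .neg m * D.X .pos n =
      (q - q⁻¹)⁻¹ • (ipow D.g D.gi (n - m) * (D.toCurrent q).ψZ .pos (n + m)
        - ipow D.g D.gi (m - n) * (D.toCurrent q).ψZ .neg (n + m))) :
    Currents q C.gU D.X (D.toCurrent q).ψ where
  g_X := C.g_X
  g_ψ s n := by
    rw [toCurrent_ψ, PowerSeries.coeff_C_mul, C.ipow_K]
    exact (Commute.units_zpow_right (u := C.kU) C.g_K _).mul_right (commute_expSeries (C.g_η s) n)
  X_ψ s n := by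
    rw [C.X_mul_ψ hq hX, show -Sgn.pos.toInt = -1 from rfl, zpow_neg_one]
    rfl
  ψ_X s n := by
    rw [C.ψ_mul_X hq hX, show -Sgn.pos.toInt = -1 from rfl, zpow_neg_one]
    rfl
  ψ_Y s n := by
    rw [C.ψ_mul_X hq hX, show -Sgn.neg.toInt = 1 from rfl, zpow_one]
    rfl
  X_same := h_same
  X_mixed n m := by
    rw [h_mixed, C.ipow_g, C.ipow_g]
    rfl

end ModeData.Cartan

end

end

/-! ### The commutators of the `H_n`, and the equivalence of currents and modes -/

noncomputable section

section

variable {A : Type*} [Ring A] [Algebra ℂ A] {q : ℂ} {D : ModeData A}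

namespace ModeData.Cartan

variable (C : D.Cartan q)

include C

lemma ψ_commute {s : Sgn} {x : A} (hK : Commute x D.K)
    (hx : ∀ i, Commute x (PowerSeries.coeff i (D.η q s))) (n : ℤ) :
    Commute x ((D.toCurrent q).ψZ s n) := by
  rw [CurrentData.ψZ, coefZ_eq_extZ, extZ]
  split_ifs
  · rw [toCurrent_ψ, PowerSeries.coeff_C_mul, C.ipow_K]
    exact (Commute.units_zpow_right (u := C.kU) hK _).mul_right (commute_expSeries hx _)
  · exact Commute.zero_right _

/-- The relation between `H_k` and `ψ⁻`: the commutator with `H_k` of the anticommutator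
`{X⁺_n, X⁻_m}` involves only `ψ⁻`, as the contributions of `ψ⁺` cancel. -/
lemma commutator_ψ_neg (hq : q ≠ 0) (hq1 : q ^ 2 ≠ 1) (hX : C.HX)
    (h_mixed : ∀ n m, D.X .pos n * D.X .neg m + D.X .neg m * D.X .pos n =
      (q - q⁻¹)⁻¹ • (ipow D.g D.gi (n - m) * (D.toCurrent q).ψZ .pos (n + m)
        - ipow D.g D.gi (m - n) * (D.toCurrent q).ψZ .neg (n + m))) (k : ℕ) (i : ℤ) :
    (k : ℂ) • (PowerSeries.coeff k (D.η q .pos) * (D.toCurrent q).ψZ .neg i -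
        (D.toCurrent q).ψZ .neg i * PowerSeries.coeff k (D.η q .pos)) =
      (-PowerSeries.coeff k (ratLog q .neg)) •
        (((↑(C.gU ^ (2 * k : ℤ)) : A) - ↑(C.gU ^ (-(2 * k : ℤ)))) *
          (D.toCurrent q).ψZ .neg (i + k)) := by
  set a := PowerSeries.coeff k (D.η q .pos) with ha
  set c := PowerSeries.coeff k (ratLog q .neg) with hc
  have hX₁ : ∀ n, (k : ℂ) • (a * D.X .pos n - D.X .pos n * a) =
      c • (↑(C.gU ^ (-(k : ℤ))) * D.X .pos (n + k)) := fun n => by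
    have := hX .pos .pos k n
    simp only [Sgn.conj, Sgn.opp, Sgn.toInt, one_mul] at this
    rw [this, ← Units.val_pow_eq_pow_val, ← zpow_natCast, ← zpow_mul, neg_one_mul]
  have hX₂ : ∀ n, (k : ℂ) • (a * D.X .neg n - D.X .neg n * a) =
      (-c) • (↑(C.gU ^ (k : ℤ)) * D.X .neg (n + k)) := fun n => by
    have := hX .pos .neg k n
    have hl : PowerSeries.coeff k (ratLog q .pos) = -c := by
      rw [hc, ratLog, ratLog, PowerSeries.coeff_mk, PowerSeries.coeff_mk]
      simp [Sgn.toInt]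
    simp only [Sgn.conj] at this
    rw [show -Sgn.neg.toInt = 1 from rfl, show Sgn.pos.toInt = 1 from rfl, one_mul, zpow_one, hl]
      at this
    rw [this, zpow_natCast, Units.val_pow_eq_pow_val]
  have hg : ∀ (n : ℤ) {x : A}, Commute D.g x → Commute (↑(C.gU ^ n) : A) x :=
    fun n x hx => C.commute_g_zpow hx n
  have hga : ∀ n : ℤ, Commute (↑(C.gU ^ n) : A) a := fun n => hg n (C.g_η .pos k)
  have hP : Commute a ((D.toCurrent q).ψZ .pos i) :=
    C.ψ_commute (C.K_η .pos k).symm (C.commute_η .pos k) i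
  have m₁ := h_mixed i 0
  have m₂ := h_mixed (i + k) 0
  have m₃ := h_mixed i (0 + k)
  simp only [C.ipow_g] at m₁ m₂ m₃
  rw [add_zero] at m₁ m₂
  rw [zero_add] at m₃
  rw [sub_zero, zero_sub] at m₁ m₂
  set P := (D.toCurrent q).ψZ .pos
  set N := (D.toCurrent q).ψZ .neg
  have hd : (q - q⁻¹)⁻¹ ≠ 0 := inv_ne_zero (sub_inv_ne_zero hq hq1)
  -- the commutator of `a` with the anticommutator of `X⁺` and `X⁻`
  have hL : (k : ℂ) • (a * (D.X .pos i * D.X .neg 0 + D.X .neg 0 * D.X .pos i) -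
      (D.X .pos i * D.X .neg 0 + D.X .neg 0 * D.X .pos i) * a) =
      c • (↑(C.gU ^ (-(k : ℤ))) * (D.X .pos (i + k) * D.X .neg 0 + D.X .neg 0 * D.X .pos (i + k))) -
      c • (↑(C.gU ^ (k : ℤ)) * (D.X .pos i * D.X .neg k + D.X .neg k * D.X .pos i)) := by
    have e₁ := congrArg (· * D.X .neg 0) (hX₁ i)
    have e₂ := congrArg (D.X .neg 0 * ·) (hX₁ i)
    have e₃ := congrArg (· * D.X .pos i) (hX₂ 0)
    have e₄ := congrArg (D.X .pos i * ·) (hX₂ 0)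
    simp only [smul_mul_assoc, mul_smul_comm, zero_add, mul_assoc, sub_mul, mul_sub,
      (hg (-(k : ℤ)) (C.g_X .neg 0)).symm.left_comm, (hg (k : ℤ) (C.g_X .pos i)).symm.left_comm]
      at e₁ e₂ e₃ e₄
    simp only [mul_add, add_mul, mul_assoc]
    linear_combination (norm := module) e₁ + e₂ + e₃ + e₄
  rw [m₁, m₂, m₃] at hL
  have z₁ : ∀ x : A, (↑(C.gU ^ (-(k : ℤ))) : A) * (↑(C.gU ^ (i + k)) * x) = ↑(C.gU ^ i) * x := by
    intro x
    rw [← mul_assoc, ← Units.val_mul, ← zpow_add]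
    congr 3
    ring
  have z₂ : ∀ x : A, (↑(C.gU ^ (k : ℤ)) : A) * (↑(C.gU ^ (i - k)) * x) = ↑(C.gU ^ i) * x := by
    intro x
    rw [← mul_assoc, ← Units.val_mul, ← zpow_add]
    congr 3
    ring
  have z₃ : ∀ x : A, (↑(C.gU ^ (-(k : ℤ))) : A) * (↑(C.gU ^ (-(i + k))) * x) =
      ↑(C.gU ^ (-i)) * (↑(C.gU ^ (-(2 * k : ℤ))) * x) := by
    intro x
    rw [← mul_assoc, ← mul_assoc, ← Units.val_mul, ← Units.val_mul, ← zpow_add, ← zpow_add]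
    congr 3
    ring
  have z₄ : ∀ x : A, (↑(C.gU ^ (k : ℤ)) : A) * (↑(C.gU ^ (k - i)) * x) =
      ↑(C.gU ^ (-i)) * (↑(C.gU ^ (2 * k : ℤ)) * x) := by
    intro x
    rw [← mul_assoc, ← mul_assoc, ← Units.val_mul, ← Units.val_mul, ← zpow_add, ← zpow_add]
    congr 3
    ring
  simp only [mul_smul_comm, smul_mul_assoc, mul_sub, sub_mul, z₁, z₂, z₃, z₄] at hL
  refine (Units.mul_right_inj (C.gU ^ (-i))).mp (smul_right_injective A hd ?_)
  have h₁ : a * (↑(C.gU ^ i) * P i) = ↑(C.gU ^ i) * P i * a := by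
    rw [← mul_assoc, ← (hga i).eq, mul_assoc, hP.eq, mul_assoc]
  have h₂ : a * (↑(C.gU ^ (-i)) * N i) = ↑(C.gU ^ (-i)) * (a * N i) := by
    rw [← mul_assoc, ← (hga (-i)).eq, mul_assoc]
  rw [h₁, h₂, mul_assoc _ (N i)] at hL
  simp only [mul_smul_comm, sub_mul, mul_sub]
  linear_combination (norm := module) -hL

/-- The relation between `H_k` and `H_{-j}`, in terms of `η`: the logarithm of the relation between
`H_k` and `ψ⁻`. -/
lemma commutator_η (hq : q ≠ 0) (hq1 : q ^ 2 ≠ 1) (hX : C.HX)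
    (h_mixed : ∀ n m, D.X .pos n * D.X .neg m + D.X .neg m * D.X .pos n =
      (q - q⁻¹)⁻¹ • (ipow D.g D.gi (n - m) * (D.toCurrent q).ψZ .pos (n + m)
        - ipow D.g D.gi (m - n) * (D.toCurrent q).ψZ .neg (n + m))) {k : ℕ} (hk : k ≠ 0) (j : ℕ) :
    (j : ℂ) • (PowerSeries.coeff k (D.η q .pos) * PowerSeries.coeff j (D.η q .neg) -
        PowerSeries.coeff j (D.η q .neg) * PowerSeries.coeff k (D.η q .pos)) =
      if j = k then (-PowerSeries.coeff k (ratLog q .neg)) •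
        ((↑(C.gU ^ (2 * k : ℤ)) : A) - ↑(C.gU ^ (-(2 * k : ℤ)))) else 0 := by
  set a := PowerSeries.coeff k (D.η q .pos) with ha
  set G := (-PowerSeries.coeff k (ratLog q .neg)) •
        ((↑(C.gU ^ (2 * k : ℤ)) : A) - ↑(C.gU ^ (-(2 * k : ℤ)))) with hG
  set E := expSeries (D.η q .neg) with hE
  set b := PowerSeries.C a with hb
  set T : PowerSeries A := PowerSeries.C G * PowerSeries.X ^ k with hT
  have hGη : ∀ i, Commute G (PowerSeries.coeff i (D.η q .neg)) := fun i =>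
    ((C.commute_g_zpow (C.g_η .neg i) _).sub_left (C.commute_g_zpow (C.g_η .neg i) _)).smul_left _
  have coefT : ∀ (x : PowerSeries A) (n : ℕ), PowerSeries.coeff n (T * x) =
      if k ≤ n then G * PowerSeries.coeff (n - k) x else 0 := fun x n => by
    rw [hT, mul_assoc, PowerSeries.coeff_C_mul, PowerSeries.coeff_X_pow_mul']
    split_ifs <;> simp
  have hTη : Commute T (eul (D.η q .neg)) := by
    refine (Commute.mul_left (commute_of_coeff fun i j => ?_) (PowerSeries.X_pow_mul.symm).symm)
    rw [PowerSeries.coeff_C, coeff_eul]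
    split_ifs
    · exact (hGη j).smul_right _
    · exact Commute.zero_left _
  have hKg : ∀ n : ℤ, Commute (↑(C.kU⁻¹) : A) (↑(C.gU ^ n)) := fun n =>
    (C.commute_g_zpow (Commute.units_inv_right (u := C.kU) C.g_K) n).symm
  have hKG : Commute (↑(C.kU⁻¹) : A) G := ((hKg _).sub_right (hKg _)).smul_right _
  have hKa : Commute (↑(C.kU⁻¹) : A) a := Commute.units_inv_left (u := C.kU) (C.K_η .pos k)
  -- the commutator with `H_k` acts on the exponential by multiplication by `T`
  have h₁ : (k : ℂ) • (b * E - E * b) = T * E := by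
    ext n
    have hψ : ∀ m : ℤ, (D.toCurrent q).ψZ .neg m = ↑(C.kU⁻¹) * extZ
        (fun n => PowerSeries.coeff n E) (-m) := fun m => by
      rw [CurrentData.ψZ, coefZ_eq_extZ, show Sgn.neg.toInt = -1 from rfl, neg_one_mul,
        toCurrent_ψ, C.ipow_K, show Sgn.neg.toInt = -1 from rfl, zpow_neg_one]
      simp only [PowerSeries.coeff_C_mul, extZ]
      split_ifs <;> simp [hE]
    have := C.commutator_ψ_neg hq hq1 hX h_mixed k (-n)
    rw [hψ, hψ, neg_neg, extZ_natCast, ← smul_mul_assoc, ← hG, ← ha, ← mul_assoc, ← mul_assoc,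
      ← hKa.eq, ← hKG.eq, mul_assoc, mul_assoc, mul_assoc, ← mul_sub, ← mul_smul_comm] at this
    rw [PowerSeries.coeff_smul, map_sub, hb, PowerSeries.coeff_C_mul, PowerSeries.coeff_mul_C,
      coefT, (Units.mul_right_inj _).mp this]
    split_ifs with hkn
    · rw [show -(-(n : ℤ) + k) = ((n - k : ℕ) : ℤ) by omega, extZ_natCast]
    · rw [extZ_of_neg _ (by omega), mul_zero]
  have hE' : eul E = eul (D.η q .neg) * E := eul_expSeries' (coeff_zero_η D _) (C.commute_η _)
  have hE'' : eul E = E * eul (D.η q .neg) := eul_expSeries (coeff_zero_η D _)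
    (commute_of_coeff fun i k => by
      rw [coeff_eul]
      exact (C.commute_η .neg i k).smul_right _)
  have hT' : eul T = (k : ℂ) • T := by
    ext n
    rw [coeff_eul, PowerSeries.coeff_smul, hT, PowerSeries.coeff_C_mul, PowerSeries.coeff_X_pow]
    split_ifs with h <;> simp [h]
  set v := eul (D.η q .neg) with hv
  have h₂ := congrArg eul h₁
  rw [map_smul, map_sub, eul_mul, eul_mul, eul_mul, hb, eul_C, ← hb, hT', hE'] at h₂
  have hEinv := C.expSeries_η_mul .neg
  rw [← hE] at hEinv
  have h₃ : (b * v - v * b - T) * E = 0 := by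
    refine smul_right_injective _ (Nat.cast_ne_zero.mpr hk : (k : ℂ) ≠ 0) ?_
    have h₄ := congrArg (v * ·) h₁
    simp only [mul_smul_comm, mul_sub, ← mul_assoc, ← hTη.eq] at h₄
    simp only [smul_zero, zero_mul, zero_add, mul_zero, add_zero, smul_mul_assoc, sub_mul,
      mul_assoc] at h₂ h₄ ⊢
    linear_combination (norm := module) h₂ - h₄
  have h₅ : b * v - v * b = T := by
    rw [← sub_eq_zero, ← mul_one (_ - T), ← hEinv, ← mul_assoc, h₃, zero_mul]
  have h₆ := congrArg (PowerSeries.coeff j) h₅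
  rw [map_sub, hb, PowerSeries.coeff_C_mul, PowerSeries.coeff_mul_C, hv, coeff_eul, hT,
    PowerSeries.coeff_C_mul, PowerSeries.coeff_X_pow, mul_smul_comm, smul_mul_assoc, ← smul_sub]
    at h₆
  rw [h₆]
  split_ifs <;> simp

/-- The relation between `H_k` and `H_{-j}` for `j, k > 0`. -/
lemma H_H_opp (hq : q ≠ 0) (hq1 : q ^ 2 ≠ 1) (hX : C.HX)
    (h_mixed : ∀ n m, D.X .pos n * D.X .neg m + D.X .neg m * D.X .pos n =
      (q - q⁻¹)⁻¹ • (ipow D.g D.gi (n - m) * (D.toCurrent q).ψZ .pos (n + m)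
        - ipow D.g D.gi (m - n) * (D.toCurrent q).ψZ .neg (n + m))) {k j : ℕ} (hk : k ≠ 0)
    (hj : j ≠ 0) :
    D.H k * D.H (-j) - D.H (-j) * D.H k =
      if j = k then ((-1) ^ k * (qint q k / k)) •
        ((q - q⁻¹)⁻¹ • (ipow D.g D.gi (2 * k) - ipow D.g D.gi (-(2 * k)))) else 0 := by
  have hd := sub_inv_ne_zero hq hq1
  have hj' : (j : ℂ) ≠ 0 := Nat.cast_ne_zero.mpr hj
  have h := C.commutator_η hq hq1 hX h_mixed hk j
  rw [coeff_η D _ hk, coeff_η D _ hj, show Sgn.pos.toInt = 1 from rfl,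
    show Sgn.neg.toInt = -1 from rfl, one_mul, neg_one_mul, smul_mul_smul_comm, smul_mul_smul_comm,
    mul_comm (((-1 : ℤ) : ℂ) * _), ← smul_sub, _root_.smul_smul] at h
  refine smul_right_injective A (mul_ne_zero hj' (mul_ne_zero (mul_ne_zero
    (by norm_num : ((1 : ℤ) : ℂ) ≠ 0) hd) (mul_ne_zero (by norm_num : ((-1 : ℤ) : ℂ) ≠ 0) hd)))
    (h.trans ?_)
  split_ifs with hjk
  · subst hjk
    have hl : PowerSeries.coeff j (ratLog q .neg) = (-1) ^ j * (q ^ j - q⁻¹ ^ j) := by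
      rw [ratLog, PowerSeries.coeff_mk]
      simp [Sgn.toInt]
    simp only [_root_.smul_smul, C.ipow_g]
    congr 1
    rw [hl, qint, zpow_neg, zpow_natCast, inv_pow]
    push_cast
    field_simp
  · exact (smul_zero _).symm

end ModeData.Cartan

lemma ModeData.modeRel_of_currentRel (hq : q ≠ 0) (hq1 : q ^ 2 ≠ 1)
    (h : ∀ x y, CurrentRel q (D.toCurrent q) x y → x = y) (x y : A) (hxy : ModeRel q D x y) :
    x = y := by
  have C := cartan_of_currentRel hq hq1 h
  have hX := C.HX_of_currentRel hq h
  have h_mixed := fun n m => h _ _ (.X_mixed n m)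
  cases hxy with
  | g_gi => exact C.g_gi
  | gi_g => exact C.gi_g
  | K_Ki => exact C.K_Ki
  | Ki_K => exact C.Ki_K
  | g_K => exact C.g_K
  | g_H n hn => exact C.g_H n hn
  | g_X s n => exact C.g_X s n
  | K_H n hn => exact C.K_H n hn
  | K_X s n => rw [C.K_X, smul_mul_assoc, mul_assoc, C.K_Ki, mul_one]
  | H_H n m hn hm =>
    obtain ⟨s, k, hk, rfl⟩ := Sgn.exists_eq_toInt_mul hn
    obtain ⟨s', j, hj, rfl⟩ := Sgn.exists_eq_toInt_mul hm
    cases s <;> cases s' <;> simp only [show Sgn.pos.toInt = 1 from rfl,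
      show Sgn.neg.toInt = -1 from rfl, one_mul, neg_one_mul]
    · rw [if_neg (by omega), sub_eq_zero]
      simpa [Sgn.toInt] using (C.H_H .pos k j hk hj).eq
    · rw [C.H_H_opp hq hq1 hX h_mixed hk hj]
      by_cases hjk : j = k
      · subst hjk
        rw [if_pos rfl, if_pos (by omega)]
        simp
      · rw [if_neg hjk, if_neg (by omega)]
    · rw [← neg_sub, C.H_H_opp hq hq1 hX h_mixed hj hk]
      by_cases hjk : j = k
      · subst hjk
        rw [if_pos rfl, if_pos (by omega)]
        have hz : (-1 : ℂ) ^ (-(j : ℤ)) = (-1) ^ j := by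
          rw [zpow_neg, zpow_natCast, ← inv_pow, inv_neg_one]
        have hqi : qint q (-j) / (-(j : ℤ) : ℤ) = qint q j / j := by
          rw [qint, qint, neg_neg]
          push_cast
          rw [div_neg, ← neg_div]
          congr 1
          ring
        rw [hz, hqi, mul_neg, neg_neg]
        module
      · rw [if_neg (Ne.symm hjk), if_neg (by omega), neg_zero]
    · rw [if_neg (by omega), sub_eq_zero]
      simpa [Sgn.toInt] using (C.H_H .neg k j hk hj).eq
  | H_X s' n m hn =>
    obtain ⟨s, k, hk, rfl⟩ := Sgn.exists_eq_toInt_mul hn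
    exact (C.H_X_iff hq hq1 s s' hk m).mpr (hX s s' k m)
  | X_same s n m =>
    rw [← h _ _ (.X_same s n m)]
    simp only [toCurrent]
    abel
  | X_mixed n m => exact h_mixed n m

lemma ModeData.currentRel_of_modeRel (hq : q ≠ 0) (hq1 : q ^ 2 ≠ 1)
    (h : ∀ x y, ModeRel q D x y → x = y) (x y : A) (hxy : CurrentRel q (D.toCurrent q) x y) :
    x = y := by
  have C := cartan_of_modeRel h
  have hX := C.HX_of_modeRel hq hq1 h
  refine (C.currents hq hX (fun s n m => ?_) fun n m => h _ _ (.X_mixed n m)).rel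
    (D := D.toCurrent q) (g := C.gU) hq hq1 rfl rfl C.ψ_mul_ψi C.ψi_mul_ψ hxy
  rw [← h _ _ (.X_same s n m)]
  abel

/-- The current relations of `ψ^± = K^{±1} exp(…)` are equivalent to the mode relations. -/
theorem ModeData.currentRel_iff_modeRel (hq : q ≠ 0) (hq1 : q ^ 2 ≠ 1) (D : ModeData A) :
    (∀ x y, CurrentRel q (D.toCurrent q) x y → x = y) ↔ (∀ x y, ModeRel q D x y → x = y) :=
  ⟨modeRel_of_currentRel hq hq1, currentRel_of_modeRel hq hq1⟩

end

end

/-! ### The logarithm of a power series -/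

noncomputable section

section Log

variable {S : Type*} [CommRing S] [Algebra ℂ S]

/-- The logarithm of `1 + u` is `∑ (-1)^{m-1} u^m / m`. -/
lemma coeff_eq_sum_log {h : PowerSeries S} (h0 : PowerSeries.coeff 0 h = 0) {n : ℕ} (hn : 0 < n) :
    PowerSeries.coeff n h = ∑ m ∈ Finset.range n, ((-1) ^ m / (m + 1 : ℂ)) •
      PowerSeries.coeff n ((expSeries h - 1) ^ (m + 1)) := by
  have hcomm : ∀ a b : S, Commute a b := fun a b => mul_comm a b
  set E := expSeries h with hE
  set u := E - 1 with hu
  have hu0 : PowerSeries.X ∣ u := by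
    rw [PowerSeries.X_dvd_iff, ← PowerSeries.coeff_zero_eq_constantCoeff_apply, hu, map_sub, hE,
      coeff_zero_expSeries, PowerSeries.coeff_one, if_pos rfl, sub_self]
  set l : PowerSeries S := ∑ m ∈ Finset.range n, ((-1) ^ m / (m + 1 : ℂ)) • u ^ (m + 1) with hl
  have hdu : eul u = E * eul h := by
    rw [hu, map_sub, eul_one, sub_zero, hE]
    exact eul_expSeries h0 (mul_comm _ _)
  have hdl : eul l = (∑ m ∈ Finset.range n, (-u) ^ m) * eul u := by
    rw [hl, map_sum, Finset.sum_mul]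
    refine Finset.sum_congr rfl fun m _ => ?_
    have hm : (m + 1 : ℂ) ≠ 0 := Nat.cast_add_one_ne_zero m
    rw [map_smul, eul_pow (Commute.all _ _), _root_.smul_smul, div_mul_cancel₀ _ hm, neg_pow u m,
      mul_assoc ((-1) ^ m), ← smul_one_mul ((-1 : ℂ) ^ m), Algebra.smul_def, mul_one, map_pow,
      map_neg, map_one]
  have hgeom : E * eul l = (1 - (-u) ^ n) * eul u := by
    have := geom_sum_mul_neg (-u) n
    rw [hdl, ← this, hu]
    ring
  have hdvd : PowerSeries.X ^ (n + 1) ∣ eul l - eul h := by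
    have h₁ : E * (eul l - eul h) = -((-u) ^ n * eul u) := by
      rw [mul_sub, hgeom, ← hdu]
      ring
    have hX : PowerSeries.X ∣ eul u := by
      rw [PowerSeries.X_dvd_iff, ← PowerSeries.coeff_zero_eq_constantCoeff_apply, coeff_eul]
      simp
    have h₂ : PowerSeries.X ^ (n + 1) ∣ E * (eul l - eul h) := by
      rw [h₁, pow_succ]
      exact (mul_dvd_mul (pow_dvd_pow_of_dvd hu0.neg_right n) hX).neg_right
    have h₃ := h₂.mul_left (expSeries (-h))
    rwa [← mul_assoc, expSeries_neg_mul h0 (fun _ _ => hcomm _ _), one_mul] at h₃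
  have hc := PowerSeries.X_pow_dvd_iff.mp hdvd n (Nat.lt_succ_self n)
  rw [map_sub, coeff_eul, coeff_eul, ← smul_sub] at hc
  have hc' := smul_right_injective S (Nat.cast_ne_zero.mpr hn.ne' : (n : ℂ) ≠ 0)
    (hc.trans (smul_zero _).symm)
  rw [← sub_eq_zero.mp hc', hl, map_sum]
  simp only [PowerSeries.coeff_smul]

lemma coeff_pow_eq_sum {u : PowerSeries S} (h0 : PowerSeries.coeff 0 u = 0) (n m : ℕ) :
    PowerSeries.coeff n (u ^ m) =
      ∑ P ∈ (Finset.piAntidiag (Finset.univ : Finset (Fin n)) m).filter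
        (fun P => ∑ i : Fin n, ((i : ℕ) + 1) * P i = n),
        (Nat.multinomial Finset.univ P : ℂ) •
          ∏ i : Fin n, PowerSeries.coeff ((i : ℕ) + 1) u ^ P i := by
  set w : PowerSeries S := ∑ i : Fin n, PowerSeries.C (PowerSeries.coeff ((i : ℕ) + 1) u) *
    PowerSeries.X ^ ((i : ℕ) + 1) with hw
  have hdvd : PowerSeries.X ^ (n + 1) ∣ u ^ m - w ^ m := by
    refine dvd_trans (PowerSeries.X_pow_dvd_iff.mpr fun k hk => ?_) (sub_dvd_pow_sub_pow u w m)
    rw [map_sub, hw, map_sum]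
    simp only [PowerSeries.coeff_C_mul, PowerSeries.coeff_X_pow]
    rcases k with _ | k
    · rw [h0, Finset.sum_eq_zero fun i _ => by rw [if_neg (by omega), mul_zero], sub_zero]
    · rw [Finset.sum_eq_single (⟨k, by omega⟩ : Fin n)]
      · simp
      · intro i _ hi
        rw [if_neg (fun h => hi (Fin.ext (by simpa using h.symm))), mul_zero]
      · exact fun h => absurd (Finset.mem_univ _) h
  have hc := PowerSeries.X_pow_dvd_iff.mp hdvd n (Nat.lt_succ_self n)
  rw [map_sub, sub_eq_zero] at hc
  rw [hc, hw, Finset.sum_pow_eq_sum_piAntidiag, map_sum, Finset.sum_filter]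
  refine Finset.sum_congr rfl fun P _ => ?_
  have hprod : ∏ i : Fin n, (PowerSeries.C (PowerSeries.coeff ((i : ℕ) + 1) u) *
      PowerSeries.X ^ ((i : ℕ) + 1)) ^ P i =
      PowerSeries.C (∏ i : Fin n, PowerSeries.coeff ((i : ℕ) + 1) u ^ P i) *
        PowerSeries.X ^ (∑ i : Fin n, ((i : ℕ) + 1) * P i) := by
    simp only [mul_pow, Finset.prod_mul_distrib, ← pow_mul, Finset.prod_pow_eq_pow_sum, map_prod,
      map_pow]
  rw [hprod, ← map_natCast (PowerSeries.C (R := S)), PowerSeries.coeff_C_mul,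
    PowerSeries.coeff_C_mul, PowerSeries.coeff_X_pow]
  by_cases h : ∑ i : Fin n, ((i : ℕ) + 1) * P i = n
  · rw [if_pos h.symm, if_pos h, mul_one, Algebra.smul_def, map_natCast]
  · rw [if_neg (Ne.symm h), if_neg h, mul_zero, mul_zero]

/-- The coefficients of a power series as polynomials in those of its exponential. -/
lemma coeff_eq_sum_multinomial {h : PowerSeries S} (h0 : PowerSeries.coeff 0 h = 0) {n : ℕ}
    (hn : 0 < n) : PowerSeries.coeff n h =
      ∑ P ∈ (Fintype.piFinset fun _ : Fin n => Finset.range (n + 1)).filter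
          (fun P => ∑ i : Fin n, ((i : ℕ) + 1) * P i = n),
        ((-1) ^ ((∑ i, P i) - 1) * (Nat.factorial ((∑ i, P i) - 1) : ℂ)
            / ∏ i, (Nat.factorial (P i) : ℂ)) •
          ∏ i : Fin n, PowerSeries.coeff ((i : ℕ) + 1) (expSeries h) ^ P i := by
  have hu0 : PowerSeries.coeff 0 (expSeries h - 1) = 0 := by
    rw [map_sub, coeff_zero_expSeries, PowerSeries.coeff_one, if_pos rfl, sub_self]
  have hle : ∀ P : Fin n → ℕ, ∑ i, P i ≤ ∑ i : Fin n, ((i : ℕ) + 1) * P i := fun P =>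
    Finset.sum_le_sum fun i _ => Nat.le_mul_of_pos_left _ (Nat.succ_pos _)
  have hpos : ∀ P : Fin n → ℕ, ∑ i : Fin n, ((i : ℕ) + 1) * P i = n → ∑ i, P i ≠ 0 := by
    intro P hP h0
    have : ∀ i, P i = 0 := fun i => Finset.sum_eq_zero_iff.mp h0 i (Finset.mem_univ i)
    simp [this] at hP
    omega
  rw [coeff_eq_sum_log h0 hn]
  refine Eq.trans ?_ (Finset.sum_fiberwise_of_maps_to (t := Finset.range n)
    (g := fun P : Fin n → ℕ => (∑ i, P i) - 1) ?_ _)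
  · refine Finset.sum_congr rfl fun m hm => ?_
    rw [coeff_pow_eq_sum hu0, Finset.smul_sum]
    refine Finset.sum_congr ?_ fun P hP => ?_
    · ext P
      simp only [Finset.mem_filter, Finset.mem_piAntidiag, Fintype.mem_piFinset, Finset.mem_range]
      constructor
      · rintro ⟨⟨hs, -⟩, hP⟩
        replace hs : ∑ i, P i = m + 1 := hs
        refine ⟨⟨fun i => ?_, hP⟩, by omega⟩
        have := Finset.single_le_sum (fun i _ => Nat.zero_le (P i)) (Finset.mem_univ i)
        have := hle P
        omega
      · rintro ⟨⟨-, hP⟩, hs⟩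
        have := hpos P hP
        have hs' : ∑ i, P i = m + 1 := by omega
        exact ⟨⟨hs', fun i _ => Finset.mem_univ i⟩, hP⟩
    · obtain ⟨hP, hs'⟩ := Finset.mem_filter.mp hP
      have := hpos P (Finset.mem_filter.mp hP).2
      have hs : ∑ i, P i = m + 1 := by omega
      have hspec := Nat.multinomial_spec Finset.univ P
      rw [hs, Nat.factorial_succ] at hspec
      have hspec' : (∏ i, (Nat.factorial (P i) : ℂ)) * Nat.multinomial Finset.univ P =
          (m + 1) * Nat.factorial m := by exact_mod_cast hspec
      have hne : ∏ i, (Nat.factorial (P i) : ℂ) ≠ 0 :=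
        Finset.prod_ne_zero_iff.mpr fun i _ => Nat.cast_ne_zero.mpr (Nat.factorial_ne_zero _)
      have hm1 : (m + 1 : ℂ) ≠ 0 := Nat.cast_add_one_ne_zero m
      rw [hs, Nat.add_sub_cancel, _root_.smul_smul]
      congr 1
      · field_simp
        linear_combination hspec'
      · refine Finset.prod_congr rfl fun i _ => ?_
        rw [map_sub, PowerSeries.coeff_one, if_neg (Nat.succ_ne_zero _), sub_zero]
  · intro P hP
    have hP' := (Finset.mem_filter.mp hP).2
    have := hpos P hP'
    have := hle P
    rw [Finset.mem_range]
    omega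

end Log

section

variable {A : Type*} [Ring A] [Algebra ℂ A]

lemma map_expSeries {B : Type*} [Ring B] [Algebra ℂ B] (φ : A →ₐ[ℂ] B) (h : PowerSeries A) :
    PowerSeries.map (φ : A →+* B) (expSeries h) =
      expSeries (PowerSeries.map (φ : A →+* B) h) := by
  ext n
  simp [expSeries, ← map_pow]

open scoped IsMulCommutative in
/-- The logarithm formula for a power series with commuting coefficients. -/
lemma coeff_eq_sum_of_commute {h : PowerSeries A} (h0 : PowerSeries.coeff 0 h = 0)
    (hh : ∀ i k, Commute (PowerSeries.coeff i h) (PowerSeries.coeff k h)) {n : ℕ} (hn : 0 < n) :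
    PowerSeries.coeff n h =
      ∑ P ∈ (Fintype.piFinset fun _ : Fin n => Finset.range (n + 1)).filter
          (fun P => ∑ i : Fin n, ((i : ℕ) + 1) * P i = n),
        ((-1) ^ ((∑ i, P i) - 1) * (Nat.factorial ((∑ i, P i) - 1) : ℂ)
            / ∏ i, (Nat.factorial (P i) : ℂ)) •
          (List.ofFn fun i : Fin n =>
            PowerSeries.coeff ((i : ℕ) + 1) (expSeries h) ^ P i).prod := by
  let S := Algebra.adjoin ℂ (Set.range fun i => PowerSeries.coeff i h)
  have : IsMulCommutative S := Algebra.isMulCommutative_adjoin ℂ (by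
    rintro _ ⟨i, rfl⟩ _ ⟨k, rfl⟩
    exact hh i k)
  let h' : PowerSeries S := PowerSeries.mk fun i =>
    ⟨PowerSeries.coeff i h, Algebra.subset_adjoin ⟨i, rfl⟩⟩
  have hmap : PowerSeries.map (S.val : S →+* A) h' = h := by
    ext i
    simp [h']
  have h0' : PowerSeries.coeff 0 h' = 0 := by
    rw [PowerSeries.coeff_mk]
    exact Subtype.ext h0
  have key := congrArg S.val (coeff_eq_sum_multinomial h0' hn)
  rw [map_coeff, hmap, map_sum] at key
  rw [key]
  refine Finset.sum_congr rfl fun P _ => ?_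
  rw [map_smul]
  congr 1
  rw [← List.prod_ofFn, map_list_prod, List.map_ofFn]
  congr 2
  funext i
  simp only [Function.comp_apply, map_pow, map_coeff, map_expSeries, hmap]

end

end

/-! ### The Drinfeld generators of the mode algebra -/

noncomputable section

section Map

variable {A B : Type*} [Ring A] [Algebra ℂ A] [Ring B] [Algebra ℂ B] (φ : A →ₐ[ℂ] B) {q : ℂ}

/-- The image of a system of modes. -/
def ModeData.map (D : ModeData A) : ModeData B where
  g := φ D.g
  gi := φ D.gi
  K := φ D.K
  Ki := φ D.Ki
  X s n := φ (D.X s n)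
  H n := φ (D.H n)

lemma ModeData.map_ofGen (γ : ModeGen → A) : (ofGen γ).map φ = ofGen (φ ∘ γ) := by
  have : ∀ n, φ ((ofGen γ).H n) = (ofGen (φ ∘ γ)).H n := fun n => by
    by_cases hn : n = 0 <;> simp [ofGen, hn]
  simp only [map, this]
  rfl

lemma ModeData.map_ψ (D : ModeData A) (s : Sgn) :
    ((D.map φ).toCurrent q).ψ s = PowerSeries.map (φ : A →+* B) ((D.toCurrent q).ψ s) := by
  have h : (D.map φ).η q s = PowerSeries.map (φ : A →+* B) (D.η q s) := by
    ext n
    by_cases hn : n = 0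
    · rw [hn, coeff_zero_η, ← map_coeff, coeff_zero_η, map_zero]
    · rw [coeff_η _ _ hn, ← map_coeff, coeff_η _ _ hn, map_smul]
      rfl
  rw [toCurrent_ψ, toCurrent_ψ, map_mul, map_expSeries, map_C_of_algHom, ipow_map, h]
  rfl

lemma ModeRel.exists_of_map {D : ModeData A} {x y : B} (h : ModeRel q (D.map φ) x y) :
    ∃ x' y', ModeRel q D x' y' ∧ φ x' = x ∧ φ y' = y := by
  cases h with
  | g_gi => exact ⟨_, _, .g_gi, map_mul _ _ _, map_one _⟩
  | gi_g => exact ⟨_, _, .gi_g, map_mul _ _ _, map_one _⟩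
  | K_Ki => exact ⟨_, _, .K_Ki, map_mul _ _ _, map_one _⟩
  | Ki_K => exact ⟨_, _, .Ki_K, map_mul _ _ _, map_one _⟩
  | g_K => exact ⟨_, _, .g_K, map_mul _ _ _, map_mul _ _ _⟩
  | g_H n hn => exact ⟨_, _, .g_H n hn, map_mul _ _ _, map_mul _ _ _⟩
  | g_X s n => exact ⟨_, _, .g_X s n, map_mul _ _ _, map_mul _ _ _⟩
  | K_H n hn => exact ⟨_, _, .K_H n hn, map_mul _ _ _, map_mul _ _ _⟩
  | K_X s n => exact ⟨_, _, .K_X s n, by simp [ModeData.map], by simp [ModeData.map]⟩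
  | H_H n m hn hm =>
    refine ⟨_, _, .H_H n m hn hm, by simp [ModeData.map], ?_⟩
    split_ifs
    · simp only [map_smul, map_sub, ipow_map, ModeData.map]
    · exact map_zero φ
  | H_X s n m hn =>
    exact ⟨_, _, .H_X s n m hn, by simp [ModeData.map], by
      simp only [map_smul, map_mul, ipow_map, ModeData.map]⟩
  | X_same s n m => exact ⟨_, _, .X_same s n m, by simp [ModeData.map], map_zero _⟩
  | X_mixed n m =>
    refine ⟨_, _, .X_mixed n m, by simp [ModeData.map], ?_⟩
    simp only [map_smul, map_mul, map_sub, ipow_map, CurrentData.ψZ, coefZ_map, ModeData.map_ψ]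
    rfl

end Map

lemma uqData_rel (q : ℂ) (x y : Uq q) (h : ModeRel q (uqData q) x y) : x = y := by
  have h₁ : uqData q = (ModeData.ofGen (FreeAlgebra.ι ℂ)).map
      (RingQuot.mkAlgHom ℂ (ModeRel q (ModeData.ofGen (FreeAlgebra.ι ℂ)))) := by
    rw [ModeData.map_ofGen]
    rfl
  rw [h₁] at h
  obtain ⟨x', y', h', rfl, rfl⟩ := h.exists_of_map
  exact RingQuot.mkAlgHom_rel ℂ h'

lemma adjoin_range_uqGen (q : ℂ) : Algebra.adjoin ℂ (Set.range fun x : ModeGen =>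
    RingQuot.mkAlgHom ℂ (ModeRel q (ModeData.ofGen (FreeAlgebra.ι ℂ))) (FreeAlgebra.ι ℂ x)) =
      (⊤ : Subalgebra ℂ (Uq q)) := by
  have h := congrArg (Subalgebra.map
      (RingQuot.mkAlgHom ℂ (ModeRel q (ModeData.ofGen (FreeAlgebra.ι ℂ)))))
    (FreeAlgebra.adjoin_range_ι ℂ ModeGen)
  rw [AlgHom.map_adjoin, ← Set.range_comp, Algebra.map_top,
    (AlgHom.range_eq_top _).mpr (RingQuot.mkAlgHom_surjective ℂ _)] at h
  exact h

/-! ### The recursion for the Drinfeld generators -/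

section Recursion

variable {A : Type*} [Ring A] [Algebra ℂ A] {q : ℂ} {D : ModeData A}

lemma coeff_one_expSeries {h : PowerSeries A} : PowerSeries.coeff 1 (expSeries h) =
    PowerSeries.coeff 1 h := by
  simp [expSeries, Finset.sum_range_succ, PowerSeries.coeff_one]

lemma ModeData.coeff_one_ψ (D : ModeData A) (s : Sgn) :
    PowerSeries.coeff 1 ((D.toCurrent q).ψ s) =
      ((s.toInt : ℂ) * (q - q⁻¹)) • (ipow D.K D.Ki s.toInt * D.H s.toInt) := by
  rw [toCurrent_ψ, PowerSeries.coeff_C_mul, coeff_one_expSeries, coeff_η _ _ one_ne_zero,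
    mul_smul_comm, Nat.cast_one, mul_one]

namespace ModeData

lemma Cartan.gi_Ki (C : D.Cartan q) : Commute D.gi D.Ki :=
  Commute.units_inv_left (u := C.gU) (Commute.units_inv_right (u := C.kU) C.g_K)

lemma anticomm_of_pos (h : ∀ x y, ModeRel q D x y → x = y) (s : Sgn) {k : ℕ} (hk : 0 < k)
    {n m : ℤ} (hnm : n + m = s.toInt * k) :
    D.X .pos n * D.X .neg m + D.X .neg m * D.X .pos n = ((s.toInt : ℂ) * (q - q⁻¹)⁻¹) •
      (ipow D.g D.gi (s.toInt * (n - m)) * PowerSeries.coeff k ((D.toCurrent q).ψ s)) := by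
  rw [h _ _ (.X_mixed n m), hnm, CurrentData.ψZ, CurrentData.ψZ]
  cases s
  · rw [show Sgn.pos.toInt * (k : ℤ) = k from one_mul _, coefZ, coefZ, if_pos (by omega),
      if_neg (by omega)]
    simp [Sgn.toInt]
  · rw [show Sgn.neg.toInt * (k : ℤ) = -k from neg_one_mul _, coefZ, coefZ, if_neg (by omega),
      if_pos (by omega)]
    simp [Sgn.toInt]

lemma anticomm_zero (h : ∀ x y, ModeRel q D x y → x = y) {n m : ℤ} (hnm : n + m = 0) :
    D.X .pos n * D.X .neg m + D.X .neg m * D.X .pos n =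
      (q - q⁻¹)⁻¹ • (ipow D.g D.gi (n - m) * D.K - ipow D.g D.gi (m - n) * D.Ki) := by
  rw [h _ _ (.X_mixed n m), hnm, CurrentData.ψZ, CurrentData.ψZ, coefZ, coefZ, if_pos le_rfl,
    if_pos le_rfl, neg_zero, Int.toNat_zero, coeff_zero_ψ, coeff_zero_ψ,
    show Sgn.pos.toInt = 1 from rfl, show Sgn.neg.toInt = -1 from rfl, ipow_one, ipow_neg_one]

/-- `H_{±1}` from the anticommutators of the `X^±_n`. -/
lemma anticomm_eq_H (hq : q ≠ 0) (hq1 : q ^ 2 ≠ 1) (h : ∀ x y, ModeRel q D x y → x = y) (s : Sgn)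
    {n m : ℤ} (hnm : n + m = s.toInt) :
    D.X .pos n * D.X .neg m + D.X .neg m * D.X .pos n =
      ipow D.g D.gi (s.toInt * (n - m)) * (ipow D.K D.Ki s.toInt * D.H s.toInt) := by
  have hss : (s.toInt : ℂ) * s.toInt = 1 := by exact_mod_cast toInt_mul_self s
  rw [anticomm_of_pos h s one_pos (by rw [hnm, Nat.cast_one, mul_one]), coeff_one_ψ, mul_smul_comm,
    _root_.smul_smul, show (s.toInt : ℂ) * (q - q⁻¹)⁻¹ * (s.toInt * (q - q⁻¹)) =
      s.toInt * s.toInt * ((q - q⁻¹)⁻¹ * (q - q⁻¹)) by ring, hss,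
    inv_mul_cancel₀ (sub_inv_ne_zero hq hq1), one_mul, one_smul]

lemma H_X_one (hq : q ≠ 0) (hq1 : q ^ 2 ≠ 1) (h : ∀ x y, ModeRel q D x y → x = y) (τ s : Sgn)
    (n : ℤ) : D.H τ.toInt * D.X s n - D.X s n * D.H τ.toInt =
      (-(s.toInt : ℂ)) • (ipow D.g D.gi (-s.toInt) * D.X s (n + τ.toInt)) := by
  have hτ : τ.toInt ≠ 0 := by cases τ <;> simp [Sgn.toInt]
  have hc : (s.toInt : ℂ) * (1 / τ.toInt) * (-1) ^ τ.toInt * qint q τ.toInt = -s.toInt := by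
    have := sub_inv_ne_zero hq hq1
    have h1 : qint q 1 = 1 := by
      rw [qint, zpow_one, zpow_neg_one, div_self this]
    have h2 : qint q (-1) = -1 := by
      rw [qint, neg_neg, zpow_one, zpow_neg_one, ← neg_sub, neg_div, div_self this]
    cases τ <;> simp [Sgn.toInt, h1, h2]
  rw [h _ _ (.H_X s τ.toInt n hτ), hc, add_comm n, show |τ.toInt| = 1 by cases τ <;> rfl, mul_one]

lemma X_shift (hq : q ≠ 0) (hq1 : q ^ 2 ≠ 1) (h : ∀ x y, ModeRel q D x y → x = y) (τ s : Sgn)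
    (n : ℤ) : D.X s (n + τ.toInt) = (-(s.toInt : ℂ)) • (ipow D.g D.gi s.toInt *
      (D.H τ.toInt * D.X s n - D.X s n * D.H τ.toInt)) := by
  have C := cartan_of_modeRel h
  have hss : (s.toInt : ℂ) * s.toInt = 1 := by exact_mod_cast toInt_mul_self s
  rw [H_X_one hq hq1 h, mul_smul_comm, _root_.smul_smul, neg_mul_neg, hss, one_smul, ← mul_assoc,
    C.ipow_g, C.ipow_g, zpow_neg, Units.mul_inv, one_mul]

lemma ipow_mul_coeff_ψ (C : D.Cartan q) (s : Sgn) (n : ℕ) :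
    ipow D.K D.Ki (-s.toInt) * PowerSeries.coeff n ((D.toCurrent q).ψ s) =
      PowerSeries.coeff n (expSeries (D.η q s)) := by
  rw [toCurrent_ψ, PowerSeries.coeff_C_mul, C.ipow_K, C.ipow_K, zpow_neg,
    Units.inv_mul_cancel_left]

lemma H_eq_coeff_η (hq : q ≠ 0) (hq1 : q ^ 2 ≠ 1) (D : ModeData A) (s : Sgn) {n : ℕ} (hn : n ≠ 0) :
    D.H (s.toInt * n) = ((s.toInt : ℂ) / (q - q⁻¹)) • PowerSeries.coeff n (D.η q s) := by
  have hss : (s.toInt : ℂ) * s.toInt = 1 := by exact_mod_cast toInt_mul_self s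
  have := sub_inv_ne_zero hq hq1
  rw [coeff_η D s hn, _root_.smul_smul, show (s.toInt : ℂ) / (q - q⁻¹) * (s.toInt * (q - q⁻¹)) = 1
    by rw [div_mul_eq_mul_div, ← mul_assoc, hss, one_mul, div_self this], one_smul]

/-- All Drinfeld generators are built up from finitely many of them. -/
theorem drinfeldRecursion (hq : q ≠ 0) (hq1 : q ^ 2 ≠ 1)
    (h : ∀ x y, ModeRel q D x y → x = y) : DrinfeldRecursion q D := by
  have C := cartan_of_modeRel h
  have hss : ∀ s : Sgn, (s.toInt : ℂ) * s.toInt = 1 := fun s => by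
    exact_mod_cast toInt_mul_self s
  refine ⟨?_, ?_, fun s n => ?_, fun s n => ?_, fun s n hn => ?_, fun s n hn => ?_⟩
  · rw [anticomm_eq_H hq hq1 h .pos (by rfl)]
    show _ = D.g * D.Ki * (ipow D.g D.gi (-1) * (ipow D.K D.Ki 1 * D.H 1))
    rw [ipow_neg_one, ipow_one, mul_assoc, ← mul_assoc D.Ki, C.gi_Ki.eq.symm, mul_assoc,
      ← mul_assoc D.g, C.g_gi, one_mul, ← mul_assoc, C.Ki_K, one_mul]
  · rw [anticomm_eq_H hq hq1 h .neg (by rfl)]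
    show _ = D.gi * D.K * (ipow D.g D.gi 1 * (ipow D.K D.Ki (-1) * D.H (-1)))
    rw [ipow_neg_one, ipow_one, mul_assoc, ← mul_assoc D.K, C.g_K.eq.symm, mul_assoc,
      ← mul_assoc D.gi, C.gi_g, one_mul, ← mul_assoc, C.K_Ki, one_mul]
  · exact X_shift hq hq1 h .pos s n
  · exact X_shift hq hq1 h .neg s (-n)
  · rw [H_eq_coeff_η hq hq1 D s hn.ne', hFormula, coeff_eq_sum_of_commute (coeff_zero_η D s)
      (C.commute_η s) hn]
    simp only [ipow_mul_coeff_ψ C]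
  · have key : ∀ {a b : A} {n' : ℤ}, a = ((s.toInt : ℂ) * (q - q⁻¹)⁻¹) • (ipow D.g D.gi n' * b) →
        b = ((s.toInt : ℂ) * (q - q⁻¹)) • (ipow D.g D.gi (-n') * a) := by
      intro a b n' e
      rw [e, mul_smul_comm, _root_.smul_smul, C.ipow_g, C.ipow_g, zpow_neg,
        Units.inv_mul_cancel_left, show (s.toInt : ℂ) * (q - q⁻¹) * (s.toInt * (q - q⁻¹)⁻¹) =
          s.toInt * s.toInt * ((q - q⁻¹) * (q - q⁻¹)⁻¹) by ring, hss,
        mul_inv_cancel₀ (sub_inv_ne_zero hq hq1), one_mul, one_smul]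
    cases s
    · have := key (anticomm_of_pos h .pos hn (n := n - 1) (m := 1) (by simp [Sgn.toInt]))
      simp only [Sgn.toInt, Sgn.opp, one_mul] at this ⊢
      rw [this]
      congr 4
      ring
    · have := key (anticomm_of_pos h .neg hn (n := -1) (m := -n + 1) (by simp [Sgn.toInt]))
      simp only [Sgn.toInt, Sgn.opp, neg_mul, one_mul, sub_neg_eq_add] at this ⊢
      rw [this, add_comm (D.X _ _ * D.X _ _)]
      congr 4
      ring

end ModeData

end Recursion

end

/-! ### The Chevalley relations -/

noncomputable section

section Serre

variable {A : Type*} [Ring A] [Algebra ℂ A] {q : ℂ}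

/-- The Serre element is a scalar multiple of `[[[x, y]_c, x], x]_c`, up to signs; it vanishes when
`[x, y]_c` is a central multiple of `h` and `[h, x]` is a central multiple of `v` with
`v x + c x v = 0`. -/
lemma serre_eq_zero {c : ℂ} (hc : c ≠ 0) (hcq : c + c⁻¹ = q + q⁻¹) {x y t h t' v : A}
    (hz : x * y + c • (y * x) = t * h) (ht : Commute t x) (hv : h * x - x * h = t' * v)
    (ht' : Commute t' x) (hvx : v * x + c • (x * v) = 0) : serre q x y = 0 := by
  have hw : (x * y + c • (y * x)) * x - x * (x * y + c • (y * x)) = t * (t' * v) := by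
    rw [hz, ← mul_assoc x, ← ht.eq, mul_assoc, mul_assoc, ← mul_sub, hv]
  have h0 : t * (t' * v) * x + c • (x * (t * (t' * v))) = 0 := by
    rw [← mul_assoc x, ← ht.eq, mul_assoc t x, ← mul_assoc x t', ← ht'.eq, mul_assoc t' x,
      mul_assoc t, mul_assoc t', ← mul_smul_comm, ← mul_smul_comm, ← mul_add, ← mul_add, hvx,
      mul_zero, mul_zero]
  have hs : (-c) • serre q x y = 0 := by
    rw [← h0, ← hw, serre, show q + q⁻¹ - 1 = c + c⁻¹ - 1 by rw [hcq]]
    have hcc : c * c⁻¹ = 1 := mul_inv_cancel₀ hc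
    simp only [pow_succ, pow_zero, one_mul, mul_add, add_mul, mul_sub, sub_mul, smul_mul_assoc,
      mul_smul_comm, mul_assoc]
    match_scalars <;> grind
  exact smul_right_injective A (neg_ne_zero.mpr hc) (hs.trans (smul_zero _).symm)

end Serre

namespace ModeData

section Chevalley

variable {A : Type*} [Ring A] [Algebra ℂ A] {q : ℂ} {D : ModeData A}

lemma X_succ_mul_X (h : ∀ x y, ModeRel q D x y → x = y) (s : Sgn) (n : ℤ) :
    D.X s (n + 1) * D.X s n = -(q ^ s.toInt • (D.X s n * D.X s (n + 1))) := by
  have := h _ _ (.X_same s n n)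
  refine eq_neg_of_add_eq_zero_left (smul_right_injective A (two_ne_zero (α := ℂ)) ?_)
  beta_reduce
  rw [smul_zero, ← this]
  module

lemma Cartan.Ki_X (C : D.Cartan q) (hq : q ≠ 0) (s : Sgn) (n : ℤ) :
    D.Ki * D.X s n = q ^ (-s.toInt) • (D.X s n * D.Ki) := by
  have := C.K_zpow_X hq s n .neg
  rw [← C.ipow_K, show Sgn.neg.toInt = -1 from rfl, neg_one_mul, ipow_neg_one] at this
  exact this

/-- The images of the Chevalley generators satisfy the Chevalley relations. -/
lemma chevRel_chevImage (hq : q ≠ 0) (hq1 : q ^ 2 ≠ 1) (h : ∀ x y, ModeRel q D x y → x = y)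
    (x y : A) (hxy : ChevRel q (chevImage D) x y) : x = y := by
  have C := cartan_of_modeRel h
  have KXp : ∀ n, D.K * D.X .pos n = q • (D.X .pos n * D.K) := fun n => by
    simpa [Sgn.toInt] using C.K_X .pos n
  have KXn : ∀ n, D.K * D.X .neg n = q⁻¹ • (D.X .neg n * D.K) := fun n => by
    simpa [Sgn.toInt] using C.K_X .neg n
  have KiXp : ∀ n, D.Ki * D.X .pos n = q⁻¹ • (D.X .pos n * D.Ki) := fun n => by
    simpa [Sgn.toInt] using C.Ki_X hq .pos n
  have KiXn : ∀ n, D.Ki * D.X .neg n = q • (D.X .neg n * D.Ki) := fun n => by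
    simpa [Sgn.toInt] using C.Ki_X hq .neg n
  -- the commutation rules, also in the form needed inside a longer product
  have smul_assoc' : ∀ {a b : A} {c : ℂ}, a * b = c • (b * a) →
      ∀ z, a * (b * z) = c • (b * (a * z)) := fun e z => by
    rw [← mul_assoc, e, smul_mul_assoc, mul_assoc]
  have comm_assoc : ∀ {a b : A}, Commute a b → ∀ z, a * (b * z) = b * (a * z) :=
    fun e z => e.left_comm z
  have one_assoc : ∀ {a b : A}, a * b = 1 → ∀ z, a * (b * z) = z := fun e z => by
    rw [← mul_assoc, e, one_mul]
  have KXp' := fun n => smul_assoc' (KXp n)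
  have KXn' := fun n => smul_assoc' (KXn n)
  have KiXp' := fun n => smul_assoc' (KiXp n)
  have KiXn' := fun n => smul_assoc' (KiXn n)
  have KKi' := one_assoc C.K_Ki
  have KiK' := one_assoc C.Ki_K
  have ggi' := one_assoc C.g_gi
  have gig' := one_assoc C.gi_g
  have gX : ∀ s n, Commute (D.X s n) D.g := fun s n => (C.g_X s n).symm
  have giX : ∀ s n, Commute (D.X s n) D.gi := fun s n =>
    (Commute.units_inv_left (u := C.gU) (C.g_X s n)).symm
  have gK : Commute D.K D.g := C.g_K.symm
  have gKi : Commute D.Ki D.g := (Commute.units_inv_right (u := C.kU) C.g_K).symm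
  have giKi : Commute D.Ki D.gi := C.gi_Ki.symm
  have giK : Commute D.K D.gi := (Commute.units_inv_left (u := C.gU) C.g_K).symm
  have gX' := fun s n => comm_assoc (gX s n)
  have giX' := fun s n => comm_assoc (giX s n)
  have gK' := comm_assoc gK
  have gKi' := comm_assoc gKi
  have giKi' := comm_assoc giKi
  have giK' := comm_assoc giK
  have KH : Commute D.K (D.H (-1)) := C.K_H (-1) (by norm_num)
  have KiH : Commute D.Ki (D.H 1) := Commute.units_inv_left (u := C.kU) (C.K_H 1 one_ne_zero)
  -- the anticommutators and commutators that produce and shift the currents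
  have hXX₁ : D.X .pos 0 * D.X .neg 1 + D.X .neg 1 * D.X .pos 0 = D.gi * (D.K * D.H 1) := by
    simpa [Sgn.toInt, ipow_one, ipow_neg_one] using
      anticomm_eq_H hq hq1 h .pos (n := 0) (m := 1) rfl
  have hXX₂ : D.X .pos (-1) * D.X .neg 0 + D.X .neg 0 * D.X .pos (-1) =
      D.g * (D.Ki * D.H (-1)) := by
    simpa [Sgn.toInt, ipow_one, ipow_neg_one] using
      anticomm_eq_H hq hq1 h .neg (n := -1) (m := 0) rfl
  have HXp : ∀ (τ : Sgn) n, D.H τ.toInt * D.X .pos n - D.X .pos n * D.H τ.toInt =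
      -D.gi * D.X .pos (n + τ.toInt) := fun τ n => by
    simpa [Sgn.toInt, ipow_neg_one] using H_X_one hq hq1 h τ .pos n
  have HXn : ∀ (τ : Sgn) n, D.H τ.toInt * D.X .neg n - D.X .neg n * D.H τ.toInt =
      D.g * D.X .neg (n + τ.toInt) := fun τ n => by
    simpa [Sgn.toInt, ipow_one] using H_X_one hq hq1 h τ .neg n
  have hpos : ∀ n, D.X .pos (n + 1) * D.X .pos n + q • (D.X .pos n * D.X .pos (n + 1)) = 0 :=
    fun n => by simpa [Sgn.toInt, eq_neg_iff_add_eq_zero] using X_succ_mul_X h .pos n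
  have hneg : ∀ n, q • (D.X .neg (n + 1) * D.X .neg n) + D.X .neg n * D.X .neg (n + 1) = 0 :=
    fun n => by
      rw [X_succ_mul_X h .neg n, smul_neg, _root_.smul_smul]
      simp [Sgn.toInt, hq]
  have hqq : q * q⁻¹ = 1 := mul_inv_cancel₀ hq
  have hqq' : q⁻¹ * q = 1 := inv_mul_cancel₀ hq
  have XK : ∀ n, D.X .pos n * D.K = q⁻¹ • (D.K * D.X .pos n) := fun n => by
    rw [KXp, _root_.smul_smul, hqq', one_smul]
  have XK' : ∀ n z, D.X .pos n * (D.K * z) = q⁻¹ • (D.K * (D.X .pos n * z)) := fun n =>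
    smul_assoc' (XK n)
  cases hxy with
  | K_Ki i =>
    fin_cases i <;> simp [chevImage, pow_two, mul_assoc, giKi', C.g_gi, C.K_Ki,
      ggi', C.Ki_K]
  | Ki_K i =>
    fin_cases i <;> simp [chevImage, pow_two, mul_assoc, gK', C.gi_g, C.Ki_K,
      gig', C.K_Ki]
  | K_K i j =>
    fin_cases i <;> fin_cases j <;> simp [chevImage, pow_two, mul_assoc, gK', C.K_Ki, C.Ki_K]
  | K_E i j =>
    fin_cases i <;> fin_cases j <;> simp [chevImage, cartan, pow_two, mul_assoc, KXp', KXn',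
      KiXn', giX', (giX _ _).eq, giKi', ggi', C.Ki_K, C.K_Ki,
      KiXp, giKi.eq]
  | K_F i j =>
    fin_cases i <;> fin_cases j <;> simp [chevImage, cartan, pow_two, mul_assoc, KXp', KXn',
      giX', (giX _ _).eq, giKi', ggi', C.Ki_K, C.K_Ki, KiK',
      KiXn]
    exact XK _
  | E_F i j =>
    fin_cases i <;> fin_cases j
    · have := anticomm_zero h (n := -1) (m := 1) (by norm_num)
      rw [show ipow D.g D.gi (-1 - 1) = D.gi ^ 2 from rfl,
        show ipow D.g D.gi (1 - -1) = D.g ^ 2 from rfl] at this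
      show D.X .neg 1 * D.Ki * -(D.K * D.X .pos (-1)) +
        -(D.K * D.X .pos (-1)) * (D.X .neg 1 * D.Ki) =
          (q - q⁻¹)⁻¹ • (D.g ^ 2 * D.Ki - D.gi ^ 2 * D.K)
      simp only [mul_neg, neg_mul, mul_assoc, KXp', KXn', KiK', C.K_Ki, mul_one, mul_smul_comm,
        _root_.smul_smul, hqq, one_smul]
      linear_combination (norm := module) -this
    · show D.X .neg 1 * D.Ki * D.X .neg 0 + D.X .neg 0 * (D.X .neg 1 * D.Ki) = 0
      rw [mul_assoc, KiXn, mul_smul_comm, ← mul_assoc, ← mul_assoc, ← smul_mul_assoc, ← add_mul,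
        show (1 : ℤ) = 0 + 1 from rfl, hneg, zero_mul]
    · show D.X .pos 0 * -(D.K * D.X .pos (-1)) + -(D.K * D.X .pos (-1)) * D.X .pos 0 = 0
      have h' : D.X .pos 0 * D.X .pos (-1) + q • (D.X .pos (-1) * D.X .pos 0) = 0 := by
        simpa using hpos (-1)
      rw [mul_neg, neg_mul, ← mul_assoc, XK, smul_mul_assoc, mul_assoc, mul_assoc, ← neg_add,
        ← mul_smul_comm, ← mul_add, eq_neg_of_add_eq_zero_left h', smul_neg,
        _root_.smul_smul, hqq', one_smul, neg_add_cancel,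
        mul_zero, neg_zero]
    · have := anticomm_zero h (n := 0) (m := 0) (by norm_num)
      simpa [chevImage, ipow] using this
  | serre_E i j hij =>
    have hi : ∀ i j : Fin 2, i ≠ j → i = 0 ∧ j = 1 ∨ i = 1 ∧ j = 0 := by decide
    obtain ⟨rfl, rfl⟩ | ⟨rfl, rfl⟩ := hi i j hij
    · refine serre_eq_zero (c := q⁻¹) (inv_ne_zero hq) (by rw [inv_inv, add_comm])
        (t := q⁻¹ • D.gi) (h := D.H 1) (t' := D.g) (v := D.X .neg 2 * D.Ki) ?_
        ((((giX _ _).symm).mul_right giKi.symm).smul_left _) ?_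
        ((gX _ _).symm.mul_right gKi.symm) ?_
      · show D.X .neg 1 * D.Ki * D.X .pos 0 + q⁻¹ • (D.X .pos 0 * (D.X .neg 1 * D.Ki)) = _
        rw [mul_assoc, KiXp, mul_smul_comm, ← smul_add, ← mul_assoc, ← mul_assoc, ← add_mul,
          add_comm, hXX₁, mul_assoc, mul_assoc, ← KiH.eq, KKi', smul_mul_assoc]
      · show D.H 1 * (D.X .neg 1 * D.Ki) - D.X .neg 1 * D.Ki * D.H 1 = _
        rw [mul_assoc (D.X _ _), KiH.eq, ← mul_assoc, ← mul_assoc, ← sub_mul]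
        exact (congrArg (· * D.Ki) (HXn .pos 1)).trans (mul_assoc _ _ _)
      · show D.X .neg (1 + 1) * D.Ki * (D.X .neg 1 * D.Ki) +
          q⁻¹ • (D.X .neg 1 * D.Ki * (D.X .neg (1 + 1) * D.Ki)) = 0
        have := congrArg (· * (D.Ki * D.Ki)) (hneg 1)
        simp only [mul_assoc, KiXn', mul_smul_comm, _root_.smul_smul, hqq', one_smul, add_mul,
          smul_mul_assoc, zero_mul] at this ⊢
        exact this
    · refine serre_eq_zero (c := q) hq rfl (t := D.gi) (h := D.H 1) (t' := -D.gi)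
        (v := D.X .pos 1) ?_ (giX _ _).symm (HXp .pos 0) (giX _ _).symm.neg_left (hpos 0)
      show D.X .pos 0 * (D.X .neg 1 * D.Ki) + q • (D.X .neg 1 * D.Ki * D.X .pos 0) = _
      rw [mul_assoc (D.X .neg 1), KiXp, mul_smul_comm, _root_.smul_smul, hqq, one_smul,
        ← mul_assoc, ← mul_assoc, ← add_mul, hXX₁, mul_assoc, mul_assoc, ← KiH.eq, KKi']
  | serre_F i j hij =>
    have hi : ∀ i j : Fin 2, i ≠ j → i = 0 ∧ j = 1 ∨ i = 1 ∧ j = 0 := by decide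
    obtain ⟨rfl, rfl⟩ | ⟨rfl, rfl⟩ := hi i j hij
    · refine serre_eq_zero (c := q⁻¹) (inv_ne_zero hq) (by rw [inv_inv, add_comm])
        (t := -D.g) (h := D.H (-1)) (t' := -D.gi) (v := -(D.K * D.X .pos (-2))) ?_
        ((gK.symm.mul_right (gX _ _).symm).neg_right.neg_left) ?_
        ((giK.symm.mul_right (giX _ _).symm).neg_right.neg_left) ?_
      · show -(D.K * D.X .pos (-1)) * D.X .neg 0 + q⁻¹ • (D.X .neg 0 * -(D.K * D.X .pos (-1))) = _
        have : q⁻¹ • (D.X .neg 0 * (D.K * D.X .pos (-1))) = D.K * (D.X .neg 0 * D.X .pos (-1)) :=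
          (KXn' _ _).symm
        rw [mul_neg, smul_neg, this, neg_mul, mul_assoc, ← neg_add, ← mul_add, hXX₂, gK', KKi',
          neg_mul]
      · show D.H (-1) * -(D.K * D.X .pos (-1)) - -(D.K * D.X .pos (-1)) * D.H (-1) = _
        rw [mul_neg, neg_mul, ← mul_assoc, ← KH.eq, mul_assoc, mul_assoc, ← neg_sub', ← mul_sub,
          neg_mul_neg, ← giK']
        exact (congrArg (fun x => -(D.K * x)) (HXp .neg (-1))).trans (by simp [Sgn.toInt])
      · show -(D.K * D.X .pos (-2)) * -(D.K * D.X .pos (-1)) +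
          q⁻¹ • (-(D.K * D.X .pos (-1)) * -(D.K * D.X .pos (-2))) = 0
        have h' : D.X .pos (-1) * D.X .pos (-2) = -(q • (D.X .pos (-2) * D.X .pos (-1))) :=
          eq_neg_of_add_eq_zero_left (by simpa using hpos (-2))
        simp only [neg_mul, mul_neg, neg_neg, mul_assoc, XK', h', mul_smul_comm, smul_neg,
          _root_.smul_smul, hqq', mul_one, add_neg_cancel]
    · refine serre_eq_zero (c := q) hq rfl (t := -(q • D.g)) (h := D.H (-1)) (t' := D.g)
        (v := D.X .neg (-1)) ?_ ((gX _ _).symm.smul_left _).neg_left (by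
          simpa [Sgn.toInt, chevImage] using HXn .neg 0) (gX _ _).symm ?_
      · show D.X .neg 0 * -(D.K * D.X .pos (-1)) + q • (-(D.K * D.X .pos (-1)) * D.X .neg 0) = _
        have : D.X .neg 0 * (D.K * D.X .pos (-1)) =
            q • (D.K * (D.X .neg 0 * D.X .pos (-1))) := by
          rw [KXn', _root_.smul_smul, hqq, one_smul]
        rw [mul_neg, neg_mul, smul_neg, this, mul_assoc, ← neg_add, ← smul_add, ← mul_add,
          add_comm, hXX₂, gK', KKi', neg_mul, smul_mul_assoc]
      · rw [add_comm]
        simpa [chevImage] using hneg (-1)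

end Chevalley

end ModeData

end

/-! ### The homomorphism from the Chevalley presentation and its image -/

noncomputable section

section

variable {A B : Type*} [Ring A] [Algebra ℂ A] [Ring B] [Algebra ℂ B] {q : ℂ}

lemma ChevRel.map_eq (φ : A →ₐ[ℂ] B) {γ : ChevGen → A}
    (hγ : ∀ x y, ChevRel q (φ ∘ γ) x y → x = y) {x y : A} (h : ChevRel q γ x y) : φ x = φ y := by
  cases h with
  | K_Ki i => simpa using hγ _ _ (.K_Ki i)
  | Ki_K i => simpa using hγ _ _ (.Ki_K i)
  | K_K i j => simpa using hγ _ _ (.K_K i j)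
  | K_E i j => simpa using hγ _ _ (.K_E i j)
  | K_F i j => simpa using hγ _ _ (.K_F i j)
  | E_F i j =>
    have := hγ _ _ (.E_F i j)
    split_ifs at this ⊢ <;> simpa using this
  | serre_E i j hij => simpa [serre] using hγ _ _ (.serre_E i j hij)
  | serre_F i j hij => simpa [serre] using hγ _ _ (.serre_F i j hij)

/-- The homomorphism from the Chevalley presentation given by elements that satisfy its
relations. -/
def chevLift (γ : ChevGen → A) (h : ∀ x y, ChevRel q γ x y → x = y) : ChevAlgebra q →ₐ[ℂ] A :=
  RingQuot.liftAlgHom ℂ ⟨FreeAlgebra.lift ℂ γ, fun _ _ hxy =>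
    ChevRel.map_eq (FreeAlgebra.lift ℂ γ) (by rwa [FreeAlgebra.ι_comp_lift]) hxy⟩

lemma chevLift_gen (γ : ChevGen → A) (h : ∀ x y, ChevRel q γ x y → x = y) (x : ChevGen) :
    chevLift γ h (chevGen q x) = γ x := by
  rw [chevLift, chevGen, RingQuot.liftAlgHom_mkAlgHom_apply, FreeAlgebra.lift_ι_apply]

namespace ModeData

variable {D : ModeData A}

/-- A subalgebra that contains `q^{±c/2}` and the images of the Chevalley generators contains all
Drinfeld generators: `H_{±1}` are anticommutators, they shift the `X^±_n`, whose anticommutators are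
the coefficients of `ψ^±`, and the `H_n` are polynomials in the latter. -/
lemma mem_of_chevImage_mem (hq : q ≠ 0) (hq1 : q ^ 2 ≠ 1) (h : ∀ x y, ModeRel q D x y → x = y)
    {S : Subalgebra ℂ A} (hg : D.g ∈ S) (hgi : D.gi ∈ S) (hS : ∀ x, chevImage D x ∈ S) :
    D.K ∈ S ∧ D.Ki ∈ S ∧ (∀ s n, D.X s n ∈ S) ∧ ∀ n, n ≠ 0 → D.H n ∈ S := by
  have C := cartan_of_modeRel h
  have R := drinfeldRecursion hq hq1 h
  have hK : D.K ∈ S := hS (.K 1)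
  have hKi : D.Ki ∈ S := hS (.Ki 1)
  have hipow : ∀ {a b : A}, a ∈ S → b ∈ S → ∀ n, ipow a b n ∈ S := fun {a b} ha hb n => by
    cases n
    · exact S.pow_mem ha _
    · exact S.pow_mem hb _
  have hp0 : D.X .pos 0 ∈ S := hS (.E 1)
  have hn0 : D.X .neg 0 ∈ S := hS (.F 1)
  have hn1 : D.X .neg 1 ∈ S := by
    have := S.mul_mem (hS (.E 0)) hK
    change D.X .neg 1 * D.Ki * D.K ∈ S at this
    rwa [mul_assoc, C.Ki_K, mul_one] at this
  have hp1 : D.X .pos (-1) ∈ S := by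
    have := S.mul_mem hKi (S.neg_mem (hS (.F 0)))
    change D.Ki * - -(D.K * D.X .pos (-1)) ∈ S at this
    rwa [neg_neg, ← mul_assoc, C.Ki_K, one_mul] at this
  have hH : ∀ τ : Sgn, D.H τ.toInt ∈ S := by
    rintro (_ | _)
    · exact R.H_one ▸ S.mul_mem (S.mul_mem hg hKi)
        (S.add_mem (S.mul_mem hp0 hn1) (S.mul_mem hn1 hp0))
    · exact R.H_neg_one ▸ S.mul_mem (S.mul_mem hgi hK)
        (S.add_mem (S.mul_mem hp1 hn0) (S.mul_mem hn0 hp1))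
  have hstep : ∀ (τ s : Sgn) n, D.X s n ∈ S → D.X s (n + τ.toInt) ∈ S := fun τ s n hX => by
    rw [X_shift hq hq1 h]
    exact S.smul_mem (S.mul_mem (hipow hg hgi _)
      (S.sub_mem (S.mul_mem (hH τ) hX) (S.mul_mem hX (hH τ)))) _
  have hX : ∀ s n, D.X s n ∈ S := fun s n => by
    induction n with
    | zero => cases s <;> assumption
    | succ n ih => exact hstep .pos s n ih
    | pred n ih => exact hstep .neg s _ ih
  have hη : ∀ s k, PowerSeries.coeff k (D.η q s) ∈ S := fun s => by
    refine mem_of_expSeries_mem (coeff_zero_η D s) fun n => ?_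
    rcases Nat.eq_zero_or_pos n with rfl | hn
    · rw [coeff_zero_expSeries]
      exact S.one_mem
    · rw [← ipow_mul_coeff_ψ C, R.ψ_n s n hn]
      exact S.mul_mem (hipow hK hKi _) (S.smul_mem (S.mul_mem (hipow hg hgi _)
        (S.add_mem (S.mul_mem (hX _ _) (hX _ _)) (S.mul_mem (hX _ _) (hX _ _)))) _)
  refine ⟨hK, hKi, hX, fun n hn => ?_⟩
  obtain ⟨s, k, hk, rfl⟩ := Sgn.exists_eq_toInt_mul hn
  rw [H_eq_coeff_η hq hq1 D s hk]
  exact S.smul_mem (hη s k) _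

end ModeData

/-- Together with `q^{±c/2}`, the Chevalley generators generate the mode algebra. -/
lemma adjoin_chevImage (hq : q ≠ 0) (hq1 : q ^ 2 ≠ 1) {S : Subalgebra ℂ (Uq q)}
    (hg : (uqData q).g ∈ S) (hgi : (uqData q).gi ∈ S) (hS : ∀ x, chevImage (uqData q) x ∈ S) :
    S = ⊤ := by
  obtain ⟨hK, hKi, hX, hH⟩ := ModeData.mem_of_chevImage_mem hq hq1 (uqData_rel q) hg hgi hS
  rw [eq_top_iff, ← adjoin_range_uqGen, Algebra.adjoin_le_iff]
  rintro _ ⟨x, rfl⟩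
  cases x with
  | g => exact hg
  | gi => exact hgi
  | K => exact hK
  | Ki => exact hKi
  | X s n => exact hX s n
  | H n hn =>
    have := hH n hn
    rwa [show (uqData q).H n = _ from dif_pos hn] at this

end

end

end OspDrinfeld

theorem mainTheorem2 (q p : ℂ) (hq0 : q ≠ 0) (hq1 : q ^ 2 ≠ 1) (hp : p ^ 2 = q) :
    -- Gauss decomposition of the L-operators, and the Drinfeld currents in the super RS algebra
    (∃ G : Sgn → GaussCoord (RSAlgebra q p),
      (∀ s, IsGauss ((rsData q p).L s) (G s) ∧
        ∀ G', IsGauss ((rsData q p).L s) G' → G' = G s) ∧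
      (∃ σ : RSAlgebra q p ≃ₐ[ℂ] RSAlgebra q p,
        (∀ s i j n, σ (rsGen q p (RSGen.L s i j n)) =
          (-1) ^ (par i + par j) * rsGen q p (RSGen.L s i j n)) ∧
        σ (rsGen q p RSGen.g) = rsGen q p RSGen.g ∧
        (∀ s n, σ (gaussX q (rsData q p).g (rsData q p).gi G s n) =
          -gaussX q (rsData q p).g (rsData q p).gi G s n) ∧
        (∀ s n, σ (gaussψ q p G s n) = gaussψ q p G s n)) ∧
      ((∀ n : ℕ, 0 < n → q ^ n ≠ 1) →
        ∃! Φ : CurrentAlgebra q →ₐ[ℂ] RSAlgebra q p,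
          Φ (curGen q CurrentGen.g) = rsGen q p RSGen.g ∧
          (∀ s n, Φ (curGen q (CurrentGen.X s n)) =
            gaussX q (rsData q p).g (rsData q p).gi G s n) ∧
          (∀ s n, Φ (curGen q (CurrentGen.ψ s n)) = gaussψ q p G s n))) ∧
    -- the current relations are equivalent to the mode relations
    (∀ (A : Type*) [Ring A] [Algebra ℂ A] (D : ModeData A),
      (∀ x y, CurrentRel q (D.toCurrent q) x y → x = y) ↔ (∀ x y, ModeRel q D x y → x = y)) ∧
    -- the Chevalley generators in terms of the Drinfeld generators, and conversely
    (∃ Ξ : ChevAlgebra q →ₐ[ℂ] Uq q,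
      (∀ x, Ξ (chevGen q x) = chevImage (uqData q) x) ∧
      Algebra.adjoin ℂ (Set.range Ξ ∪ {(uqData q).g, (uqData q).gi}) = ⊤) ∧
    DrinfeldRecursion q (uqData q) := by
  have hD := rsData_rel q p
  have hex : ∀ s, ∃ G, IsGauss ((rsData q p).L s) G := fun s =>
    (rsData q p).exists_isGauss s (fun i => hD _ _ (.t_minor s i)) fun i => hD _ _ (.minor_t s i)
  choose G hG using hex
  refine ⟨⟨G, fun s => ⟨hG s, fun G' hG' => (hG s).unique hG'⟩,
    ⟨rsTwist q p, fun s i j n => ?_, ?_, rsTwist_gaussX hG, rsTwist_gaussψ hG⟩, fun hr => ?_⟩,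
    fun A _ _ D => D.currentRel_iff_modeRel hq0 hq1,
    ⟨chevLift (chevImage (uqData q)) (ModeData.chevRel_chevImage hq0 hq1 (uqData_rel q)),
      chevLift_gen _ _, ?_⟩, ModeData.drinfeldRecursion hq0 hq1 (uqData_rel q)⟩
  · rw [rsTwist_gen]
    simp [rsTwistGen, parSign]
  · rw [rsTwist_gen]
    rfl
  · obtain ⟨Φ, hg, hX, hψ⟩ := RSData.exists_hom hD (rs_g_commute q p) hG hp hq0 hr
    exact ⟨Φ, ⟨hg, hX, hψ⟩, fun F ⟨hg', hX', hψ'⟩ => currentAlgebra_hom_ext (hg'.trans hg.symm)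
      (fun s n => (hX' s n).trans (hX s n).symm) fun s n => (hψ' s n).trans (hψ s n).symm⟩
  · refine adjoin_chevImage hq0 hq1 (Algebra.subset_adjoin (.inr (.inl rfl)))
      (Algebra.subset_adjoin (.inr (.inr rfl))) fun x => Algebra.subset_adjoin (.inl ?_)
    exact ⟨chevGen q x, chevLift_gen _ _ x⟩
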